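/- Let $d,N\ge 1$ be integers, $-1\le s<d$ and $\sigma>0$. Let $\mathbb{T}^d=(\mathbb{R}/\mathbb{Z})^d$ carry Lebesgue measure (of total mass $1$), and let $\mathsf{g}$ be the periodic Riesz potential on $\mathbb{T}^d$, that is, the zero-average solution of $|\nabla|^{d-s}\mathsf{g}=\mathsf{c}_{d,s}(\delta_0-1)$; equivalently, $\hat{\mathsf{g}}(\xi)=\mathsf{c}_{d,s}(2\pi|\xi|)^{s-d}\mathbf{1}_{\xi\ne0}$ for $\xi\in\mathbb{Z}^d$, where $\mathsf{c}_{d,s}=\frac{4^{(d-s)/2}\Gamma((d-s)/2)\pi^{d/2}}{\Gamma(s/2)}$ if $s\neq 0$ and $\mathsf{c}_{d,0}=\frac{\Gamma(d/2)(4\pi)^{d/2}}{2}$. It is an integrable function, smooth away from $0$. Put $$G_N(x_1,\dots,x_N)=\exp\Big(-\frac{1}{2N\sigma}\sum_{1\le i\ne j\le N}\mathsf{g}(x_i-x_j)\Big),$$ and consider the Liouville equation (gradient flow) $$\partial_t f=\sum_{i=1}^N\operatorname{div}_{x_i}\Big(f\,\frac1N\sum_{j\ne i}\nabla\mathsf{g}(x_i-x_j)\Big)+\sigma\sum_{i=1}^N\Delta_{x_i}f,\qquad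 f|_{t=0}=f_N^0. \tag{L}$$ Let $f_N^0$ be a probability density on $(\mathbb{T}^d)^N$ such that $\int\log\big(f_N^0/G_N\big)\,df_N^0<\infty$. Then (L) has a global entropy solution with initial datum $f_N^0$; that is, there is a measurable $f_N:[0,\infty)\times(\mathbb{T}^d)^N\to\mathbb{R}$ such that $f_N^t\ge 0$ a.e. and $\int f_N^t\,dx=1$ for every $t\ge0$, $f_N^t|_{t=0}=f_N^0$, and: 1. for each $i$, $f_N\,\frac1N\sum_{j\ne i}\nabla\mathsf{g}(x_i-x_j)\in L^1((0,T)\times(\mathbb{T}^d)^N)$ for all $T>0$, and $f_N$ solves (L) in the sense of distributions: for all $\varphi\in C_c^\infty([0,\infty)\times(\mathbb{T}^d)^N)$, $$\int_0^\infty\!\!\int f_N^t\Big(\partial_t\varphi-\sum_{i=1}^N\frac1N\sum_{j\ne i}\nabla\mathsf{g}(x_i-x_j)\cdot\nabla_{x_i}\varphi+\sigma\sum_{i=1}^N\Delta_{x_i}\varphi\Big)dx\,dt+\int f_N^0\,\varphi|_{t=0}\,dx=0;$$ 2. for every $t\ge0$ the function $f_N^t\log(f_N^t/G_N)$ is integrable;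 for a.e. $\tau>0$, $f_N^\tau$ has a weak gradient in $L^1$; and for every $t\ge0$, $$\int\log\Big(\frac{f_N^t}{G_N}\Big)df_N^t+\sigma\sum_{i=1}^N\int_0^t\!\!\int\Big|\nabla_{x_i}\log\frac{f_N^\tau}{G_N}\Big|^2df_N^\tau\,d\tau\le\int\log\Big(\frac{f_N^0}{G_N}\Big)df_N^0,$$ where $\nabla_{x_i}\log(f_N^\tau/G_N)=\nabla_{x_i}f_N^\tau/f_N^\tau-\nabla_{x_i}\log G_N$ on $\{f_N^\tau>0\}$, and the dissipation integrals are finite. -/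

import Mathlib

open MeasureTheory Set Filter Topology
open scoped ContDiff

noncomputable section

/-- Configurations of `N` points of the flat torus `(ℝ/ℤ)^d`. Its `volume` is the product of the
Lebesgue measures of the circles `ℝ/ℤ`, a probability measure. -/
abbrev TorusConfig (N d : ℕ) : Type := Fin N → UnitAddTorus (Fin d)

/-- The constant `c_{d,s}` of the periodic Riesz potential. -/
def rieszConst (d : ℕ) (s : ℝ) : ℝ :=
  if s = 0 then Real.Gamma ((d : ℝ) / 2) * (4 * Real.pi) ^ ((d : ℝ) / 2) / 2
  else (4 : ℝ) ^ (((d : ℝ) - s) / 2) * Real.Gamma (((d : ℝ) - s) / 2)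
    * Real.pi ^ ((d : ℝ) / 2) / Real.Gamma (s / 2)

/-- The Euclidean length of a frequency `ξ ∈ ℤ^d`. -/
def freqNorm {d : ℕ} (ξ : Fin d → ℤ) : ℝ := √(∑ k, (ξ k : ℝ) ^ 2)

/-- The Fourier coefficients `c_{d,s} (2π|ξ|)^{s-d} 1_{ξ ≠ 0}` of the zero-average solution `g` of
`|∇|^{d-s} g = c_{d,s} (δ₀ - 1)` on the torus. -/
def rieszCoeff (d : ℕ) (s : ℝ) (ξ : Fin d → ℤ) : ℝ :=
  if ξ = 0 then 0 else rieszConst d s * (2 * Real.pi * freqNorm ξ) ^ (s - (d : ℝ))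

/-- The smooth function `e^{tΔ} g` (`t > 0`), where `g` is the distribution with Fourier
coefficients `rieszCoeff d s`. It is given by an absolutely convergent Fourier series. -/
def rieszHeat (d : ℕ) (s t : ℝ) (x : UnitAddTorus (Fin d)) : ℝ :=
  ∑' ξ : Fin d → ℤ, rieszCoeff d s ξ * Real.exp (-(4 * Real.pi ^ 2 * t * freqNorm ξ ^ 2))
    * (UnitAddTorus.mFourier ξ x).re

/-- The periodic Riesz potential `g`: the distribution with Fourier coefficients `rieszCoeff d s`
is an integrable function that is smooth away from the origin, and its value at a point `x ≠ 0` is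
the limit of `(e^{tΔ} g)(x)` as `t ↓ 0`. (The value at the origin plays no role.) -/
def rieszPotential (d : ℕ) (s : ℝ) (x : UnitAddTorus (Fin d)) : ℝ :=
  limUnder (𝓝[>] (0 : ℝ)) (fun t => rieszHeat d s t x)

/-- The partial derivative `∂_k u` of a function on the torus. -/
def torusPartial {d : ℕ} (k : Fin d) (u : UnitAddTorus (Fin d) → ℝ)
    (x : UnitAddTorus (Fin d)) : ℝ :=
  deriv (fun h : ℝ => u (x + Pi.single k (h : UnitAddCircle))) 0

/-- The partial derivative of a function on configuration space in the `k`-th coordinate of the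
`i`-th point `x_i`. -/
def configPartial {N d : ℕ} (i : Fin N) (k : Fin d) (u : TorusConfig N d → ℝ)
    (x : TorusConfig N d) : ℝ :=
  deriv (fun h : ℝ => u (x + Pi.single i (Pi.single k (h : UnitAddCircle)))) 0

/-- `C^∞` functions on configuration space: the periodic lift is `C^∞`. -/
def IsSmoothConfig {N d : ℕ} (ψ : TorusConfig N d → ℝ) : Prop :=
  ContDiff ℝ ∞ (fun y : Fin N → Fin d → ℝ => ψ (fun i k => (y i k : UnitAddCircle)))

/-- Test functions in `C_c^∞([0,∞) × (𝕋^d)^N)`, written as restrictions of functions that are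
smooth on `ℝ × (𝕋^d)^N`. -/
structure IsSpaceTimeTest {N d : ℕ} (φ : ℝ → TorusConfig N d → ℝ) : Prop where
  smooth : ContDiff ℝ ∞ (fun p : ℝ × (Fin N → Fin d → ℝ) =>
    φ p.1 (fun i k => (p.2 i k : UnitAddCircle)))
  support : ∃ T : ℝ, ∀ t, T ≤ t → ∀ x, φ t x = 0

/-- `v ∈ L¹` is the weak partial derivative of `u ∈ L¹` in the `k`-th coordinate of `x_i`. -/
structure HasWeakPartial {N d : ℕ} (i : Fin N) (k : Fin d) (u v : TorusConfig N d → ℝ) :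
    Prop where
  integrable : Integrable u
  integrable_deriv : Integrable v
  integral_eq : ∀ ψ : TorusConfig N d → ℝ, IsSmoothConfig ψ →
    ∫ x, u x * configPartial i k ψ x = -∫ x, v x * ψ x

/-- The Gibbs factor `G_N = exp (-(1/(2Nσ)) ∑_{i ≠ j} g(x_i - x_j))`. -/
def gibbsFactor {N d : ℕ} (s σ : ℝ) (x : TorusConfig N d) : ℝ :=
  Real.exp (-(1 / (2 * (N : ℝ) * σ))
    * ∑ i, ∑ j ∈ Finset.univ.erase i, rieszPotential d s (x i - x j))

/-- The entropy `∫ log (f / G_N) df` of a density `f` relative to the Gibbs factor. It is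
meaningful when `f log (f / G_N)` is integrable. -/
def gibbsEntropy {N d : ℕ} (s σ : ℝ) (f : TorusConfig N d → ℝ) : ℝ :=
  ∫ x, Real.log (f x / gibbsFactor s σ x) * f x

/-- The `k`-th component of the velocity `(1/N) ∑_{j ≠ i} M ∇g(x_i - x_j)` of the `i`-th point. -/
def interactionDrift {N d : ℕ} (s : ℝ) (M : Matrix (Fin d) (Fin d) ℝ) (i : Fin N) (k : Fin d)
    (x : TorusConfig N d) : ℝ :=
  1 / (N : ℝ) * ∑ j ∈ Finset.univ.erase i,
    M.mulVec (fun l => torusPartial l (rieszPotential d s) (x i - x j)) k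

/-- Lebesgue measure on `(0,T] × (𝕋^d)^N`. -/
def slabMeasure (N d : ℕ) (T : ℝ) : Measure (ℝ × TorusConfig N d) :=
  (volume.restrict (Ioc 0 T)).prod volume

/-- `f` solves, in the sense of distributions on `[0,∞) × (𝕋^d)^N`, the Liouville equation
`∂_t f = -∑_i div_{x_i} (f (1/N) ∑_{j ≠ i} M ∇g(x_i - x_j)) + σ ∑_i Δ_{x_i} f`, `f|_{t=0} = f₀`.
The product of `f` with the velocity is required to be locally integrable, so that every term is a
distribution. -/
structure IsLiouvilleSolution {N d : ℕ} (s σ : ℝ) (M : Matrix (Fin d) (Fin d) ℝ)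
    (f₀ : TorusConfig N d → ℝ) (f : ℝ → TorusConfig N d → ℝ) : Prop where
  initial : f 0 =ᵐ[volume] f₀
  flux_integrable : ∀ (T : ℝ) (i : Fin N) (k : Fin d),
    Integrable (fun p : ℝ × TorusConfig N d => f p.1 p.2 * interactionDrift s M i k p.2)
      (slabMeasure N d T)
  weak_eq : ∀ φ : ℝ → TorusConfig N d → ℝ, IsSpaceTimeTest φ →
    (∫ p : ℝ × TorusConfig N d,
        f p.1 p.2 * (deriv (fun r => φ r p.2) p.1
          + ∑ i, ∑ k, interactionDrift s M i k p.2 * configPartial i k (φ p.1) p.2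
          + σ * ∑ i, ∑ k, configPartial i k (configPartial i k (φ p.1)) p.2)
        ∂((volume.restrict (Ioi (0 : ℝ))).prod volume))
      + ∫ x, f₀ x * φ 0 x = 0

/-- `|∇_{x_i} log (f / G_N)|² f`, where `w i k` is the weak partial derivative of `f` in the `k`-th
coordinate of `x_i`, so that `∇_{x_i} log (f / G_N) = w_i / f - ∇_{x_i} log G_N` where `f > 0`;
the set where `f = 0` does not contribute. -/
def fisherDensity {N d : ℕ} (s σ : ℝ) (f : TorusConfig N d → ℝ)
    (w : Fin N → Fin d → TorusConfig N d → ℝ) (i : Fin N) (x : TorusConfig N d) : ℝ :=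
  (∑ k, (w i k x / f x - configPartial i k (fun y => Real.log (gibbsFactor s σ y)) x) ^ 2) * f x

/-- Global entropy solutions of the Liouville equation with initial datum `f₀`. -/
structure IsGlobalEntropySolution {N d : ℕ} (s σ : ℝ) (M : Matrix (Fin d) (Fin d) ℝ)
    (f₀ : TorusConfig N d → ℝ) (f : ℝ → TorusConfig N d → ℝ) : Prop where
  measurable : AEStronglyMeasurable (Function.uncurry f)
    ((volume.restrict (Ioi (0 : ℝ))).prod volume)
  nonneg : ∀ t, 0 ≤ t → ∀ᵐ x, 0 ≤ f t x
  integrable : ∀ t, 0 ≤ t → Integrable (f t)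
  mass : ∀ t, 0 ≤ t → ∫ x, f t x = 1
  solution : IsLiouvilleSolution s σ M f₀ f
  entropy_integrable : ∀ t, 0 ≤ t →
    Integrable (fun x => Real.log (f t x / gibbsFactor s σ x) * f t x)
  dissipation : ∃ w : ℝ → Fin N → Fin d → TorusConfig N d → ℝ,
    (∀ᵐ τ ∂(volume.restrict (Ioi (0 : ℝ))), ∀ i k, HasWeakPartial i k (f τ) (w τ i k)) ∧
    (∀ (T : ℝ) (i : Fin N),
      Integrable (fun p : ℝ × TorusConfig N d => fisherDensity s σ (f p.1) (w p.1) i p.2)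
        (slabMeasure N d T)) ∧
    ∀ t, 0 ≤ t →
      gibbsEntropy s σ (f t)
          + σ * ∑ i, ∫ τ in (0 : ℝ)..t, ∫ x, fisherDensity s σ (f τ) (w τ) i x
        ≤ gibbsEntropy s σ f₀

end

/-!
# Global entropy solutions of the Liouville equation for repulsive Riesz flows

The equation is `∂_t f = σ div (G ∇(f / G))`, where `G` is the Gibbs factor. In terms of the density
`h = f / G` with respect to the Gibbs measure `𝔪 = G dx` it is the heat flow `∂_t h = -σ A h` of the
closed quadratic form `𝓔(u) = ∫ |∇u|² d𝔪` (`dirichlet`), so `h` is constructed by resolvents of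
`𝓔`, without solving a stochastic or a regularized partial differential equation. Since the datum is
only in `L log L`, the limit is followed through `z = 2√h`: here `z² / 4` is the density, `‖z‖²` is
four times the mass, and the Fisher information of `h` is `∫ |∇z|² d𝔪`, the energy of `z`.

*The potential.* The heat flow of the potential is a Mellin transform of the heat kernel of the
torus, a product of Jacobi theta functions. The two asymptotic forms of the kernel give the
potential and its derivatives off the origin, and show that the gradient is a bounded perturbation
of `-a x / |x|^(s+2)` (`exists_rieszPart_bound`). For `s ≥ 0` it follows that `G`, extended by zero
to the collisions, is continuous; for `s < 0` the potential itself is continuous. In both cases `G`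
can be integrated by parts along coordinate lines against continuously differentiable functions,
`∫ ∂u d𝔪 = -∫ u b d𝔪` with `b = ∇ log G` (`integral_partial_gibbsCont`). Thus the form is closable.

*The force is form bounded.* The estimate that makes `f ∇g` integrable, and lets the equation pass
to limits, is `∫ u² |b| d𝔪 ≤ C (‖u‖² + ‖u‖ ‖∇u‖)` (`exists_logGrad_bound`). For `s ≥ 0` one integrates
by parts against `u²` times the vector field whose `i`-th component is `∑ j, ∇ρ^(1/2) (x i - x j)`,
with `ρ` a smooth periodic substitute for `|x|² + ε`. The field is bounded. Its divergence is
bounded below, because `ρ^(1/2)` is semiconvex; and the repulsive force pairs with it to at least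
the sum of the singularities `|x i - x j|^(-s-1)`: of the other pairs, semiconvexity
(`field_semiconvex`) and repulsion leave only terms of order `|x i - x j|^(-s)`. For `s < 0` the
factor `G` is bounded above and below, and the estimate is an inequality of Hardy type for each pair.

*The semigroup.* For a closed form (`ClosedForm`) the Riesz representation theorem gives the
resolvents `P_l = l (l + A)⁻¹`, and the bounded operators `A_l = l (1 - P_l)` generate semigroups
`T_l t = exp (-t A_l)`, which form a Cauchy family as `l → ∞`. An element whose resolvents have
bounded energy is in the domain (`exists_tendsto_grad_J`). By the chain rule for contractions the
resolvents are positive, preserve constants and mass, and contract `L¹` (`isMarkov_P`); so do the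
semigroups, whose exponential series in `P_l` has positive coefficients.

*Entropy.* The datum is cut off to `[1/(n+1), n+1]`, and `H` is the flow of `T_{n+1}` from it, with
`v = P_{n+1} H`. Since `log` is increasing, `⟪log H, A_l H⟫ ≥ ⟪log v, A_l H⟫`, and the right side is
`⟪∇ log v, ∇v⟫ = ‖∇(2√v)‖²` (`exists_domain_smoothRoot`, `entropy_dissipation_le`). By contraction
in `L¹` both `2√H` and `2√v` converge in `L²`, to the same limit `z`, for every time. Fatou's lemma
for the entropy, and the convergence of the energies, measured after a fixed resolvent that is
then removed by monotone convergence, yield the entropy inequality for `z` (`entropy_le`,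
`rootGrad_entropy`).

*The equation.* A test function and an integration by parts turn the equation for `H` into integrals
of `H` against `∂_t φ` and of `v` against `Δφ` and `∇φ · b`. The first two are continuous for the convergence of `2√H`
and `2√v`. In the third, `∫ z² ψ b d𝔪` changes by at most
`C (κ⁻³ ‖z - w‖² + κ (‖z‖² + ‖w‖² + ‖∇z‖² + ‖∇w‖²))` for every small `κ` (`exists_force_sub_bound`),
and the energies are bounded after integration in time (`tendstoIntegral_force`,
`rootFlow_weak_eq`). The solution `f = z² G / 4` is finally taken to be jointly measurable in time
and space (`exists_measurable_uncurry`).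

The local notations are `𝕊` for the circle, `𝕋 d` for the torus, `𝕏` for the configurations of `N`
points, `𝐃 i k` for the derivative in the `k`-th coordinate of the `i`-th point, `𝐆` for the Gibbs
factor, continuous up to the collisions, `𝐛` for the gradient of its logarithm, and `𝐚` for the
exponent `(d - s) / 2` of the Mellin transform.
-/

noncomputable section

namespace RieszFlow

open Real (norm_eq_abs rpow_nonneg exp_pos norm_of_nonneg exp_le_exp exp_le_one_iff rpow_add rpow_one exp_add rpow_neg inv_rpow sq_sqrt rpow_le_rpow_of_nonpos sqrt_eq_rpow log_nonneg Gamma_pos_of_pos rpow_mul rpow_le_rpow_of_exponent_le log_le_log pi_pos sqrt_pos exp_sum exp log sin dist_eq pi_gt_three continuous_sqrt continuous_mul_log)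
open Finset (sum_congr mul_sum sum_nonneg sum_le_sum sum_mul ne_of_mem_erase sum_neg_distrib sum_const prod_congr sum_sub_distrib single_le_sum sum_add_distrib prod_mul_distrib mul_prod_erase univ mem_univ card_univ)
open ENNReal (ofReal ofReal_le_ofReal ofReal_lt_top toReal_ofReal tendsto_ofReal ofReal_ne_top)
open intervalIntegral (integral_of_le integral_eq_sub_of_hasDerivAt)
open UnitAddTorus (mFourier)
open QuotientAddGroup (induction_on)
open Complex (I)
open Fintype (card_fin)
open Pi (single)
open Nat (cast_nonneg)
open scoped Real
open scoped RealInnerProductSpace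

local notation "𝕊" => UnitAddCircle
local notation "𝕋" d:max => UnitAddTorus (Fin d)
local notation "𝐃" => configPartial

section

open HurwitzZeta

/-! ### Theta kernels on the circle -/

/-- A convergent Gaussian sum over `ℤ`, which serves as the constant in the bounds on the theta
kernels. -/
def thetaConst : ℝ := ∑' n : ℤ, (1 + |(n : ℝ)|) * exp (-((n : ℝ) ^ 2 / 2))

lemma summable_thetaConst :
    Summable (fun n : ℤ => (1 + |(n : ℝ)|) * exp (-((n : ℝ) ^ 2 / 2))) := by
  have key : ∀ m : ℕ, (1 + (m : ℝ)) * exp (-((m : ℝ) ^ 2 / 2)) ≤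
      8 * ((1 + (m : ℝ)) * exp (-(1 / 2)) ^ m) := fun m => by
    have h1 : exp (-((m : ℝ) ^ 2 / 2)) ≤ 8 * exp (-(1 / 2)) ^ m := by
      rw [← Real.exp_nat_mul]
      have h8 : (1 : ℝ) ≤ 8 := by norm_num
      refine le_trans (exp_le_exp.2 ?_) (le_mul_of_one_le_left (exp_pos _).le h8)
      have hm : (m : ℝ) ≤ (m : ℝ) ^ 2 := by exact_mod_cast Nat.le_self_pow two_ne_zero m
      linarith
    nlinarith
  have hr : ‖exp (-(1 / 2))‖ < 1 := by
    rw [norm_of_nonneg (exp_pos _).le]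
    exact Real.exp_lt_one_iff.2 (by norm_num)
  have hs : Summable (fun m : ℕ => (1 + (m : ℝ)) * exp (-((m : ℝ) ^ 2 / 2))) := by
    refine Summable.of_nonneg_of_le (fun m => by positivity) key (Summable.mul_left _ ?_)
    have := (summable_geometric_of_norm_lt_one hr).add (summable_pow_mul_geometric_of_norm_lt_one 1 hr)
    refine this.congr (fun m => ?_)
    ring
  refine Summable.of_nat_of_neg ?_ ?_
  · simpa using hs
  · simpa using hs

lemma thetaConst_nonneg : 0 ≤ thetaConst := tsum_nonneg (fun n => by positivity)

/-- A series whose terms off `n = 0` are dominated by `e^{-T} (1 + |n|) e^{-n²/2}` is close to its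
central term. -/
lemma norm_sub_central_le {E : Type*} [NormedAddCommGroup E] [CompleteSpace E] {f : ℤ → E} {S : E}
    (hf : HasSum f S) (T : ℝ)
    (h : ∀ n : ℤ, n ≠ 0 → ‖f n‖ ≤ exp (-T) * ((1 + |(n : ℝ)|) * exp (-((n : ℝ) ^ 2 / 2)))) :
    ‖S - f 0‖ ≤ thetaConst * exp (-T) := by
  have h1 := hasSum_ite_sub_hasSum hf 0
  have h2 := summable_thetaConst.hasSum.mul_left (exp (-T))
  rw [mul_comm]
  refine h1.norm_le_of_bounded h2 (fun n => ?_)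
  split_ifs with hn
  · simp only [norm_zero]; positivity
  · exact h n hn

lemma one_le_int_sq {n : ℤ} (hn : n ≠ 0) : (1 : ℝ) ≤ (n : ℝ) ^ 2 := by
  have : 0 < n ^ 2 := by positivity
  exact_mod_cast this

lemma abs_cosKernel_sub_one_le (a : 𝕊) {t : ℝ} (ht : 1 ≤ t) :
    |cosKernel a t - 1| ≤ thetaConst * exp (-(t / 4)) := by
  induction a using induction_on with | H a =>
  have h := hasSum_int_cosKernel a (zero_lt_one.trans_le ht)
  have h2 := norm_sub_central_le h (t / 4) (fun n hn => ?_)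
  · have : ((cosKernel (a : 𝕊) t : ℝ) : ℂ) - 1 = ((cosKernel (a : 𝕊) t - 1 : ℝ) : ℂ) := by push_cast; ring
    simp only [Int.cast_zero, mul_zero, Complex.exp_zero, one_mul, ne_eq, OfNat.ofNat_ne_zero,
      not_false_eq_true, zero_pow, zero_mul, Real.exp_zero, Complex.ofReal_one] at h2
    rw [this, Complex.norm_real, norm_eq_abs] at h2
    exact h2
  · have e1 : ‖Complex.exp (2 * π * I * a * n)‖ = 1 := by
      have : (2 * π * I * a * n : ℂ) = ((2 * π * a * n : ℝ) : ℂ) * I := by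
        push_cast; ring
      rw [this, Complex.norm_exp_ofReal_mul_I]
    rw [norm_mul, e1, one_mul, Complex.norm_real, norm_of_nonneg (exp_pos _).le]
    have hn2 := one_le_int_sq hn
    have : exp (-π * (n : ℝ) ^ 2 * t) ≤ exp (-(t / 4)) * exp (-((n : ℝ) ^ 2 / 2)) := by
      rw [← exp_add]
      refine exp_le_exp.2 ?_
      nlinarith [mul_nonneg (sub_nonneg.2 hn2) (sub_nonneg.2 ht),
        mul_nonneg (sub_nonneg.2 pi_gt_three.le) (mul_nonneg (sq_nonneg (n : ℝ)) (zero_le_one.trans ht))]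
    refine this.trans ?_
    gcongr
    exact le_mul_of_one_le_left (exp_pos _).le (by linarith [abs_nonneg (n : ℝ)])

lemma abs_sinKernel_le (a : 𝕊) {t : ℝ} (ht : 1 ≤ t) :
    |sinKernel a t| ≤ thetaConst * exp (-(t / 4)) := by
  induction a using induction_on with | H a =>
  have h := hasSum_int_sinKernel a (zero_lt_one.trans_le ht)
  have h2 := norm_sub_central_le h (t / 4) (fun n hn => ?_)
  · simp only [Int.cast_zero, mul_zero, zero_mul, sub_zero] at h2
    rw [Complex.norm_real, norm_eq_abs] at h2
    exact h2
  · have e1 : ‖Complex.exp (2 * π * I * a * n)‖ = 1 := by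
      have : (2 * π * I * a * n : ℂ) = ((2 * π * a * n : ℝ) : ℂ) * I := by
        push_cast; ring
      rw [this, Complex.norm_exp_ofReal_mul_I]
    rw [norm_mul, norm_mul, e1, mul_one, Complex.norm_real,
      norm_of_nonneg (exp_pos _).le, norm_mul, norm_neg, Complex.norm_I, one_mul,
      Complex.norm_intCast]
    have hn2 := one_le_int_sq hn
    have : exp (-π * (n : ℝ) ^ 2 * t) ≤ exp (-(t / 4)) * exp (-((n : ℝ) ^ 2 / 2)) := by
      rw [← exp_add]
      refine exp_le_exp.2 ?_
      nlinarith [mul_nonneg (sub_nonneg.2 hn2) (sub_nonneg.2 ht),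
        mul_nonneg (sub_nonneg.2 pi_gt_three.le) (mul_nonneg (sq_nonneg (n : ℝ)) (zero_le_one.trans ht))]
    calc |(n : ℝ)| * exp (-π * (n : ℝ) ^ 2 * t)
        ≤ (1 + |(n : ℝ)|) * (exp (-(t / 4)) * exp (-((n : ℝ) ^ 2 / 2))) := by
          gcongr; linarith
      _ = _ := by ring

lemma exp_shift_le {a : ℝ} (ha : |a| ≤ 1 / 2) {x : ℝ} (hx : 1 ≤ x) {n : ℤ} (hn : n ≠ 0) :
    exp (-π * ((n : ℝ) + a) ^ 2 * x) ≤ exp (-(x / 4)) * exp (-((n : ℝ) ^ 2 / 2)) := by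
  rw [← exp_add]
  refine exp_le_exp.2 ?_
  have hn2 := one_le_int_sq hn
  have hn1 : 1 ≤ |(n : ℝ)| := by
    rw [← Int.cast_abs]; exact_mod_cast Int.one_le_abs hn
  have h1 : |(n : ℝ)| / 2 ≤ |(n : ℝ) + a| := by
    have := abs_sub_abs_le_abs_sub (n : ℝ) (-a)
    rw [abs_neg, sub_neg_eq_add] at this
    linarith
  have h2 : (n : ℝ) ^ 2 / 4 ≤ ((n : ℝ) + a) ^ 2 := by
    rw [← sq_abs ((n : ℝ) + a), ← sq_abs (n : ℝ)]
    nlinarith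
  have h3 : 3 * ((n : ℝ) ^ 2 / 4) * x ≤ π * ((n : ℝ) + a) ^ 2 * x := by
    have := pi_gt_three
    gcongr
  nlinarith

lemma abs_evenKernel_sub_le {a : ℝ} (ha : |a| ≤ 1 / 2) {x : ℝ} (hx : 1 ≤ x) :
    |evenKernel a x - exp (-π * a ^ 2 * x)| ≤ thetaConst * exp (-(x / 4)) := by
  have h := hasSum_int_evenKernel a (zero_lt_one.trans_le hx)
  have h2 := norm_sub_central_le h (x / 4) (fun n hn => ?_)
  · simpa using h2
  · rw [norm_of_nonneg (exp_pos _).le]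
    refine (exp_shift_le ha hx hn).trans ?_
    gcongr
    exact le_mul_of_one_le_left (exp_pos _).le (by linarith [abs_nonneg (n : ℝ)])

lemma abs_oddKernel_sub_le {a : ℝ} (ha : |a| ≤ 1 / 2) {x : ℝ} (hx : 1 ≤ x) :
    |oddKernel a x - a * exp (-π * a ^ 2 * x)| ≤ thetaConst * exp (-(x / 4)) := by
  have h := hasSum_int_oddKernel a (zero_lt_one.trans_le hx)
  have h2 := norm_sub_central_le h (x / 4) (fun n hn => ?_)
  · simpa using h2
  · rw [norm_mul, norm_of_nonneg (exp_pos _).le, norm_eq_abs]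
    calc |(n : ℝ) + a| * exp (-π * ((n : ℝ) + a) ^ 2 * x)
        ≤ (1 + |(n : ℝ)|) * (exp (-(x / 4)) * exp (-((n : ℝ) ^ 2 / 2))) := by
          refine mul_le_mul ?_ (exp_shift_le ha hx hn) (exp_pos _).le (by positivity)
          linarith [abs_add_le (n : ℝ) a]
      _ = _ := by ring

lemma cosKernel_eq_evenKernel (a : 𝕊) {t : ℝ} (ht : 0 < t) :
    cosKernel a t = t ^ (-(1 / 2) : ℝ) * evenKernel a (1 / t) := by
  rw [evenKernel_functional_equation, one_div_one_div, ← mul_assoc,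
    rpow_neg ht.le, one_div t, inv_rpow ht.le, one_div (_⁻¹), inv_inv,
    inv_mul_cancel₀ (Real.rpow_pos_of_pos ht _).ne', one_mul]

lemma sinKernel_eq_oddKernel (a : 𝕊) {t : ℝ} (ht : 0 < t) :
    sinKernel a t = t ^ (-(3 / 2) : ℝ) * oddKernel a (1 / t) := by
  rw [oddKernel_functional_equation, one_div_one_div, ← mul_assoc,
    rpow_neg ht.le, one_div t, inv_rpow ht.le, one_div (_⁻¹), inv_inv,
    inv_mul_cancel₀ (Real.rpow_pos_of_pos ht _).ne', one_mul]

lemma hasDerivAt_cosKernel (a : 𝕊) {t : ℝ} (ht : 0 < t) (u : ℝ) :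
    HasDerivAt (fun h : ℝ => cosKernel (a + (h : 𝕊)) t) (-2 * π * sinKernel (a + (u : 𝕊)) t) u := by
  induction a using induction_on with | H a =>
  have him : 0 < (I * (t : ℂ)).im := by simpa using ht
  have h := (hasDerivAt_jacobiTheta₂_fst ((a + u : ℝ) : ℂ) him)
  have h2 : HasDerivAt (fun h : ℝ => jacobiTheta₂ ((a + h : ℝ) : ℂ) (I * t))
      (jacobiTheta₂' ((a + u : ℝ) : ℂ) (I * t)) u := by
    have h3 := h.comp_ofReal
    have h4 : HasDerivAt (fun h : ℝ => a + h) 1 u := (hasDerivAt_id u).const_add a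
    have := HasDerivAt.scomp u h3 h4
    rw [one_smul] at this
    exact this
  have h5 : (fun h : ℝ => jacobiTheta₂ ((a + h : ℝ) : ℂ) (I * t))
      = fun h : ℝ => ((cosKernel ((a : 𝕊) + (h : 𝕊)) t : ℝ) : ℂ) := by
    funext h
    rw [← AddCircle.coe_add, cosKernel_def]
  have h6 : jacobiTheta₂' ((a + u : ℝ) : ℂ) (I * t)
      = ((-2 * π * sinKernel ((a : 𝕊) + (u : 𝕊)) t : ℝ) : ℂ) := by
    rw [← AddCircle.coe_add, Complex.ofReal_mul, sinKernel_def]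
    have : (-2 * (π : ℂ)) ≠ 0 := by simp [Real.pi_ne_zero]
    push_cast
    field_simp
  rw [h5, h6] at h2
  have h7 := (Complex.reCLM.hasFDerivAt.comp_hasDerivAt u h2)
  simpa [Function.comp_def] using h7

end

section

open HurwitzZeta

/-! ### The heat kernel of the torus -/

lemma continuous_cosKernel {t : ℝ} (ht : 0 < t) :
    Continuous (fun a : 𝕊 => cosKernel a t) := by
  refine (QuotientAddGroup.isQuotientMap_mk (AddSubgroup.zmultiples 1)).continuous_iff.2 ?_
  have h : ∀ u : ℝ, HasDerivAt (fun h : ℝ => cosKernel ((h : 𝕊)) t) _ u := fun u => by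
    simpa using hasDerivAt_cosKernel 0 ht u
  exact continuous_iff_continuousAt.2 (fun u => (h u).continuousAt)

lemma continuous_sinKernel {t : ℝ} (ht : 0 < t) :
    Continuous (fun a : 𝕊 => sinKernel a t) := by
  refine (QuotientAddGroup.isQuotientMap_mk (AddSubgroup.zmultiples 1)).continuous_iff.2 ?_
  have him : 0 < (I * (t : ℂ)).im := by simpa using ht
  have h : Continuous (fun a : ℝ => jacobiTheta₂' (a : ℂ) (I * t) / (-2 * π)) := by
    refine Continuous.div_const ?_ _
    refine continuous_iff_continuousAt.2 (fun a => ?_)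
    have h2 := continuousAt_jacobiTheta₂' (a : ℂ) him
    have h3 : ContinuousAt (fun a : ℝ => ((a : ℂ), I * (t : ℂ))) a := by fun_prop
    exact ContinuousAt.comp (f := fun a : ℝ => ((a : ℂ), I * (t : ℂ)))
      h2 h3
  have h4 : (fun a : ℝ => sinKernel (a : 𝕊) t) =
      fun a : ℝ => (jacobiTheta₂' (a : ℂ) (I * t) / (-2 * π)).re := by
    funext a
    rw [← sinKernel_def, Complex.ofReal_re]
  change Continuous (fun a : ℝ => sinKernel (a : 𝕊) t)
  rw [h4]
  exact Complex.continuous_re.comp h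

lemma exists_lift (a : 𝕊) : ∃ r : ℝ, |r| ≤ 1 / 2 ∧ (r : 𝕊) = a := by
  induction a using induction_on with | H a =>
  refine ⟨a - round a, abs_sub_round a, ?_⟩
  rw [AddCircle.coe_sub]
  have : ((round a : ℝ) : 𝕊) = 0 := by
    rw [AddCircle.coe_eq_zero_iff]; exact ⟨round a, by simp⟩
  rw [this, sub_zero]

lemma norm_coe_circle {r : ℝ} (hr : |r| ≤ 1 / 2) : ‖(r : 𝕊)‖ = |r| := by
  exact (AddCircle.norm_coe_eq_abs_iff (p := 1) one_ne_zero).2 (by simpa using hr)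

/-- Two products of factors bounded by `B` are close if their factors are. -/
lemma abs_prod_sub_prod_le {ι : Type*} (s : Finset ι) (u v : ι → ℝ) {B δ : ℝ} (hB : 1 ≤ B)
    (hu : ∀ i, |u i| ≤ B) (hv : ∀ i, |v i| ≤ B) (h : ∀ i, |u i - v i| ≤ δ) :
    |∏ i ∈ s, u i - ∏ i ∈ s, v i| ≤ s.card * B ^ s.card * δ := by
  classical
  induction s using Finset.induction_on with
  | empty => simp
  | insert i s hi ih =>
    have hδ : 0 ≤ δ := (abs_nonneg _).trans (h i)
    rw [Finset.prod_insert hi, Finset.prod_insert hi, Finset.card_insert_of_notMem hi]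
    have hp : |∏ j ∈ s, v j| ≤ B ^ s.card := by
      rw [Finset.abs_prod, ← Finset.prod_const]
      exact Finset.prod_le_prod (fun _ _ => abs_nonneg _) (fun j _ => hv j)
    have e : u i * ∏ j ∈ s, u j - v i * ∏ j ∈ s, v j
        = u i * (∏ j ∈ s, u j - ∏ j ∈ s, v j) + (u i - v i) * ∏ j ∈ s, v j := by ring
    rw [e]
    refine (abs_add_le _ _).trans ?_
    rw [abs_mul, abs_mul]
    have h1 : |u i| * |∏ j ∈ s, u j - ∏ j ∈ s, v j| ≤ B * (s.card * B ^ s.card * δ) :=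
      mul_le_mul (hu i) ih (abs_nonneg _) (by linarith)
    have h2 : |u i - v i| * |∏ j ∈ s, v j| ≤ δ * (B ^ s.card * B) := by
      refine mul_le_mul (h i) (hp.trans ?_) (abs_nonneg _) hδ
      exact le_mul_of_one_le_right (by positivity) hB
    refine (add_le_add h1 h2).trans (le_of_eq ?_)
    push_cast; ring

variable {d : ℕ}

/-- The heat kernel of the torus `(ℝ/ℤ)^d` at time `t / (4π)`. -/
def torusTheta (t : ℝ) (x : 𝕋 d) : ℝ := ∏ k, cosKernel (x k) t

/-- The partial derivative of `torusTheta` in the `k`-th coordinate. -/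
def torusThetaPart (k : Fin d) (t : ℝ) (x : 𝕋 d) : ℝ :=
  ∏ l, if l = k then -2 * π * sinKernel (x l) t else cosKernel (x l) t

lemma continuous_torusTheta {t : ℝ} (ht : 0 < t) :
    Continuous (torusTheta t : 𝕋 d → ℝ) :=
  continuous_finsetProd _ (fun k _ => (continuous_cosKernel ht).comp (continuous_apply k))

lemma continuous_torusThetaPart (k : Fin d) {t : ℝ} (ht : 0 < t) :
    Continuous (torusThetaPart k t : 𝕋 d → ℝ) := by
  refine continuous_finsetProd _ (fun l _ => ?_)
  split_ifs
  · exact ((continuous_sinKernel ht).comp (continuous_apply l)).const_mul _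
  · exact (continuous_cosKernel ht).comp (continuous_apply l)

lemma continuousOn_torusTheta (x : 𝕋 d) :
    ContinuousOn (fun t => torusTheta t x) (Ioi 0) :=
  continuousOn_finsetProd _ (fun k _ => continuousOn_cosKernel (x k))

lemma continuousOn_torusThetaPart (k : Fin d) (x : 𝕋 d) :
    ContinuousOn (fun t => torusThetaPart k t x) (Ioi 0) := by
  refine continuousOn_finsetProd _ (fun l _ => ?_)
  split_ifs
  · exact (continuousOn_sinKernel (x l)).const_mul _
  · exact continuousOn_cosKernel (x l)

lemma hasDerivAt_torusTheta (k : Fin d) {t : ℝ} (ht : 0 < t) (x : 𝕋 d) (u : ℝ) :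
    HasDerivAt (fun h : ℝ => torusTheta t (x + single k (h : 𝕊)))
      (torusThetaPart k t (x + single k (u : 𝕊))) u := by
  have h := HasDerivAt.fun_finsetProd (u := (univ : Finset (Fin d)))
    (f := fun l (h : ℝ) => cosKernel ((x + single k (h : 𝕊) : 𝕋 d) l) t)
    (f' := fun l => if l = k then
      -2 * π * sinKernel ((x + single k (u : 𝕊) : 𝕋 d) l) t else 0) (x := u) ?_
  · refine h.congr_deriv ?_
    rw [Finset.sum_eq_single k]
    · rw [torusThetaPart, ← mul_prod_erase _ _ (mem_univ k), if_pos rfl, if_pos rfl,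
        smul_eq_mul, mul_comm]
      congr 1
      refine prod_congr rfl (fun l hl => ?_)
      rw [if_neg (ne_of_mem_erase hl)]
    · intro l _ hl; rw [if_neg hl, smul_zero]
    · simp
  · intro l _
    by_cases hl : l = k
    · subst hl
      simpa using hasDerivAt_cosKernel (x l) ht u
    · simpa [hl] using hasDerivAt_const u _

/-- The constant in the Gaussian approximations of the heat kernel. -/
def prodConst (d : ℕ) : ℝ := d * (1 + thetaConst) ^ d * thetaConst

lemma prodConst_nonneg (d : ℕ) : 0 ≤ prodConst d := by
  have := thetaConst_nonneg
  unfold prodConst; positivity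

lemma abs_torusTheta_sub_one_le {t : ℝ} (ht : 1 ≤ t) (x : 𝕋 d) :
    |torusTheta t x - 1| ≤ prodConst d * exp (-(t / 4)) := by
  have hK := thetaConst_nonneg
  have hexp : exp (-(t / 4)) ≤ 1 := exp_le_one_iff.2 (by linarith)
  have hc : ∀ k, |cosKernel (x k) t - 1| ≤ thetaConst * exp (-(t / 4)) :=
    fun k => abs_cosKernel_sub_one_le (x k) ht
  have h := abs_prod_sub_prod_le univ (fun k => cosKernel (x k) t)
    (fun _ => 1) (B := 1 + thetaConst) (by linarith) (fun k => ?_)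
    (fun k => by simp; exact hK) hc
  · simp only [Finset.prod_const_one, card_univ, card_fin] at h
    rw [prodConst, mul_assoc _ thetaConst]; exact h
  · have := (abs_sub_abs_le_abs_sub (cosKernel (x k) t) 1).trans (hc k)
    rw [abs_one] at this
    nlinarith

lemma abs_torusThetaPart_le (k : Fin d) {t : ℝ} (ht : 1 ≤ t) (x : 𝕋 d) :
    |torusThetaPart k t x| ≤ 2 * π * prodConst d * exp (-(t / 4)) := by
  have hK := thetaConst_nonneg
  have hexp : exp (-(t / 4)) ≤ 1 := exp_le_one_iff.2 (by linarith)
  have hc : ∀ l, |(if l = k then sinKernel (x l) t else cosKernel (x l) t)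
      - (if l = k then 0 else 1)| ≤ thetaConst * exp (-(t / 4)) := fun l => by
    split_ifs
    · rw [sub_zero]; exact abs_sinKernel_le (x l) ht
    · exact abs_cosKernel_sub_one_le (x l) ht
  have hv : ∀ l, |(if l = k then (0 : ℝ) else 1)| ≤ 1 := by
    intro l; split_ifs <;> simp
  have h := abs_prod_sub_prod_le univ
    (fun l => if l = k then sinKernel (x l) t else cosKernel (x l) t)
    (fun l => if l = k then 0 else 1) (B := 1 + thetaConst) (by linarith) (fun l => ?_)
    (fun l => (hv l).trans (by linarith)) hc
  · have e0 : ∏ l, (if l = k then (0 : ℝ) else 1) = 0 := Finset.prod_eq_zero (mem_univ k) (by simp)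
    have e1 : torusThetaPart k t x = -2 * π * ∏ l, (if l = k then
        sinKernel (x l) t else cosKernel (x l) t) := by
      rw [torusThetaPart, ← mul_prod_erase _ _ (mem_univ k),
        ← mul_prod_erase _ _ (mem_univ k), if_pos rfl, if_pos rfl, mul_assoc]
      congr 2
      refine prod_congr rfl (fun l hl => ?_)
      rw [if_neg (ne_of_mem_erase hl), if_neg (ne_of_mem_erase hl)]
    rw [e0, sub_zero, card_univ, card_fin] at h
    rw [e1, abs_mul]
    have : |-2 * π| = 2 * π := by
      rw [neg_mul, abs_neg, abs_of_pos (by positivity)]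
    rw [this, mul_assoc (2 * π)]
    refine mul_le_mul_of_nonneg_left (h.trans (le_of_eq ?_)) (by positivity)
    rw [prodConst]; ring
  · have := (abs_sub_abs_le_abs_sub _ _).trans (hc l)
    have h3 := hv l
    nlinarith

lemma abs_evenKernel_le {a : ℝ} (ha : |a| ≤ 1 / 2) {x : ℝ} (hx : 1 ≤ x) :
    |evenKernel a x| ≤ 1 + thetaConst := by
  have hK := thetaConst_nonneg
  have h := abs_evenKernel_sub_le ha hx
  have hexp : exp (-(x / 4)) ≤ 1 := exp_le_one_iff.2 (by linarith)
  have h1 : exp (-π * a ^ 2 * x) ≤ 1 :=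
    exp_le_one_iff.2 (by have := pi_pos; have : 0 ≤ π * a ^ 2 * x := by positivity
                         linarith)
  have h2 := abs_sub_abs_le_abs_sub (evenKernel a x) (exp (-π * a ^ 2 * x))
  rw [abs_of_pos (exp_pos _)] at h2
  nlinarith

lemma abs_oddKernel_le {a : ℝ} (ha : |a| ≤ 1 / 2) {x : ℝ} (hx : 1 ≤ x) :
    |oddKernel a x| ≤ 1 + thetaConst := by
  have hK := thetaConst_nonneg
  have h := abs_oddKernel_sub_le ha hx
  have hexp : exp (-(x / 4)) ≤ 1 := exp_le_one_iff.2 (by linarith)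
  have h1 : exp (-π * a ^ 2 * x) ≤ 1 :=
    exp_le_one_iff.2 (by have := pi_pos; have : 0 ≤ π * a ^ 2 * x := by positivity
                         linarith)
  have h2 := abs_sub_abs_le_abs_sub (oddKernel a x) (a * exp (-π * a ^ 2 * x))
  rw [abs_mul, abs_of_pos (exp_pos _)] at h2
  nlinarith [abs_nonneg a]

lemma prod_rpow_neg_half {t : ℝ} (ht : 0 < t) :
    ∏ _k : Fin d, t ^ (-(1 / 2) : ℝ) = t ^ (-((d : ℝ) / 2)) := by
  rw [Finset.prod_const, card_univ, card_fin, ← Real.rpow_natCast, ← rpow_mul ht.le]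
  congr 1; ring

lemma prod_exp_sq (y : Fin d → ℝ) (t : ℝ) :
    ∏ k, exp (-π * y k ^ 2 * (1 / t)) = exp (-(π * (∑ k, y k ^ 2) / t)) := by
  rw [← exp_sum]
  congr 1
  rw [mul_sum, Finset.sum_div, ← sum_neg_distrib]
  exact sum_congr rfl (fun k _ => by ring)

/-- For small times the heat kernel is the Gaussian up to an exponentially small error. -/
lemma abs_torusTheta_sub_gauss_le {y : Fin d → ℝ} (hy : ∀ k, |y k| ≤ 1 / 2) {t : ℝ} (ht : 0 < t)
    (ht1 : t ≤ 1) :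
    |torusTheta t (fun k => (y k : 𝕊))
        - t ^ (-((d : ℝ) / 2)) * exp (-(π * (∑ k, y k ^ 2) / t))|
      ≤ prodConst d * (t ^ (-((d : ℝ) / 2)) * exp (-(1 / 4 / t))) := by
  have hK := thetaConst_nonneg
  have hx : 1 ≤ 1 / t := (one_le_div ht).2 ht1
  have e : torusTheta t (fun k => (y k : 𝕊))
      = t ^ (-((d : ℝ) / 2)) * ∏ k, evenKernel (y k) (1 / t) := by
    rw [torusTheta, ← prod_rpow_neg_half ht, ← prod_mul_distrib]
    exact prod_congr rfl (fun k _ => cosKernel_eq_evenKernel _ ht)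
  rw [e, ← mul_sub, abs_mul, abs_of_pos (Real.rpow_pos_of_pos ht _), ← prod_exp_sq]
  have h := abs_prod_sub_prod_le univ (fun k => evenKernel (y k) (1 / t))
    (fun k => exp (-π * y k ^ 2 * (1 / t))) (by linarith)
    (fun k => abs_evenKernel_le (hy k) hx) (fun k => ?_)
    (fun k => abs_evenKernel_sub_le (hy k) hx)
  · rw [card_univ, card_fin] at h
    have e2 : 1 / t / 4 = 1 / 4 / t := by ring
    rw [e2] at h
    rw [mul_left_comm]
    refine mul_le_mul_of_nonneg_left (h.trans (le_of_eq ?_)) (rpow_nonneg ht.le _)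
    rw [prodConst]; ring
  · rw [abs_of_pos (exp_pos _)]
    refine (exp_le_one_iff.2 ?_).trans (by linarith)
    have : 0 ≤ π * y k ^ 2 * (1 / t) := by positivity
    linarith

/-- For small times the derivative of the heat kernel is that of the Gaussian up to an
exponentially small error. -/
lemma abs_torusThetaPart_sub_gauss_le (k : Fin d) {y : Fin d → ℝ} (hy : ∀ k, |y k| ≤ 1 / 2) {t : ℝ}
    (ht : 0 < t) (ht1 : t ≤ 1) :
    |torusThetaPart k t (fun k => (y k : 𝕊))
        + 2 * π * y k * (t ^ (-((d : ℝ) / 2) - 1) * exp (-(π * (∑ k, y k ^ 2) / t)))|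
      ≤ 2 * π * prodConst d * (t ^ (-((d : ℝ) / 2) - 1) * exp (-(1 / 4 / t))) := by
  have hK := thetaConst_nonneg
  have hx : 1 ≤ 1 / t := (one_le_div ht).2 ht1
  have ht' : t ^ (-((d : ℝ) / 2) - 1) = t ^ (-((d : ℝ) / 2)) * t⁻¹ := by
    rw [Real.rpow_sub ht, rpow_one, div_eq_mul_inv]
  have e : torusThetaPart k t (fun k => (y k : 𝕊)) = -(2 * π * t ^ (-((d : ℝ) / 2) - 1)) * ∏ l, (if l = k then
        oddKernel (y l) (1 / t) else evenKernel (y l) (1 / t)) := by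
    rw [ht', ← prod_rpow_neg_half ht, torusThetaPart]
    have : ∀ l, (if l = k then -2 * π * sinKernel (y l) t
        else cosKernel (y l) t) = t ^ (-(1 / 2) : ℝ) * ((if l = k then
        oddKernel (y l) (1 / t) else evenKernel (y l) (1 / t)) *
        (if l = k then -2 * π * t⁻¹ else 1)) := fun l => by
      split_ifs
      · rw [sinKernel_eq_oddKernel _ ht]
        have : t ^ (-(3 / 2) : ℝ) = t ^ (-(1 / 2) : ℝ) * t⁻¹ := by
          rw [← Real.rpow_neg_one t, ← rpow_add ht]; norm_num
        rw [this]; ring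
      · rw [cosKernel_eq_evenKernel _ ht, mul_one]
    simp_rw [this]
    rw [prod_mul_distrib, prod_mul_distrib, Finset.prod_ite_eq' Finset.univ k, if_pos (Finset.mem_univ k)]
    ring
  have e3 : ∏ l, (if l = k then y l * exp (-π * y l ^ 2 * (1 / t)) else
      exp (-π * y l ^ 2 * (1 / t)))
      = y k * exp (-(π * (∑ k, y k ^ 2) / t)) := by
    rw [← prod_exp_sq]
    have : ∀ l, (if l = k then y l * exp (-π * y l ^ 2 * (1 / t)) else
      exp (-π * y l ^ 2 * (1 / t))) = (if l = k then y l else 1) *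
      exp (-π * y l ^ 2 * (1 / t)) := by
      intro l; split_ifs <;> simp
    simp_rw [this]
    rw [prod_mul_distrib, Finset.prod_ite_eq' Finset.univ k, if_pos (Finset.mem_univ k)]
  have h := abs_prod_sub_prod_le univ (fun l => if l = k then
        oddKernel (y l) (1 / t) else evenKernel (y l) (1 / t))
    (fun l => if l = k then y l * exp (-π * y l ^ 2 * (1 / t)) else
      exp (-π * y l ^ 2 * (1 / t))) (B := 1 + thetaConst)
    (δ := thetaConst * exp (-(1 / t / 4))) (by linarith)
    (fun l => ?_) (fun l => ?_) (fun l => ?_)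
  · rw [e3, card_univ, card_fin] at h
    have e2 : 1 / t / 4 = 1 / 4 / t := by ring
    rw [e2] at h
    have hc : 0 ≤ 2 * π * t ^ (-((d : ℝ) / 2) - 1) := by positivity
    have e4 : torusThetaPart k t (fun k => (y k : 𝕊)) + 2 * π * y k * (t ^ (-((d : ℝ) / 2) - 1) *
          exp (-(π * (∑ k, y k ^ 2) / t)))
        = -(2 * π * t ^ (-((d : ℝ) / 2) - 1)) * ((∏ l, (if l = k then
        oddKernel (y l) (1 / t) else evenKernel (y l) (1 / t)))
          - y k * exp (-(π * (∑ k, y k ^ 2) / t))) := by rw [e]; ring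
    rw [e4, abs_mul, abs_neg, abs_of_nonneg hc]
    refine (mul_le_mul_of_nonneg_left h hc).trans (le_of_eq ?_)
    rw [prodConst]; ring
  · split_ifs
    · exact abs_oddKernel_le (hy l) hx
    · exact abs_evenKernel_le (hy l) hx
  · have h1 : exp (-π * y l ^ 2 * (1 / t)) ≤ 1 := by
      refine exp_le_one_iff.2 ?_
      have : 0 ≤ π * y l ^ 2 * (1 / t) := by positivity
      linarith
    split_ifs
    · rw [abs_mul, abs_of_pos (exp_pos _)]
      nlinarith [hy l, abs_nonneg (y l)]
    · rw [abs_of_pos (exp_pos _)]; linarith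
  · split_ifs
    · exact abs_oddKernel_sub_le (hy l) hx
    · exact abs_evenKernel_sub_le (hy l) hx

/-- The periodised Gaussian dominates each single Gaussian. -/
lemma gauss_le_torusTheta (y : Fin d → ℝ) {t : ℝ} (ht : 0 < t) :
    t ^ (-((d : ℝ) / 2)) * exp (-(π * (∑ k, y k ^ 2) / t)) ≤ torusTheta t (fun k => (y k : 𝕊)) := by
  rw [torusTheta, ← prod_rpow_neg_half ht, ← prod_exp_sq, ← prod_mul_distrib]
  refine Finset.prod_le_prod (fun k _ => by positivity) (fun k _ => ?_)
  rw [cosKernel_eq_evenKernel _ ht]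
  refine mul_le_mul_of_nonneg_left ?_ (by positivity)
  have h := hasSum_int_evenKernel (y k) (one_div_pos.2 ht)
  have := le_hasSum h 0 (fun n _ => (exp_pos _).le)
  simpa using this

lemma torusTheta_nonneg {t : ℝ} (ht : 0 < t) (x : 𝕋 d) : 0 ≤ torusTheta t x := by
  choose y _ hy using fun k => exists_lift (x k)
  have := gauss_le_torusTheta y ht
  rw [show (fun k => (y k : 𝕊)) = x from funext hy] at this
  exact le_trans (by positivity) this

end

section

/-! ### The Riesz potential as an integral of the heat kernel -/

/-- A product of absolutely convergent series, expanded over multi-indices. -/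
lemma hasSum_prod_multiIndex : ∀ {d : ℕ} (f : Fin d → ℤ → ℂ), (∀ k, Summable (fun n => ‖f k n‖)) →
    Summable (fun ξ : Fin d → ℤ => ‖∏ k, f k (ξ k)‖) ∧
    HasSum (fun ξ : Fin d → ℤ => ∏ k, f k (ξ k)) (∏ k, ∑' n, f k n)
  | 0, f, _ => by
    refine ⟨(hasSum_fintype _).summable, ?_⟩
    convert hasSum_fintype (fun ξ : Fin 0 → ℤ => ∏ k, f k (ξ k)) using 1
    simp
  | d + 1, f, h => by
    obtain ⟨ih1, ih2⟩ := hasSum_prod_multiIndex (fun k : Fin d => f k.succ) (fun k => h k.succ)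
    let e : ℤ × (Fin d → ℤ) ≃ (Fin (d + 1) → ℤ) := Fin.consEquiv (fun _ => ℤ)
    have he : ∀ p : ℤ × (Fin d → ℤ), ∏ k, f k (e p k) = f 0 p.1 * ∏ k : Fin d, f k.succ (p.2 k) := fun p => by
      rw [Fin.prod_univ_succ]
      simp [e, Fin.consEquiv]
    have hn := (h 0).mul_norm ih1
    have h1 : Summable (fun ξ : Fin (d + 1) → ℤ => ‖∏ k, f k (ξ k)‖) := by
      rw [← e.summable_iff]
      refine hn.congr (fun p => ?_)
      simp only [Function.comp_apply, he]
    refine ⟨h1, ?_⟩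
    rw [← e.hasSum_iff]
    have h2 : Summable (fun p : ℤ × (Fin d → ℤ) => f 0 p.1 * ∏ k : Fin d, f k.succ (p.2 k)) := hn.of_norm
    have h3 := h2.hasSum
    rw [← tsum_mul_tsum_of_summable_norm (h 0) ih1, ih2.tsum_eq] at h3
    rw [Fin.prod_univ_succ]
    refine h3.congr_fun (fun p => ?_)
    simp only [Function.comp_apply, he]

variable {d : ℕ}

lemma freqNorm_sq (ξ : Fin d → ℤ) : freqNorm ξ ^ 2 = ∑ k, (ξ k : ℝ) ^ 2 :=
  sq_sqrt (sum_nonneg (fun _ _ => sq_nonneg _))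

lemma one_le_freqNorm_sq {ξ : Fin d → ℤ} (hξ : ξ ≠ 0) : 1 ≤ freqNorm ξ ^ 2 := by
  obtain ⟨k, hk⟩ := Function.ne_iff.1 hξ
  rw [freqNorm_sq]
  exact (one_le_int_sq hk).trans (single_le_sum (f := fun k => (ξ k : ℝ) ^ 2) (fun _ _ => sq_nonneg _)
      (mem_univ k))

lemma abs_mFourier_re_le (ξ : Fin d → ℤ) (x : 𝕋 d) :
    |(mFourier ξ x).re| ≤ 1 :=
  (Complex.abs_re_le_norm _).trans
    (((mFourier ξ).norm_coe_le_norm x).trans UnitAddTorus.mFourier_norm.le)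

lemma hasSum_torusTheta (x : 𝕋 d) {t : ℝ} (ht : 0 < t) :
    Summable (fun ξ : Fin d → ℤ => exp (-(π * t * freqNorm ξ ^ 2))) ∧
    HasSum (fun ξ : Fin d → ℤ => exp (-(π * t * freqNorm ξ ^ 2)) *
      (mFourier ξ x).re) (torusTheta t x) := by
  choose y hy using fun k => QuotientAddGroup.mk_surjective (x k)
  let f : Fin d → ℤ → ℂ := fun k n => Complex.exp (2 * π * I * y k * n) * exp (-π * n ^ 2 * t)
  have hf : ∀ k, HasSum (f k) ((HurwitzZeta.cosKernel (x k) t : ℝ) : ℂ) := fun k => by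
    rw [← hy k]
    exact HurwitzZeta.hasSum_int_cosKernel (y k) ht
  have hnorm : ∀ k n, ‖f k n‖ = exp (-π * n ^ 2 * t) := fun k n => by
    have : (2 * π * I * y k * n : ℂ) = ((2 * π * y k * n : ℝ) : ℂ) * I := by
      push_cast; ring
    rw [norm_mul, this, Complex.norm_exp_ofReal_mul_I, one_mul, Complex.norm_real,
      norm_of_nonneg (exp_pos _).le]
  obtain ⟨h1, h2⟩ := hasSum_prod_multiIndex f (fun k => (hf k).summable.norm)
  have e : ∀ ξ : Fin d → ℤ, ∏ k, f k (ξ k) =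
      (exp (-(π * t * freqNorm ξ ^ 2)) : ℂ) * mFourier ξ x := fun ξ => by
    simp only [f]
    rw [prod_mul_distrib, mul_comm]
    congr 1
    · rw [← Complex.ofReal_prod, ← exp_sum, freqNorm_sq, mul_sum, ← sum_neg_distrib]
      congr 3
      funext k; ring
    · rw [mFourier, ContinuousMap.coe_mk]
      refine prod_congr rfl (fun k _ => ?_)
      rw [← hy k]
      have := fourier_coe_apply (T := 1) (n := ξ k) (x := y k)
      refine Eq.trans ?_ this.symm
      congr 1
      push_cast; ring
  constructor
  · refine h1.congr (fun ξ => ?_)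
    rw [prod_congr rfl (fun k _ => rfl), norm_prod]
    simp_rw [hnorm]
    rw [← exp_sum, freqNorm_sq, mul_sum, ← sum_neg_distrib]
    congr 1
    exact sum_congr rfl (fun k _ => by ring)
  · have h3 : ∏ k, ∑' n, f k n = ((torusTheta t x : ℝ) : ℂ) := by
      rw [torusTheta, Complex.ofReal_prod]
      exact prod_congr rfl (fun k _ => (hf k).tsum_eq)
    rw [h3] at h2
    have h4 := Complex.hasSum_re h2
    rw [Complex.ofReal_re] at h4
    refine h4.congr_fun (fun ξ => ?_)
    rw [e, Complex.re_ofReal_mul]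

lemma hasSum_torusTheta_sub_one (x : 𝕋 d) {t : ℝ} (ht : 0 < t) :
    HasSum (fun ξ : Fin d → ℤ => if ξ = 0 then 0 else
      exp (-(π * t * freqNorm ξ ^ 2)) *
      (mFourier ξ x).re) (torusTheta t x - 1) := by
  have h := hasSum_ite_sub_hasSum (hasSum_torusTheta x ht).2 0
  have e : exp (-(π * t * freqNorm (0 : Fin d → ℤ) ^ 2)) *
      (mFourier (0 : Fin d → ℤ) x).re = 1 := by
    rw [freqNorm_sq, UnitAddTorus.mFourier_zero, ContinuousMap.one_apply]; simp
  rwa [e] at h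

/-- The factor relating the Riesz potential to the Mellin transform of the heat kernel. -/
def mellinConst (d : ℕ) (s : ℝ) : ℝ :=
  rieszConst d s * (4 * π) ^ (-(((d : ℝ) - s) / 2)) / Real.Gamma (((d : ℝ) - s) / 2)

lemma rieszCoeff_eq {s : ℝ} (hsd : s < d) {ξ : Fin d → ℤ} (hξ : ξ ≠ 0) :
    rieszCoeff d s ξ = mellinConst d s * ∫ t in Ioi (0 : ℝ),
      t ^ (((d : ℝ) - s) / 2 - 1) * exp (-(π * freqNorm ξ ^ 2 * t)) := by
  have hα : 0 < ((d : ℝ) - s) / 2 := by linarith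
  have h1 := one_le_freqNorm_sq hξ
  have hf : 0 ≤ freqNorm ξ := Real.sqrt_nonneg _
  have hp : 0 < π * freqNorm ξ ^ 2 := by positivity
  rw [Real.integral_rpow_mul_exp_neg_mul_Ioi hα hp, rieszCoeff, if_neg hξ, mellinConst]
  have e1 : (2 * π * freqNorm ξ) ^ (s - (d : ℝ))
      = (4 * π) ^ (-(((d : ℝ) - s) / 2)) * (1 / (π * freqNorm ξ ^ 2)) ^ (((d : ℝ) - s) / 2) := by
    have e2 : (1 / (π * freqNorm ξ ^ 2)) ^ (((d : ℝ) - s) / 2)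
        = (π * freqNorm ξ ^ 2) ^ (-(((d : ℝ) - s) / 2)) := by
      rw [one_div, inv_rpow hp.le, rpow_neg hp.le]
    rw [e2, ← Real.mul_rpow (by positivity) hp.le]
    have e3 : 4 * π * (π * freqNorm ξ ^ 2) = (2 * π * freqNorm ξ) ^ (2 : ℝ) := by
      rw [Real.rpow_two]; ring
    rw [e3, ← rpow_mul (by positivity)]
    congr 1; ring
  rw [e1]
  field_simp

lemma rieszHeat_eq {s : ℝ} (hsd : s < d) {τ : ℝ} (hτ : 0 < τ) (x : 𝕋 d) :
    rieszHeat d s τ x = mellinConst d s * ∫ t in Ioi (0 : ℝ),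
      t ^ (((d : ℝ) - s) / 2 - 1) * (torusTheta (t + 4 * π * τ) x - 1) := by
  set α := ((d : ℝ) - s) / 2 with hα_def
  let F : (Fin d → ℤ) → ℝ → ℝ := fun ξ t => if ξ = 0 then 0 else
    t ^ (α - 1) * (exp (-(π * (t + 4 * π * τ) * freqNorm ξ ^ 2)) * (mFourier ξ x).re)
  have hFeq : ∀ ξ, ξ ≠ 0 → ∀ t, F ξ t = exp (-(4 * π ^ 2 * τ * freqNorm ξ ^ 2))
      * (mFourier ξ x).re * (t ^ (α - 1) *
      exp (-(π * freqNorm ξ ^ 2 * t))) := fun ξ hξ t => by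
    simp only [F, if_neg hξ]
    rw [show -(π * (t + 4 * π * τ) * freqNorm ξ ^ 2) =
      -(π * freqNorm ξ ^ 2 * t) + -(4 * π ^ 2 * τ * freqNorm ξ ^ 2) by ring,
      exp_add]
    ring
  have hint : ∀ c : ℝ, 0 < c → IntegrableOn (fun t : ℝ => t ^ (α - 1) * exp (-(c * t))) (Ioi 0) := fun c hc => by
    have := integrableOn_rpow_mul_exp_neg_mul_rpow (s := α - 1) (by linarith)
      zero_lt_one hc
    simpa using this
  have hFint : ∀ ξ, Integrable (F ξ) (volume.restrict (Ioi 0)) := fun ξ => by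
    by_cases hξ : ξ = 0
    · have : F ξ = fun _ => 0 := by funext t; simp [F, hξ]
      rw [this]; exact integrable_zero _ _ _
    · rw [show F ξ = _ from funext (hFeq ξ hξ)]
      have h1 := one_le_freqNorm_sq hξ
      exact (hint _ (by positivity)).const_mul _
  have hsum : Summable (fun ξ => ∫ t in Ioi 0, ‖F ξ t‖) := by
    refine Summable.of_nonneg_of_le (fun ξ => integral_nonneg (fun _ => norm_nonneg _))
      (fun ξ => ?_) (((hasSum_torusTheta x (t := 4 * π * τ) (by positivity)).1).mul_left
        (∫ t in Ioi 0, t ^ (α - 1) * exp (-(π * t))))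
    rw [← integral_mul_const]
    refine integral_mono_ae (hFint ξ).norm ((hint _ pi_pos).mul_const _) ?_
    filter_upwards [ae_restrict_mem measurableSet_Ioi] with t ht
    have ht0 : 0 < t := ht
    by_cases hξ : ξ = 0
    · simp only [F, hξ, if_true, norm_zero]; positivity
    · have h1 := one_le_freqNorm_sq hξ
      rw [hFeq ξ hξ, norm_mul, norm_mul, norm_of_nonneg (exp_pos _).le,
        norm_of_nonneg (by positivity : 0 ≤ t ^ (α - 1) * _), norm_eq_abs]
      have h2 := abs_mFourier_re_le ξ x
      have h3 : exp (-(π * freqNorm ξ ^ 2 * t)) ≤ exp (-(π * t)) := by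
        refine exp_le_exp.2 (neg_le_neg ?_)
        have : 0 ≤ π * t := by positivity
        nlinarith
      rw [show π * (4 * π * τ) * freqNorm ξ ^ 2 = 4 * π ^ 2 * τ * freqNorm ξ ^ 2 by ring]
      calc exp (-(4 * π ^ 2 * τ * freqNorm ξ ^ 2)) * |(mFourier ξ x).re| *
            (t ^ (α - 1) * exp (-(π * freqNorm ξ ^ 2 * t)))
          ≤ exp (-(4 * π ^ 2 * τ * freqNorm ξ ^ 2)) * 1 * (t ^ (α - 1) * exp (-(π * t))) := by gcongr
        _ = _ := by ring
  have key := hasSum_integral_of_summable_integral_norm hFint hsum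
  have e1 : ∫ t in Ioi 0, ∑' ξ, F ξ t
      = ∫ t in Ioi 0, t ^ (α - 1) * (torusTheta (t + 4 * π * τ) x - 1) := by
    refine setIntegral_congr_fun measurableSet_Ioi (fun t ht => ?_)
    have ht0 : (0 : ℝ) < t := ht
    have h := (hasSum_torusTheta_sub_one x (t := t + 4 * π * τ) (by positivity)).mul_left
      (t ^ (α - 1))
    rw [← h.tsum_eq]
    refine tsum_congr (fun ξ => ?_)
    simp only [F]
    split_ifs <;> simp
  rw [← e1, ← key.tsum_eq, ← tsum_mul_left, rieszHeat]
  refine tsum_congr (fun ξ => ?_)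
  by_cases hξ : ξ = 0
  · simp [hξ, rieszCoeff, F]
  · rw [show F ξ = _ from funext (hFeq ξ hξ), integral_const_mul, rieszCoeff_eq hsd hξ]
    ring

end

section

/-! ### Decay of the heat kernel off the origin -/

variable {d : ℕ}

lemma exists_rpow_mul_exp_le (p : ℝ) {c : ℝ} (hc : 0 < c) :
    ∃ C : ℝ, 0 ≤ C ∧ ∀ t : ℝ, 1 ≤ t → t ^ p * exp (-(c * t)) ≤ C := by
  obtain ⟨n, hn⟩ := exists_nat_ge p
  refine ⟨n.factorial / c ^ n, by positivity, fun t ht => ?_⟩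
  have h1 : t ^ p ≤ t ^ n := by
    rw [← Real.rpow_natCast]; exact rpow_le_rpow_of_exponent_le ht hn
  have h2 := Real.pow_div_factorial_le_exp (c * t) (by positivity) n
  rw [Real.exp_neg, ← div_eq_mul_inv, div_le_div_iff₀ (exp_pos _) (by positivity)]
  rw [div_le_iff₀ (by positivity), mul_pow] at h2
  nlinarith [pow_pos hc n]

lemma exists_rpow_mul_exp_inv_le (p : ℝ) {c : ℝ} (hc : 0 < c) :
    ∃ C : ℝ, 0 ≤ C ∧ ∀ t : ℝ, 0 < t → t ≤ 1 → t ^ p * exp (-(c / t)) ≤ C := by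
  obtain ⟨C, hC0, hC⟩ := exists_rpow_mul_exp_le (-p) hc
  refine ⟨C, hC0, fun t ht ht1 => ?_⟩
  have := hC (1 / t) ((one_le_div ht).2 ht1)
  rwa [one_div, inv_rpow ht.le, rpow_neg ht.le, inv_inv, ← div_eq_mul_inv] at this

/-- The squared distance of a point of the torus to the origin. -/
def torusSq (x : 𝕋 d) : ℝ := ∑ k, ‖x k‖ ^ 2

lemma continuous_torusSq : Continuous (torusSq : 𝕋 d → ℝ) := by
  unfold torusSq; fun_prop

lemma torusSq_nonneg (x : 𝕋 d) : 0 ≤ torusSq x := sum_nonneg (fun _ _ => sq_nonneg _)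

lemma torusSq_pos {x : 𝕋 d} (hx : x ≠ 0) : 0 < torusSq x := by
  obtain ⟨k, hk⟩ := Function.ne_iff.1 hx
  refine Finset.sum_pos' (fun _ _ => sq_nonneg _) ⟨k, mem_univ k, ?_⟩
  have : 0 < ‖x k‖ := norm_pos_iff.2 hk
  positivity

lemma torusSq_coe {y : Fin d → ℝ} (hy : ∀ k, |y k| ≤ 1 / 2) :
    torusSq (fun k => (y k : 𝕊)) = ∑ k, y k ^ 2 :=
  sum_congr rfl (fun k _ => by rw [norm_coe_circle (hy k), sq_abs])

lemma exists_lift_torus (x : 𝕋 d) : ∃ y : Fin d → ℝ, (∀ k, |y k| ≤ 1 / 2) ∧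
    (fun k => (y k : 𝕊)) = x ∧ torusSq x = ∑ k, y k ^ 2 := by
  choose y hy1 hy2 using fun k => exists_lift (x k)
  refine ⟨y, hy1, funext hy2, ?_⟩
  rw [← torusSq_coe hy1, show (fun k => (y k : 𝕊)) = x from funext hy2]

lemma exp_neg_eighth_ge {t : ℝ} (ht1 : t ≤ 1) : 1 / 2 ≤ exp (-(t / 8)) := by
  have := Real.add_one_le_exp (-(t / 8))
  linarith

lemma exp_quarter_le_eighth {t : ℝ} (ht : 0 ≤ t) : exp (-(t / 4)) ≤ exp (-(t / 8)) :=
  exp_le_exp.2 (by linarith)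

/-- Away from the origin the heat kernel and its derivatives are bounded uniformly in time, with
exponential decay. -/
lemma exists_theta_bound_off {r : ℝ} (hr : 0 < r) : ∃ C : ℝ, 0 ≤ C ∧
    ∀ x : 𝕋 d, r ≤ torusSq x → ∀ t : ℝ, 0 < t →
      |torusTheta t x - 1| ≤ C * exp (-(t / 8)) ∧
      ∀ k, |torusThetaPart k t x| ≤ C * exp (-(t / 8)) := by
  have hc : 0 < min (π * r) (1 / 4) := lt_min (by positivity) (by norm_num)
  obtain ⟨C1, hC1, h1⟩ := exists_rpow_mul_exp_inv_le (-((d : ℝ) / 2)) hc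
  obtain ⟨C2, hC2, h2⟩ := exists_rpow_mul_exp_inv_le (-((d : ℝ) / 2) - 1) hc
  have hK := prodConst_nonneg d
  refine ⟨prodConst d + 2 * π * prodConst d + 2 * ((1 + prodConst d) * C1 + 1)
    + 2 * (2 * π * (1 + prodConst d) * C2), by positivity, fun x hx t ht => ?_⟩
  rcases le_total 1 t with ht1 | ht1
  · have e1 := exp_quarter_le_eighth ht.le
    have e0 := exp_pos (-(t / 8))
    refine ⟨(abs_torusTheta_sub_one_le ht1 x).trans ?_, fun k => (abs_torusThetaPart_le k ht1 x).trans ?_⟩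
    · refine mul_le_mul ?_ e1 (exp_pos _).le (by positivity)
      have : 0 ≤ 2 * π * prodConst d + 2 * ((1 + prodConst d) * C1 + 1)
        + 2 * (2 * π * (1 + prodConst d) * C2) := by positivity
      linarith
    · refine mul_le_mul ?_ e1 (exp_pos _).le (by positivity)
      have : 0 ≤ 2 * ((1 + prodConst d) * C1 + 1) + 2 * (2 * π * (1 + prodConst d) * C2) := by positivity
      linarith
  · have e0 := exp_neg_eighth_ge ht1
    obtain ⟨y, hy, rfl, hR⟩ := exists_lift_torus x
    have b1 : exp (-(π * (∑ k, y k ^ 2) / t)) ≤ exp (-(min (π * r) (1 / 4) / t)) := by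
      refine exp_le_exp.2 (neg_le_neg ?_)
      rw [← hR]
      gcongr
      exact (min_le_left _ _).trans (by gcongr)
    have b2 : exp (-(1 / 4 / t)) ≤ exp (-(min (π * r) (1 / 4) / t)) := by
      refine exp_le_exp.2 (neg_le_neg ?_)
      gcongr
      exact min_le_right _ _
    have p1 : 0 ≤ t ^ (-((d : ℝ) / 2)) := rpow_nonneg ht.le _
    have p2 : 0 ≤ t ^ (-((d : ℝ) / 2) - 1) := rpow_nonneg ht.le _
    constructor
    · have h3 := abs_torusTheta_sub_gauss_le hy ht ht1
      have h4 := h1 t ht ht1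
      have h5 : |torusTheta t (fun k => (y k : 𝕊))| ≤ (1 + prodConst d) * C1 := by
        have h6 := abs_sub_abs_le_abs_sub (torusTheta t (fun k => (y k : 𝕊)))
          (t ^ (-((d : ℝ) / 2)) * exp (-(π * (∑ k, y k ^ 2) / t)))
        rw [abs_of_nonneg (mul_nonneg p1 (exp_pos _).le)] at h6
        have h7 : t ^ (-((d : ℝ) / 2)) * exp (-(π * (∑ k, y k ^ 2) / t)) ≤ C1 :=
          (mul_le_mul_of_nonneg_left b1 p1).trans h4
        have h8 : t ^ (-((d : ℝ) / 2)) * exp (-(1 / 4 / t)) ≤ C1 := (mul_le_mul_of_nonneg_left b2 p1).trans h4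
        nlinarith
      have h9 : |torusTheta t (fun k => (y k : 𝕊)) - 1| ≤ (1 + prodConst d) * C1 + 1 :=
        (abs_sub _ _).trans (by rw [abs_one]; linarith)
      refine h9.trans ?_
      have q1 : 0 ≤ (1 + prodConst d) * C1 + 1 := by positivity
      have q2 : 0 ≤ prodConst d + 2 * π * prodConst d + 2 * (2 * π * (1 + prodConst d) * C2) := by positivity
      nlinarith
    · intro k
      have h3 := abs_torusThetaPart_sub_gauss_le k hy ht ht1
      have h4 := h2 t ht ht1
      have h5 : |torusThetaPart k t (fun k => (y k : 𝕊))| ≤ 2 * π * (1 + prodConst d) * C2 := by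
        have h7 : t ^ (-((d : ℝ) / 2) - 1) * exp (-(π * (∑ k, y k ^ 2) / t)) ≤ C2 :=
          (mul_le_mul_of_nonneg_left b1 p2).trans h4
        have h8 : t ^ (-((d : ℝ) / 2) - 1) * exp (-(1 / 4 / t)) ≤ C2 :=
          (mul_le_mul_of_nonneg_left b2 p2).trans h4
        have h7' : 0 ≤ t ^ (-((d : ℝ) / 2) - 1) * exp (-(π * (∑ k, y k ^ 2) / t)) := by
          positivity
        generalize t ^ (-((d : ℝ) / 2) - 1) * exp (-(π * (∑ k, y k ^ 2) / t)) = m at *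
        have h6 := abs_add_le (torusThetaPart k t (fun k => (y k : 𝕊)) + 2 * π * y k * m) (-(2 * π * y k * m))
        rw [add_neg_cancel_right, abs_neg, abs_mul, abs_mul, abs_of_pos (by positivity : 0 < 2 * π),
          abs_of_nonneg h7'] at h6
        have h10 : 2 * π * |y k| * m ≤ 2 * π * 1 * C2 := by
          gcongr
          linarith [hy k]
        have h11 := h3.trans (mul_le_mul_of_nonneg_left h8 (by positivity))
        linarith
      refine h5.trans ?_
      have q1 : 0 ≤ 2 * π * (1 + prodConst d) * C2 := by positivity
      have q2 : 0 ≤ prodConst d + 2 * π * prodConst d + 2 * ((1 + prodConst d) * C1 + 1) := by positivity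
      nlinarith

/-- The heat kernel is bounded by its value at the origin. -/
lemma exists_theta_bound (d : ℕ) : ∃ C : ℝ, 0 ≤ C ∧ ∀ x : 𝕋 d, ∀ t : ℝ, 0 < t →
      |torusTheta t x - 1| ≤ C * (1 + t ^ (-((d : ℝ) / 2))) * exp (-(t / 8)) := by
  have hK := prodConst_nonneg d
  refine ⟨prodConst d + 2 * (1 + prodConst d), by positivity, fun x t ht => ?_⟩
  have p1 : 0 ≤ t ^ (-((d : ℝ) / 2)) := rpow_nonneg ht.le _
  rcases le_total 1 t with ht1 | ht1
  · have e1 := exp_quarter_le_eighth ht.le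
    refine (abs_torusTheta_sub_one_le ht1 x).trans ?_
    refine mul_le_mul ?_ e1 (exp_pos _).le (by positivity)
    nlinarith
  · have e0 := exp_neg_eighth_ge ht1
    obtain ⟨y, hy, rfl, hR⟩ := exists_lift_torus x
    have h3 := abs_torusTheta_sub_gauss_le hy ht ht1
    have h6 := abs_sub_abs_le_abs_sub (torusTheta t (fun k => (y k : 𝕊)))
          (t ^ (-((d : ℝ) / 2)) * exp (-(π * (∑ k, y k ^ 2) / t)))
    rw [abs_of_nonneg (mul_nonneg p1 (exp_pos _).le)] at h6
    have b1 : exp (-(π * (∑ k, y k ^ 2) / t)) ≤ 1 := exp_le_one_iff.2 (by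
      have : 0 ≤ π * (∑ k, y k ^ 2) / t :=
        div_nonneg (mul_nonneg pi_pos.le (sum_nonneg (fun _ _ => sq_nonneg _))) ht.le
      linarith)
    have b2 : exp (-(1 / 4 / t)) ≤ 1 := exp_le_one_iff.2 (by
      have : 0 ≤ 1 / 4 / t := by positivity
      linarith)
    have h8 := mul_le_mul_of_nonneg_left (mul_le_mul_of_nonneg_left b2 p1) hK
    have h9 : |torusTheta t (fun k => (y k : 𝕊)) - 1| ≤ (1 + prodConst d) * (1 + t ^ (-((d : ℝ) / 2))) := by
      refine (abs_sub _ _).trans ?_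
      rw [abs_one]
      nlinarith
    refine h9.trans ?_
    have q : 0 ≤ (1 + prodConst d) * (1 + t ^ (-((d : ℝ) / 2))) := by positivity
    have q2 : 0 ≤ prodConst d * (1 + t ^ (-((d : ℝ) / 2))) * exp (-(t / 8)) := by positivity
    nlinarith

lemma integrableOn_rpow_mul_exp_eighth {p : ℝ} (hp : 0 < p) :
    IntegrableOn (fun t : ℝ => t ^ (p - 1) * exp (-(t / 8))) (Ioi 0) := by
  have := integrableOn_rpow_mul_exp_neg_mul_rpow (s := p - 1) (b := 1 / 8) (by linarith)
    zero_lt_one (by norm_num)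
  refine this.congr_fun (fun t _ => ?_) measurableSet_Ioi
  simp only [rpow_one]
  congr 2; ring

end

section

/-! ### The Riesz potential and its derivatives off the origin -/

variable {d : ℕ} {s : ℝ}
local notation "𝐚" => ((d : ℝ) - s) / 2

/-- The integrand of the Mellin transform that defines the Riesz potential. -/
def rieszIntegrand (s t : ℝ) (x : 𝕋 d) : ℝ := t ^ (((d : ℝ) - s) / 2 - 1) * (torusTheta t x - 1)

/-- The integrand of the partial derivative of the Riesz potential. -/
def rieszPartIntegrand (k : Fin d) (s t : ℝ) (x : 𝕋 d) : ℝ :=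
  t ^ (((d : ℝ) - s) / 2 - 1) * torusThetaPart k t x

/-- The Riesz potential as a Mellin transform of the heat kernel. -/
def rieszInt (d : ℕ) (s : ℝ) (x : 𝕋 d) : ℝ := mellinConst d s * ∫ t in Ioi (0 : ℝ), rieszIntegrand s t x

/-- The partial derivatives of the Riesz potential. -/
def rieszPart (d : ℕ) (s : ℝ) (k : Fin d) (x : 𝕋 d) : ℝ :=
  mellinConst d s * ∫ t in Ioi (0 : ℝ), rieszPartIntegrand k s t x

lemma continuousOn_rpow_Ioi (p : ℝ) : ContinuousOn (fun t : ℝ => t ^ p) (Ioi 0) :=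
  fun t ht => (Real.continuousAt_rpow_const t p (Or.inl (ne_of_gt ht))).continuousWithinAt

lemma aestronglyMeasurable_rieszIntegrand (s : ℝ) (x : 𝕋 d) :
    AEStronglyMeasurable (fun t => rieszIntegrand s t x) (volume.restrict (Ioi 0)) :=
  ((continuousOn_rpow_Ioi _).mul ((continuousOn_torusTheta x).sub
    continuousOn_const)).aestronglyMeasurable measurableSet_Ioi

lemma aestronglyMeasurable_rieszPartIntegrand (k : Fin d) (s : ℝ) (x : 𝕋 d) :
    AEStronglyMeasurable (fun t => rieszPartIntegrand k s t x) (volume.restrict (Ioi 0)) :=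
  ((continuousOn_rpow_Ioi _).mul (continuousOn_torusThetaPart k x)).aestronglyMeasurable measurableSet_Ioi

/-- A dominating function for the integrands on the set `U`. -/
def IsThetaBound (s : ℝ) (U : Set (𝕋 d)) (b : ℝ → ℝ) : Prop :=
  IntegrableOn (fun t => t ^ (((d : ℝ) - s) / 2 - 1) * b t) (Ioi 0) ∧ AntitoneOn b (Ioi 0) ∧
    ∀ x ∈ U, ∀ t : ℝ, 0 < t → |torusTheta t x - 1| ≤ b t

lemma exists_isThetaBound_off (hsd : s < d) {r : ℝ} (hr : 0 < r) :
    ∃ b, IsThetaBound s {x : 𝕋 d | r ≤ torusSq x} b := by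
  obtain ⟨C, hC, h⟩ := exists_theta_bound_off hr
  refine ⟨fun t => C * exp (-(t / 8)), ?_, ?_, fun x hx t ht => (h x hx t ht).1⟩
  · have := (integrableOn_rpow_mul_exp_eighth (p := 𝐚) (by linarith)).const_mul C
    refine IntegrableOn.congr_fun this (fun t _ => ?_) measurableSet_Ioi
    ring
  · intro t _ t' _ htt'
    exact mul_le_mul_of_nonneg_left (exp_le_exp.2 (by linarith)) hC

lemma exists_isThetaBound_univ (hsd : s < d) (hs : s < 0) :
    ∃ b, IsThetaBound s (univ : Set (𝕋 d)) b := by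
  obtain ⟨C, hC, h⟩ := exists_theta_bound d
  refine ⟨fun t => C * (1 + t ^ (-((d : ℝ) / 2))) * exp (-(t / 8)), ?_, ?_, fun x _ t ht => h x t ht⟩
  · have h1 := (integrableOn_rpow_mul_exp_eighth (p := 𝐚) (by linarith)).const_mul C
    have h2 := (integrableOn_rpow_mul_exp_eighth (p := -s / 2) (by linarith)).const_mul C
    refine IntegrableOn.congr_fun (Integrable.add h1 h2) (fun t ht => ?_) measurableSet_Ioi
    have e : t ^ (-s / 2 - 1) = t ^ (𝐚 - 1) * t ^ (-((d : ℝ) / 2)) := by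
      rw [← rpow_add ht]; congr 1; ring
    simp only [Pi.add_apply, e]
    ring
  · intro t ht t' ht' htt'
    have h1 : t' ^ (-((d : ℝ) / 2)) ≤ t ^ (-((d : ℝ) / 2)) :=
      rpow_le_rpow_of_nonpos ht htt' (by have : 0 ≤ d := cast_nonneg d; linarith)
    have h4 : 0 ≤ t ^ (-((d : ℝ) / 2)) := rpow_nonneg (le_of_lt ht) _
    dsimp only
    gcongr

lemma IsThetaBound.integrableOn {U : Set (𝕋 d)} {b : ℝ → ℝ}
    (h : IsThetaBound s U b) {x : 𝕋 d} (hx : x ∈ U) :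
    IntegrableOn (fun t => rieszIntegrand s t x) (Ioi 0) := by
  refine Integrable.mono' h.1 (aestronglyMeasurable_rieszIntegrand s x) ?_
  filter_upwards [ae_restrict_mem measurableSet_Ioi] with t ht
  have hp : 0 ≤ t ^ (𝐚 - 1) := rpow_nonneg (le_of_lt ht) _
  rw [rieszIntegrand, norm_eq_abs, abs_mul, abs_of_nonneg hp]
  gcongr; exact h.2.2 x hx t ht

lemma IsThetaBound.rieszPotential_eq (hsd : s < d) {U : Set (𝕋 d)}
    {b : ℝ → ℝ} (h : IsThetaBound s U b) {x : 𝕋 d} (hx : x ∈ U) :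
    rieszPotential d s x = rieszInt d s x := by
  refine Tendsto.limUnder_eq ?_
  have h0 : Tendsto (fun τ : ℝ => mellinConst d s * ∫ t in Ioi 0,
      t ^ (𝐚 - 1) * (torusTheta (t + 4 * π * τ) x - 1)) (𝓝[>] 0)
      (𝓝 (rieszInt d s x)) := by
    refine Tendsto.const_mul _ ?_
    refine tendsto_integral_filter_of_dominated_convergence
      (fun t => t ^ (𝐚 - 1) * b t) ?_ ?_ h.1 ?_
    · filter_upwards [self_mem_nhdsWithin] with τ hτ
      have hτ' : 0 < τ := hτ
      refine ((continuousOn_rpow_Ioi _).mul (ContinuousOn.sub ?_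
        continuousOn_const)).aestronglyMeasurable measurableSet_Ioi
      refine (continuousOn_torusTheta x).comp (by fun_prop) (fun t ht => ?_)
      have : 0 < t := ht
      have := pi_pos
      exact mem_Ioi.2 (by positivity)
    · filter_upwards [self_mem_nhdsWithin] with τ hτ
      have hτ' : (0 : ℝ) < τ := hτ
      filter_upwards [ae_restrict_mem measurableSet_Ioi] with t ht
      have ht' : (0 : ℝ) < t := ht
      have hp : 0 ≤ t ^ (𝐚 - 1) := rpow_nonneg (le_of_lt ht) _
      have := pi_pos
      have h5 : 0 < t + 4 * π * τ := by positivity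
      rw [norm_eq_abs, abs_mul, abs_of_nonneg hp]
      refine mul_le_mul_of_nonneg_left ((h.2.2 x hx _ h5).trans ?_) hp
      exact h.2.1 ht (mem_Ioi.2 h5) (by have : 0 ≤ 4 * π * τ := by positivity
                                        linarith)
    · filter_upwards [ae_restrict_mem measurableSet_Ioi] with t ht
      refine Tendsto.const_mul _ (Tendsto.sub_const ?_ 1)
      have h6 : Tendsto (fun τ : ℝ => t + 4 * π * τ) (𝓝[>] 0) (𝓝 t) := by
        have : Tendsto (fun τ : ℝ => t + 4 * π * τ) (𝓝 0) (𝓝 (t + 4 * π * 0)) :=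
          Continuous.tendsto (by fun_prop) 0
        rw [mul_zero, add_zero] at this
        exact this.mono_left nhdsWithin_le_nhds
      exact ((continuousOn_torusTheta x).continuousAt (Ioi_mem_nhds ht)).tendsto.comp h6
  refine h0.congr' ?_
  filter_upwards [self_mem_nhdsWithin] with τ hτ
  exact (rieszHeat_eq hsd hτ x).symm

lemma IsThetaBound.continuousAt {U : Set (𝕋 d)}
    {b : ℝ → ℝ} (h : IsThetaBound s U b) {x : 𝕋 d} (hx : U ∈ 𝓝 x) :
    ContinuousAt (rieszInt d s) x := by
  refine ContinuousAt.mul continuousAt_const ?_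
  refine continuousAt_of_dominated (bound := fun t => t ^ (𝐚 - 1) * b t)
    (.of_forall (fun x => aestronglyMeasurable_rieszIntegrand s x)) ?_ h.1 ?_
  · filter_upwards [hx] with y hy
    filter_upwards [ae_restrict_mem measurableSet_Ioi] with t ht
    have hp : 0 ≤ t ^ (𝐚 - 1) := rpow_nonneg (le_of_lt ht) _
    rw [rieszIntegrand, norm_eq_abs, abs_mul, abs_of_nonneg hp]
    gcongr; exact h.2.2 y hy t ht
  · filter_upwards [ae_restrict_mem measurableSet_Ioi] with t ht
    exact (((continuous_torusTheta ht).sub continuous_const).const_mul _).continuousAt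

lemma rieszPotential_eq_of_ne (hsd : s < d) {x : 𝕋 d} (hx : x ≠ 0) :
    rieszPotential d s x = rieszInt d s x := by
  obtain ⟨b, hb⟩ := exists_isThetaBound_off hsd (torusSq_pos hx)
  exact hb.rieszPotential_eq hsd (le_refl (torusSq x))

lemma torusSq_half_mem_nhds {x : 𝕋 d} (hx : x ≠ 0) :
    {y : 𝕋 d | torusSq x / 2 ≤ torusSq y} ∈ 𝓝 x := by
  have h := torusSq_pos hx
  have h1 : {y : 𝕋 d | torusSq x / 2 < torusSq y} ∈ 𝓝 x :=
    (isOpen_lt continuous_const continuous_torusSq).mem_nhds (show torusSq x / 2 < torusSq x by linarith)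
  exact mem_of_superset h1 (fun y hy => (show torusSq x / 2 < torusSq y from hy).le)

lemma continuousAt_rieszInt (hsd : s < d) {x : 𝕋 d} (hx : x ≠ 0) :
    ContinuousAt (rieszInt d s) x := by
  obtain ⟨b, hb⟩ := exists_isThetaBound_off hsd (half_pos (torusSq_pos hx))
  exact hb.continuousAt (torusSq_half_mem_nhds hx)

lemma rieszPotential_eventuallyEq (hsd : s < d) {x : 𝕋 d} (hx : x ≠ 0) :
    rieszPotential d s =ᶠ[𝓝 x] rieszInt d s := by
  filter_upwards [isOpen_ne.mem_nhds hx] with y hy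
  exact rieszPotential_eq_of_ne hsd hy

/-- The Riesz potential is continuous away from the origin. -/
lemma continuousAt_rieszPotential (hsd : s < d) {x : 𝕋 d} (hx : x ≠ 0) :
    ContinuousAt (rieszPotential d s) x :=
  (continuousAt_rieszInt hsd hx).congr (rieszPotential_eventuallyEq hsd hx).symm

/-- For negative `s` the Riesz potential is continuous on the whole torus. -/
lemma continuous_rieszPotential (hsd : s < d) (hs : s < 0) :
    Continuous (rieszPotential d s) := by
  obtain ⟨b, hb⟩ := exists_isThetaBound_univ hsd hs
  have h1 : rieszPotential d s = rieszInt d s := funext (fun x => hb.rieszPotential_eq hsd (mem_univ x))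
  rw [h1]
  exact continuous_iff_continuousAt.2 (fun x => hb.continuousAt univ_mem)

lemma rieszHeat_neg (s τ : ℝ) (x : 𝕋 d) :
    rieszHeat d s τ (-x) = rieszHeat d s τ x := by
  refine tsum_congr (fun ξ => ?_)
  congr 1
  have h1 : mFourier ξ (-x) = mFourier (-ξ) x := by
    simp only [mFourier, ContinuousMap.coe_mk]
    refine prod_congr rfl (fun k _ => ?_)
    simp [fourier_apply]
  rw [h1, UnitAddTorus.mFourier_neg]
  exact Complex.conj_re _

lemma rieszPotential_neg (s : ℝ) (x : 𝕋 d) :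
    rieszPotential d s (-x) = rieszPotential d s x := by
  unfold rieszPotential
  simp_rw [rieszHeat_neg]

lemma continuousAt_rieszPart (hsd : s < d) (k : Fin d) {x : 𝕋 d}
    (hx : x ≠ 0) : ContinuousAt (rieszPart d s k) x := by
  obtain ⟨C, hC, h⟩ := exists_theta_bound_off (half_pos (torusSq_pos hx))
  refine ContinuousAt.mul continuousAt_const ?_
  refine continuousAt_of_dominated (bound := fun t => t ^ (𝐚 - 1) * exp (-(t / 8)) * C)
    (.of_forall (fun x => aestronglyMeasurable_rieszPartIntegrand k s x)) ?_
    ((integrableOn_rpow_mul_exp_eighth (by linarith)).mul_const C) ?_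
  · filter_upwards [torusSq_half_mem_nhds hx] with y hy
    filter_upwards [ae_restrict_mem measurableSet_Ioi] with t ht
    have hp : 0 ≤ t ^ (𝐚 - 1) := rpow_nonneg (le_of_lt ht) _
    rw [rieszPartIntegrand, norm_eq_abs, abs_mul, abs_of_nonneg hp, mul_assoc, mul_comm _ C]
    gcongr; exact (h y hy t ht).2 k
  · filter_upwards [ae_restrict_mem measurableSet_Ioi] with t ht
    exact ((continuous_torusThetaPart k ht).const_mul _).continuousAt

/-- Translation of a point of the torus along a coordinate axis. -/
lemma continuous_add_single (k : Fin d) (x : 𝕋 d) :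
    Continuous (fun h : ℝ => x + single k (h : 𝕊)) := by
  refine continuous_const.add ?_
  exact (continuous_single k).comp (AddCircle.continuous_mk' 1)

/-- Differentiation of the Mellin integral along a curve in the torus. -/
lemma hasDerivAt_rieszInt_comp (hsd : s < d) (k : Fin d) {e : ℝ → 𝕋 d}
    (he : Continuous e) (hx : e 0 ≠ 0)
    (hd : ∀ t : ℝ, 0 < t → ∀ u : ℝ,
      HasDerivAt (fun h : ℝ => torusTheta t (e h)) (torusThetaPart k t (e u)) u) :
    HasDerivAt (fun h : ℝ => rieszInt d s (e h)) (rieszPart d s k (e 0)) 0 := by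
  obtain ⟨C, hC, h⟩ := exists_theta_bound_off (half_pos (torusSq_pos hx))
  have hmem := he.continuousAt.preimage_mem_nhds (torusSq_half_mem_nhds hx)
  obtain ⟨b, hb⟩ := exists_isThetaBound_off hsd (torusSq_pos hx)
  have e1 : Integrable (fun t => rieszIntegrand s t (e 0)) (volume.restrict (Ioi 0)) :=
    hb.integrableOn (le_refl (torusSq (e 0)))
  have e2 : ∀ᵐ t ∂(volume.restrict (Ioi 0)), ∀ u ∈ e ⁻¹' {y : 𝕋 d | torusSq (e 0) / 2 ≤ torusSq y},
      ‖rieszPartIntegrand k s t (e u)‖ ≤ t ^ (𝐚 - 1) * exp (-(t / 8)) * C := by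
    filter_upwards [ae_restrict_mem measurableSet_Ioi] with t ht u hu
    have hp : 0 ≤ t ^ (𝐚 - 1) := rpow_nonneg (le_of_lt ht) _
    rw [rieszPartIntegrand, norm_eq_abs, abs_mul, abs_of_nonneg hp, mul_assoc, mul_comm _ C]
    gcongr; exact (h _ hu t ht).2 k
  have e3 : ∀ᵐ t ∂(volume.restrict (Ioi 0)), ∀ u ∈ e ⁻¹' {y : 𝕋 d | torusSq (e 0) / 2 ≤ torusSq y},
      HasDerivAt (fun u : ℝ => rieszIntegrand s t (e u)) (rieszPartIntegrand k s t (e u)) u := by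
    filter_upwards [ae_restrict_mem measurableSet_Ioi] with t ht u _
    exact ((hd t ht u).sub_const 1).const_mul _
  have e4 : Integrable (fun t => t ^ (𝐚 - 1) * exp (-(t / 8)) * C)
      (volume.restrict (Ioi 0)) :=
    (integrableOn_rpow_mul_exp_eighth (by linarith)).mul_const C
  exact (hasDerivAt_integral_of_dominated_loc_of_deriv_le
    (F := fun u t => rieszIntegrand s t (e u)) (F' := fun u t => rieszPartIntegrand k s t (e u)) hmem
    (.of_forall (fun u => aestronglyMeasurable_rieszIntegrand s (e u))) e1
    (aestronglyMeasurable_rieszPartIntegrand k s (e 0)) e2 e4 e3).2.const_mul _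

/-- The Riesz potential has classical partial derivatives away from the origin. -/
lemma hasDerivAt_rieszPotential (hsd : s < d) (k : Fin d) {x : 𝕋 d} (hx : x ≠ 0) :
    HasDerivAt (fun h : ℝ => rieszPotential d s (x + single k (h : 𝕊))) (rieszPart d s k x) 0 := by
  have hx0 : x + single k ((0 : ℝ) : 𝕊) = x := by simp
  have h0 := hasDerivAt_rieszInt_comp hsd k (continuous_add_single k x) (by rwa [hx0])
    (fun t ht u => hasDerivAt_torusTheta k ht x u)
  rw [hx0] at h0
  refine h0.congr_of_eventuallyEq ?_
  have h1 := rieszPotential_eventuallyEq hsd hx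
  rw [← hx0] at h1
  exact (continuous_add_single k x).continuousAt.eventually h1

lemma torusPartial_rieszPotential (hsd : s < d) (k : Fin d) {x : 𝕋 d}
    (hx : x ≠ 0) : torusPartial k (rieszPotential d s) x = rieszPart d s k x :=
  (hasDerivAt_rieszPotential hsd k hx).deriv

end

section

/-! ### The singularity at the origin -/

variable {d : ℕ} {s : ℝ}
local notation "𝐚" => ((d : ℝ) - s) / 2

/-- The strength of the singularity of the gradient of the Riesz potential at the origin. -/
def singConst (d : ℕ) (s : ℝ) : ℝ :=
  2 * π * mellinConst d s * ((1 / π) ^ (s / 2 + 1) * Real.Gamma (s / 2 + 1))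

/-- The Mellin integral of a Gaussian. -/
lemma integral_gauss_mellin {q R : ℝ} (hq : 0 < q) (hR : 0 < R) :
    IntegrableOn (fun t : ℝ => t ^ (-q - 1) * exp (-(R / t))) (Ioi 0) ∧
    ∫ t in Ioi (0 : ℝ), t ^ (-q - 1) * exp (-(R / t)) = (1 / R) ^ q * Real.Gamma q := by
  have e : ∀ t ∈ Ioi 0, (|(-1 : ℝ)| * t ^ ((-1 : ℝ) - 1)) •
      ((t ^ (-1 : ℝ)) ^ (q - 1) * exp (-(R * t ^ (-1 : ℝ))))
      = t ^ (-q - 1) * exp (-(R / t)) := fun t ht => by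
    have ht0 : 0 < t := ht
    rw [← rpow_mul ht0.le, smul_eq_mul, abs_neg, abs_one, one_mul, ← mul_assoc,
      ← rpow_add ht0, Real.rpow_neg_one, div_eq_mul_inv]
    congr 2; ring
  have h := integral_comp_rpow_Ioi (fun y : ℝ => y ^ (q - 1) * exp (-(R * y))) (p := -1) (by norm_num)
  have h2 := integrableOn_Ioi_comp_rpow_iff (fun y : ℝ => y ^ (q - 1) * exp (-(R * y)))
    (p := -1) (by norm_num)
  have h3 := integrableOn_rpow_mul_exp_neg_mul_rpow (s := q - 1) (by linarith)
    zero_lt_one hR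
  constructor
  · refine (h2.2 ?_).congr_fun e measurableSet_Ioi
    simpa using h3
  · rw [← setIntegral_congr_fun measurableSet_Ioi e, h, Real.integral_rpow_mul_exp_neg_mul_Ioi hq hR]

/-- The gradient of the Riesz potential is, up to a bounded error, the Coulomb-type field
`-a x / |x|^{s+2}`. -/
lemma exists_rieszPart_bound (hs : -1 ≤ s) (hsd : s < d) : ∃ C : ℝ, 0 ≤ C ∧
    ∀ (k : Fin d) (y : Fin d → ℝ), (∀ l, |y l| ≤ 1 / 2) → 0 < ∑ l, y l ^ 2 →
      |rieszPart d s k (fun l => (y l : 𝕊))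
        + singConst d s * y k * (∑ l, y l ^ 2) ^ (-(s / 2 + 1))| ≤ C := by
  have hK := prodConst_nonneg d
  have hπ := pi_pos
  have hq : 0 < s / 2 + 1 := by linarith
  obtain ⟨C1, hC1, h1⟩ := exists_rpow_mul_exp_inv_le (-(s / 2 + 1) - 1) (c := 1 / 4) (by norm_num)
  let B : ℝ → ℝ := fun t => (Ioc 0 1).indicator (fun _ => 2 * π * prodConst d * C1) t
    + (2 * π * prodConst d) * (t ^ (𝐚 - 1) * exp (-(t / 8)))
    + π * (Ioi 1).indicator (fun t => t ^ (-(s / 2 + 1) - 1)) t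
  have hBi : Integrable B (volume.restrict (Ioi 0)) := by
    refine (Integrable.add ?_ ?_).add ?_
    · refine Integrable.integrableOn ?_
      rw [integrable_indicator_iff measurableSet_Ioc]
      exact integrableOn_const (by simp)
    · exact (integrableOn_rpow_mul_exp_eighth (by linarith)).const_mul _
    · refine Integrable.const_mul (Integrable.integrableOn ?_) _
      rw [integrable_indicator_iff measurableSet_Ioi]
      exact integrableOn_Ioi_rpow_of_lt (by linarith) zero_lt_one
  refine ⟨|mellinConst d s| * ∫ t in Ioi 0, B t, ?_, fun k y hy hR => ?_⟩
  · refine mul_nonneg (abs_nonneg _) (setIntegral_nonneg measurableSet_Ioi (fun t ht => ?_))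
    have ht0 : 0 < t := ht
    have i1 : 0 ≤ (Ioc 0 1).indicator (fun _ => 2 * π * prodConst d * C1) t :=
      indicator_nonneg (fun _ _ => by positivity) t
    have i2 : 0 ≤ (Ioi 1).indicator (fun t : ℝ => t ^ (-(s / 2 + 1) - 1)) t :=
      indicator_nonneg (fun t ht => rpow_nonneg (zero_le_one.trans (le_of_lt ht)) _) t
    simp only [B]
    positivity
  set x : 𝕋 d := fun l => (y l : 𝕊) with hx_def
  have hx : 0 < torusSq x := by rw [hx_def, torusSq_coe hy]; exact hR
  obtain ⟨C, hC, hb⟩ := exists_theta_bound_off hx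
  have hPi : IntegrableOn (fun t => rieszPartIntegrand k s t x) (Ioi 0) := by
    refine Integrable.mono' ((integrableOn_rpow_mul_exp_eighth (p := 𝐚)
      (by linarith)).mul_const C) (aestronglyMeasurable_rieszPartIntegrand k s x) ?_
    filter_upwards [ae_restrict_mem measurableSet_Ioi] with t ht
    have hp : 0 ≤ t ^ (𝐚 - 1) := rpow_nonneg (le_of_lt ht) _
    rw [rieszPartIntegrand, norm_eq_abs, abs_mul, abs_of_nonneg hp, mul_assoc, mul_comm _ C]
    gcongr; exact (hb x le_rfl t ht).2 k
  obtain ⟨hmi, hme⟩ := integral_gauss_mellin hq (mul_pos hπ hR)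
  have hmi' := hmi.const_mul (2 * π * y k)
  have e : rieszPart d s k x + singConst d s * y k * (∑ l, y l ^ 2) ^ (-(s / 2 + 1))
      = mellinConst d s * ∫ t in Ioi 0, (rieszPartIntegrand k s t x + 2 * π * y k *
        (t ^ (-(s / 2 + 1) - 1) * exp (-(π * (∑ l, y l ^ 2) / t)))) := by
    rw [integral_add hPi hmi', integral_const_mul, hme, rieszPart, singConst, one_div, one_div,
      inv_rpow hπ.le, inv_rpow (mul_pos hπ hR).le, Real.mul_rpow hπ.le hR.le,
      rpow_neg hR.le, mul_inv]
    ring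
  rw [e, abs_mul]
  refine mul_le_mul_of_nonneg_left ?_ (abs_nonneg _)
  rw [← norm_eq_abs]
  refine norm_integral_le_of_norm_le hBi ?_
  filter_upwards [ae_restrict_mem measurableSet_Ioi] with t ht
  have ht0 : 0 < t := ht
  have hp : 0 ≤ t ^ (𝐚 - 1) := rpow_nonneg ht0.le _
  have hm : t ^ (-(s / 2 + 1) - 1) = t ^ (𝐚 - 1) * t ^ (-((d : ℝ) / 2) - 1) := by
    rw [← rpow_add ht0]; congr 1; ring
  rw [norm_eq_abs]
  rcases le_or_gt t 1 with ht1 | ht1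
  · have g1 := abs_torusThetaPart_sub_gauss_le k hy ht0 ht1
    have g2 := h1 t ht0 ht1
    have e2 : rieszPartIntegrand k s t x + 2 * π * y k *
        (t ^ (-(s / 2 + 1) - 1) * exp (-(π * (∑ l, y l ^ 2) / t)))
        = t ^ (𝐚 - 1) * (torusThetaPart k t x + 2 * π * y k *
          (t ^ (-((d : ℝ) / 2) - 1) * exp (-(π * (∑ l, y l ^ 2) / t)))) := by
      rw [hm, rieszPartIntegrand]; ring
    rw [e2, abs_mul, abs_of_nonneg hp]
    have g3 := mul_le_mul_of_nonneg_left g1 hp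
    refine g3.trans ?_
    have e3 : t ^ (𝐚 - 1) * (2 * π * prodConst d *
        (t ^ (-((d : ℝ) / 2) - 1) * exp (-(1 / 4 / t))))
        = 2 * π * prodConst d * (t ^ (-(s / 2 + 1) - 1) * exp (-(1 / 4 / t))) := by
      rw [hm]; ring
    rw [e3]
    simp only [B]
    rw [indicator_of_mem (mem_Ioc.2 ⟨ht0, ht1⟩), indicator_of_notMem (by simpa using ht1)]
    have g4 := mul_le_mul_of_nonneg_left g2 (by positivity : 0 ≤ 2 * π * prodConst d)
    have g5 : 0 ≤ 2 * π * prodConst d * (t ^ (𝐚 - 1) * exp (-(t / 8))) := by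
      positivity
    linarith
  · have g1 := abs_torusThetaPart_le k ht1.le x
    have g2 := exp_quarter_le_eighth ht0.le
    have g0 : 0 ≤ t ^ (-(s / 2 + 1) - 1) := rpow_nonneg ht0.le _
    have g3 : exp (-(π * (∑ l, y l ^ 2) / t)) ≤ 1 := by
      refine exp_le_one_iff.2 ?_
      have : 0 ≤ π * (∑ l, y l ^ 2) / t := by positivity
      linarith
    simp only [B]
    rw [indicator_of_notMem (fun h => by linarith [h.2]), indicator_of_mem (mem_Ioi.2 ht1), zero_add]
    refine (abs_add_le _ _).trans (add_le_add ?_ ?_)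
    · rw [rieszPartIntegrand, abs_mul, abs_of_nonneg hp]
      calc _ ≤ t ^ (𝐚 - 1) * (2 * π * prodConst d * exp (-(t / 8))) :=
            mul_le_mul_of_nonneg_left (g1.trans (by gcongr)) hp
        _ = _ := by ring
    · rw [abs_mul, abs_mul, abs_of_pos (by positivity : 0 < 2 * π),
        abs_of_nonneg (mul_nonneg g0 (exp_pos _).le)]
      have g6 : t ^ (-(s / 2 + 1) - 1) * exp (-(π * (∑ l, y l ^ 2) / t)) ≤
          t ^ (-(s / 2 + 1) - 1) := mul_le_of_le_one_right g0 g3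
      calc 2 * π * |y k| * (t ^ (-(s / 2 + 1) - 1) *
            exp (-(π * (∑ l, y l ^ 2) / t)))
          ≤ 2 * π * (1 / 2) * t ^ (-(s / 2 + 1) - 1) := by
            gcongr
            exact hy k
        _ = π * t ^ (-(s / 2 + 1) - 1) := by ring

lemma mellinConst_pos (hs : 0 ≤ s) (hsd : s < d) : 0 < mellinConst d s := by
  have hα : 0 < 𝐚 := by linarith
  have hd : (0 : ℝ) < d := by linarith
  refine div_pos (mul_pos ?_ (by positivity)) (Gamma_pos_of_pos hα)
  unfold rieszConst
  split_ifs with h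
  · have := Gamma_pos_of_pos (half_pos hd)
    positivity
  · have h1 := Gamma_pos_of_pos hα
    positivity

lemma singConst_pos (hs : 0 ≤ s) (hsd : s < d) : 0 < singConst d s := by
  have := mellinConst_pos hs hsd
  have := Gamma_pos_of_pos (by linarith : 0 < s / 2 + 1)
  unfold singConst
  positivity

/-- For `s ≥ 0` the Riesz potential is bounded below, and blows up at least logarithmically at the
origin. -/
lemma exists_rieszPotential_lower (hs : 0 ≤ s) (hsd : s < d) : ∃ C c : ℝ, 0 < c ∧
    ∀ x : 𝕋 d, x ≠ 0 → -C ≤ rieszPotential d s x ∧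
      ∀ M : ℝ, 0 ≤ M → π * torusSq x ≤ exp (-M) → c * M - C ≤ rieszPotential d s x := by
  have hκ := mellinConst_pos hs hsd
  have hα : 0 < 𝐚 := by linarith
  have hK := prodConst_nonneg d
  let B : ℝ → ℝ := fun t => -((Ioc 0 1).indicator (fun t => t ^ (𝐚 - 1)) t
    + prodConst d * (t ^ (𝐚 - 1) * exp (-(t / 8))))
  have hBi : IntegrableOn B (Ioi 0) := by
    refine (Integrable.add (Integrable.integrableOn ?_) ?_).neg
    · rw [integrable_indicator_iff measurableSet_Ioc,
        ← intervalIntegrable_iff_integrableOn_Ioc_of_le zero_le_one]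
      exact intervalIntegral.intervalIntegrable_rpow' (by linarith)
    · exact (integrableOn_rpow_mul_exp_eighth hα).const_mul _
  have hB0 : ∀ t, 0 < t → B t ≤ 0 := fun t ht => by
    have i1 : 0 ≤ (Ioc 0 1).indicator (fun t : ℝ => t ^ (𝐚 - 1)) t :=
      indicator_nonneg (fun t ht => rpow_nonneg (le_of_lt ht.1) _) t
    simp only [B]
    have : 0 ≤ prodConst d * (t ^ (𝐚 - 1) * exp (-(t / 8))) := by positivity
    linarith
  have hBle : ∀ x : 𝕋 d, ∀ t, 0 < t → B t ≤ rieszIntegrand s t x := fun x t ht => by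
    have hp : 0 ≤ t ^ (𝐚 - 1) := rpow_nonneg ht.le _
    simp only [B, rieszIntegrand]
    rcases le_or_gt t 1 with ht1 | ht1
    · rw [indicator_of_mem (mem_Ioc.2 ⟨ht, ht1⟩)]
      have := mul_nonneg hp (torusTheta_nonneg ht x)
      have h2 : 0 ≤ prodConst d * (t ^ (𝐚 - 1) * exp (-(t / 8))) := by positivity
      linarith
    · rw [indicator_of_notMem (fun h => by linarith [h.2]), zero_add]
      have h1 := abs_torusTheta_sub_one_le ht1.le x
      have h2 := exp_quarter_le_eighth ht.le
      have h3 := (abs_le.1 (h1.trans (mul_le_mul_of_nonneg_left h2 hK))).1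
      have := mul_le_mul_of_nonneg_left h3 hp
      linarith
  have hAi : ∀ x : 𝕋 d, x ≠ 0 → IntegrableOn (fun t => rieszIntegrand s t x) (Ioi 0) := fun x hx => by
    obtain ⟨b, hb⟩ := exists_isThetaBound_off hsd (torusSq_pos hx)
    exact hb.integrableOn (le_refl (torusSq x))
  refine ⟨-(mellinConst d s * ∫ t in Ioi 0, B t), mellinConst d s * exp (-1),
    by positivity, fun x hx => ⟨?_, fun M hM hR => ?_⟩⟩
  · rw [neg_neg, rieszPotential_eq_of_ne hsd hx, rieszInt]
    refine mul_le_mul_of_nonneg_left ?_ hκ.le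
    exact setIntegral_mono_on hBi (hAi x hx) measurableSet_Ioi (fun t ht => hBle x t ht)
  · rw [sub_neg_eq_add, rieszPotential_eq_of_ne hsd hx, rieszInt, mul_assoc, ← mul_add]
    refine mul_le_mul_of_nonneg_left ?_ hκ.le
    set δ := exp (-M) with hδ
    have hδ0 : 0 < δ := exp_pos _
    have hδ1 : δ ≤ 1 := exp_le_one_iff.2 (by linarith)
    let E : ℝ → ℝ := (Ioc δ 1).indicator (fun t => exp (-1) * t⁻¹)
    have hinv : IntervalIntegrable (fun t : ℝ => t⁻¹) volume δ 1 := by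
      refine intervalIntegral.intervalIntegrable_inv (fun t ht => ?_) continuousOn_id
      rw [uIcc_of_le hδ1] at ht
      exact (hδ0.trans_le ht.1).ne'
    have hEi : IntegrableOn E (Ioi 0) := by
      refine Integrable.integrableOn ?_
      rw [integrable_indicator_iff measurableSet_Ioc]
      exact ((intervalIntegrable_iff_integrableOn_Ioc_of_le hδ1).1 hinv).const_mul _
    have hE : ∫ t in Ioi 0, E t = exp (-1) * M := by
      rw [setIntegral_indicator measurableSet_Ioc,
        inter_eq_self_of_subset_right (fun t ht => mem_Ioi.2 (hδ0.trans ht.1)),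
        integral_const_mul, ← integral_of_le hδ1, integral_inv_of_pos hδ0 one_pos,
        one_div, Real.log_inv, hδ, Real.log_exp, neg_neg]
    rw [← hE, ← integral_add hEi hBi]
    refine setIntegral_mono_on (hEi.add hBi) (hAi x hx) measurableSet_Ioi (fun t ht => ?_)
    have ht0 : 0 < t := ht
    by_cases hmem : t ∈ Ioc δ 1
    · simp only [E, indicator_of_mem hmem, B, rieszIntegrand]
      rw [indicator_of_mem (mem_Ioc.2 ⟨ht0, hmem.2⟩)]
      have hp : 0 ≤ t ^ (𝐚 - 1) := rpow_nonneg ht0.le _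
      have h2 : 0 ≤ prodConst d * (t ^ (𝐚 - 1) * exp (-(t / 8))) := by positivity
      have h3 : exp (-1) * t⁻¹ ≤ t ^ (𝐚 - 1) * torusTheta t x := by
        obtain ⟨y, hy, rfl, hyR⟩ := exists_lift_torus x
        have h4 := gauss_le_torusTheta y ht0
        have h5 : exp (-1) ≤ exp (-(π * (∑ k, y k ^ 2) / t)) := by
          refine exp_le_exp.2 (neg_le_neg ?_)
          rw [div_le_one ht0, ← hyR]
          exact hR.trans hmem.1.le
        have h6 : t⁻¹ ≤ t ^ (𝐚 - 1) * t ^ (-((d : ℝ) / 2)) := by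
          rw [← rpow_add ht0, ← Real.rpow_neg_one]
          exact Real.rpow_le_rpow_of_exponent_ge ht0 hmem.2 (by linarith)
        calc exp (-1) * t⁻¹ ≤ exp (-(π * (∑ k, y k ^ 2) / t)) *
              (t ^ (𝐚 - 1) * t ^ (-((d : ℝ) / 2))) := by gcongr
          _ = t ^ (𝐚 - 1) * (t ^ (-((d : ℝ) / 2)) *
              exp (-(π * (∑ k, y k ^ 2) / t))) := by ring
          _ ≤ _ := mul_le_mul_of_nonneg_left h4 hp
      linarith
    · simp only [E, indicator_of_notMem hmem, zero_add]
      exact hBle x t ht0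

end

section

/-! ### Integration along coordinate lines of the configuration space -/

instance : IsProbabilityMeasure (volume : Measure 𝕊) := ⟨UnitAddCircle.measure_univ⟩

variable {N d : ℕ}
local notation "𝕏" => TorusConfig N d

instance : BorelSpace 𝕏 := Pi.borelSpace

instance : (volume : Measure 𝕏).IsAddLeftInvariant :=
  Measure.pi.isAddLeftInvariant _

instance : (volume : Measure 𝕏).IsAddRightInvariant :=
  ⟨fun g => by
    simp_rw [add_comm _ g]
    exact map_add_left_eq_self _ g⟩

/-- The displacement of the `k`-th coordinate of the `i`-th point by `c`. -/
def shift (i : Fin N) (k : Fin d) (c : 𝕊) : 𝕏 := single i (single k c)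

@[simp] lemma shift_zero (i : Fin N) (k : Fin d) : shift i k 0 = 0 := by simp [shift]

lemma shift_add (i : Fin N) (k : Fin d) (a b : 𝕊) :
    shift i k (a + b) = shift i k a + shift i k b := by
  simp [shift, Pi.single_add]

lemma continuous_shift (i : Fin N) (k : Fin d) : Continuous (shift i k) :=
  (continuous_single i).comp (continuous_single (A := fun _ : Fin d => 𝕊) k)

lemma continuous_add_shift (i : Fin N) (k : Fin d) (x : 𝕏) :
    Continuous (fun h : ℝ => x + shift i k (h : 𝕊)) :=
  continuous_const.add ((continuous_shift i k).comp (AddCircle.continuous_mk' 1))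

lemma shift_apply_same (i : Fin N) (k : Fin d) (c : 𝕊) :
    shift i k c i = single k c := by simp [shift]

lemma shift_apply_ne {i j : Fin N} (h : j ≠ i) (k : Fin d) (c : 𝕊) :
    shift i k c j = 0 := by simp [shift, h]

lemma measurable_add_shift (i : Fin N) (k : Fin d) :
    Measurable (fun p : 𝕏 × 𝕊 => p.1 + shift i k p.2) :=
  (continuous_fst.add ((continuous_shift i k).comp continuous_snd)).measurable

lemma lintegral_shift (i : Fin N) (k : Fin d) {f : 𝕏 → ENNReal} (hf : Measurable f) :
    ∫⁻ x, ∫⁻ c : 𝕊, f (x + shift i k c) = ∫⁻ x, f x := by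
  rw [lintegral_lintegral_swap (f := fun x (c : 𝕊) => f (x + shift i k c))
    (hf.comp (measurable_add_shift i k)).aemeasurable]
  simp_rw [lintegral_add_right_eq_self]
  simp

lemma ae_of_ae_shift (i : Fin N) (k : Fin d) {S : Set 𝕏} (hS : MeasurableSet S)
    (h : ∀ x, ∀ᵐ c : 𝕊, x + shift i k c ∉ S) : ∀ᵐ x, x ∉ S := by
  have h1 := lintegral_shift i k (measurable_one.indicator hS)
  have h2 : ∀ x, ∫⁻ c : 𝕊, S.indicator (1 : 𝕏 → ENNReal) (x + shift i k c) = 0 := fun x => by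
    refine lintegral_eq_zero_of_ae_eq_zero ?_
    filter_upwards [h x] with c hc
    rw [indicator_of_notMem hc]; rfl
  simp_rw [h2] at h1
  rw [lintegral_zero, lintegral_indicator_one hS] at h1
  exact measure_eq_zero_iff_ae_notMem.1 h1.symm

lemma countable_coe_circle (c : 𝕊) : {t : ℝ | (t : 𝕊) = c}.Countable := by
  induction c using induction_on with | H a =>
  refine (countable_range (fun n : ℤ => a + n)).mono (fun t ht => ?_)
  have : ((t - a : ℝ) : 𝕊) = 0 := by
    rw [AddCircle.coe_sub, sub_eq_zero]; exact ht
  obtain ⟨n, hn⟩ := (AddCircle.coe_eq_zero_iff _).1 this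
  refine ⟨n, ?_⟩
  simp only [zsmul_eq_mul, mul_one] at hn
  simp only
  linarith

instance : NullSingletonClass (volume : Measure 𝕊) := ⟨fun c => by
  have h := UnitAddCircle.lintegral_preimage 0 (({c} : Set 𝕊).indicator 1)
  rw [lintegral_indicator_one (measurableSet_singleton c)] at h
  rw [← h]
  refine lintegral_eq_zero_of_ae_eq_zero ?_
  have : ∀ᵐ t : ℝ ∂(volume.restrict (Ioc 0 (0 + 1))), t ∉ {t : ℝ | (t : 𝕊) = c} :=
    ae_restrict_of_ae (measure_eq_zero_iff_ae_notMem.1 ((countable_coe_circle c).measure_zero _))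
  filter_upwards [this] with t ht
  have ht' : (t : 𝕊) ∉ ({c} : Set 𝕊) := ht
  simp [ht']⟩

/-- The set of configurations in which two points coincide. -/
def collisions (N d : ℕ) : Set (TorusConfig N d) := {x | ∃ i j, i ≠ j ∧ x i = x j}

lemma sub_ne_zero_of_notMem_collisions {x : 𝕏} (hx : x ∉ collisions N d) {i j : Fin N}
    (hij : i ≠ j) : x i - x j ≠ 0 :=
  fun h => hx ⟨i, j, hij, sub_eq_zero.1 h⟩

lemma isClosed_collisions : IsClosed (collisions N d) := by
  have : collisions N d = ⋃ i, ⋃ j, ⋃ (_ : i ≠ j), {x | x i = x j} := by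
    ext x; simp [collisions]
  rw [this]
  refine isClosed_iUnion_of_finite (fun i => isClosed_iUnion_of_finite (fun j =>
    isClosed_iUnion_of_finite (fun _ => ?_)))
  exact isClosed_eq (continuous_apply i) (continuous_apply j)

lemma ae_notMem_collisions (hd : 1 ≤ d) : ∀ᵐ x, x ∉ collisions N d := by
  have h1 : ∀ i j : Fin N, i ≠ j → ∀ᵐ x : 𝕏, x ∉ {x : 𝕏 | x i = x j} := fun i j hij => by
    refine ae_of_ae_shift i ⟨0, hd⟩
      (isClosed_eq (continuous_apply i) (continuous_apply j)).measurableSet (fun x => ?_)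
    have h2 : ∀ᵐ c : 𝕊, c ∉ ({x j ⟨0, hd⟩ - x i ⟨0, hd⟩} : Set 𝕊) :=
      measure_eq_zero_iff_ae_notMem.1 (measure_singleton _)
    filter_upwards [h2] with c hc h3
    refine hc ?_
    have h4 := congrFun (h3) ⟨0, hd⟩
    simp only [Pi.add_apply, shift_apply_same, shift_apply_ne hij.symm, Pi.single_eq_same,
      Pi.zero_apply, add_zero] at h4
    rw [mem_singleton_iff, ← h4, add_sub_cancel_left]
  have h2 : ∀ᵐ x : 𝕏, ∀ i j, i ≠ j → x ∉ {x : 𝕏 | x i = x j} := by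
    rw [ae_all_iff]; intro i; rw [ae_all_iff]; intro j
    by_cases hij : i = j
    · exact Eventually.of_forall (fun x h => absurd hij h)
    · filter_upwards [h1 i j hij] with x hx _ using hx
  filter_upwards [h2] with x hx h
  obtain ⟨i, j, hij, h⟩ := h
  exact hx i j hij h

lemma countable_line_collisions (i : Fin N) (k : Fin d) {x : 𝕏} (hx : x ∉ collisions N d) :
    {t : ℝ | x + shift i k (t : 𝕊) ∈ collisions N d}.Countable := by
  have : {t : ℝ | x + shift i k (t : 𝕊) ∈ collisions N d} ⊆ ⋃ j, {t : ℝ | (t : 𝕊) = x j k - x i k} := by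
    rintro t ⟨a, b, hab, h⟩
    rw [mem_iUnion]
    have key : ∀ j, j ≠ i → (x + shift i k (t : 𝕊)) i =
        (x + shift i k (t : 𝕊)) j → (t : 𝕊) = x j k - x i k := fun j hj h3 => by
      have h4 := congrFun h3 k
      simp only [Pi.add_apply, shift_apply_same, shift_apply_ne hj, Pi.single_eq_same,
        Pi.zero_apply, add_zero] at h4
      rw [← h4, add_sub_cancel_left]
    by_cases ha : a = i
    · subst ha
      exact ⟨b, key b hab.symm h⟩
    · by_cases hb : b = i
      · subst hb
        exact ⟨a, key a hab h.symm⟩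
      · exfalso
        refine hx ⟨a, b, hab, ?_⟩
        rwa [Pi.add_apply, Pi.add_apply, shift_apply_ne ha, shift_apply_ne hb, add_zero, add_zero] at h
  exact (countable_iUnion (fun j => countable_coe_circle _)).mono this

lemma hasDerivAt_shift_of_zero {i : Fin N} {k : Fin d} {u : 𝕏 → ℝ} {v : ℝ}
    {x : 𝕏} (t : ℝ)
    (h : HasDerivAt (fun h : ℝ => u (x + shift i k (t : 𝕊) + shift i k (h : 𝕊))) v 0) :
    HasDerivAt (fun h : ℝ => u (x + shift i k (h : 𝕊))) v t := by
  have h1 : HasDerivAt (fun h : ℝ => u (x + shift i k (t : 𝕊)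
      + shift i k (h : 𝕊))) v (t - t) := by rwa [sub_self]
  have h2 := h1.comp_sub_const t t
  refine h2.congr_of_eventuallyEq (.of_forall (fun h => ?_))
  simp only
  rw [add_assoc, ← shift_add, ← AddCircle.coe_add, add_sub_cancel]

/-- The integral over configuration space of a derivative along a coordinate line vanishes, if the
primitive is continuous across the collisions. -/
lemma integral_lineDeriv_eq_zero (hd : 1 ≤ d) (i : Fin N) (k : Fin d) {q q' : 𝕏 → ℝ}
    (hq : Continuous q) (hq' : Measurable q') (hint : Integrable q')
    (hder : ∀ x, x ∉ collisions N d → HasDerivAt (fun h : ℝ => q (x + shift i k (h : 𝕊))) (q' x) 0) :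
    ∫ x, q' x = 0 := by
  have hm : AEStronglyMeasurable (fun p : 𝕏 × 𝕊 => q' (p.1 + shift i k p.2)) (volume.prod volume) :=
    (hq'.comp (measurable_add_shift i k)).aestronglyMeasurable
  have hI : Integrable (fun p : 𝕏 × 𝕊 => q' (p.1 + shift i k p.2)) (volume.prod volume) := by
    refine ⟨hm, ?_⟩
    rw [hasFiniteIntegral_iff_enorm, lintegral_prod _ hm.enorm,
      lintegral_shift i k hq'.enorm]
    exact hint.2
  have h1 : ∫ x, ∫ c : 𝕊, q' (x + shift i k c) = ∫ x, q' x := by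
    rw [integral_integral_swap hI]
    simp_rw [integral_add_right_eq_self]
    simp
  rw [← h1]
  refine integral_eq_zero_of_ae ?_
  filter_upwards [hI.prod_right_ae, ae_notMem_collisions hd] with x hx hxc
  have h2 := UnitAddCircle.intervalIntegral_preimage 0 (fun c => q' (x + shift i k c))
  have h3 : IntervalIntegrable (fun t : ℝ => q' (x + shift i k (t : 𝕊))) volume 0 (0 + 1) := by
    rw [intervalIntegrable_iff_integrableOn_Ioc_of_le (by norm_num)]
    exact (UnitAddCircle.measurePreserving_mk 0).integrable_comp_of_integrable hx
  have h4 := integral_eq_of_hasDerivAt_off_countable_of_le (fun t : ℝ => q (x + shift i k (t : 𝕊)))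
    (fun t : ℝ => q' (x + shift i k (t : 𝕊))) (by norm_num)
    (countable_line_collisions i k hxc) (hq.comp (continuous_add_shift i k x)).continuousOn
    (fun t ht => hasDerivAt_shift_of_zero t (hder _ ht.2)) h3
  simp only [Pi.zero_apply]
  rw [← h2, h4]
  have : ((0 + 1 : ℝ) : 𝕊) = ((0 : ℝ) : 𝕊) := by
    rw [zero_add, AddCircle.coe_period, AddCircle.coe_zero]
  rw [this, sub_self]

/-- A bounded function whose derivative is bounded on one side has an integrable derivative. -/
lemma lintegral_deriv_le {q q' : ℝ → ℝ} {M K b : ℝ} (hb : 0 ≤ b) (hK : 0 ≤ K)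
    (hq : ContinuousOn q (Icc 0 b)) (hder : ∀ t ∈ Ioo 0 b, HasDerivAt q (q' t) t)
    (hM : ∀ t ∈ Icc 0 b, q t ∈ Icc 0 M)
    (hlow : (∀ t ∈ Ioo 0 b, -K ≤ q' t) ∨ (∀ t ∈ Ioo 0 b, q' t ≤ K)) :
    ∫⁻ t in Ioc 0 b, ‖q' t‖ₑ ≤ ofReal (M + 2 * K * b) := by
  have main : ∀ q q' : ℝ → ℝ, ContinuousOn q (Icc 0 b) → (∀ t ∈ Ioo 0 b, HasDerivAt q (q' t) t) →
      (q b - q 0 ≤ M) → (∀ t ∈ Ioo 0 b, -K ≤ q' t) →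
      ∫⁻ t in Ioc 0 b, ‖q' t‖ₑ ≤ ofReal (M + 2 * K * b) := fun q q' hq hder hM hlow => by
    have h1 : ContinuousOn (fun t => q t + K * t) (Icc 0 b) := hq.add (by fun_prop)
    have h2 : ∀ t ∈ Ioo 0 b, HasDerivAt (fun t => q t + K * t) (q' t + K) t := fun t ht => by
      simpa using (hder t ht).fun_add ((hasDerivAt_id t).const_mul K)
    have h3 := intervalIntegral.integrableOn_deriv_of_nonneg h1 h2 (fun t ht => by linarith [hlow t ht])
    have h3' : IntervalIntegrable (fun t => q' t + K) volume 0 b :=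
      (intervalIntegrable_iff_integrableOn_Ioc_of_le hb).2 h3
    have h4 := intervalIntegral.integral_eq_sub_of_hasDerivAt_of_le hb h1 h2 h3'
    have hpos : ∀ᵐ t ∂(volume.restrict (Ioc 0 b)), 0 ≤ q' t + K := by
      rw [← restrict_Ioo_eq_restrict_Ioc]
      filter_upwards [ae_restrict_mem measurableSet_Ioo] with t ht
      linarith [hlow t ht]
    calc ∫⁻ t in Ioc 0 b, ‖q' t‖ₑ ≤ ∫⁻ t in Ioc 0 b, ofReal ((q' t + K) + K) := by
          refine lintegral_mono_ae ?_
          filter_upwards [hpos] with t ht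
          rw [Real.enorm_eq_ofReal_abs]
          refine ofReal_le_ofReal (abs_le.2 ⟨by linarith, by linarith⟩)
      _ = ofReal (∫ t in Ioc 0 b, ((q' t + K) + K)) := by
          rw [ofReal_integral_eq_lintegral_ofReal]
          · exact h3.add (integrableOn_const (by simp))
          · filter_upwards [hpos] with t ht
            simp only [Pi.zero_apply]; linarith
      _ ≤ ofReal (M + 2 * K * b) := by
          refine ofReal_le_ofReal ?_
          rw [integral_add h3 (integrableOn_const (by simp)), ← integral_of_le hb, h4,
            ← integral_of_le hb, intervalIntegral.integral_const]
          simp only [smul_eq_mul]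
          linarith
  have h0 := hM 0 (left_mem_Icc.2 hb)
  have hb' := hM b (right_mem_Icc.2 hb)
  rcases hlow with h | h
  · exact main q q' hq hder (by linarith [h0.1, hb'.2]) h
  · have := main (fun t => -q t) (fun t => -q' t) hq.neg (fun t ht => (hder t ht).neg)
      (by linarith [h0.2, hb'.1]) (fun t ht => by linarith [h t ht])
    simpa using this

end

section

/-! ### The Gibbs factor of a pair of points -/

variable {N d : ℕ}

/-- The standing assumptions on the parameters. -/
structure Admissible (N d : ℕ) (s σ : ℝ) : Prop where
  one_le_d : 1 ≤ d
  one_le_N : 1 ≤ N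
  le_s : -1 ≤ s
  s_lt : s < d
  σ_pos : 0 < σ

/-- The inverse temperature in the Gibbs factor. -/
def invTemp (N : ℕ) (σ : ℝ) : ℝ := 1 / (2 * (N : ℝ) * σ)

lemma Admissible.invTemp_pos {s σ : ℝ} (hp : Admissible N d s σ) : 0 < invTemp N σ := by
  have h1 := hp.σ_pos
  have h2 : (0 : ℝ) < N := by exact_mod_cast hp.one_le_N
  unfold invTemp; positivity

open Classical in
/-- The factor `exp (-b g)` of one pair of points, with its limiting value `0` at the origin if
`g` is repulsive. -/
def pairFactor (d : ℕ) (s b : ℝ) (z : 𝕋 d) : ℝ :=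
  if z = 0 ∧ 0 ≤ s then 0 else exp (-(b * rieszPotential d s z))

lemma pairFactor_of_ne {s b : ℝ} {z : 𝕋 d} (hz : z ≠ 0) :
    pairFactor d s b z = exp (-(b * rieszPotential d s z)) := by
  simp [pairFactor, hz]

lemma pairFactor_of_neg {s b : ℝ} (hs : s < 0) (z : 𝕋 d) :
    pairFactor d s b z = exp (-(b * rieszPotential d s z)) := by
  simp [pairFactor, not_le.2 hs]

lemma pairFactor_nonneg (s b : ℝ) (z : 𝕋 d) : 0 ≤ pairFactor d s b z := by
  unfold pairFactor; split_ifs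
  · exact le_rfl
  · exact (exp_pos _).le

lemma continuous_pairFactor {s b : ℝ} (hsd : s < d) (hb : 0 < b) :
    Continuous (pairFactor d s b) := by
  rcases lt_or_ge s 0 with hs | hs
  · rw [show pairFactor d s b = _ from funext (pairFactor_of_neg hs)]
    exact Real.continuous_exp.comp (continuous_const.mul (continuous_rieszPotential hsd hs)).neg
  · refine continuous_iff_continuousAt.2 (fun z => ?_)
    by_cases hz : z = 0
    · subst hz
      obtain ⟨C, c, hc, h⟩ := exists_rieszPotential_lower hs hsd
      have h0 : pairFactor d s b 0 = 0 := by simp [pairFactor, hs]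
      rw [ContinuousAt, h0]
      rw [Metric.tendsto_nhds]
      intro ε hε
      obtain ⟨M, hM0, hM⟩ : ∃ M : ℝ, 0 ≤ M ∧ exp (-(b * (c * M - C))) < ε := by
        have h1 : Tendsto (fun M : ℝ => exp (-(b * (c * M - C)))) atTop (𝓝 0) := by
          refine Real.tendsto_exp_neg_atTop_nhds_zero.comp ?_
          refine Tendsto.const_mul_atTop hb ?_
          exact tendsto_atTop_add_const_right _ _ (tendsto_id.const_mul_atTop hc)
        obtain ⟨M, hM⟩ := ((h1.eventually_lt_const hε).and (eventually_ge_atTop 0)).exists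
        exact ⟨M, hM.2, hM.1⟩
      have h2 : ∀ᶠ z : 𝕋 d in 𝓝 0, π * torusSq z < exp (-M) := by
        have h3 : Continuous (fun z : 𝕋 d => π * torusSq z) := continuous_torusSq.const_mul _
        refine h3.continuousAt.eventually_lt continuousAt_const ?_
        have : torusSq (0 : 𝕋 d) = 0 := by simp [torusSq]
        rw [this, mul_zero]; exact exp_pos _
      filter_upwards [h2] with z hz
      rw [dist_eq, sub_zero, abs_of_nonneg (pairFactor_nonneg _ _ _)]
      by_cases hz0 : z = 0
      · rw [hz0, h0]; exact hε
      · rw [pairFactor_of_ne hz0]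
        refine lt_of_le_of_lt (exp_le_exp.2 (neg_le_neg ?_)) hM
        gcongr; exact (h z hz0).2 M hM0 hz.le
    · have h1 : ContinuousAt (fun z => exp (-(b * rieszPotential d s z))) z :=
        Real.continuous_exp.continuousAt.comp
          (continuousAt_const.mul (continuousAt_rieszPotential hsd hz)).neg
      refine h1.congr ?_
      filter_upwards [isOpen_ne.mem_nhds hz] with w hw
      exact (pairFactor_of_ne hw).symm

lemma exists_pairFactor_le {s b : ℝ} (hsd : s < d) (hb : 0 < b) :
    ∃ M : ℝ, 1 ≤ M ∧ ∀ z, pairFactor d s b z ≤ M := by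
  obtain ⟨M, hM⟩ := (isCompact_univ.image (continuous_pairFactor hsd hb)).bddAbove
  exact ⟨max M 1, le_max_right _ _, fun z => (hM ⟨z, mem_univ z, rfl⟩).trans (le_max_left _ _)⟩

/-- The partial derivative of `pairFactor` away from the origin. -/
def pairDeriv (s b : ℝ) (k : Fin d) (z : 𝕋 d) : ℝ := -(b * rieszPart d s k z) * pairFactor d s b z

lemma hasDerivAt_pairFactor {s b : ℝ} (hsd : s < d) (k : Fin d) {z : 𝕋 d} (hz : z ≠ 0) :
    HasDerivAt (fun h : ℝ => pairFactor d s b (z + single k (h : 𝕊))) (pairDeriv s b k z) 0 := by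
  have h1 := ((hasDerivAt_rieszPotential hsd k hz).const_mul b).neg.exp
  have hz0 : z + single k ((0 : ℝ) : 𝕊) = z := by simp
  have h2 : HasDerivAt (fun h : ℝ => exp (-(b * rieszPotential d s
      (z + single k (h : 𝕊))))) (pairDeriv s b k z) 0 := by
    refine h1.congr_deriv ?_
    simp only [Pi.neg_apply, hz0]
    rw [pairDeriv, pairFactor_of_ne hz]; ring
  refine h2.congr_of_eventuallyEq ?_
  have h3 : ∀ᶠ h : ℝ in 𝓝 0, z + single k (h : 𝕊) ≠ 0 := by
    refine (continuous_add_single k z).continuousAt.eventually_ne ?_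
    rwa [hz0]
  filter_upwards [h3] with h hh
  exact pairFactor_of_ne hh

lemma measurable_rieszPart {s : ℝ} (hsd : s < d) (k : Fin d) : Measurable (rieszPart d s k) :=
  measurable_of_continuousOn_compl_singleton 0
    (fun _ hz => (continuousAt_rieszPart hsd k hz).continuousWithinAt)

lemma measurable_pairDeriv {s b : ℝ} (hsd : s < d) (hb : 0 < b) (k : Fin d) :
    Measurable (pairDeriv s b k) :=
  ((measurable_rieszPart hsd k).const_mul b).neg.mul (continuous_pairFactor hsd hb).measurable

/-- The derivative of the pair factor is one-signed up to a bounded error on each half line, so it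
is integrable along half lines, uniformly. -/
lemma lintegral_pairDeriv_half_le {s b C M : ℝ} (hsd : s < d) (hb : 0 < b)
    (hM1 : 1 ≤ M) (hM : ∀ z, pairFactor d s b z ≤ M) (hC0 : 0 ≤ C)
    (hC : ∀ (k : Fin d) (y : Fin d → ℝ), (∀ l, |y l| ≤ 1 / 2) → 0 < ∑ l, y l ^ 2 →
      |rieszPart d s k (fun l => (y l : 𝕊))
        + singConst d s * y k * (∑ l, y l ^ 2) ^ (-(s / 2 + 1))| ≤ C)
    (k : Fin d) (y : Fin d → ℝ) (hy : ∀ l, |y l| ≤ 1 / 2) (hyk : y k = 0) (e : ℝ)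
    (he : e = 1 ∨ e = -1) :
    ∫⁻ t in Ioc (0 : ℝ) (1 / 2), ‖pairDeriv s b k ((fun l => (y l : 𝕊)) + single k ((e * t : ℝ) : 𝕊))‖ₑ
      ≤ ofReal (M + 2 * (b * C * M) * (1 / 2)) := by
  obtain ⟨Z, hZ⟩ : ∃ Z : ℝ → 𝕋 d, ∀ t, (fun l => (y l : 𝕊)) + single k ((e * t : ℝ) : 𝕊) = Z t :=
    ⟨_, fun _ => rfl⟩
  obtain ⟨u, hu⟩ : ∃ u : ℝ → Fin d → ℝ, ∀ t, Function.update y k (e * t) = u t := ⟨_, fun _ => rfl⟩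
  have huk : ∀ t, u t k = e * t := fun t => by rw [← hu, Function.update_self]
  have hul : ∀ t l, l ≠ k → u t l = y l := fun t l hl => by rw [← hu, Function.update_of_ne hl]
  have he2 : |e| = 1 := by rcases he with rfl | rfl <;> simp
  have hee : e * e = 1 := by rcases he with rfl | rfl <;> norm_num
  have hlift : ∀ t : ℝ, (fun l => (u t l : 𝕊)) = Z t := fun t => by
    rw [← hZ]
    funext l
    by_cases hl : l = k
    · subst hl; simp [huk, hyk]
    · simp [hul t l hl, hl]
  have hbd : ∀ t ∈ Ioo 0 (1 / 2), (∀ l, |u t l| ≤ 1 / 2) ∧ 0 < ∑ l, u t l ^ 2 := fun t ht => by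
    refine ⟨fun l => ?_, Finset.sum_pos' (fun _ _ => sq_nonneg _) ⟨k, mem_univ k, ?_⟩⟩
    · by_cases hl : l = k
      · rw [hl, huk, abs_mul, he2, one_mul, abs_of_pos ht.1]; exact ht.2.le
      · rw [hul t l hl]; exact hy l
    · rw [huk, mul_pow, sq e, hee, one_mul]; exact pow_pos ht.1 2
  have hne : ∀ t ∈ Ioo 0 (1 / 2), Z t ≠ 0 := fun t ht h0 => by
    have h1 := torusSq_coe (hbd t ht).1
    have h2 := (hbd t ht).2
    rw [← h1, hlift, h0] at h2
    simp [torusSq] at h2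
  have hder : ∀ t ∈ Ioo 0 (1 / 2),
      HasDerivAt (fun t => pairFactor d s b (Z t)) (e * pairDeriv s b k (Z t)) t := fun t ht => by
    have h1 := hasDerivAt_pairFactor (b := b) hsd k (hne t ht)
    have h2 : HasDerivAt (fun r : ℝ => e * r - e * t) e t := by
      simpa using ((hasDerivAt_id t).const_mul e).sub_const (e * t)
    rw [← sub_self (e * t)] at h1
    refine ((h1.comp t h2).congr_deriv (mul_comm _ _)).congr_of_eventuallyEq (.of_forall fun r => ?_)
    simp only [Function.comp_apply]
    rw [← hZ t, add_assoc, ← Pi.single_add, ← AddCircle.coe_add, add_sub_cancel, hZ]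
  have hP : ∀ t ∈ Ioo 0 (1 / 2),
      |rieszPart d s k (Z t) + singConst d s * (e * t) * (∑ l, u t l ^ 2) ^ (-(s / 2 + 1))| ≤ C := fun t ht => by
    rw [← huk, ← hlift]
    exact hC k _ (hbd t ht).1 (hbd t ht).2
  have hE0 : ∀ t, 0 ≤ pairFactor d s b (Z t) := fun t => pairFactor_nonneg _ _ _
  have hEM : ∀ t, pairFactor d s b (Z t) ≤ M := fun t => hM _
  have key : ∀ q E : ℝ, -C ≤ q → 0 ≤ E → E ≤ M → -(b * C * M) ≤ b * (q * E) := fun q E hq hE hE' => by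
    have h1 := mul_le_mul_of_nonneg_right hq hE
    have h2 := mul_le_mul_of_nonneg_left hE' hC0
    have h3 := mul_le_mul_of_nonneg_left (show -(C * M) ≤ q * E by linarith) hb.le
    linarith
  have hsign : (∀ t ∈ Ioo 0 (1 / 2), -(b * C * M) ≤ e * pairDeriv s b k (Z t)) ∨
      (∀ t ∈ Ioo 0 (1 / 2), e * pairDeriv s b k (Z t) ≤ b * C * M) := by
    have hform : ∀ t ∈ Ioo 0 (1 / 2), ∃ r w : ℝ, 0 ≤ w ∧ |e * r| ≤ C ∧
        e * pairDeriv s b k (Z t) = b * ((singConst d s * w - e * r) * pairFactor d s b (Z t)) := fun t ht => by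
      refine ⟨rieszPart d s k (Z t) + singConst d s * (e * t) * (∑ l, u t l ^ 2) ^ (-(s / 2 + 1)), t * (∑ l, u t l ^ 2) ^ (-(s / 2 + 1)),
        mul_nonneg ht.1.le (rpow_nonneg (hbd t ht).2.le _), by rw [abs_mul, he2, one_mul]; exact hP t ht, ?_⟩
      rw [pairDeriv]
      linear_combination (b * singConst d s * t * (∑ l, u t l ^ 2)
        ^ (-(s / 2 + 1)) * pairFactor d s b (Z t)) * hee
    refine (le_total 0 (singConst d s)).imp (fun ha t ht => ?_) fun ha t ht => ?_ <;>
      obtain ⟨r, w, hw, hr, heq⟩ := hform t ht <;> rw [heq]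
    · have h2 := mul_nonneg ha hw
      exact key _ _ (by linarith [(abs_le.1 hr).2]) (hE0 t) (hEM t)
    · have h2 := mul_nonneg_of_nonpos_of_nonpos ha (neg_nonpos.2 hw)
      linarith [key (-(singConst d s * w - e * r)) _ (by linarith [(abs_le.1 hr).1]) (hE0 t) (hEM t)]
  have hcont : ContinuousOn (fun t => pairFactor d s b (Z t)) (Icc 0 (1 / 2)) := by
    refine Continuous.continuousOn ((continuous_pairFactor hsd hb).comp ?_)
    rw [show Z = fun t => _ from funext fun t => (hZ t).symm]
    exact (continuous_add_single k _).comp (continuous_const.mul continuous_id)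
  refine le_trans (le_of_eq ?_) (lintegral_deriv_le (by norm_num) (by positivity) hcont hder
    (fun t _ => ⟨hE0 t, hEM t⟩) hsign)
  refine lintegral_congr (fun t => ?_)
  rw [enorm_mul, Real.enorm_eq_ofReal_abs e, he2, ENNReal.ofReal_one, one_mul, hZ]

lemma lintegral_circle_le (φ : 𝕊 → ENNReal) :
    ∫⁻ c, φ c ≤ (∫⁻ t in Ioc (0 : ℝ) (1 / 2), φ ((-1 * t : ℝ) : 𝕊))
      + ∫⁻ t in Ioc (0 : ℝ) (1 / 2), φ ((1 * t : ℝ) : 𝕊) := by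
  rw [← UnitAddCircle.lintegral_preimage (-(1 / 2))]
  have hsplit : Ioc (-(1 / 2) : ℝ) (-(1 / 2) + 1) = Ioc (-(1 / 2)) 0 ∪ Ioc 0 (1 / 2) := by
    rw [Ioc_union_Ioc_eq_Ioc (by norm_num) (by norm_num)]; norm_num
  rw [hsplit]
  refine (lintegral_union_le _ _ _).trans (add_le_add ?_ ?_)
  · have h2 := (Measure.measurePreserving_neg (volume : Measure ℝ)).setLIntegral_comp_preimage_emb
      (MeasurableEquiv.neg ℝ).measurableEmbedding
      (fun a : ℝ => φ (a : 𝕊)) (Ioc (-(1 / 2)) 0)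
    rw [← h2]
    have h3 : (Neg.neg : ℝ → ℝ) ⁻¹' Ioc (-(1 / 2)) 0 = Ico 0 (1 / 2) := by
      ext t; simp only [mem_preimage, mem_Ioc, mem_Ico]; constructor <;> rintro ⟨h, h'⟩ <;>
        constructor <;> linarith
    rw [h3, restrict_Ico_eq_restrict_Ioc]
    simp only [neg_one_mul]
    exact le_rfl
  · simp

/-- The derivative of the pair factor is integrable along coordinate lines, uniformly. -/
lemma exists_lintegral_pairDeriv_le {s b : ℝ} (hs : -1 ≤ s) (hsd : s < d) (hb : 0 < b) :
    ∃ B : ENNReal, B ≠ ⊤ ∧ ∀ (k : Fin d) (z : 𝕋 d), ∫⁻ c : 𝕊, ‖pairDeriv s b k (z + single k c)‖ₑ ≤ B := by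
  obtain ⟨M, hM1, hM⟩ := exists_pairFactor_le hsd hb
  obtain ⟨C, hC0, hC⟩ := exists_rieszPart_bound hs hsd
  set L : ENNReal := ofReal (M + 2 * (b * C * M) * (1 / 2)) with hL
  have half := fun k y hy hyk e he => lintegral_pairDeriv_half_le hsd hb hM1 hM hC0 hC k y hy hyk e he
  refine ⟨L + L, by simp [hL], fun k z => ?_⟩
  -- move the origin of the line to the point whose `k`-th coordinate vanishes
  obtain ⟨y', hy', hyz, -⟩ := exists_lift_torus z
  set y := Function.update y' k 0 with hy_def
  have hy : ∀ l, |y l| ≤ 1 / 2 := fun l => by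
    by_cases hl : l = k
    · subst hl; simp [hy_def]
    · simpa [hy_def, hl] using hy' l
  have hyk : y k = 0 := by simp [hy_def]
  have hz : ∀ c : 𝕊, z + single k c = (fun l => (y l : 𝕊)) + single k (z k + c) := fun c => by
    funext l
    by_cases hl : l = k
    · subst hl; simp [hyk]
    · simp [hy_def, hl, ← hyz]
  obtain ⟨φ, hφ⟩ : ∃ φ : 𝕊 → ENNReal, ∀ c, φ c = ‖pairDeriv s b k
      ((fun l => (y l : 𝕊)) + single k c)‖ₑ := ⟨_, fun _ => rfl⟩
  have h0 : ∀ c, ‖pairDeriv s b k (z + single k c)‖ₑ = φ (z k + c) := fun c => by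
    rw [hφ, hz]
  simp only [h0]
  rw [lintegral_add_left_eq_self φ (z k)]
  refine (lintegral_circle_le φ).trans (add_le_add ?_ ?_)
  · simp only [hφ]
    exact half k y hy hyk (-1) (Or.inr rfl)
  · simp only [hφ]
    exact half k y hy hyk 1 (Or.inl rfl)

end

section

/-! ### Continuously differentiable functions of a configuration -/

variable {N d : ℕ}
local notation "𝕏" => TorusConfig N d

/-- `u` is continuous and has continuous partial derivatives in all coordinates of all points. -/
structure IsC1 (u : 𝕏 → ℝ) : Prop where
  continuous : Continuous u
  differentiable : ∀ i k x, DifferentiableAt ℝ (fun h : ℝ => u (x + shift i k (h : 𝕊))) 0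
  continuous_partial : ∀ i k, Continuous (𝐃 i k u)

lemma IsC1.hasDerivAt {u : 𝕏 → ℝ} (hu : IsC1 u) (i : Fin N) (k : Fin d) (x : 𝕏) :
    HasDerivAt (fun h : ℝ => u (x + shift i k (h : 𝕊))) (𝐃 i k u x) 0 :=
  (hu.differentiable i k x).hasDerivAt

lemma configPartial_eq {u : 𝕏 → ℝ} {i : Fin N} {k : Fin d} {x : 𝕏} {v : ℝ}
    (h : HasDerivAt (fun h : ℝ => u (x + shift i k (h : 𝕊))) v 0) :
    𝐃 i k u x = v := h.deriv

lemma IsC1.of_hasDerivAt {u : 𝕏 → ℝ} (hu : Continuous u)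
    (v : Fin N → Fin d → 𝕏 → ℝ) (hv : ∀ i k, Continuous (v i k))
    (h : ∀ i k x, HasDerivAt (fun h : ℝ => u (x + shift i k (h : 𝕊))) (v i k x) 0) :
    IsC1 u :=
  ⟨hu, fun i k x => (h i k x).differentiableAt, fun i k => by
    rw [show 𝐃 i k u = v i k from funext fun x => configPartial_eq (h i k x)]
    exact hv i k⟩

lemma coe_zero_shift (i : Fin N) (k : Fin d) (x : 𝕏) :
    x + shift i k ((0 : ℝ) : 𝕊) = x := by simp

lemma IsC1.hasDerivAt_add {u v : 𝕏 → ℝ} (hu : IsC1 u) (hv : IsC1 v) (i : Fin N) (k : Fin d) (x : 𝕏) :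
    HasDerivAt (fun h : ℝ => u (x + shift i k (h : 𝕊)) + v (x + shift i k (h : 𝕊)))
      (𝐃 i k u x + 𝐃 i k v x) 0 :=
  (hu.hasDerivAt i k x).add (hv.hasDerivAt i k x)

lemma IsC1.hasDerivAt_mul {u v : 𝕏 → ℝ} (hu : IsC1 u) (hv : IsC1 v) (i : Fin N) (k : Fin d) (x : 𝕏) :
    HasDerivAt (fun h : ℝ => u (x + shift i k (h : 𝕊)) * v (x + shift i k (h : 𝕊)))
      (𝐃 i k u x * v x + u x * 𝐃 i k v x) 0 := by
  have := (hu.hasDerivAt i k x).mul (hv.hasDerivAt i k x)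
  rwa [coe_zero_shift] at this

lemma IsC1.hasDerivAt_comp {u : 𝕏 → ℝ} (hu : IsC1 u) {η : ℝ → ℝ} {i : Fin N}
    {k : Fin d} {x : 𝕏} {e : ℝ} (hη : HasDerivAt η e (u x)) :
    HasDerivAt (fun h : ℝ => η (u (x + shift i k (h : 𝕊)))) (e * 𝐃 i k u x) 0 := by
  have h1 := hu.hasDerivAt i k x
  have h2 : HasDerivAt η e (u (x + shift i k ((0 : ℝ) : 𝕊))) := by rwa [coe_zero_shift]
  exact h2.comp 0 h1

lemma isC1_const (c : ℝ) : IsC1 (fun _ : 𝕏 => c) :=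
  .of_hasDerivAt continuous_const (fun _ _ _ => 0) (fun _ _ => continuous_const)
    (fun _ _ _ => hasDerivAt_const _ _)

lemma IsC1.add {u v : 𝕏 → ℝ} (hu : IsC1 u) (hv : IsC1 v) : IsC1 (fun x => u x + v x) :=
  .of_hasDerivAt (hu.continuous.add hv.continuous) _
    (fun i k => (hu.continuous_partial i k).add (hv.continuous_partial i k)) (hu.hasDerivAt_add hv)

lemma IsC1.mul {u v : 𝕏 → ℝ} (hu : IsC1 u) (hv : IsC1 v) : IsC1 (fun x => u x * v x) :=
  .of_hasDerivAt (hu.continuous.mul hv.continuous) _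
    (fun i k => ((hu.continuous_partial i k).mul hv.continuous).add
      (hu.continuous.mul (hv.continuous_partial i k))) (hu.hasDerivAt_mul hv)

lemma IsC1.partial_sq_mul {u v : 𝕏 → ℝ} (hu : IsC1 u) (hv : IsC1 v) (i : Fin N) (k : Fin d) (x : 𝕏) :
    𝐃 i k (fun x => u x * u x * v x) x = 2 * (u x * 𝐃 i k u x * v x) + u x * u x * 𝐃 i k v x := by
  rw [configPartial_eq ((hu.mul hu).hasDerivAt_mul hv i k x), configPartial_eq (hu.hasDerivAt_mul hu i k x)]
  ring

lemma IsC1.const_mul {u : 𝕏 → ℝ} (hu : IsC1 u) (c : ℝ) : IsC1 (fun x => c * u x) := (isC1_const c).mul hu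

lemma IsC1.sum {ι : Type*} (S : Finset ι) {u : ι → 𝕏 → ℝ} (hu : ∀ a ∈ S, IsC1 (u a)) :
    IsC1 (fun x => ∑ a ∈ S, u a x) := by
  classical
  induction S using Finset.induction_on with
  | empty => simpa using isC1_const 0
  | insert a S ha ih =>
    simp only [Finset.sum_insert ha]
    exact (hu a (by simp)).add (ih fun b hb => hu b (by simp [hb]))

lemma IsC1.comp {u : 𝕏 → ℝ} (hu : IsC1 u) {η η' : ℝ → ℝ}
    (hη : ∀ x, HasDerivAt η (η' (u x)) (u x)) (hη' : ContinuousOn η' (range u)) :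
    IsC1 (fun x => η (u x)) := by
  have hc : ContinuousOn η (range u) := by
    rintro _ ⟨x, rfl⟩
    exact (hη x).continuousAt.continuousWithinAt
  exact .of_hasDerivAt (hc.comp_continuous hu.continuous mem_range_self) _
    (fun i k => (hη'.comp_continuous hu.continuous mem_range_self).mul (hu.continuous_partial i k))
    (fun i k x => hu.hasDerivAt_comp (hη x))

/-- The covering of the configuration space by its universal cover. -/
def configMk (y : Fin N → Fin d → ℝ) : 𝕏 := fun i k => (y i k : 𝕊)

lemma isOpenQuotientMap_configMk : IsOpenQuotientMap (configMk (N := N) (d := d)) := by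
  have h1 : IsOpenQuotientMap (fun t : ℝ => (t : 𝕊)) := QuotientAddGroup.isOpenQuotientMap_mk
  exact IsOpenQuotientMap.piMap fun _ => IsOpenQuotientMap.piMap fun _ => h1

lemma configMk_add_smul (y : Fin N → Fin d → ℝ) (i : Fin N) (k : Fin d) (h : ℝ) :
    configMk (y + h • (single i (single k 1) : Fin N → Fin d → ℝ)) = configMk y + shift i k (h : 𝕊) := by
  funext j l
  by_cases hj : j = i
  · subst hj
    by_cases hl : l = k
    · subst hl; simp [configMk, shift]
    · simp [configMk, shift, hl]
  · simp [configMk, shift, hj]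

/-- A function of the points with a differentiable lift has the expected partial derivatives. -/
lemma hasDerivAt_of_lift {ψ : 𝕏 → ℝ} {y : Fin N → Fin d → ℝ} (i : Fin N) (k : Fin d)
    (h : DifferentiableAt ℝ (fun y => ψ (configMk y)) y) :
    HasDerivAt (fun h : ℝ => ψ (configMk y + shift i k (h : 𝕊)))
      (fderiv ℝ (fun y => ψ (configMk y)) y (single i (single k 1))) 0 := by
  have h1 := (h.hasFDerivAt.hasLineDerivAt (single i (single k 1))).congr_deriv rfl
  refine h1.congr_of_eventuallyEq (.of_forall fun t => ?_)
  simp only [configMk_add_smul]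

lemma isC1_of_lift {ψ : 𝕏 → ℝ} (h : ContDiff ℝ 1 (fun y => ψ (configMk y))) :
    IsC1 ψ := by
  have hd : Differentiable ℝ (fun y => ψ (configMk y)) := h.differentiable one_ne_zero
  refine ⟨isOpenQuotientMap_configMk.continuous_comp_iff.1 h.continuous, fun i k x => ?_, fun i k => ?_⟩
  · obtain ⟨y, rfl⟩ := isOpenQuotientMap_configMk.surjective x
    exact (hasDerivAt_of_lift i k (hd y)).differentiableAt
  · refine isOpenQuotientMap_configMk.continuous_comp_iff.1 ?_
    have : (𝐃 i k ψ) ∘ configMk = fun y =>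
        fderiv ℝ (fun y => ψ (configMk y)) y (single i (single k 1)) := by
      funext y
      exact configPartial_eq (hasDerivAt_of_lift i k (hd y))
    rw [this]
    exact (h.continuous_fderiv one_ne_zero).clm_apply continuous_const

lemma IsSmoothConfig.isC1 {ψ : 𝕏 → ℝ} (h : IsSmoothConfig ψ) : IsC1 ψ :=
  isC1_of_lift (ContDiff.of_le h (by norm_cast))

lemma IsSmoothConfig.partial {ψ : 𝕏 → ℝ} (h : IsSmoothConfig ψ) (i : Fin N) (k : Fin d) :
    IsSmoothConfig (𝐃 i k ψ) := by
  have h' : ContDiff ℝ ∞ (fun y => ψ (configMk y)) := h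
  have : (fun y => 𝐃 i k ψ (configMk y)) = fun y =>
      fderiv ℝ (fun y => ψ (configMk y)) y (single i (single k 1)) := by
    funext y
    exact configPartial_eq (hasDerivAt_of_lift i k ((h'.differentiable (by simp)) y))
  change ContDiff ℝ ∞ (fun y => 𝐃 i k ψ (configMk y))
  rw [this]
  exact (h'.fderiv_right (by simp)).clm_apply contDiff_const

/-- `sin (2πc)` on the circle. -/
def circleSin : 𝕊 → ℝ := Function.Periodic.lift (f := fun t : ℝ => sin (2 * π * t)) (fun t => by
    simp only; rw [mul_add, mul_one, Real.sin_add_two_pi])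

/-- `cos (2πc)` on the circle. -/
def circleCos : 𝕊 → ℝ := Function.Periodic.lift (f := fun t : ℝ => Real.cos (2 * π * t)) (fun t => by
    simp only; rw [mul_add, mul_one, Real.cos_add_two_pi])

@[simp] lemma circleSin_coe (t : ℝ) : circleSin (t : 𝕊) = sin (2 * π * t) := rfl
@[simp] lemma circleCos_coe (t : ℝ) : circleCos (t : 𝕊) = Real.cos (2 * π * t) := rfl

/-- A function of one difference of points with a smooth lift is continuously differentiable. -/
lemma isC1_of_pair (i j : Fin N) {V : 𝕋 d → ℝ}
    (hV : ContDiff ℝ 1 (fun y : Fin d → ℝ => V (fun l => (y l : 𝕊)))) :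
    IsC1 (fun x : 𝕏 => V (x i - x j)) := by
  refine isC1_of_lift ?_
  have h1 : ContDiff ℝ 1 (fun y : Fin N → Fin d → ℝ => y i - y j) :=
    (contDiff_apply ℝ (Fin d → ℝ) i).sub (contDiff_apply ℝ (Fin d → ℝ) j)
  exact hV.comp h1

/-- The partial derivative in the first point of a function of one difference of points. -/
lemma configPartial_pair {i j : Fin N} (hij : i ≠ j) (k : Fin d) {V : 𝕋 d → ℝ} (x : 𝕏) :
    𝐃 i k (fun x : 𝕏 => V (x i - x j)) x = torusPartial k V (x i - x j) := by
  unfold configPartial torusPartial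
  congr 1
  funext h
  have h1 : (x + single i (single k (h : 𝕊)) : 𝕏) i = x i + single k (h : 𝕊) := by simp
  have h2 : (x + single i (single k (h : 𝕊)) : 𝕏) j = x j := by
    simp [hij.symm]
  simp only [h1, h2]
  congr 1; abel

/-! ### The Gibbs weight and integration by parts -/

/-- The Gibbs factor, extended continuously to the collisions. -/
def gibbsCont (s σ : ℝ) (x : 𝕏) : ℝ :=
  ∏ p ∈ (univ : Finset (Fin N)).offDiag, pairFactor d s (invTemp N σ) (x p.1 - x p.2)

/-- The partial derivatives of the logarithm of the Gibbs factor. -/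
def logGrad (s σ : ℝ) (i : Fin N) (k : Fin d) (x : 𝕏) : ℝ :=
  -(2 * invTemp N σ) * ∑ j ∈ univ.erase i, rieszPart d s k (x i - x j)

lemma gibbsCont_eq {s σ : ℝ} {x : 𝕏} (hx : x ∉ collisions N d) :
    gibbsCont s σ x = gibbsFactor s σ x := by
  unfold gibbsCont gibbsFactor
  have h1 : ∀ p ∈ (univ : Finset (Fin N)).offDiag, pairFactor d s (invTemp N σ) (x p.1 - x p.2)
        = exp (-(invTemp N σ * rieszPotential d s (x p.1 - x p.2))) := fun p hp =>
    pairFactor_of_ne (sub_ne_zero_of_notMem_collisions hx (Finset.mem_offDiag.1 hp).2.2)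
  rw [prod_congr rfl h1, ← exp_sum]
  congr 1
  rw [sum_neg_distrib, ← mul_sum, neg_mul]
  unfold invTemp
  congr 2
  rw [Finset.sum_sigma']
  refine Finset.sum_nbij' (fun p => ⟨p.1, p.2⟩) (fun p => (p.1, p.2)) ?_ ?_ ?_ ?_ ?_
  · intro p hp; simp only [Finset.mem_offDiag] at hp; simp [Ne.symm hp.2.2]
  · intro p hp; simp only [Finset.mem_sigma, Finset.mem_erase] at hp
    simp [Ne.symm hp.2.1]
  · intros; rfl
  · intros; rfl
  · intros; rfl

lemma gibbsCont_nonneg (s σ : ℝ) (x : 𝕏) : 0 ≤ gibbsCont s σ x :=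
  Finset.prod_nonneg fun _ _ => pairFactor_nonneg _ _ _

lemma gibbsFactor_pos (s σ : ℝ) (x : 𝕏) : 0 < gibbsFactor s σ x := exp_pos _

lemma gibbsCont_pos {s σ : ℝ} {x : 𝕏} (hx : x ∉ collisions N d) :
    0 < gibbsCont s σ x := by rw [gibbsCont_eq hx]; exact gibbsFactor_pos _ _ _

variable {s σ : ℝ}

lemma continuous_gibbsCont (hp : Admissible N d s σ) : Continuous (gibbsCont (N := N) (d := d) s σ) :=
  continuous_finsetProd _ fun p _ => (continuous_pairFactor hp.s_lt hp.invTemp_pos).comp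
    ((continuous_apply p.1).sub (continuous_apply p.2))

/-- The Gibbs weight is at most a constant times the factor of any single pair. -/
lemma exists_gibbsCont_le (hp : Admissible N d s σ) : ∃ M : ℝ, 1 ≤ M ∧ (∀ x : 𝕏, gibbsCont s σ x ≤ M) ∧
    ∀ (x : 𝕏) (i j : Fin N), i ≠ j → gibbsCont s σ x ≤ M * pairFactor d s (invTemp N σ) (x i - x j) := by
  obtain ⟨M, hM1, hM⟩ := exists_pairFactor_le hp.s_lt hp.invTemp_pos
  have key : ∀ (x : 𝕏) (S : Finset (Fin N × Fin N)), S.card ≤ N * N →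
      ∏ p ∈ S, pairFactor d s (invTemp N σ) (x p.1 - x p.2) ≤ M ^ (N * N) := fun x S hS =>
    (Finset.prod_le_prod (fun p _ => pairFactor_nonneg _ _ _) fun p _ => hM _).trans
      (by rw [Finset.prod_const]; exact pow_le_pow_right₀ hM1 hS)
  have hcard : ∀ S : Finset (Fin N × Fin N), S.card ≤ N * N := fun S => by
    simpa using S.card_le_univ
  refine ⟨M ^ (N * N), one_le_pow₀ hM1, fun x => key x _ (hcard _), fun x i j hij => ?_⟩
  unfold gibbsCont
  rw [← mul_prod_erase _ _ (show (i, j) ∈ (univ : Finset (Fin N)).offDiag by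
    simpa using hij), mul_comm]
  exact mul_le_mul_of_nonneg_right (key x _ (hcard _)) (pairFactor_nonneg _ _ _)

/-- For a bounded potential the Gibbs weight is bounded below. -/
lemma exists_le_gibbsCont (hp : Admissible N d s σ) (hs : s < 0) :
    ∃ m : ℝ, 0 < m ∧ ∀ x : 𝕏, m ≤ gibbsCont s σ x := by
  have h0 : ∀ x : 𝕏, 0 < gibbsCont s σ x := fun x =>
    Finset.prod_pos fun p _ => by rw [pairFactor_of_neg hs]; exact exp_pos _
  obtain ⟨x, -, hx⟩ := isCompact_univ.exists_isMinOn (s := (univ : Set 𝕏))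
    univ_nonempty (continuous_gibbsCont hp).continuousOn
  exact ⟨gibbsCont s σ x, h0 x, fun y => hx (mem_univ y)⟩

lemma measurable_logGrad (hp : Admissible N d s σ) (i : Fin N) (k : Fin d) :
    Measurable (logGrad (N := N) s σ i k) :=
  (Finset.measurable_sum _ fun j _ => (measurable_rieszPart hp.s_lt k).comp
    ((measurable_pi_apply i).sub (measurable_pi_apply j))).const_mul _

lemma rieszPart_neg (hsd : s < d) (k : Fin d) {z : 𝕋 d} (hz : z ≠ 0) :
    rieszPart d s k (-z) = -rieszPart d s k z := by
  have h1 := hasDerivAt_rieszPotential hsd k (neg_ne_zero.2 hz)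
  have h2 := hasDerivAt_rieszPotential hsd k hz
  have h3 : HasDerivAt (fun h : ℝ => rieszPotential d s (z + single k ((-h : ℝ) : 𝕊)))
      (rieszPart d s k z * (-1)) 0 := by
    have h4 : HasDerivAt (fun h : ℝ => rieszPotential d s (z + single k (h : 𝕊)))
      (rieszPart d s k z) (-0) := by rwa [neg_zero]
    exact h4.comp 0 (hasDerivAt_neg 0)
  have h5 : (fun h : ℝ => rieszPotential d s (z + single k ((-h : ℝ) : 𝕊)))
      = fun h : ℝ => rieszPotential d s (-z + single k (h : 𝕊)) := by
    funext h
    rw [← rieszPotential_neg, AddCircle.coe_neg, Pi.single_neg, neg_add, neg_neg]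
  rw [h5] at h3
  rw [h1.unique h3]; ring

lemma hasDerivAt_pair_potential (hsd : s < d) (i : Fin N) (k : Fin d) {x : 𝕏}
    (hx : x ∉ collisions N d) {a c : Fin N} (hac : a ≠ c) :
    HasDerivAt (fun h : ℝ => rieszPotential d s ((x + shift i k (h : 𝕊)) a - (x + shift i k (h : 𝕊)) c))
      (if a = i then rieszPart d s k (x i - x c) else
        if c = i then rieszPart d s k (x i - x a) else 0) 0 := by
  split_ifs with h1 h2
  · subst h1
    refine (hasDerivAt_rieszPotential hsd k (sub_ne_zero_of_notMem_collisions hx hac)).congr_of_eventuallyEq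
      (.of_forall fun h => ?_)
    simp only [Pi.add_apply, shift_apply_same, shift_apply_ne hac.symm, add_zero]
    congr 1; abel
  · subst h2
    refine (hasDerivAt_rieszPotential hsd k (sub_ne_zero_of_notMem_collisions hx hac.symm)).congr_of_eventuallyEq
      (.of_forall fun h => ?_)
    simp only [Pi.add_apply, shift_apply_same, shift_apply_ne hac, add_zero]
    rw [← rieszPotential_neg]
    congr 1; abel
  · simp only [Pi.add_apply, shift_apply_ne h1, shift_apply_ne h2, add_zero]
    exact hasDerivAt_const _ _

lemma hasDerivAt_log_gibbsFactor (hp : Admissible N d s σ) (i : Fin N) (k : Fin d)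
    {x : 𝕏} (hx : x ∉ collisions N d) :
    HasDerivAt (fun h : ℝ => log (gibbsFactor s σ (x + shift i k (h : 𝕊)))) (logGrad s σ i k x) 0 := by
  simp only [gibbsFactor, Real.log_exp]
  have h1 := (HasDerivAt.fun_sum (u := univ) fun a _ =>
    HasDerivAt.fun_sum (u := univ.erase a) fun c hc =>
      hasDerivAt_pair_potential hp.s_lt i k hx (ne_of_mem_erase hc).symm).const_mul (-(1 / (2 * (N : ℝ) * σ)))
  refine h1.congr_deriv ?_
  rw [logGrad, invTemp]
  have h2 : ∑ a, ∑ c ∈ univ.erase a, (if a = i then rieszPart d s k (x i - x c) else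
        if c = i then rieszPart d s k (x i - x a) else 0)
      = 2 * ∑ j ∈ univ.erase i, rieszPart d s k (x i - x j) := by
    rw [← Finset.add_sum_erase _ _ (mem_univ i), two_mul]
    congr 1
    · simp
    · refine sum_congr rfl fun a ha => ?_
      have ha' := ne_of_mem_erase ha
      simp only [ha', if_false]
      rw [Finset.sum_ite_eq' _ i]
      simp [Ne.symm ha']
  rw [h2]; ring

lemma configPartial_log_gibbsFactor (hp : Admissible N d s σ) (i : Fin N) (k : Fin d)
    {x : 𝕏} (hx : x ∉ collisions N d) :
    𝐃 i k (fun y => log (gibbsFactor s σ y)) x = logGrad s σ i k x :=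
  configPartial_eq (hasDerivAt_log_gibbsFactor hp i k hx)

lemma interactionDrift_eq (hp : Admissible N d s σ) (i : Fin N) (k : Fin d)
    {x : 𝕏} (hx : x ∉ collisions N d) :
    interactionDrift s (-1) i k x = σ * logGrad s σ i k x := by
  have hσ := hp.σ_pos.ne'
  unfold interactionDrift logGrad invTemp
  have h1 : ∀ j ∈ univ.erase i, (-1 : Matrix (Fin d) (Fin d) ℝ).mulVec
      (fun l => torusPartial l (rieszPotential d s) (x i - x j)) k = -rieszPart d s k (x i - x j) := fun j hj => by
    rw [Matrix.neg_mulVec, Matrix.one_mulVec, Pi.neg_apply, torusPartial_rieszPotential hp.s_lt k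
      (sub_ne_zero_of_notMem_collisions hx (ne_of_mem_erase hj).symm)]
  rw [sum_congr rfl h1, sum_neg_distrib]
  field_simp

lemma hasDerivAt_gibbsCont (hp : Admissible N d s σ) (i : Fin N) (k : Fin d)
    {x : 𝕏} (hx : x ∉ collisions N d) :
    HasDerivAt (fun h : ℝ => gibbsCont s σ (x + shift i k (h : 𝕊)))
      (logGrad s σ i k x * gibbsCont s σ x) 0 := by
  have h1 := (hasDerivAt_log_gibbsFactor hp i k hx).exp
  rw [coe_zero_shift, Real.exp_log (gibbsFactor_pos _ _ _), ← gibbsCont_eq hx, mul_comm] at h1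
  refine h1.congr_of_eventuallyEq ?_
  have h2 : ∀ᶠ h : ℝ in 𝓝 0, x + shift i k (h : 𝕊) ∈ (collisions N d)ᶜ := by
    refine (continuous_add_shift i k x).continuousAt.eventually_mem ?_
    rw [coe_zero_shift]
    exact isClosed_collisions.isOpen_compl.mem_nhds hx
  filter_upwards [h2] with h hh
  rw [Real.exp_log (gibbsFactor_pos _ _ _), gibbsCont_eq hh]

lemma measurable_pair (hp : Admissible N d s σ) (i j : Fin N) (k : Fin d) :
    Measurable (fun x : 𝕏 => rieszPart d s k (x i - x j)) :=
  (measurable_rieszPart hp.s_lt k).comp ((measurable_pi_apply i).sub (measurable_pi_apply j))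

lemma integrable_rieszPart_gibbsCont (hp : Admissible N d s σ) {i j : Fin N} (hij : i ≠ j) (k : Fin d) :
    Integrable (fun x : 𝕏 => rieszPart d s k (x i - x j) * gibbsCont s σ x) := by
  obtain ⟨B, hB, hBk⟩ := exists_lintegral_pairDeriv_le hp.le_s hp.s_lt hp.invTemp_pos
  obtain ⟨M, hM1, -, hM⟩ := exists_gibbsCont_le hp
  have hm : Measurable fun x : 𝕏 => pairDeriv s (invTemp N σ) k (x i - x j) :=
    (measurable_pairDeriv hp.s_lt hp.invTemp_pos k).comp ((measurable_pi_apply i).sub (measurable_pi_apply j))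
  have h1 : Integrable (fun x : 𝕏 => pairDeriv s (invTemp N σ) k (x i - x j)) := by
    refine ⟨hm.aestronglyMeasurable, ?_⟩
    rw [hasFiniteIntegral_iff_enorm, ← lintegral_shift i k hm.enorm]
    refine lt_of_le_of_lt (lintegral_mono (g := fun _ => B) fun x => ?_) (by simp [hB.lt_top])
    refine le_trans (le_of_eq (lintegral_congr fun c => ?_)) (hBk k (x i - x j))
    simp only [Pi.add_apply, shift_apply_same, shift_apply_ne hij.symm, add_zero]
    congr 2; abel
  refine (h1.norm.const_mul (M / invTemp N σ)).mono'
    ((measurable_pair hp i j k).mul (continuous_gibbsCont hp).measurable).aestronglyMeasurable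
    (.of_forall fun x => ?_)
  have hb := hp.invTemp_pos
  rw [norm_mul, norm_eq_abs, norm_eq_abs, norm_eq_abs, abs_of_nonneg (gibbsCont_nonneg _ _ _), pairDeriv,
    abs_mul, abs_neg, abs_mul, abs_of_pos hb, abs_of_nonneg (pairFactor_nonneg _ _ _)]
  calc _ ≤ |rieszPart d s k (x i - x j)| * (M * pairFactor d s (invTemp N σ) (x i - x j)) :=
        mul_le_mul_of_nonneg_left (hM x i j hij) (abs_nonneg _)
    _ = _ := by field_simp

lemma integrable_logGrad_gibbsCont (hp : Admissible N d s σ) (i : Fin N) (k : Fin d) :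
    Integrable (fun x : 𝕏 => logGrad s σ i k x * gibbsCont s σ x) := by
  simp only [logGrad, mul_assoc, sum_mul]
  refine Integrable.const_mul (integrable_finsetSum _ fun j hj => ?_) _
  exact integrable_rieszPart_gibbsCont hp (ne_of_mem_erase hj).symm k

lemma exists_abs_le_of_continuous {u : 𝕏 → ℝ} (hu : Continuous u) : ∃ B, ∀ x, |u x| ≤ B := by
  obtain ⟨B, hB⟩ := (isCompact_univ.image hu.abs).bddAbove
  exact ⟨B, fun x => hB ⟨x, mem_univ x, rfl⟩⟩

lemma integrable_of_continuous {u : 𝕏 → ℝ} (hu : Continuous u) : Integrable u := by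
  obtain ⟨B, hB⟩ := exists_abs_le_of_continuous hu
  exact Integrable.of_bound hu.aestronglyMeasurable B (.of_forall hB)

lemma integrable_continuous_mul {u v : 𝕏 → ℝ} (hv : Integrable v) (hu : Continuous u) :
    Integrable (fun x => u x * v x) := by
  obtain ⟨B, hB⟩ := exists_abs_le_of_continuous hu
  exact hv.bdd_mul hu.aestronglyMeasurable (.of_forall hB)

/-- Integration by parts against the Gibbs weight. -/
lemma integral_partial_gibbsCont (hp : Admissible N d s σ) {u : 𝕏 → ℝ} (hu : IsC1 u) (i : Fin N) (k : Fin d) :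
    ∫ x, 𝐃 i k u x * gibbsCont s σ x = -∫ x, u x * (logGrad s σ i k x * gibbsCont s σ x) := by
  have hG := continuous_gibbsCont hp
  have h1 : Integrable (fun x => 𝐃 i k u x * gibbsCont s σ x) :=
    integrable_of_continuous ((hu.continuous_partial i k).mul hG)
  have h2 : Integrable (fun x => u x * (logGrad s σ i k x * gibbsCont s σ x)) :=
    integrable_continuous_mul (integrable_logGrad_gibbsCont hp i k) hu.continuous
  have h3 := integral_lineDeriv_eq_zero hp.one_le_d i k
    (q' := fun x => 𝐃 i k u x * gibbsCont s σ x + u x * (logGrad s σ i k x * gibbsCont s σ x))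
    (hu.continuous.mul hG)
    (((hu.continuous_partial i k).measurable.mul hG.measurable).add
      (hu.continuous.measurable.mul ((measurable_logGrad hp i k).mul hG.measurable)))
    (h1.add h2) (fun x hx => by
      have := (hu.hasDerivAt i k x).mul (hasDerivAt_gibbsCont hp i k hx)
      rwa [coe_zero_shift] at this)
  rw [integral_add h1 h2] at h3
  linarith

/-- The integral of a partial derivative vanishes. -/
lemma integral_configPartial (hd : 1 ≤ d) {u : 𝕏 → ℝ} (hu : IsC1 u) (i : Fin N) (k : Fin d) :
    ∫ x, 𝐃 i k u x = 0 :=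
  integral_lineDeriv_eq_zero hd i k hu.continuous (hu.continuous_partial i k).measurable
    (integrable_of_continuous (hu.continuous_partial i k)) (fun x _ => hu.hasDerivAt i k x)

end

section

/-! ### A bounded semiconvex gradient field on the torus -/

variable {N d : ℕ}

/-- A smooth positive function on the torus, comparable to the squared distance to the origin plus
`ε`. -/
def rho (ε : ℝ) (z : 𝕋 d) : ℝ := ∑ k, (1 - circleCos (z k)) / (2 * π ^ 2) + ε

/-- The smooth periodic substitute `S ρ^{-b/2}` for the field `z |z|^{-b}`; for `b = 1` it is the
gradient of `ρ^{1/2}`. -/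
def field (b ε : ℝ) (k : Fin d) (z : 𝕋 d) : ℝ := circleSin (z k) / (2 * π) * rho ε z ^ (-(b / 2))

lemma circleCos_bounds (c : 𝕊) : -1 ≤ circleCos c ∧ circleCos c ≤ 1 := by
  induction c using induction_on with | H t =>
  exact ⟨Real.neg_one_le_cos _, Real.cos_le_one _⟩

lemma circleSin_sq (c : 𝕊) : circleSin c ^ 2 = 1 - circleCos c ^ 2 := by
  induction c using induction_on with | H t =>
  exact Real.sin_sq _

lemma circleSin_neg (c : 𝕊) : circleSin (-c) = -circleSin c := by
  induction c using induction_on with | H t =>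
  change sin (2 * π * (-t)) = -sin (2 * π * t)
  rw [mul_neg, Real.sin_neg]

lemma circleCos_neg (c : 𝕊) : circleCos (-c) = circleCos c := by
  induction c using induction_on with | H t =>
  change Real.cos (2 * π * (-t)) = Real.cos (2 * π * t)
  rw [mul_neg, Real.cos_neg]

lemma rho_term_nonneg (c : 𝕊) : 0 ≤ (1 - circleCos c) / (2 * π ^ 2) :=
  div_nonneg (by linarith [(circleCos_bounds c).2]) (by positivity)

lemma le_rho (ε : ℝ) (z : 𝕋 d) : ε ≤ rho ε z := by
  unfold rho
  linarith [sum_nonneg fun (k : Fin d) (_ : k ∈ Finset.univ) => rho_term_nonneg (z k)]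

lemma rho_pos {ε : ℝ} (hε : 0 < ε) (z : 𝕋 d) : 0 < rho ε z := hε.trans_le (le_rho ε z)

lemma term_le_rho {ε : ℝ} (hε : 0 < ε) (z : 𝕋 d) (k : Fin d) :
    (1 - circleCos (z k)) / (2 * π ^ 2) ≤ rho ε z := by
  have := single_le_sum (f := fun k => (1 - circleCos (z k)) / (2 * π ^ 2))
    (fun k _ => rho_term_nonneg (z k)) (mem_univ k)
  unfold rho; linarith

lemma rho_le (ε : ℝ) (hε : ε ≤ 1) (z : 𝕋 d) : rho ε z ≤ d + 1 := by
  have : ∑ k, (1 - circleCos (z k)) / (2 * π ^ 2) ≤ ∑ _k : Fin d, 1 := by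
    refine sum_le_sum fun k _ => ?_
    rw [div_le_one (by positivity)]
    nlinarith [(circleCos_bounds (z k)).1, pi_gt_three]
  simp only [sum_const, card_univ, card_fin, nsmul_eq_mul, mul_one] at this
  unfold rho; linarith

lemma rho_le_torusSq (ε : ℝ) (z : 𝕋 d) : rho ε z ≤ torusSq z + ε := by
  obtain ⟨y, -, rfl, h⟩ := exists_lift_torus z
  rw [h]
  unfold rho
  refine add_le_add (sum_le_sum fun k _ => ?_) le_rfl
  rw [circleCos_coe, div_le_iff₀ (by positivity)]
  nlinarith [Real.one_sub_sq_div_two_le_cos (x := 2 * π * y k)]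

lemma sin_sq_le_term (c : 𝕊) :
    (circleSin c / (2 * π)) ^ 2 ≤ (1 - circleCos c) / (2 * π ^ 2) := by
  rw [div_pow, circleSin_sq, div_le_div_iff₀ (by positivity) (by positivity)]
  have := circleCos_bounds c
  have h1 : (1 - circleCos c) * (1 + circleCos c) ≤ (1 - circleCos c) * 2 :=
    mul_le_mul_of_nonneg_left (by linarith) (by linarith)
  have h2 := mul_le_mul_of_nonneg_right h1 (show 0 ≤ 2 * π ^ 2 by positivity)
  linarith

lemma rho_rpow_le {ε p : ℝ} (hε : 0 < ε) (hε1 : ε ≤ 1) (hp : 0 ≤ p) (hp1 : p ≤ 1)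
    (z : 𝕋 d) : rho ε z ^ p ≤ d + 1 := by
  have hd : (1 : ℝ) ≤ d + 1 := by linarith
  calc rho ε z ^ p ≤ ((d : ℝ) + 1) ^ p :=
        Real.rpow_le_rpow (rho_pos hε z).le (rho_le ε hε1 z) hp
    _ ≤ ((d : ℝ) + 1) ^ 1 := rpow_le_rpow_of_exponent_le hd hp1
    _ = d + 1 := rpow_one _

lemma abs_field_le {b ε : ℝ} (hb : 0 ≤ b) (hb1 : b ≤ 1) (hε : 0 < ε) (hε1 : ε ≤ 1) (k : Fin d)
    (z : 𝕋 d) : |field b ε k z| ≤ d + 1 := by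
  have hρ := rho_pos hε z
  have h1 : |circleSin (z k) / (2 * π)| ≤ rho ε z ^ (1 / 2 : ℝ) := by
    rw [← sqrt_eq_rpow]
    exact Real.abs_le_sqrt ((sin_sq_le_term _).trans (term_le_rho hε z k))
  rw [field, abs_mul, abs_of_nonneg (rpow_nonneg hρ.le _)]
  refine (mul_le_mul_of_nonneg_right h1 (rpow_nonneg hρ.le _)).trans ?_
  rw [← rpow_add hρ]
  exact rho_rpow_le hε hε1 (by linarith) (by linarith) z

lemma field_neg (b ε : ℝ) (k : Fin d) (z : 𝕋 d) : field b ε k (-z) = -field b ε k z := by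
  simp only [field, rho, Pi.neg_apply, circleSin_neg, circleCos_neg]; ring

@[simp] lemma field_zero (b ε : ℝ) (k : Fin d) : field b ε k 0 = 0 := by
  have := circleSin_coe 0
  simp only [AddCircle.coe_zero, mul_zero, Real.sin_zero] at this
  simp [field, this]

lemma contDiff_field {b ε : ℝ} (hε : 0 < ε) (k : Fin d) :
    ContDiff ℝ 1 (fun y : Fin d → ℝ => field b ε k (fun l => (y l : 𝕊))) := by
  have h1 : ContDiff ℝ 1 (fun y : Fin d → ℝ => rho ε (fun l => (y l : 𝕊))) := by
    simp only [rho, circleCos_coe]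
    fun_prop
  have h2 := h1.rpow_const_of_ne (p := -(b / 2)) (fun y => (rho_pos hε _).ne')
  have h3 : ContDiff ℝ 1 (fun y : Fin d → ℝ => circleSin (y k : 𝕊) / (2 * π)) := by
    simp only [circleSin_coe]
    fun_prop
  exact h3.mul h2

/-- The derivative of the field along a line of the universal cover. -/
lemma hasDerivAt_field_line {b ε : ℝ} (hε : 0 < ε) (k : Fin d) (y w : Fin d → ℝ) (t : ℝ) :
    HasDerivAt (fun t : ℝ => field b ε k (fun l => ((y l + t * w l : ℝ) : 𝕊)))
      (circleCos ((y k + t * w k : ℝ) : 𝕊) * w k * rho ε (fun l => ((y l + t * w l : ℝ) : 𝕊)) ^ (-(b / 2))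
        - b * (circleSin ((y k + t * w k : ℝ) : 𝕊) / (2 * π))
          * (∑ l, circleSin ((y l + t * w l : ℝ) : 𝕊) / (2 * π) * w l)
          * rho ε (fun l => ((y l + t * w l : ℝ) : 𝕊)) ^ (-(b / 2) - 1)) t := by
  have hlin : ∀ l, HasDerivAt (fun t : ℝ => 2 * π * (y l + t * w l)) (2 * π * w l) t :=
    fun l => by simpa using (((hasDerivAt_id t).mul_const (w l)).const_add (y l)).const_mul (2 * π)
  have h1 : HasDerivAt (fun t : ℝ => rho ε (fun l => ((y l + t * w l : ℝ) : 𝕊)))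
      (2 * ∑ l, circleSin ((y l + t * w l : ℝ) : 𝕊) / (2 * π) * w l) t := by
    simp only [rho, circleCos_coe, circleSin_coe]
    have := (HasDerivAt.fun_sum (u := univ) fun l _ =>
      (((hlin l).cos.const_sub 1).div_const (2 * π ^ 2))).add_const ε
    refine this.congr_deriv ?_
    rw [mul_sum]
    refine sum_congr rfl fun l _ => ?_
    field_simp
  have h2 := h1.rpow_const (p := -(b / 2)) (Or.inl (rho_pos hε _).ne')
  have h3 : HasDerivAt (fun t : ℝ => circleSin ((y k + t * w k : ℝ) : 𝕊) / (2 * π))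
      (circleCos ((y k + t * w k : ℝ) : 𝕊) * w k) t := by
    simp only [circleCos_coe, circleSin_coe]
    refine ((hlin k).sin.div_const (2 * π)).congr_deriv ?_
    field_simp
  refine (h3.mul h2).congr_deriv ?_
  ring

lemma torusPartial_field {b ε : ℝ} (hε : 0 < ε) (k : Fin d) (z : 𝕋 d) :
    torusPartial k (field b ε k) z = circleCos (z k) * rho ε z ^ (-(b / 2))
      - b * (circleSin (z k) / (2 * π)) ^ 2 * rho ε z ^ (-(b / 2) - 1) := by
  obtain ⟨y, -, rfl, -⟩ := exists_lift_torus z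
  have h1 := hasDerivAt_field_line (b := b) hε k y (single k 1) 0
  have h2 := h1.congr_of_eventuallyEq (f₁ := fun h : ℝ => field b ε k
      ((fun l => (y l : 𝕊)) + single k (h : 𝕊))) <| by
    refine Eventually.of_forall fun h => ?_
    simp only
    congr 1
    funext l
    by_cases hl : l = k
    · subst hl; simp
    · simp [hl]
  have h3 : torusPartial k (field b ε k) (fun l => (y l : 𝕊)) = _ := h2.deriv
  rw [h3]
  simp only [zero_mul, add_zero, Pi.single_eq_same, mul_one]
  rw [Finset.sum_eq_single k (fun l _ hl => by simp [hl]) (by simp)]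
  simp only [Pi.single_eq_same, mul_one]
  ring

lemma sum_sin_sq_le {ε : ℝ} (hε : 0 < ε) (z : 𝕋 d) :
    ∑ k, (circleSin (z k) / (2 * π)) ^ 2 ≤ rho ε z := by
  refine (sum_le_sum fun k _ => sin_sq_le_term (z k)).trans ?_
  unfold rho; linarith

/-- The divergence of the field is bounded below, with a singular gain if `b < d`. -/
lemma div_field_ge {b ε : ℝ} (hb : 0 ≤ b) (hb1 : b ≤ 1) (hε : 0 < ε) (hε1 : ε ≤ 1) (z : 𝕋 d) :
    (d - b) * rho ε z ^ (-(b / 2)) - 2 * π ^ 2 * (d + 1) ≤ ∑ k, torusPartial k (field b ε k) z := by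
  have hρ := rho_pos hε z
  simp only [torusPartial_field hε]
  rw [sum_sub_distrib, ← sum_mul, ← sum_mul, ← mul_sum]
  have h1 : ∑ k, circleCos (z k) = d - 2 * π ^ 2 * (rho ε z - ε) := by
    unfold rho
    rw [add_sub_cancel_right, mul_sum, eq_sub_iff_add_eq, ← sum_add_distrib]
    rw [sum_congr rfl (g := fun _ => 1) (fun k _ => by field_simp; ring)]
    simp
  have h2 : rho ε z * rho ε z ^ (-(b / 2) - 1) = rho ε z ^ (-(b / 2)) := by
    rw [Real.rpow_sub_one hρ.ne']; field_simp
  have h3 : rho ε z * rho ε z ^ (-(b / 2)) ≤ d + 1 := by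
    have : rho ε z * rho ε z ^ (-(b / 2)) = rho ε z ^ (1 - b / 2) := by
      rw [sub_eq_add_neg, rpow_add hρ, rpow_one]
    rw [this]
    exact rho_rpow_le hε hε1 (by linarith) (by linarith) z
  have h4 : (b * ∑ k, (circleSin (z k) / (2 * π)) ^ 2) * rho ε z ^ (-(b / 2) - 1)
      ≤ (b * rho ε z) * rho ε z ^ (-(b / 2) - 1) :=
    mul_le_mul_of_nonneg_right (mul_le_mul_of_nonneg_left (sum_sin_sq_le hε z) hb) (rpow_nonneg hρ.le _)
  rw [mul_assoc b (rho ε z), h2] at h4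
  rw [h1]
  have h5 : 2 * π ^ 2 * (rho ε z * rho ε z ^ (-(b / 2))) ≤ 2 * π ^ 2 * (d + 1) :=
    mul_le_mul_of_nonneg_left h3 (by positivity)
  have h6 : 0 ≤ 2 * π ^ 2 * ε * rho ε z ^ (-(b / 2)) := by
    have := rpow_nonneg hρ.le (-(b / 2)); positivity
  linarith

/-- One-sided Lipschitz bound for the gradient of the semiconvex function `ρ^{1/2}`. -/
lemma field_semiconvex {ε : ℝ} (hε : 0 < ε) (hε1 : ε ≤ 1) (y w : Fin d → ℝ) :
    -(2 * π ^ 2 * (d + 1) * ∑ k, w k ^ 2) ≤ ∑ k, w k * (field 1 ε k (fun l => ((y l + w l : ℝ) : 𝕊))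
        - field 1 ε k (fun l => (y l : 𝕊))) := by
  set K := 2 * π ^ 2 * ((d : ℝ) + 1) * ∑ k, w k ^ 2 with hK
  have hder := fun t => (HasDerivAt.fun_sum (u := univ) fun k _ =>
    (hasDerivAt_field_line (b := 1) hε k y w t).const_mul (w k)).add ((hasDerivAt_id t).mul_const K)
  have hmono : Monotone ((fun t : ℝ => ∑ k, w k * field 1 ε k
      (fun l => ((y l + t * w l : ℝ) : 𝕊))) + fun t => id t * K) := by
    refine monotone_of_deriv_nonneg (fun t => (hder t).differentiableAt) fun t => ?_
    rw [(hder t).deriv]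
    obtain ⟨z, hz⟩ : ∃ z : 𝕋 d, z = fun l => ((y l + t * w l : ℝ) : 𝕊) := ⟨_, rfl⟩
    have hzl : ∀ l, ((y l + t * w l : ℝ) : 𝕊) = z l := fun l => by rw [hz]
    simp only [hzl, one_mul]
    obtain ⟨σ, hσ⟩ : ∃ σ : Fin d → ℝ, ∀ l, σ l = circleSin (z l) / (2 * π) := ⟨_, fun _ => rfl⟩
    have hρ := rho_pos hε z
    simp only [← hσ]
    have h2 : rho ε z * rho ε z ^ (-(1 / 2 : ℝ) - 1) = rho ε z ^ (-(1 / 2 : ℝ)) := by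
      rw [Real.rpow_sub_one hρ.ne']; field_simp
    have h3 : rho ε z * rho ε z ^ (-(1 / 2 : ℝ)) ≤ d + 1 := by
      have : rho ε z * rho ε z ^ (-(1 / 2 : ℝ)) = rho ε z ^ (1 / 2 : ℝ) := by
        rw [show (1 / 2 : ℝ) = 1 + -(1 / 2) by norm_num, rpow_add hρ, rpow_one]; norm_num
      rw [this]
      exact rho_rpow_le hε hε1 (by norm_num) (by norm_num) z
    set A := rho ε z ^ (-(1 / 2 : ℝ)) with hA
    set B := rho ε z ^ (-(1 / 2 : ℝ) - 1) with hB
    have hA0 : 0 ≤ A := rpow_nonneg hρ.le _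
    have hB0 : 0 ≤ B := rpow_nonneg hρ.le _
    set W := ∑ k, w k ^ 2 with hW
    have hW0 : 0 ≤ W := sum_nonneg fun _ _ => sq_nonneg _
    have e1 : ∑ k, w k * (circleCos (z k) * w k * A - σ k * (∑ l, σ l * w l) * B)
        = A * (∑ k, circleCos (z k) * w k ^ 2) - (∑ l, σ l * w l) ^ 2 * B := by
      rw [sq (∑ l, σ l * w l), mul_sum, sum_mul, sum_mul, ← sum_sub_distrib]
      exact sum_congr rfl fun k _ => by ring
    rw [e1]
    have h5 : (∑ l, σ l * w l) ^ 2 ≤ rho ε z * W := by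
      refine (Finset.sum_mul_sq_le_sq_mul_sq _ _ _).trans (mul_le_mul_of_nonneg_right ?_ hW0)
      simp only [hσ]
      exact sum_sin_sq_le hε z
    have h6 : W - 2 * π ^ 2 * rho ε z * W ≤ ∑ k, circleCos (z k) * w k ^ 2 := by
      rw [hW, mul_sum, ← sum_sub_distrib]
      refine sum_le_sum fun k _ => ?_
      have h7 := term_le_rho hε z k
      rw [div_le_iff₀ (by positivity)] at h7
      have h8 : (1 - circleCos (z k)) * w k ^ 2 ≤ rho ε z * (2 * π ^ 2) * w k ^ 2 :=
        mul_le_mul_of_nonneg_right h7 (sq_nonneg _)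
      linarith
    have h9 := mul_le_mul_of_nonneg_left h6 hA0
    have h10 := mul_le_mul_of_nonneg_right h5 hB0
    have h11 : rho ε z * W * B = W * A := by rw [← h2]; ring
    have h12 : 2 * π ^ 2 * W * (rho ε z * A) ≤ 2 * π ^ 2 * W * (d + 1) :=
      mul_le_mul_of_nonneg_left h3 (by positivity)
    rw [hK]
    linarith
  have := hmono (zero_le_one)
  simp only [Pi.add_apply, id, zero_mul, add_zero, one_mul] at this
  simp only [mul_sub]
  rw [sum_sub_distrib]
  linarith

lemma mul_sin_ge {x : ℝ} (hx : |x| ≤ π) : 0 ≤ x * sin x ∧ x ^ 2 - x ^ 4 ≤ x * sin x := by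
  have key : ∀ x : ℝ, 0 ≤ x → x ≤ π → 0 ≤ x * sin x ∧ x ^ 2 - x ^ 4 ≤ x * sin x := fun x h0 hpi => by
    have h1 := mul_nonneg h0 (Real.sin_nonneg_of_nonneg_of_le_pi h0 hpi)
    refine ⟨h1, ?_⟩
    rcases h0.eq_or_lt with rfl | h0'
    · simp
    · have h2 := mul_le_mul_of_nonneg_left (Real.sin_gt_sub_cube h0').le h0
      nlinarith
  rcases le_total 0 x with h | h
  · exact key x h ((le_abs_self x).trans hx)
  · have := key (-x) (by linarith) ((neg_le_abs x).trans hx)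
    simpa [Even.neg_pow (by decide : Even 2), Even.neg_pow (by decide : Even 4)] using this

/-- Near the origin the field points outwards. -/
lemma sum_mul_field_ge {ε : ℝ} (hε : 0 < ε) (y : Fin d → ℝ) (hy : ∀ l, |y l| ≤ 1 / 2) {R : ℝ}
    (hR : R = ∑ l, y l ^ 2) :
    (R - 4 * π ^ 2 * R ^ 2) * (R + ε) ^ (-(1 / 2 : ℝ)) ≤ ∑ k, y k * field 1 ε k (fun l => (y l : 𝕊)) := by
  set z : 𝕋 d := fun l => (y l : 𝕊) with hz
  have hρ := rho_pos hε z
  have hρR : rho ε z ≤ R + ε := by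
    have := rho_le_torusSq ε z; rwa [torusSq_coe hy, ← hR] at this
  have e1 : ∑ k, y k * field 1 ε k z
      = (∑ k, y k * (sin (2 * π * y k) / (2 * π))) * rho ε z ^ (-(1 / 2 : ℝ)) := by
    rw [sum_mul]
    refine sum_congr rfl fun k _ => ?_
    rw [field, hz, circleSin_coe]; ring
  have hk : ∀ k, 0 ≤ y k * (sin (2 * π * y k) / (2 * π)) ∧
      y k ^ 2 - 4 * π ^ 2 * y k ^ 4 ≤ y k * (sin (2 * π * y k) / (2 * π)) := fun k => by
    have hpi := pi_pos
    have h1 := mul_sin_ge (x := 2 * π * y k) (by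
      rw [abs_mul, abs_of_pos (by positivity)]; nlinarith [hy k])
    have h2 : y k * (sin (2 * π * y k) / (2 * π))
        = (2 * π * y k * sin (2 * π * y k)) / (4 * π ^ 2) := by field_simp; ring
    rw [h2]
    refine ⟨div_nonneg h1.1 (by positivity), ?_⟩
    rw [le_div_iff₀ (by positivity)]
    linarith
  have hs0 : 0 ≤ ∑ k, y k * (sin (2 * π * y k) / (2 * π)) := sum_nonneg fun k _ => (hk k).1
  have hs1 : R - 4 * π ^ 2 * R ^ 2 ≤ ∑ k, y k * (sin (2 * π * y k) / (2 * π)) := by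
    have h1 : ∑ k, (y k ^ 2 - 4 * π ^ 2 * y k ^ 4) ≤ _ := sum_le_sum fun k _ => (hk k).2
    have h2 : ∑ k, y k ^ 4 ≤ R ^ 2 := by
      have : ∑ k, y k ^ 4 = ∑ k, (y k ^ 2) ^ 2 := sum_congr rfl fun k _ => by ring
      rw [this, hR]
      exact Finset.sum_sq_le_sq_sum_of_nonneg fun k _ => sq_nonneg _
    rw [sum_sub_distrib, ← mul_sum, ← hR] at h1
    have h3 := mul_le_mul_of_nonneg_left h2 (show 0 ≤ 4 * π ^ 2 by positivity)
    linarith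
  rw [e1]
  calc _ ≤ (∑ k, y k * (sin (2 * π * y k) / (2 * π))) * (R + ε) ^ (-(1 / 2 : ℝ)) :=
        mul_le_mul_of_nonneg_right hs1 (rpow_nonneg (by linarith) _)
    _ ≤ _ := mul_le_mul_of_nonneg_left
        (rpow_le_rpow_of_nonpos hρ hρR (by norm_num)) hs0

end

section

/-! ### The interaction is controlled by the Dirichlet form -/

variable {N d : ℕ} {s σ : ℝ}
local notation "𝕏" => TorusConfig N d
local notation "𝐆" => gibbsCont s σ
local notation "𝐛" => logGrad s σ

lemma card_univ_erase_le (i : Fin N) : ((univ.erase i).card : ℝ) ≤ N := by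
  have := (univ.erase i).card_le_univ
  rw [card_fin] at this
  exact_mod_cast this

lemma torusSq_le (z : 𝕋 d) : torusSq z ≤ d := by
  obtain ⟨y, hy, -, h⟩ := exists_lift_torus z
  rw [h]
  have : ∑ k, y k ^ 2 ≤ ∑ _k : Fin d, 1 := sum_le_sum fun k _ => by
    have := abs_le.1 (hy k); nlinarith
  simpa using this

/-- The repulsive force paired with the field is singular along the same pair of points, and
bounded below by a lower order singularity for the other pairs. -/
lemma exists_force_field_ge (hs : 0 ≤ s) (hsd : s < d) : ∃ a K : ℝ, 0 < a ∧ 0 ≤ K ∧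
    ∀ ε : ℝ, 0 < ε → ε ≤ 1 → ∀ w : 𝕋 d, w ≠ 0 →
      a * (torusSq w ^ (-(s / 2)) * (torusSq w + ε) ^ (-(1 / 2 : ℝ)))
          - K * (torusSq w ^ (-(s / 2)) + 1) ≤ ∑ k, -rieszPart d s k w * field 1 ε k w ∧
      ∀ z : 𝕋 d, -(K * (torusSq w ^ (-(s / 2)) + 1)) ≤
        ∑ k, -rieszPart d s k w * (field 1 ε k (z + w) - field 1 ε k z) := by
  obtain ⟨C, hC0, hC⟩ := exists_rieszPart_bound (by linarith) hsd
  have ha := singConst_pos hs hsd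
  set a := singConst d s with ha_def
  refine ⟨a, a * (4 * π ^ 2 * (d + 1)) + d * (C * (2 * (d + 1))), ha, by positivity,
    fun ε hε hε1 w hw => ?_⟩
  obtain ⟨y, hy, hyw, hR⟩ := exists_lift_torus w
  have hR0 : 0 < torusSq w := torusSq_pos hw
  have hRd := torusSq_le w
  set R := torusSq w with hR_def
  -- the force is the model field `a y |y|^(-s-2)` plus a bounded error `e`
  obtain ⟨e, he⟩ : ∃ e : Fin d → ℝ, ∀ k, -rieszPart d s k w = a * y k * R ^ (-(s / 2 + 1)) + e k :=
    ⟨fun k => -rieszPart d s k w - a * y k * R ^ (-(s / 2 + 1)), fun k => by ring⟩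
  have heC : ∀ k, |e k| ≤ C := fun k => by
    have h1 := hC k y hy (by rw [← hR]; exact hR0)
    rw [hyw, ← hR] at h1
    have h2 := he k
    have h3 : e k = -(rieszPart d s k w + a * y k * R ^ (-(s / 2 + 1))) := by linarith
    rw [h3, abs_neg]; exact h1
  have hRA : R * R ^ (-(s / 2 + 1)) = R ^ (-(s / 2)) := by
    rw [neg_add, ← sub_eq_add_neg, Real.rpow_sub_one hR0.ne']; field_simp
  have hB0 : 0 ≤ R ^ (-(s / 2 + 1)) := rpow_nonneg hR0.le _
  have err : ∀ v : Fin d → ℝ, (∀ k, |v k| ≤ 2 * (d + 1)) → -(d * (C * (2 * (d + 1)))) ≤ ∑ k, e k * v k := fun v hv => by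
    have : ∑ _k : Fin d, -(C * (2 * ((d : ℝ) + 1))) ≤ ∑ k, e k * v k := by
      refine sum_le_sum fun k _ => ?_
      have h1 : |e k * v k| ≤ C * (2 * (d + 1)) := by
        rw [abs_mul]; exact mul_le_mul (heC k) (hv k) (abs_nonneg _) hC0
      linarith [(abs_le.1 h1).1]
    simp only [sum_const, card_univ, card_fin, nsmul_eq_mul] at this
    linarith
  have hsplit : ∀ v : Fin d → ℝ, ∑ k, -rieszPart d s k w * v k
      = a * R ^ (-(s / 2 + 1)) * ∑ k, y k * v k + ∑ k, e k * v k := fun v => by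
    rw [mul_sum, ← sum_add_distrib]
    exact sum_congr rfl fun k _ => by rw [he]; ring
  constructor
  · rw [hsplit]
    have h1 := err (fun k => field 1 ε k w) fun k =>
      (abs_field_le zero_le_one le_rfl hε hε1 k w).trans (by linarith)
    have h2 := sum_mul_field_ge hε y hy hR
    rw [hyw] at h2
    set q := (R + ε) ^ (-(1 / 2 : ℝ)) with hq
    have hq0 : 0 ≤ q := rpow_nonneg (by linarith) _
    have h3 := mul_le_mul_of_nonneg_left h2 (mul_nonneg ha.le hB0)
    -- the correction of relative order `R` is of order `R^(-s/2)`, absorbed by `K`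
    have h4 : R * q ≤ d + 1 := by
      have h5 : R * q ≤ (R + ε) * q := mul_le_mul_of_nonneg_right (by linarith) hq0
      have h6 : (R + ε) * q = (R + ε) ^ (1 / 2 : ℝ) := by
        have h61 : (1 / 2 : ℝ) = 1 + -(1 / 2) := by norm_num
        rw [hq, h61, rpow_add (by linarith), rpow_one]
        norm_num
      have h7 : (R + ε) ^ (1 / 2 : ℝ) ≤ ((d : ℝ) + 1) ^ (1 / 2 : ℝ) :=
        Real.rpow_le_rpow (by linarith) (by linarith) (by norm_num)
      have h8 : ((d : ℝ) + 1) ^ (1 / 2 : ℝ) ≤ ((d : ℝ) + 1) ^ (1 : ℝ) :=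
        rpow_le_rpow_of_exponent_le (by linarith) (by norm_num)
      rw [rpow_one] at h8
      linarith
    have h9 : a * R ^ (-(s / 2 + 1)) * ((R - 4 * π ^ 2 * R ^ 2) * q)
        = a * (R ^ (-(s / 2)) * q) - a * (4 * π ^ 2) * R ^ (-(s / 2)) * (R * q) := by
      rw [← hRA]; ring
    have h10 : a * (4 * π ^ 2) * R ^ (-(s / 2)) * (R * q) ≤ a * (4 * π ^ 2) * R ^ (-(s / 2)) * (d + 1) :=
      mul_le_mul_of_nonneg_left h4 (by positivity)
    have h11 : 0 ≤ a * (4 * π ^ 2 * (d + 1)) := by positivity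
    have h12 : 0 ≤ d * (C * (2 * (d + 1))) * R ^ (-(s / 2)) := by positivity
    rw [h9] at h3
    linarith
  · intro z
    rw [hsplit]
    have h1 := err (fun k => field 1 ε k (z + w) - field 1 ε k z) fun k => by
      have h2 := abs_field_le zero_le_one le_rfl hε hε1 k (z + w)
      have h3 := abs_field_le zero_le_one le_rfl hε hε1 k z
      exact (abs_sub _ _).trans (by linarith)
    obtain ⟨ζ, -, hζ, -⟩ := exists_lift_torus z
    have h2 := field_semiconvex hε hε1 ζ y
    have h3 : (fun l => ((ζ l + y l : ℝ) : 𝕊)) = z + w := by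
      rw [← hζ, ← hyw]; rfl
    rw [h3, hζ, ← hR] at h2
    have h4 := mul_le_mul_of_nonneg_left h2 (mul_nonneg ha.le hB0)
    have h5 : a * R ^ (-(s / 2 + 1)) * -(2 * π ^ 2 * (d + 1) * R)
        = -(a * (2 * π ^ 2 * (d + 1)) * R ^ (-(s / 2))) := by rw [← hRA]; ring
    rw [h5] at h4
    have h11 : 0 ≤ a * (4 * π ^ 2 * (d + 1)) := by positivity
    have h12 : 0 ≤ d * (C * (2 * (d + 1))) * R ^ (-(s / 2)) := by positivity
    have h13 : 0 ≤ a * (2 * π ^ 2 * (d + 1)) * R ^ (-(s / 2)) := by positivity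
    linarith

/-- The lower order singularity is absorbed by the leading one. -/
lemma exists_absorb (hs : 0 ≤ s) {a K : ℝ} (ha : 0 < a) (hK : 0 ≤ K) : ∃ ε₀ L : ℝ, 0 < ε₀ ∧ ε₀ ≤ 1 ∧
    ∀ ε : ℝ, 0 < ε → ε ≤ ε₀ → ∀ R : ℝ, 0 < R →
      K * (R ^ (-(s / 2)) + 1) ≤ a * (R ^ (-(s / 2)) * (R + ε) ^ (-(1 / 2 : ℝ))) + L := by
  set δ : ℝ := (a / (K + 1)) ^ 2 with hδ
  refine ⟨min 1 (δ / 2), K * ((δ / 2) ^ (-(s / 2)) + 1) + K, by positivity, min_le_left _ _,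
    fun ε hε hεδ R hR => ?_⟩
  have hεδ := hεδ.trans (min_le_right _ _)
  have hA0 : 0 ≤ R ^ (-(s / 2)) := rpow_nonneg hR.le _
  rcases le_or_gt (R + ε) δ with h | h
  · have h1 : K + 1 ≤ a * (R + ε) ^ (-(1 / 2 : ℝ)) := by
      have h2 : δ ^ (-(1 / 2 : ℝ)) ≤ (R + ε) ^ (-(1 / 2 : ℝ)) :=
        rpow_le_rpow_of_nonpos (by linarith) h (by norm_num)
      have h3 : δ ^ (-(1 / 2 : ℝ)) = (K + 1) / a := by
        rw [hδ, rpow_neg (by positivity), ← sqrt_eq_rpow, Real.sqrt_sq (by positivity), inv_div]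
      rw [h3, div_le_iff₀ ha] at h2
      linarith
    have h4 : R ^ (-(s / 2)) * (K + 1) ≤ R ^ (-(s / 2)) * (a * (R + ε) ^ (-(1 / 2 : ℝ))) :=
      mul_le_mul_of_nonneg_left h1 hA0
    have h5 : 0 ≤ K * ((δ / 2) ^ (-(s / 2)) + 1) := by positivity
    nlinarith
  · have h1 : R ^ (-(s / 2)) ≤ (δ / 2) ^ (-(s / 2)) :=
      rpow_le_rpow_of_nonpos (by positivity) (by linarith) (by linarith)
    have h2 : 0 ≤ a * (R ^ (-(s / 2)) * (R + ε) ^ (-(1 / 2 : ℝ))) :=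
      mul_nonneg ha.le (mul_nonneg hA0 (rpow_nonneg (by linarith) _))
    have h3 := mul_le_mul_of_nonneg_left (add_le_add_left h1 1) hK
    linarith

/-- The total field acting on the `i`-th point. -/
def totalField (b ε : ℝ) (i : Fin N) (k : Fin d) (x : 𝕏) : ℝ :=
  ∑ l ∈ univ.erase i, field b ε k (x i - x l)

lemma totalField_eq (b ε : ℝ) (i : Fin N) (k : Fin d) (x : 𝕏) :
    totalField b ε i k x = ∑ l, field b ε k (x i - x l) := by
  rw [totalField, ← Finset.add_sum_erase _ _ (mem_univ i)]
  simp

lemma isC1_field {b ε : ℝ} (hε : 0 < ε) (i j : Fin N) (k : Fin d) :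
    IsC1 (fun x : 𝕏 => field b ε k (x i - x j)) := isC1_of_pair i j (contDiff_field hε k)

lemma isC1_totalField {b ε : ℝ} (hε : 0 < ε) (i : Fin N) (k : Fin d) :
    IsC1 (totalField (N := N) b ε i k) := IsC1.sum _ fun l _ => isC1_field hε i l k

lemma sum_erase_comm (f : Fin N → Fin N → ℝ) :
    ∑ i, ∑ j ∈ univ.erase i, f i j = ∑ i, ∑ j ∈ univ.erase i, f j i := by
  refine Finset.sum_comm' fun i j => ?_
  simp only [Finset.mem_univ, Finset.mem_erase, and_true, true_and]
  exact ne_comm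

/-- After symmetrization in each pair, the total force paired with the total field controls the
singularities of all pairs. -/
lemma exists_force_totalField_ge (hs : 0 ≤ s) (hsd : s < d) : ∃ a K ε₀ : ℝ, 0 < a ∧ 0 < ε₀ ∧ ε₀ ≤ 1 ∧
    ∀ ε : ℝ, 0 < ε → ε ≤ ε₀ → ∀ x : 𝕏, x ∉ collisions N d →
      a * (∑ i, ∑ j ∈ univ.erase i, torusSq (x i - x j) ^ (-(s / 2))
        * (torusSq (x i - x j) + ε) ^ (-(1 / 2 : ℝ))) - K
      ≤ ∑ i, ∑ k, (∑ j ∈ univ.erase i, -rieszPart d s k (x i - x j)) * totalField 1 ε i k x := by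
  obtain ⟨a, K, ha, hK, h⟩ := exists_force_field_ge hs hsd
  obtain ⟨ε₀, L, hε₀, hε₀1, hL⟩ := exists_absorb hs (half_pos ha) (show 0 ≤ N * K by positivity)
  refine ⟨a / 4, N * N * |L| / 2, ε₀, by positivity, hε₀, hε₀1, fun ε hε hεε x hx => ?_⟩
  have hε1 := hεε.trans hε₀1
  set T : Fin N → Fin N → ℝ := fun i j => ∑ k, -rieszPart d s k (x i - x j) * totalField 1 ε i k x with hT
  have e1 : ∑ i, ∑ k, (∑ j ∈ univ.erase i, -rieszPart d s k (x i - x j)) * totalField 1 ε i k x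
      = ∑ i, ∑ j ∈ univ.erase i, T i j := by
    refine sum_congr rfl fun i _ => ?_
    simp only [sum_mul]
    exact Finset.sum_comm
  have pair : ∀ i, ∀ j ∈ univ.erase i, a / 2 * (torusSq (x i - x j) ^ (-(s / 2))
        * (torusSq (x i - x j) + ε) ^ (-(1 / 2 : ℝ))) - L ≤ T i j + T j i := fun i j hj => by
    have hij : i ≠ j := (ne_of_mem_erase hj).symm
    have hw := sub_ne_zero_of_notMem_collisions hx hij
    obtain ⟨h1, h2⟩ := h ε hε hε1 _ hw
    have h3 := hL ε hε hεε _ (torusSq_pos hw)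
    set A := torusSq (x i - x j) ^ (-(s / 2)) with hA
    set q := (torusSq (x i - x j) + ε) ^ (-(1 / 2 : ℝ)) with hq
    have e2 : T i j + T j i = ∑ l, ∑ k, -rieszPart d s k (x i - x j)
        * (field 1 ε k (x i - x l) - field 1 ε k (x j - x l)) := by
      rw [Finset.sum_comm, hT]
      simp only
      rw [← sum_add_distrib]
      refine sum_congr rfl fun k _ => ?_
      rw [← neg_sub (x i) (x j), rieszPart_neg hsd k hw, totalField_eq, totalField_eq,
        ← mul_sum, sum_sub_distrib]
      ring
    have h4 : ∀ l, (if l = i then a * (A * q) else 0) - K * (A + 1) ≤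
        ∑ k, -rieszPart d s k (x i - x j) * (field 1 ε k (x i - x l) - field 1 ε k (x j - x l)) := fun l => by
      split_ifs with hl
      · subst hl
        refine h1.trans (le_of_eq (sum_congr rfl fun k _ => ?_))
        rw [sub_self, field_zero, ← neg_sub (x l) (x j), field_neg]; ring
      · rw [zero_sub]
        refine (h2 (x j - x l)).trans (le_of_eq (sum_congr rfl fun k _ => ?_))
        rw [show x j - x l + (x i - x j) = x i - x l by abel]
    have h5 := sum_le_sum fun l (_ : l ∈ Finset.univ) => h4 l
    rw [sum_sub_distrib, Finset.sum_ite_eq' univ i, if_pos (Finset.mem_univ i),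
      sum_const, card_univ, card_fin, nsmul_eq_mul, ← e2] at h5
    linarith
  have h7 := sum_le_sum fun i (_ : i ∈ Finset.univ) => sum_le_sum (pair i)
  simp only [sum_add_distrib, sum_sub_distrib, ← mul_sum] at h7
  rw [← sum_erase_comm T] at h7
  have h8 : ∑ i : Fin N, ∑ _j ∈ univ.erase i, L ≤ N * N * |L| := by
    have : ∀ i : Fin N, ∑ _j ∈ univ.erase i, L ≤ N * |L| := fun i => by
      rw [sum_const, nsmul_eq_mul]
      exact (mul_le_mul_of_nonneg_left (le_abs_self L) (cast_nonneg _)).trans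
        (mul_le_mul_of_nonneg_right (card_univ_erase_le i) (abs_nonneg _))
    refine (sum_le_sum fun i _ => this i).trans (le_of_eq ?_)
    simp [mul_assoc]
  rw [e1]
  linarith

/-- The quadratic quantity controlling the interaction. -/
def energyBound (s σ : ℝ) (u : 𝕏 → ℝ) : ℝ :=
  (∫ x, u x ^ 2 * gibbsCont s σ x) + ∑ i, ∑ k, ∫ x, |u x| * |𝐃 i k u x| * gibbsCont s σ x

lemma continuous_abs_mul_partial (hp : Admissible N d s σ) {u : 𝕏 → ℝ} (hu : IsC1 u) (i : Fin N) (k : Fin d) :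
    Continuous fun x => |u x| * |𝐃 i k u x| * 𝐆 x :=
  (hu.continuous.abs.mul (hu.continuous_partial i k).abs).mul (continuous_gibbsCont hp)

lemma integral_sq_gibbsCont_nonneg (u : 𝕏 → ℝ) :
    0 ≤ ∫ x, u x ^ 2 * 𝐆 x :=
  integral_nonneg fun _ => mul_nonneg (sq_nonneg _) (gibbsCont_nonneg _ _ _)

lemma integral_abs_partial_gibbsCont_nonneg (u : 𝕏 → ℝ) (i : Fin N) (k : Fin d) :
    0 ≤ ∫ x, |u x| * |𝐃 i k u x| * 𝐆 x :=
  integral_nonneg fun _ => mul_nonneg (by positivity) (gibbsCont_nonneg _ _ _)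

lemma energyBound_nonneg (u : 𝕏 → ℝ) : 0 ≤ energyBound s σ u :=
  add_nonneg (integral_sq_gibbsCont_nonneg u) (sum_nonneg fun i _ => sum_nonneg fun k _ =>
    integral_abs_partial_gibbsCont_nonneg u i k)

lemma le_mul_energyBound {A B : ℝ} (hA : 0 ≤ A) (hB : 0 ≤ B) (u : 𝕏 → ℝ) :
    A * (∑ i, ∑ k, ∫ x, |u x| * |𝐃 i k u x| * 𝐆 x)
      + B * ∫ x, u x ^ 2 * 𝐆 x ≤ (A + B) * energyBound s σ u := by
  have h1 := integral_sq_gibbsCont_nonneg (s := s) (σ := σ) u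
  have h2 : 0 ≤ ∑ i, ∑ k, ∫ x, |u x| * |𝐃 i k u x| * 𝐆 x :=
    sum_nonneg fun i _ => sum_nonneg fun k _ => integral_abs_partial_gibbsCont_nonneg u i k
  unfold energyBound
  nlinarith [mul_nonneg hB h2]

/-- The singular weight of the pair `z`, regularized at the scale `ε`. -/
def regWeight (s ε : ℝ) (z : 𝕋 d) : ℝ :=
  if 0 ≤ s then torusSq z ^ (-(s / 2)) * (torusSq z + ε) ^ (-(1 / 2 : ℝ))
  else (torusSq z + ε) ^ (-((s + 1) / 2))

lemma regWeight_nonneg {ε : ℝ} (hε : 0 ≤ ε) (z : 𝕋 d) : 0 ≤ regWeight s ε z := by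
  have h1 := torusSq_nonneg z
  unfold regWeight
  split_ifs
  · exact mul_nonneg (rpow_nonneg h1 _) (rpow_nonneg (by linarith) _)
  · exact rpow_nonneg (by linarith) _

lemma measurable_regWeight (ε : ℝ) : Measurable (regWeight (d := d) s ε) := by
  have h1 : Measurable (torusSq (d := d)) := continuous_torusSq.measurable
  unfold regWeight
  split_ifs
  · exact (h1.pow_const _).mul ((h1.add_const ε).pow_const _)
  · exact (h1.add_const ε).pow_const _

lemma tendsto_regWeight {z : 𝕋 d} (hz : z ≠ 0) :
    Tendsto (fun ε => regWeight s ε z) (𝓝[>] 0) (𝓝 (torusSq z ^ (-((s + 1) / 2)))) := by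
  have hR := torusSq_pos hz
  have h0 : ∀ p : ℝ, Tendsto (fun ε : ℝ => (torusSq z + ε) ^ p) (𝓝[>] 0) (𝓝 (torusSq z ^ p)) := fun p => by
    have : ContinuousAt (fun ε : ℝ => (torusSq z + ε) ^ p) 0 :=
      (continuousAt_const.add continuousAt_id).rpow_const (Or.inl (by simpa using hR.ne'))
    have h := this.tendsto
    simp only [add_zero] at h
    exact h.mono_left nhdsWithin_le_nhds
  unfold regWeight
  split_ifs
  · have := (h0 (-(1 / 2))).const_mul (torusSq z ^ (-(s / 2)))
    rwa [← rpow_add hR, show -(s / 2) + -(1 / 2) = -((s + 1) / 2) by ring] at this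
  · exact h0 _

lemma integral_sum_sum {α ι κ : Type*} [MeasurableSpace α] {μ : Measure α} [Fintype ι] [Fintype κ]
    {F : ι → κ → α → ℝ} (hF : ∀ i k, Integrable (F i k) μ) :
    Integrable (fun x => ∑ i, ∑ k, F i k x) μ ∧
      ∫ x, ∑ i, ∑ k, F i k x ∂μ = ∑ i, ∑ k, ∫ x, F i k x ∂μ := by
  have h := fun i => integrable_finsetSum univ fun k _ => hF i k
  refine ⟨integrable_finsetSum _ fun i _ => h i, ?_⟩
  rw [integral_finsetSum _ fun i _ => h i]
  exact sum_congr rfl fun i _ => integral_finsetSum _ fun k _ => hF i k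

lemma neg_two_mul_le {a b v A : ℝ} (h : |v| ≤ A) : -(2 * (a * b * v)) ≤ 2 * A * (|a| * |b|) := by
  have h1 := neg_le_abs (a * b * v)
  rw [abs_mul, abs_mul] at h1
  linarith [mul_le_mul_of_nonneg_left h (mul_nonneg (abs_nonneg a) (abs_nonneg b))]

lemma integrable_sq_mul_abs {u f : 𝕏 → ℝ} (hu : Continuous u) (hf : Integrable fun x => f x * 𝐆 x) :
    Integrable fun x => u x ^ 2 * (|f x| * 𝐆 x) :=
  integrable_continuous_mul (hf.abs.congr (.of_forall fun x => by
    simp only [abs_mul, abs_of_nonneg (gibbsCont_nonneg s σ x)])) (hu.pow 2)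

/-- The regularized estimate for repulsive singularities, from the total field. -/
lemma exists_regWeight_bound_of_nonneg (hp : Admissible N d s σ) (hs : 0 ≤ s) :
    ∃ C ε₀ : ℝ, 0 < ε₀ ∧ ∀ ε : ℝ, 0 < ε → ε ≤ ε₀ → ∀ u : 𝕏 → ℝ, IsC1 u → ∀ i j : Fin N, i ≠ j →
      ∫⁻ x, ofReal (u x ^ 2 * regWeight s ε (x i - x j) * 𝐆 x)
        ≤ ofReal (C * energyBound s σ u) := by
  obtain ⟨a, K, ε₀, ha, hε₀, hε₀1, h⟩ := exists_force_totalField_ge hs hp.s_lt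
  have hb := hp.invTemp_pos
  set β := invTemp N σ with hβ
  have hN0 : (0 : ℝ) ≤ N := cast_nonneg N
  have hd0 : (0 : ℝ) ≤ d := cast_nonneg d
  set A : ℝ := 2 * (N * (d + 1)) with hA
  set B : ℝ := N * (N * (2 * π ^ 2 * (d + 1))) with hB
  refine ⟨(A / (2 * β) + (B / (2 * β) + |K|)) / a, ε₀, hε₀, fun ε hε hεε u hu i₀ j₀ hij => ?_⟩
  have hε1 := hεε.trans hε₀1
  set X : Fin N → Fin d → 𝕏 → ℝ := fun i k => totalField 1 ε i k with hX
  have hXC : ∀ i k, IsC1 (X i k) := fun i k => isC1_totalField hε i k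
  have hXb : ∀ i k x, |X i k x| ≤ N * (d + 1) := fun i k x => by
    rw [hX]
    simp only [totalField_eq]
    refine (Finset.abs_sum_le_sum_abs _ _).trans ?_
    refine (sum_le_sum fun l _ => abs_field_le zero_le_one le_rfl hε hε1 k _).trans ?_
    rw [sum_const, card_univ, card_fin, nsmul_eq_mul]
  have hdiv : ∀ i x, -(N * (2 * π ^ 2 * (d + 1))) ≤ ∑ k, 𝐃 i k (X i k) x := fun i x => by
    have e1 : ∀ k, 𝐃 i k (X i k) x
        = ∑ l ∈ univ.erase i, torusPartial k (field 1 ε k) (x i - x l) := fun k => by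
      refine configPartial_eq ?_
      refine HasDerivAt.fun_sum fun l hl => ?_
      rw [← configPartial_pair (ne_of_mem_erase hl).symm]
      exact (isC1_field hε i l k).hasDerivAt i k x
    simp only [e1]
    rw [Finset.sum_comm]
    have h1 : ∀ l ∈ univ.erase i, -(2 * π ^ 2 * (d + 1)) ≤
        ∑ k, torusPartial k (field 1 ε k) (x i - x l) := fun l _ => by
      refine le_trans ?_ (div_field_ge zero_le_one le_rfl hε hε1 _)
      have h2 : 0 ≤ ((d : ℝ) - 1) * rho ε (x i - x l) ^ (-(1 / 2 : ℝ)) :=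
        mul_nonneg (by have : (1 : ℝ) ≤ d := by exact_mod_cast hp.one_le_d
                       linarith) (rpow_nonneg (rho_pos hε _).le _)
      linarith
    have h3 := sum_le_sum h1
    refine le_trans ?_ h3
    rw [sum_const, nsmul_eq_mul, mul_neg, neg_le_neg_iff]
    refine mul_le_mul_of_nonneg_right ?_ (by positivity)
    exact card_univ_erase_le i
  -- integrate by parts with the vector field `u² X`
  have hφ : ∀ i k, IsC1 (fun x => u x * u x * X i k x) := fun i k => (hu.mul hu).mul (hXC i k)
  have hG := continuous_gibbsCont hp
  have hG0 := gibbsCont_nonneg (N := N) (d := d) s σ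
  have hI1 : ∀ i k, Integrable fun x => 𝐃 i k (fun x => u x * u x * X i k x) x * 𝐆 x :=
    fun i k => integrable_of_continuous (((hφ i k).continuous_partial i k).mul hG)
  have hI2 : ∀ i k, Integrable fun x => u x * u x * X i k x * (𝐛 i k x * 𝐆 x) :=
    fun i k => integrable_continuous_mul (integrable_logGrad_gibbsCont hp i k) (hφ i k).continuous
  have hI3 : Integrable fun x => u x ^ 2 * 𝐆 x := integrable_of_continuous ((hu.continuous.pow 2).mul hG)
  have hI4 : ∀ i k, Integrable fun x => |u x| * |𝐃 i k u x| * 𝐆 x :=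
    fun i k => integrable_of_continuous (continuous_abs_mul_partial hp hu i k)
  have hbound : ∑ i, ∑ k, ∫ x, u x * u x * X i k x * (𝐛 i k x * 𝐆 x)
      ≤ A * (∑ i, ∑ k, ∫ x, |u x| * |𝐃 i k u x| * 𝐆 x) + B * ∫ x, u x ^ 2 * 𝐆 x := by
    have hibp : ∑ i, ∑ k, ∫ x, u x * u x * X i k x * (𝐛 i k x * 𝐆 x)
        = ∫ x, -∑ i, ∑ k, 𝐃 i k (fun x => u x * u x * X i k x) x * 𝐆 x := by
      rw [integral_neg, (integral_sum_sum hI1).2]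
      simp only [integral_partial_gibbsCont hp (hφ _ _), sum_neg_distrib, neg_neg]
    have hI5 := (integral_sum_sum hI4).1.const_mul A
    rw [hibp, ← (integral_sum_sum hI4).2, ← integral_const_mul, ← integral_const_mul,
      ← integral_add hI5 (hI3.const_mul _)]
    refine integral_mono (integral_sum_sum hI1).1.neg (hI5.add (hI3.const_mul _)) fun x => ?_
    simp only [← sum_mul]
    rw [← neg_mul, ← mul_assoc, ← mul_assoc, ← add_mul]
    refine mul_le_mul_of_nonneg_right ?_ (hG0 x)
    have h1 : -(∑ i, ∑ k, 2 * (u x * 𝐃 i k u x * X i k x)) ≤ A * ∑ i, ∑ k, |u x| * |𝐃 i k u x| := by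
      simp only [mul_sum, ← sum_neg_distrib]
      exact sum_le_sum fun i _ => sum_le_sum fun k _ => neg_two_mul_le (hXb i k x)
    have h2 : -(∑ i, u x * u x * ∑ k, 𝐃 i k (X i k) x) ≤ B * u x ^ 2 := by
      have h3 := sum_le_sum fun i (_ : i ∈ Finset.univ) =>
        mul_le_mul_of_nonneg_left (hdiv i x) (mul_self_nonneg (u x))
      rw [sum_const, card_univ, card_fin, nsmul_eq_mul] at h3
      rw [hB]; linarith
    simp only [hu.partial_sq_mul (hXC _ _), sum_add_distrib, ← mul_sum] at h1 h2 ⊢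
    linarith
  -- compare pointwise with the singular weight
  set T : 𝕏 → ℝ := fun x => ∑ i, ∑ k, u x * u x * X i k x * (𝐛 i k x * 𝐆 x) with hT
  have hTI : Integrable T := (integral_sum_sum hI2).1
  have hTint := (integral_sum_sum hI2).2
  set F : 𝕏 → ℝ := fun x => (T x / (2 * β) + |K| * (u x ^ 2 * 𝐆 x)) / a with hF
  have hFI : Integrable F := ((hTI.div_const _).add (hI3.const_mul _)).div_const _
  have hpt : ∀ x, x ∉ collisions N d → u x ^ 2 * regWeight s ε (x i₀ - x j₀) * 𝐆 x ≤ F x := fun x hx => by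
    have h1 := h ε hε hεε x hx
    have h2 : torusSq (x i₀ - x j₀) ^ (-(s / 2)) * (torusSq (x i₀ - x j₀) + ε) ^ (-(1 / 2 : ℝ)) ≤
        ∑ i, ∑ j ∈ univ.erase i, torusSq (x i - x j) ^ (-(s / 2))
        * (torusSq (x i - x j) + ε) ^ (-(1 / 2 : ℝ)) := by
      have h3 : ∀ i j, 0 ≤ torusSq (x i - x j) ^ (-(s / 2))
          * (torusSq (x i - x j) + ε) ^ (-(1 / 2 : ℝ)) := fun i j =>
        mul_nonneg (rpow_nonneg (torusSq_nonneg _) _)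
          (rpow_nonneg (by linarith [torusSq_nonneg (x i - x j)]) _)
      refine le_trans ?_ (single_le_sum (fun i _ => sum_nonneg fun j _ => h3 i j) (mem_univ i₀))
      exact single_le_sum (f := fun j => torusSq (x i₀ - x j) ^ (-(s / 2))
          * (torusSq (x i₀ - x j) + ε) ^ (-(1 / 2 : ℝ))) (fun j _ => h3 i₀ j)
        (Finset.mem_erase.2 ⟨hij.symm, mem_univ j₀⟩)
    have h4 : T x = 2 * β * (u x ^ 2 * 𝐆 x) *
        ∑ i, ∑ k, (∑ j ∈ univ.erase i, -rieszPart d s k (x i - x j)) * totalField 1 ε i k x := by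
      rw [hT]
      simp only [mul_sum (a := 2 * β * (u x ^ 2 * 𝐆 x))]
      refine sum_congr rfl fun i _ => sum_congr rfl fun k _ => ?_
      rw [logGrad, sum_neg_distrib, hX]; ring
    rw [hF]
    simp only
    rw [h4, le_div_iff₀ ha, regWeight, if_pos hs, mul_assoc (2 * β), mul_div_cancel_left₀ _ (by positivity)]
    have h5 : 0 ≤ u x ^ 2 * 𝐆 x := mul_nonneg (sq_nonneg _) (hG0 x)
    have h1' := h1.trans' (sub_le_sub_left (le_abs_self K) _)
    have h6 := mul_le_mul_of_nonneg_left ((mul_le_mul_of_nonneg_left h2 ha.le).trans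
      (sub_le_iff_le_add.1 h1')) h5
    linarith
  have hae := ae_notMem_collisions (N := N) hp.one_le_d
  have hF0 : 0 ≤ᵐ[volume] F := by
    filter_upwards [hae] with x hx
    exact le_trans (mul_nonneg (mul_nonneg (sq_nonneg _) (regWeight_nonneg hε.le _)) (hG0 x)) (hpt x hx)
  calc _ ≤ ∫⁻ x, ofReal (F x) := lintegral_mono_ae (by
        filter_upwards [hae] with x hx
        exact ofReal_le_ofReal (hpt x hx))
    _ = ofReal (∫ x, F x) := (ofReal_integral_eq_lintegral_ofReal hFI hF0).symm
    _ ≤ _ := by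
      refine ofReal_le_ofReal ?_
      rw [hF]
      rw [integral_div, integral_add (hTI.div_const _) (hI3.const_mul _), integral_div, integral_const_mul,
        hTint, div_le_iff₀ ha]
      have h7 := le_mul_energyBound (s := s) (σ := σ) (A := A / (2 * β)) (B := B / (2 * β) + |K|)
        (by positivity) (by positivity) u
      have h8 := div_le_div_of_nonneg_right hbound (show 0 ≤ 2 * β by positivity)
      have e5 : (A / (2 * β) + (B / (2 * β) + |K|)) / a * energyBound s σ u * a
          = (A / (2 * β) + (B / (2 * β) + |K|)) * energyBound s σ u := by field_simp
      have e6 : ∀ S I Y : ℝ, Y / (2 * β) ≤ (A * S + B * I) / (2 * β) →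
          Y / (2 * β) + |K| * I ≤ A / (2 * β) * S + (B / (2 * β) + |K|) * I := fun S I Y h9 => by
        have h10 : (A * S + B * I) / (2 * β) = A / (2 * β) * S + B / (2 * β) * I := by ring
        linarith
      rw [e5]
      exact (e6 _ _ _ h8).trans h7

/-- The regularized estimate for bounded potentials, from the Lebesgue measure. -/
lemma exists_regWeight_bound_of_neg (hp : Admissible N d s σ) (hs : s < 0) :
    ∃ C ε₀ : ℝ, 0 < ε₀ ∧ ∀ ε : ℝ, 0 < ε → ε ≤ ε₀ → ∀ u : 𝕏 → ℝ, IsC1 u → ∀ i j : Fin N, i ≠ j →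
      ∫⁻ x, ofReal (u x ^ 2 * regWeight s ε (x i - x j) * 𝐆 x)
        ≤ ofReal (C * energyBound s σ u) := by
  obtain ⟨m, hm, hmG⟩ := exists_le_gibbsCont hp hs
  obtain ⟨M, hM1, hMG, -⟩ := exists_gibbsCont_le hp
  have hb : 0 ≤ s + 1 := by linarith [hp.le_s]
  have hb1 : s + 1 ≤ 1 := by linarith
  have hd1 : (1 : ℝ) ≤ d := by exact_mod_cast hp.one_le_d
  have hdb : 0 < (d : ℝ) - (s + 1) := by linarith
  set c := (d : ℝ) - (s + 1) with hc
  set A : ℝ := 2 * (d + 1) with hA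
  set B : ℝ := 2 * π ^ 2 * (d + 1) with hB
  have hA0 : 0 ≤ A := by positivity
  have hB0 : 0 ≤ B := by positivity
  refine ⟨M * (A / m + B / m) / c, 1, one_pos, fun ε hε hε1 u hu i j hij => ?_⟩
  have hG := continuous_gibbsCont hp
  have hG0 := gibbsCont_nonneg (N := N) (d := d) s σ
  set V : Fin d → 𝕏 → ℝ := fun k x => field (s + 1) ε k (x i - x j) with hV
  have hVC : ∀ k, IsC1 (V k) := fun k => isC1_field hε i j k
  have hφ : ∀ k, IsC1 (fun x => u x * u x * V k x) := fun k => (hu.mul hu).mul (hVC k)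
  have hφ' : ∀ k x, 𝐃 i k (fun x => u x * u x * V k x) x
      = 2 * (u x * 𝐃 i k u x * V k x) + u x * u x * torusPartial k (field (s + 1) ε k) (x i - x j) := fun k x => by
    rw [hu.partial_sq_mul (hVC k), configPartial_pair hij]
  have hz : Continuous fun x : 𝕏 => x i - x j := (continuous_apply i).sub (continuous_apply j)
  have hRc : Continuous fun x : 𝕏 => (torusSq (x i - x j) + ε) ^ (-((s + 1) / 2)) :=
    ((continuous_torusSq.comp hz).add continuous_const).rpow_const fun x =>
      Or.inl (add_pos_of_nonneg_of_pos (torusSq_nonneg _) hε).ne'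
  have hI0 : Integrable fun x : 𝕏 => u x ^ 2 * (torusSq (x i - x j) + ε) ^ (-((s + 1) / 2)) :=
    integrable_of_continuous ((hu.continuous.pow 2).mul hRc)
  have hI1 : ∀ k, Integrable fun x => 𝐃 i k (fun x => u x * u x * V k x) x :=
    fun k => integrable_of_continuous ((hφ k).continuous_partial i k)
  have hI3 : Integrable fun x => u x ^ 2 * 𝐆 x :=
    integrable_of_continuous ((hu.continuous.pow 2).mul hG)
  have hI4 : ∀ k, Integrable fun x => |u x| * |𝐃 i k u x| * 𝐆 x :=
    fun k => integrable_of_continuous (continuous_abs_mul_partial hp hu i k)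
  have hzero : ∫ x, ∑ k, 𝐃 i k (fun x => u x * u x * V k x) x = 0 := by
    rw [integral_finsetSum _ fun k _ => hI1 k]
    exact Finset.sum_eq_zero fun k _ => integral_configPartial hp.one_le_d (hφ k) i k
  -- the weight is at most the divergence of the field of homogeneity `-s`, as `s + 1 < d`;
  -- the divergence of `u² V` has zero integral
  have hpt : ∀ x, c * (u x ^ 2 * (torusSq (x i - x j) + ε) ^ (-((s + 1) / 2))) ≤
      ∑ k, 𝐃 i k (fun x => u x * u x * V k x) x
        + (A / m * (∑ k, |u x| * |𝐃 i k u x| * 𝐆 x)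
          + B / m * (u x ^ 2 * 𝐆 x)) := fun x => by
    have h1 := div_field_ge hb hb1 hε hε1 (x i - x j)
    have h2 : (torusSq (x i - x j) + ε) ^ (-((s + 1) / 2)) ≤ rho ε (x i - x j) ^ (-((s + 1) / 2)) :=
      rpow_le_rpow_of_nonpos (rho_pos hε _) (rho_le_torusSq _ _) (by linarith)
    have h3 := mul_le_mul_of_nonneg_left ((sub_le_sub_right (mul_le_mul_of_nonneg_left h2 hdb.le) B).trans h1)
      (sq_nonneg (u x))
    simp only [hφ', sum_add_distrib, ← mul_sum]
    have h4 : -(∑ k, 2 * (u x * 𝐃 i k u x * V k x)) ≤ A * (∑ k, |u x| * |𝐃 i k u x|) := by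
      rw [mul_sum, ← sum_neg_distrib]
      exact sum_le_sum fun k _ => neg_two_mul_le (abs_field_le hb hb1 hε hε1 k (x i - x j))
    have h5 : ∀ q r : ℝ, 0 ≤ q → 0 ≤ r → q * r ≤ q / m * (r * 𝐆 x) := fun q r hq hr => by
      have := mul_le_mul_of_nonneg_left (hmG x) (mul_nonneg hq hr)
      rw [div_mul_eq_mul_div, le_div_iff₀ hm]
      linarith
    have h6 := h5 A (∑ k, |u x| * |𝐃 i k u x|) hA0 (sum_nonneg fun k _ => by positivity)
    have h7 := h5 B (u x ^ 2) hB0 (sq_nonneg _)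
    rw [← mul_sum] at h4
    rw [← sum_mul]
    linarith
  have hI5 : Integrable fun x => ∑ k, |u x| * |𝐃 i k u x| * 𝐆 x :=
    integrable_finsetSum _ fun k _ => hI4 k
  have hI6 : Integrable fun x => A / m * (∑ k, |u x| * |𝐃 i k u x| * 𝐆 x)
      + B / m * (u x ^ 2 * 𝐆 x) := (hI5.const_mul (A / m)).add (hI3.const_mul (B / m))
  have hI7 : Integrable fun x => ∑ k, 𝐃 i k (fun x => u x * u x * V k x) x :=
    integrable_finsetSum _ fun k _ => hI1 k
  have hint := integral_mono (hI0.const_mul c) (hI7.add hI6) hpt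
  simp only [Pi.add_apply] at hint
  rw [integral_const_mul, integral_add hI7 hI6, hzero, zero_add, integral_add (hI5.const_mul (A / m)) (hI3.const_mul (B / m)), integral_const_mul,
    integral_const_mul, integral_finsetSum _ fun k _ => hI4 k] at hint
  have hsum : ∑ k, ∫ x, |u x| * |𝐃 i k u x| * 𝐆 x
      ≤ ∑ i, ∑ k, ∫ x, |u x| * |𝐃 i k u x| * 𝐆 x :=
    single_le_sum
      (fun i _ => sum_nonneg fun k _ => integral_abs_partial_gibbsCont_nonneg u i k) (mem_univ i)
  have hle := le_mul_energyBound (s := s) (σ := σ) (A := A / m) (B := B / m) (by positivity) (by positivity) u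
  have hle2 := mul_le_mul_of_nonneg_left hsum (show 0 ≤ A / m by positivity)
  have hfin : ∫ x : 𝕏, u x ^ 2 * (torusSq (x i - x j) + ε) ^ (-((s + 1) / 2))
      ≤ (A / m + B / m) * energyBound s σ u / c := by
    rw [le_div_iff₀ hdb]; linarith
  have hR0 : ∀ x : 𝕏, 0 ≤ u x ^ 2 * (torusSq (x i - x j) + ε) ^ (-((s + 1) / 2)) := fun x =>
    mul_nonneg (sq_nonneg _) (rpow_nonneg (by linarith [torusSq_nonneg (x i - x j)]) _)
  calc _ ≤ ∫⁻ x : 𝕏, ofReal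
          (M * (u x ^ 2 * (torusSq (x i - x j) + ε) ^ (-((s + 1) / 2)))) := by
        refine lintegral_mono fun x => ofReal_le_ofReal ?_
        rw [regWeight, if_neg (not_le.2 hs), mul_comm M]
        exact mul_le_mul_of_nonneg_left (hMG x) (hR0 x)
    _ = ofReal (∫ x : 𝕏, M * (u x ^ 2 * (torusSq (x i - x j) + ε) ^ (-((s + 1) / 2)))) :=
        (ofReal_integral_eq_lintegral_ofReal (hI0.const_mul M)
          (.of_forall fun x => mul_nonneg (by linarith) (hR0 x))).symm
    _ ≤ _ := by
        refine ofReal_le_ofReal ?_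
        rw [integral_const_mul]
        refine (mul_le_mul_of_nonneg_left hfin (by linarith)).trans (le_of_eq ?_)
        ring

/-- The interaction force is form bounded, in multiplicative form: the singularity of order `s + 1`
costs one derivative. -/
lemma exists_logGrad_bound (hp : Admissible N d s σ) : ∃ C : ℝ, 0 ≤ C ∧
    ∀ u : 𝕏 → ℝ, IsC1 u → ∀ (i : Fin N) (k : Fin d),
      ∫ x, u x ^ 2 * (|𝐛 i k x| * 𝐆 x) ≤ C * energyBound s σ u := by
  obtain ⟨C₁, ε₀, hε₀, h₁⟩ :=
    (le_or_gt 0 s).elim (exists_regWeight_bound_of_nonneg hp) (exists_regWeight_bound_of_neg hp)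
  obtain ⟨C₂, hC₂, h₂⟩ := exists_rieszPart_bound (d := d) hp.le_s hp.s_lt
  set a := |singConst d s| with ha
  have hb := hp.invTemp_pos
  set β := invTemp N σ with hβ
  set D := a * |C₁| + C₂ with hD
  have hD0 : 0 ≤ D := by positivity
  have hG := continuous_gibbsCont hp
  have hG0 := gibbsCont_nonneg (N := N) (d := d) s σ
  have hae := ae_notMem_collisions (N := N) hp.one_le_d
  have pairBound : ∀ u : 𝕏 → ℝ, IsC1 u → ∀ (k : Fin d) (i j : Fin N), i ≠ j →
      ∫ x, u x ^ 2 * (|rieszPart d s k (x i - x j)| * 𝐆 x) ≤ D * energyBound s σ u := fun u hu k i j hij => by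
    have hQ := energyBound_nonneg (s := s) (σ := σ) u
    have hI3 : Integrable fun x => u x ^ 2 * 𝐆 x :=
      integrable_of_continuous ((hu.continuous.pow 2).mul hG)
    have hz : Measurable fun x : 𝕏 => x i - x j := ((continuous_apply i).sub (continuous_apply j)).measurable
    -- let the regularization tend to zero
    have hlim : ∫⁻ x, ofReal (u x ^ 2 * torusSq (x i - x j) ^ (-((s + 1) / 2)) * 𝐆 x)
        ≤ ofReal (|C₁| * energyBound s σ u) := by
      obtain ⟨e, -, he0, hetend⟩ := exists_seq_strictAnti_tendsto' hε₀
      have hle : ∀ n, ∫⁻ x, ofReal (u x ^ 2 * regWeight s (e n) (x i - x j) * 𝐆 x)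
          ≤ ofReal (|C₁| * energyBound s σ u) := fun n =>
        (h₁ (e n) (he0 n).1 (he0 n).2.le u hu i j hij).trans (ofReal_le_ofReal
          (mul_le_mul_of_nonneg_right (le_abs_self _) hQ))
      have hmeas : ∀ n, AEMeasurable (fun x => ofReal
          (u x ^ 2 * regWeight s (e n) (x i - x j) * 𝐆 x)) := fun n =>
        (((hu.continuous.measurable.pow_const 2).mul ((measurable_regWeight (e n)).comp hz)).mul
          hG.measurable).ennreal_ofReal.aemeasurable
      have hfatou := lintegral_liminf_le' (u := atTop) (μ := (volume : Measure 𝕏)) hmeas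
      refine le_trans (le_of_eq (lintegral_congr_ae ?_)) (hfatou.trans ?_)
      · filter_upwards [hae] with x hx
        have h3 := tendsto_regWeight (s := s) (sub_ne_zero_of_notMem_collisions hx hij)
        have h4 := h3.comp (tendsto_nhdsWithin_iff.2 ⟨hetend, Eventually.of_forall fun n => (he0 n).1⟩)
        exact ((ENNReal.continuous_ofReal.tendsto _).comp ((h4.const_mul (u x ^ 2)).mul_const _)).liminf_eq.symm
      · refine (liminf_le_liminf (.of_forall hle)).trans (le_of_eq ?_)
        exact liminf_const _
    -- compare the force with the singular weight
    have hforce : ∀ x : 𝕏, x ∉ collisions N d → |rieszPart d s k (x i - x j)| ≤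
        a * torusSq (x i - x j) ^ (-((s + 1) / 2)) + C₂ := fun x hx => by
      have hw := sub_ne_zero_of_notMem_collisions hx hij
      obtain ⟨y, hy, hyw, hR⟩ := exists_lift_torus (x i - x j)
      have hR0 := torusSq_pos hw
      have h3 := h₂ k y hy (by rw [← hR]; exact hR0)
      rw [hyw, ← hR] at h3
      set R := torusSq (x i - x j) with hRdef
      have h4 : |y k| ≤ R ^ (1 / 2 : ℝ) := by
        rw [← sqrt_eq_rpow]
        refine Real.abs_le_sqrt ?_
        rw [hR]
        exact single_le_sum (f := fun k => y k ^ 2) (fun _ _ => sq_nonneg _) (mem_univ k)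
      have h5 : |singConst d s * y k * R ^ (-(s / 2 + 1))| ≤ a * R ^ (-((s + 1) / 2)) := by
        rw [abs_mul, abs_mul, abs_of_nonneg (rpow_nonneg hR0.le _), mul_assoc]
        refine mul_le_mul_of_nonneg_left ?_ (abs_nonneg _)
        refine (mul_le_mul_of_nonneg_right h4 (rpow_nonneg hR0.le _)).trans (le_of_eq ?_)
        rw [← rpow_add hR0]; congr 1; ring
      have h6 := abs_sub_abs_le_abs_sub (rieszPart d s k (x i - x j)) (-(singConst d s * y k * R ^ (-(s / 2 + 1))))
      rw [sub_neg_eq_add, abs_neg] at h6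
      linarith
    have hmR : Measurable fun x : 𝕏 => u x ^ 2 * torusSq (x i - x j) ^ (-((s + 1) / 2)) * 𝐆 x :=
      ((hu.continuous.measurable.pow_const 2).mul
        ((continuous_torusSq.measurable.comp hz).pow_const _)).mul hG.measurable
    have hR0 : ∀ x : 𝕏, 0 ≤ u x ^ 2 * torusSq (x i - x j) ^ (-((s + 1) / 2)) * 𝐆 x :=
      fun x => mul_nonneg (mul_nonneg (sq_nonneg _) (rpow_nonneg (torusSq_nonneg _) _)) (hG0 x)
    have hIR : Integrable fun x : 𝕏 =>
        u x ^ 2 * torusSq (x i - x j) ^ (-((s + 1) / 2)) * 𝐆 x := by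
      refine ⟨hmR.aestronglyMeasurable, ?_⟩
      rw [hasFiniteIntegral_iff_ofReal (.of_forall hR0)]
      exact hlim.trans_lt ofReal_lt_top
    have hIRle : ∫ x : 𝕏, u x ^ 2 * torusSq (x i - x j) ^ (-((s + 1) / 2)) * 𝐆 x
        ≤ |C₁| * energyBound s σ u := by
      rw [integral_eq_lintegral_of_nonneg_ae (.of_forall hR0) hmR.aestronglyMeasurable]
      exact ENNReal.toReal_le_of_le_ofReal (by positivity) hlim
    have hIP := integrable_sq_mul_abs hu.continuous (integrable_rieszPart_gibbsCont hp hij k)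
    calc _ ≤ ∫ x, a * (u x ^ 2 * torusSq (x i - x j) ^ (-((s + 1) / 2)) * 𝐆 x)
          + C₂ * (u x ^ 2 * 𝐆 x) := by
          refine integral_mono_ae hIP ((hIR.const_mul a).add (hI3.const_mul C₂)) ?_
          filter_upwards [hae] with x hx
          have h7 := mul_le_mul_of_nonneg_right (hforce x hx) (mul_nonneg (sq_nonneg (u x)) (hG0 x))
          linarith
      _ ≤ _ := by
          rw [integral_add (hIR.const_mul a) (hI3.const_mul C₂), integral_const_mul, integral_const_mul, hD]
          have h8 := mul_le_mul_of_nonneg_left hIRle (show 0 ≤ a by positivity)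
          have h9 := mul_le_mul_of_nonneg_left (show ∫ x, u x ^ 2 * 𝐆 x ≤ energyBound s σ u from
            le_add_of_nonneg_right (sum_nonneg fun i _ => sum_nonneg fun k _ =>
              integral_abs_partial_gibbsCont_nonneg u i k)) hC₂
          linarith
  refine ⟨2 * β * (N * D), by positivity, fun u hu i k => ?_⟩
  have hQ := energyBound_nonneg (s := s) (σ := σ) u
  have hIj : ∀ j ∈ univ.erase i, Integrable fun x : 𝕏 =>
      u x ^ 2 * (|rieszPart d s k (x i - x j)| * 𝐆 x) := fun j hj =>
    integrable_sq_mul_abs hu.continuous (integrable_rieszPart_gibbsCont hp (ne_of_mem_erase hj).symm k)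
  have hIl := integrable_sq_mul_abs hu.continuous (integrable_logGrad_gibbsCont hp i k)
  calc _ ≤ ∫ x, 2 * β * ∑ j ∈ univ.erase i, u x ^ 2 * (|rieszPart d s k (x i - x j)| * 𝐆 x) := by
        refine integral_mono hIl ((integrable_finsetSum _ hIj).const_mul _) fun x => ?_
        simp only
        rw [← mul_sum, ← sum_mul]
        have h1 : |𝐛 i k x| ≤ 2 * β * ∑ j ∈ univ.erase i, |rieszPart d s k (x i - x j)| := by
          rw [logGrad, abs_mul, abs_neg, abs_of_pos (by positivity)]
          gcongr; exact Finset.abs_sum_le_sum_abs _ _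
        have h2 := mul_le_mul_of_nonneg_right h1 (mul_nonneg (sq_nonneg (u x)) (hG0 x))
        linarith
    _ ≤ 2 * β * ∑ j ∈ univ.erase i, D * energyBound s σ u := by
        rw [integral_const_mul, integral_finsetSum _ hIj]
        refine mul_le_mul_of_nonneg_left (sum_le_sum fun j hj => ?_) (by positivity)
        exact pairBound u hu k i j (ne_of_mem_erase hj).symm
    _ ≤ _ := by
        rw [sum_const, nsmul_eq_mul, mul_assoc (2 * β), mul_assoc (N : ℝ)]
        refine mul_le_mul_of_nonneg_left (mul_le_mul_of_nonneg_right ?_ (mul_nonneg hD0 hQ)) (by positivity)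
        exact card_univ_erase_le i

end

section

/-! ### The resolvent of a closed quadratic form -/

/-- A closed quadratic form `‖grad y‖²` on a Hilbert space `H`: the domain `D` is complete for the
graph norm and is mapped to a dense subspace of `H`. -/
structure ClosedForm (D H K : Type*) [NormedAddCommGroup D] [InnerProductSpace ℝ D]
    [NormedAddCommGroup H] [InnerProductSpace ℝ H] [NormedAddCommGroup K] [InnerProductSpace ℝ K] where
  ι : D →L[ℝ] H
  grad : D →L[ℝ] K
  inner_eq : ∀ x y : D, ⟪x, y⟫ = ⟪ι x, ι y⟫ + ⟪grad x, grad y⟫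
  dense : DenseRange ι

namespace ClosedForm

variable {D H K : Type*} [NormedAddCommGroup D] [InnerProductSpace ℝ D]
  [NormedAddCommGroup H] [InnerProductSpace ℝ H]
  [NormedAddCommGroup K] [InnerProductSpace ℝ K] (E : ClosedForm D H K)

/-- The bilinear form `l ⟪ι x, ι y⟫ + ⟪grad x, grad y⟫`. -/
def bilin (l : ℝ) : D →L[ℝ] D →L[ℝ] ℝ :=
  l • ((innerSL ℝ (E := H)).bilinearComp E.ι E.ι) + (innerSL ℝ (E := K)).bilinearComp E.grad E.grad

lemma bilin_apply (l : ℝ) (x y : D) :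
    E.bilin l x y = l * ⟪E.ι x, E.ι y⟫ + ⟪E.grad x, E.grad y⟫ := by
  simp [bilin]

lemma norm_sq_eq (x : D) : ‖x‖ ^ 2 = ‖E.ι x‖ ^ 2 + ‖E.grad x‖ ^ 2 := by
  rw [← real_inner_self_eq_norm_sq, E.inner_eq, real_inner_self_eq_norm_sq, real_inner_self_eq_norm_sq]

lemma isCoercive_bilin {l : ℝ} (hl : 0 < l) : IsCoercive (E.bilin l) := by
  refine ⟨min l 1, by positivity, fun x => ?_⟩
  rw [bilin_apply, real_inner_self_eq_norm_sq, real_inner_self_eq_norm_sq, mul_assoc, ← sq, E.norm_sq_eq]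
  have h1 := min_le_left l 1
  have h2 := min_le_right l 1
  nlinarith [sq_nonneg ‖E.grad x‖]

variable [CompleteSpace D] [CompleteSpace H]

open Classical in
/-- The solution operator of `l ⟪ι x, ι y⟫ + ⟪grad x, grad y⟫ = l ⟪F, ι y⟫`, for `l > 0`. -/
def J (l : ℝ) : H →L[ℝ] D := if hl : 0 < l then
    ((E.isCoercive_bilin hl).continuousLinearEquivOfBilin.symm : D →L[ℝ] D) ∘L
      (l • ContinuousLinearMap.adjoint E.ι)
  else 0

/-- The resolvent `l (l + L)⁻¹` of the operator `L` of the form. -/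
def P (l : ℝ) : H →L[ℝ] H := E.ι ∘L E.J l

/-- The Yosida approximation `l (1 - P l)` of the operator of the form. -/
def A (l : ℝ) : H →L[ℝ] H := l • (1 - E.P l)

lemma P_apply (l : ℝ) (F : H) : E.P l F = E.ι (E.J l F) := rfl

lemma A_apply (l : ℝ) (F : H) : E.A l F = l • (F - E.P l F) := rfl

variable {l m : ℝ}

lemma J_spec (hl : 0 < l) (F : H) (y : D) :
    l * ⟪E.P l F, E.ι y⟫ + ⟪E.grad (E.J l F), E.grad y⟫ = l * ⟪F, E.ι y⟫ := by
  rw [P_apply, ← bilin_apply, ← (E.isCoercive_bilin hl).continuousLinearEquivOfBilin_apply, J, dif_pos hl]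
  simp [inner_smul_left, ContinuousLinearMap.adjoint_inner_left]

lemma J_unique (hl : 0 < l) {F : H} {x : D}
    (h : ∀ y, l * ⟪E.ι x, E.ι y⟫ + ⟪E.grad x, E.grad y⟫ = l * ⟪F, E.ι y⟫) : x = E.J l F := by
  have h1 : ∀ y, E.bilin l (x - E.J l F) y = 0 := fun y => by
    have h2 := h y
    rw [← E.J_spec hl F y, P_apply, ← bilin_apply, ← bilin_apply] at h2
    rw [map_sub, sub_apply, h2, sub_self]
  obtain ⟨c, hc, hcoer⟩ := E.isCoercive_bilin hl
  have h3 := hcoer (x - E.J l F)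
  rw [h1] at h3
  have h4 : ‖x - E.J l F‖ = 0 := by
    by_contra h5
    have : 0 < ‖x - E.J l F‖ := lt_of_le_of_ne (norm_nonneg _) (Ne.symm h5)
    have : 0 < c * ‖x - E.J l F‖ * ‖x - E.J l F‖ := by positivity
    linarith
  exact sub_eq_zero.1 (norm_eq_zero.1 h4)

lemma inner_A (hl : 0 < l) (F : H) (y : D) :
    ⟪E.A l F, E.ι y⟫ = ⟪E.grad (E.J l F), E.grad y⟫ := by
  rw [A_apply, inner_smul_left, inner_sub_left]
  have := E.J_spec hl F y
  simp only [conj_trivial]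
  linarith

lemma inner_P_comm (hl : 0 < l) (F G : H) : ⟪F, E.P l G⟫ = ⟪E.P l F, G⟫ := by
  have h1 := E.J_spec hl F (E.J l G)
  have h2 := E.J_spec hl G (E.J l F)
  rw [← P_apply] at h1 h2
  rw [real_inner_comm, real_inner_comm (E.grad (E.J l F)), real_inner_comm (E.P l F) G] at h2
  have h3 : l * ⟪F, E.P l G⟫ = l * ⟪E.P l F, G⟫ := by linarith
  exact mul_left_cancel₀ hl.ne' h3

lemma norm_P_sq_le (hl : 0 < l) (F : H) : ‖E.P l F‖ ^ 2 ≤ ⟪F, E.P l F⟫ := by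
  have h1 := E.J_spec hl F (E.J l F)
  rw [← P_apply, real_inner_self_eq_norm_sq, real_inner_self_eq_norm_sq] at h1
  have := sq_nonneg ‖E.grad (E.J l F)‖
  have h2 : l * ‖E.P l F‖ ^ 2 ≤ l * ⟪F, E.P l F⟫ := by linarith
  exact le_of_mul_le_mul_left h2 hl

lemma norm_P_le (hl : 0 < l) (F : H) : ‖E.P l F‖ ≤ ‖F‖ := by
  have h1 := (E.norm_P_sq_le hl F).trans (real_inner_le_norm _ _)
  by_contra! h
  have h0 : 0 < ‖E.P l F‖ := (norm_nonneg _).trans_lt h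
  nlinarith

/-- The resolvent identity. -/
lemma J_eq (hl : 0 < l) (hm : 0 < m) (F : H) :
    E.J m F = E.J l ((m / l) • F + (1 - m / l) • E.P m F) := by
  refine E.J_unique hl fun y => ?_
  have h1 := E.J_spec hm F y
  rw [← P_apply, inner_add_left, inner_smul_left, inner_smul_left]
  simp only [conj_trivial]
  field_simp
  linarith

lemma P_eq (hl : 0 < l) (hm : 0 < m) (F : H) :
    E.P m F = (m / l) • E.P l F + (1 - m / l) • E.P l (E.P m F) := by
  conv_lhs => rw [P_apply, E.J_eq hl hm, ← P_apply, map_add, map_smul, map_smul]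

lemma P_comm (hl : 0 < l) (hm : 0 < m) : Commute (E.P l) (E.P m) := by
  by_cases h : m = l
  · rw [h]
  ext F
  have h1 : (1 - m / l) • (E.P l (E.P m F) - E.P m (E.P l F)) = 0 := by
    refine ext_inner_right ℝ fun G => ?_
    have h2 := congrArg (fun x => ⟪x, G⟫) (E.P_eq hl hm F)
    have h3 := congrArg (fun x => ⟪F, x⟫) (E.P_eq hl hm G)
    simp only [inner_add_left, inner_add_right, inner_smul_left, inner_smul_right, conj_trivial] at h2 h3
    rw [E.inner_P_comm hm, E.inner_P_comm hl, E.inner_P_comm hl, E.inner_P_comm hm] at h3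
    rw [inner_smul_left, inner_sub_left, inner_zero_left, conj_trivial]
    linarith
  have h4 : 1 - m / l ≠ 0 := by
    rw [sub_ne_zero]; intro h5
    rw [eq_div_iff hl.ne', one_mul] at h5
    exact h h5.symm
  exact sub_eq_zero.1 ((smul_eq_zero.1 h1).resolve_left h4)

/-- The resolvent reduces the form, and approximates the identity at a rate on the domain. -/
lemma J_ι_bounds (hl : 0 < l) (y : D) :
    ‖E.grad (E.J l (E.ι y))‖ ≤ ‖E.grad y‖ ∧ l * ‖E.P l (E.ι y) - E.ι y‖ ^ 2 ≤ ‖E.grad y‖ ^ 2 := by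
  have h1 := E.J_spec hl (E.ι y) (E.J l (E.ι y) - y)
  rw [map_sub, map_sub, ← P_apply, inner_sub_right (E.grad _), real_inner_self_eq_norm_sq] at h1
  have h2 : l * ⟪E.P l (E.ι y), E.P l (E.ι y) - E.ι y⟫ - l * ⟪E.ι y, E.P l (E.ι y) - E.ι y⟫
      = l * ‖E.P l (E.ι y) - E.ι y‖ ^ 2 := by
    rw [← mul_sub, ← inner_sub_left, real_inner_self_eq_norm_sq]
  have h3 := real_inner_le_norm (E.grad (E.J l (E.ι y))) (E.grad y)
  have h5 : ‖E.grad (E.J l (E.ι y))‖ ≤ ‖E.grad y‖ := by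
    by_contra! h
    have h0 : 0 < ‖E.grad (E.J l (E.ι y))‖ := (norm_nonneg _).trans_lt h
    nlinarith
  refine ⟨h5, ?_⟩
  nlinarith [norm_nonneg (E.grad y)]

lemma tendsto_P (F : H) : Tendsto (fun l => E.P l F) atTop (𝓝 F) := by
  rw [Metric.tendsto_atTop]
  intro ε hε
  obtain ⟨y, hy⟩ := E.dense.exists_dist_lt F (show 0 < ε / 3 by positivity)
  refine ⟨max 1 ((3 / ε) ^ 2 * (‖E.grad y‖ ^ 2 + 1)), fun l hl => ?_⟩
  have hl1 : 0 < l := lt_of_lt_of_le one_pos ((le_max_left _ _).trans hl)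
  have hl2 : (3 / ε) ^ 2 * (‖E.grad y‖ ^ 2 + 1) ≤ l := (le_max_right _ _).trans hl
  have h1 := (E.J_ι_bounds hl1 y).2
  have h2 : ‖E.P l (E.ι y) - E.ι y‖ < ε / 3 := by
    by_contra! h
    have h3 : (ε / 3) ^ 2 ≤ ‖E.P l (E.ι y) - E.ι y‖ ^ 2 := pow_le_pow_left₀ (by positivity) h 2
    have h4 : l * (ε / 3) ^ 2 ≤ ‖E.grad y‖ ^ 2 := (mul_le_mul_of_nonneg_left h3 hl1.le).trans h1
    have h5 : (3 / ε) ^ 2 * (‖E.grad y‖ ^ 2 + 1) * (ε / 3) ^ 2 ≤ l * (ε / 3) ^ 2 :=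
      mul_le_mul_of_nonneg_right hl2 (by positivity)
    have h6 : (3 / ε) ^ 2 * (‖E.grad y‖ ^ 2 + 1) * (ε / 3) ^ 2 = ‖E.grad y‖ ^ 2 + 1 := by
      field_simp
    linarith
  have h3 : ‖E.P l (F - E.ι y)‖ < ε / 3 := by
    refine (E.norm_P_le hl1 _).trans_lt ?_
    rwa [← dist_eq_norm]
  rw [dist_eq_norm]
  have e1 : E.P l F - F = E.P l (F - E.ι y) + (E.P l (E.ι y) - E.ι y) + (E.ι y - F) := by
    rw [map_sub]; abel
  rw [e1]
  have h4 : ‖E.ι y - F‖ < ε / 3 := by rw [← dist_eq_norm, dist_comm]; exact hy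
  calc _ ≤ ‖E.P l (F - E.ι y)‖ + ‖E.P l (E.ι y) - E.ι y‖ + ‖E.ι y - F‖ := norm_add₃_le
    _ < ε := by linarith

lemma denseRange_P_one : DenseRange (E.P 1) := fun F => by
  refine mem_closure_of_tendsto (E.tendsto_P F) ?_
  filter_upwards [eventually_gt_atTop 0] with l hl
  refine ⟨l • F + (1 - l) • E.P l F, ?_⟩
  have := E.P_eq one_pos hl F
  rw [div_one] at this
  rw [map_add, map_smul, map_smul, ← this]

lemma A_P_one (hl : 0 < l) (w : H) : E.A l (E.P 1 w) = E.P l (w - E.P 1 w) := by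
  have h := congrArg (fun x => l • x) (E.P_eq hl one_pos w)
  simp only [smul_add, smul_smul] at h
  rw [mul_one_div_cancel hl.ne', one_smul, mul_sub, mul_one, mul_one_div_cancel hl.ne', sub_smul, one_smul] at h
  rw [A_apply, smul_sub, h, map_sub]; abel

lemma A_comm (hl : 0 < l) (hm : 0 < m) : Commute (E.A l) (E.A m) := by
  unfold A
  have h := E.P_comm hl hm
  exact (((Commute.one_left _).sub_left ((Commute.one_right _).sub_right h)).smul_left l).smul_right m

/-! ### The approximating semigroups -/

/-- The semigroup `exp (-t A_l)` of the Yosida approximation. -/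
def T (l t : ℝ) : H →L[ℝ] H := NormedSpace.exp ((-t) • E.A l)

lemma T_zero (l : ℝ) (F : H) : E.T l 0 F = F := by simp [T]

lemma hasDerivAt_T (l t : ℝ) (F : H) : HasDerivAt (fun t => E.T l t F) (-E.A l (E.T l t F)) t := by
  have h1 := hasDerivAt_exp_smul_const' (E.A l) (-t)
  have h2 := h1.scomp t (hasDerivAt_neg t)
  have h3 := (ContinuousLinearMap.apply ℝ H F).hasFDerivAt.comp_hasDerivAt t h2
  refine h3.congr_deriv ?_
  simp [T]

lemma T_eq (l t : ℝ) : E.T l t = exp (-(t * l)) • NormedSpace.exp ((t * l) • E.P l) := by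
  let _ : NormedAlgebra ℚ (H →L[ℝ] H) := NormedAlgebra.restrictScalars ℚ ℝ (H →L[ℝ] H)
  have h1 : (-t) • E.A l = (-(t * l)) • (1 : H →L[ℝ] H) + (t * l) • E.P l := by
    rw [A, smul_smul, smul_sub, neg_mul, neg_smul, neg_smul, sub_neg_eq_add]
  have hc : Commute ((-(t * l)) • (1 : H →L[ℝ] H)) ((t * l) • E.P l) :=
    ((Commute.one_left _).smul_left _).smul_right _
  rw [T, h1, NormedSpace.exp_add_of_commute hc]
  have h2 : NormedSpace.exp ((-(t * l)) • (1 : H →L[ℝ] H)) = exp (-(t * l)) • (1 : H →L[ℝ] H) := by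
    rw [← Algebra.algebraMap_eq_smul_one, ← Algebra.algebraMap_eq_smul_one, Real.exp_eq_exp_ℝ]
    exact (NormedSpace.algebraMap_exp_comm _).symm
  rw [h2, smul_mul_assoc, one_mul]

/-- The exponential series of the approximating semigroup in the powers of the resolvent. -/
lemma hasSum_T (l t : ℝ) (F : H) :
    HasSum (fun n : ℕ => (exp (-(t * l)) * ((t * l) ^ n / n.factorial)) • (E.P l ^ n) F) (E.T l t F) := by
  have h1 := NormedSpace.exp_series_hasSum_exp' (𝕂 := ℝ) ((t * l) • E.P l)
  have h2 := ((ContinuousLinearMap.apply ℝ H F).hasSum h1).const_smul (exp (-(t * l)))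
  have h3 : ∀ n : ℕ, exp (-(t * l)) • (ContinuousLinearMap.apply ℝ H F)
      (((n.factorial : ℝ)⁻¹) • ((t * l) • E.P l) ^ n)
      = (exp (-(t * l)) * ((t * l) ^ n / n.factorial)) • (E.P l ^ n) F := fun n => by
    rw [ContinuousLinearMap.apply_apply, smul_pow, smul_smul, smul_apply, smul_smul]
    congr 1; ring
  rw [T_eq]
  simp only [h3] at h2
  exact h2

lemma norm_T_le (hl : 0 < l) {t : ℝ} (ht : 0 ≤ t) (F : H) : ‖E.T l t F‖ ≤ ‖F‖ := by
  have h1 : HasSum (fun n : ℕ => exp (-(t * l)) * ((t * l) ^ n / n.factorial) * ‖F‖) ‖F‖ := by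
    have h2 := NormedSpace.expSeries_div_hasSum_exp (t * l)
    rw [← Real.exp_eq_exp_ℝ] at h2
    have h3 := (h2.mul_left (exp (-(t * l)))).mul_right ‖F‖
    rwa [← exp_add, neg_add_cancel, Real.exp_zero, one_mul] at h3
  have hP : ∀ n : ℕ, ‖(E.P l ^ n) F‖ ≤ ‖F‖ := fun n => by
    induction n with
    | zero => simp
    | succ n ih =>
      rw [pow_succ']
      exact (E.norm_P_le hl _).trans ih
  refine (E.hasSum_T l t F).norm_le_of_bounded h1 fun n => ?_
  have h0 : 0 ≤ exp (-(t * l)) * ((t * l) ^ n / n.factorial) := by positivity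
  rw [norm_smul, norm_of_nonneg h0]
  gcongr; exact hP n

/-- A bounded operator commuting with `A` commutes with the semigroup. -/
lemma T_comm {B : H →L[ℝ] H} (h : Commute (E.A l) B) (t : ℝ) : Commute (E.T l t) B := by
  unfold T
  let _ : NormedAlgebra ℚ (H →L[ℝ] H) := NormedAlgebra.restrictScalars ℚ ℝ (H →L[ℝ] H)
  exact (h.smul_left (-t)).exp_left

lemma P_comm_A (hl : 0 < l) (hm : 0 < m) : Commute (E.A l) (E.P m) :=
  ((Commute.one_left _).sub_left (E.P_comm hl hm)).smul_left l

/-- Two approximating semigroups differ by no more than their generators. -/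
lemma norm_T_sub_le (hl : 0 < l) (hm : 0 < m) {t : ℝ} (ht : 0 ≤ t) (F : H) :
    ‖E.T l t F - E.T m t F‖ ≤ t * ‖E.A l F - E.A m F‖ := by
  have hder : ∀ r ∈ Icc 0 t, HasDerivWithinAt (fun r => E.T l r (E.T m (t - r) F))
      (E.T l r (E.T m (t - r) (E.A m F - E.A l F))) (Icc 0 t) r := fun r _ => by
    have h1 : HasDerivAt (fun r : ℝ => E.T m (t - r) F) (E.A m (E.T m (t - r) F)) r := by
      have := (E.hasDerivAt_T m (t - r) F).scomp r ((hasDerivAt_id r).const_sub t)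
      simpa [Function.comp_def] using this
    have h2 : HasDerivAt (fun r : ℝ => E.T l r) (-(E.A l * E.T l r)) r := by
      have h3 := hasDerivAt_exp_smul_const' (E.A l) (-r)
      refine (h3.scomp r (hasDerivAt_neg r)).congr_deriv ?_
      simp [T]
    have h3 := h2.clm_apply h1
    refine (h3.congr_deriv ?_).hasDerivWithinAt
    have c1 : ∀ G : H, E.A l (E.T l r G) = E.T l r (E.A l G) := fun G =>
      congrArg (fun B : H →L[ℝ] H => B G) (E.T_comm (Commute.refl (E.A l)) r).eq.symm
    have c2 : E.A m (E.T m (t - r) F) = E.T m (t - r) (E.A m F) :=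
      congrArg (fun B : H →L[ℝ] H => B F) (E.T_comm (Commute.refl (E.A m)) (t - r)).eq.symm
    have c3 : E.A l (E.T m (t - r) F) = E.T m (t - r) (E.A l F) :=
      congrArg (fun B : H →L[ℝ] H => B F) (E.T_comm (E.A_comm hm hl) (t - r)).eq.symm
    rw [neg_apply, mul_apply_eq_comp, c1, c2, c3, map_sub, map_sub]; abel
  have h := (convex_Icc 0 t).norm_image_sub_le_of_norm_hasDerivWithin_le
    (C := ‖E.A l F - E.A m F‖) hder (fun r hr => by
      refine (E.norm_T_le hl hr.1 _).trans ((E.norm_T_le hm (by linarith [hr.2]) _).trans ?_)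
      rw [norm_sub_rev]) (left_mem_Icc.2 ht) (right_mem_Icc.2 ht)
  simp only [sub_self, sub_zero, T_zero, norm_of_nonneg ht] at h
  linarith

/-- The approximating semigroups converge, locally uniformly in time. -/
lemma exists_norm_T_sub_lt (F : H) {S ε : ℝ} (hε : 0 < ε) : ∃ M : ℝ, ∀ l m t : ℝ, M ≤ l → M ≤ m →
    0 ≤ t → t ≤ S → ‖E.T l t F - E.T m t F‖ < ε := by
  obtain ⟨w, hw⟩ := E.denseRange_P_one.exists_dist_lt F (show 0 < ε / 3 by positivity)
  have h1 : Tendsto (fun l => E.A l (E.P 1 w)) atTop (𝓝 (w - E.P 1 w)) := by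
    refine (E.tendsto_P (w - E.P 1 w)).congr' ?_
    filter_upwards [eventually_gt_atTop 0] with l hl
    exact (E.A_P_one hl w).symm
  rw [Metric.tendsto_atTop] at h1
  have hδ : 0 < ε / (6 * (|S| + 1)) := by positivity
  obtain ⟨M, hM⟩ := h1 _ hδ
  refine ⟨max M 1, fun l m t hl hm ht htS => ?_⟩
  have hl0 : 0 < l := lt_of_lt_of_le one_pos ((le_max_right _ _).trans hl)
  have hm0 : 0 < m := lt_of_lt_of_le one_pos ((le_max_right _ _).trans hm)
  have h2 := hM l ((le_max_left _ _).trans hl)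
  have h3 := hM m ((le_max_left _ _).trans hm)
  have h4 : ‖E.A l (E.P 1 w) - E.A m (E.P 1 w)‖ ≤ ε / (3 * (|S| + 1)) := by
    rw [← dist_eq_norm]
    refine (dist_triangle_right _ _ (w - E.P 1 w)).trans ?_
    have : ε / (3 * (|S| + 1)) = ε / (6 * (|S| + 1)) + ε / (6 * (|S| + 1)) := by field_simp; ring
    linarith
  have h5 : t * ‖E.A l (E.P 1 w) - E.A m (E.P 1 w)‖ ≤ ε / 3 := by
    have h6 : t ≤ |S| + 1 := by linarith [le_abs_self S]
    calc _ ≤ (|S| + 1) * (ε / (3 * (|S| + 1))) := mul_le_mul h6 h4 (norm_nonneg _) (by positivity)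
      _ = ε / 3 := by field_simp
  have h7 := E.norm_T_sub_le hl0 hm0 ht (E.P 1 w)
  have h8 := E.norm_T_le hl0 ht (F - E.P 1 w)
  have h9 := E.norm_T_le hm0 ht (E.P 1 w - F)
  rw [dist_eq_norm] at hw
  rw [norm_sub_rev (E.P 1 w) F] at h9
  have e1 : E.T l t F - E.T m t F = E.T l t (F - E.P 1 w) + (E.T l t (E.P 1 w) - E.T m t (E.P 1 w))
      + E.T m t (E.P 1 w - F) := by rw [map_sub, map_sub]; abel
  rw [e1]
  calc _ ≤ _ := norm_add₃_le
    _ < ε := by linarith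

/-! ### Recovering an element of the domain from its resolvents -/

lemma norm_grad_J_sub_sq_le (hm : 0 < m) (hml : m ≤ l) (z : H) :
    ‖E.grad (E.J l z) - E.grad (E.J m z)‖ ^ 2 ≤ ‖E.grad (E.J l z)‖ ^ 2 - ‖E.grad (E.J m z)‖ ^ 2 := by
  have hl : 0 < l := hm.trans_le hml
  set p := z - E.P m z with hp
  set q := z - E.P l z with hq
  have e1 : ∀ y, ⟪E.grad (E.J m z), E.grad y⟫ = m * ⟪p, E.ι y⟫ := fun y => by
    rw [← E.inner_A hm, A_apply, inner_smul_left]; simp [hp]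
  have e2 : ∀ y, ⟪E.grad (E.J l z), E.grad y⟫ = l * ⟪q, E.ι y⟫ := fun y => by
    rw [← E.inner_A hl, A_apply, inner_smul_left]; simp [hq]
  have e3 : E.ι (E.J l z - E.J m z) = p - q := by
    rw [map_sub, ← P_apply, ← P_apply, hp, hq]; abel
  have h1 := e1 (E.J l z - E.J m z)
  have h2 := e2 (E.J l z - E.J m z)
  rw [e3, map_sub, inner_sub_right, inner_sub_right] at h1 h2
  rw [real_inner_self_eq_norm_sq, real_inner_self_eq_norm_sq] at h1
  rw [real_inner_self_eq_norm_sq, real_inner_self_eq_norm_sq, real_inner_comm p q] at h2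
  rw [real_inner_comm (E.grad (E.J l z))] at h1
  have h3 : 0 ≤ ‖E.grad (E.J l z) - E.grad (E.J m z)‖ ^ 2 := sq_nonneg _
  rw [norm_sub_sq_real] at h3 ⊢
  have h4 := real_inner_le_norm p q
  have hq0 := norm_nonneg q
  -- the distance to the resolvent decreases
  have h5 : ‖q‖ ≤ ‖p‖ := by
    by_contra! h
    have h6 : (‖p‖ - ‖q‖) * (l * ‖q‖ - m * ‖p‖) ≥ 0 := by nlinarith
    have h7 : m * ‖p‖ < l * ‖q‖ := by nlinarith
    nlinarith
  have h6 : ⟪p, q⟫ ≤ ‖p‖ ^ 2 := by nlinarith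
  have h7 : 0 ≤ m * (‖p‖ ^ 2 - ⟪p, q⟫) := mul_nonneg hm.le (by linarith)
  linarith

/-- If the resolvents of `z` have bounded energy, they converge to an element of the domain. -/
lemma exists_tendsto_grad_J {z : H} {C : ℝ} (h : ∀ n : ℕ, ‖E.grad (E.J (n + 1) z)‖ ^ 2 ≤ C) :
    ∃ y : D, E.ι y = z ∧ Tendsto (fun n : ℕ => E.J (n + 1) z) atTop (𝓝 y) ∧
      ‖E.grad y‖ ^ 2 ≤ C ∧ ∀ n : ℕ, ‖E.grad (E.J (n + 1) z)‖ ^ 2 ≤ ‖E.grad y‖ ^ 2 := by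
  set a : ℕ → ℝ := fun n => ‖E.grad (E.J (n + 1) z)‖ ^ 2 with ha
  have hpos : ∀ n : ℕ, (0 : ℝ) < n + 1 := fun n => by positivity
  have hsub : ∀ m n : ℕ, m ≤ n → ‖E.grad (E.J (n + 1) z) - E.grad (E.J (m + 1) z)‖ ^ 2 ≤ a n - a m :=
    fun m n hmn => E.norm_grad_J_sub_sq_le (hpos m) (by gcongr) z
  have hmono : Monotone a := fun m n hmn => by
    have := (sq_nonneg _).trans (hsub m n hmn); linarith
  have hconv : Tendsto a atTop (𝓝 (⨆ n, a n)) :=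
    tendsto_atTop_ciSup hmono ⟨C, by rintro _ ⟨n, rfl⟩; exact h n⟩
  have hP : Tendsto (fun n : ℕ => E.P (n + 1) z) atTop (𝓝 z) :=
    (E.tendsto_P z).comp (tendsto_atTop_add_const_right _ _ tendsto_natCast_atTop_atTop)
  -- energies increase and are bounded, so the gradients form a Cauchy sequence
  have hcauchy : CauchySeq (fun n : ℕ => E.J (n + 1) z) := by
    have hca := hconv.cauchySeq
    have hcp := hP.cauchySeq
    rw [Metric.cauchySeq_iff'] at hca hcp ⊢
    intro ε hε
    obtain ⟨n₁, h₁⟩ := hca (ε ^ 2 / 4) (by positivity)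
    obtain ⟨n₂, h₂⟩ := Metric.cauchySeq_iff.1 hP.cauchySeq (ε / 2) (by positivity)
    refine ⟨max n₁ n₂, fun n hn => ?_⟩
    have h3 := hsub _ _ hn
    have h4 : a n - a (max n₁ n₂) ≤ ε ^ 2 / 4 := by
      have h5 := h₁ n ((le_max_left _ _).trans hn)
      have h6 := hmono (le_max_left n₁ n₂)
      rw [dist_eq] at h5
      have := (abs_lt.1 h5).2
      linarith
    have h5 := h₂ n ((le_max_right _ _).trans hn) (max n₁ n₂) (le_max_right _ _)
    rw [dist_eq_norm] at h5 ⊢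
    have h6 := E.norm_sq_eq (E.J (n + 1) z - E.J ((max n₁ n₂ : ℕ) + 1) z)
    rw [map_sub, map_sub, ← P_apply, ← P_apply] at h6
    have h7 : ‖E.P (n + 1) z - E.P ((max n₁ n₂ : ℕ) + 1) z‖ ^ 2 < (ε / 2) ^ 2 :=
      pow_lt_pow_left₀ h5 (norm_nonneg _) two_ne_zero
    refine lt_of_pow_lt_pow_left₀ 2 hε.le ?_
    rw [h6]
    nlinarith
  obtain ⟨y, hy⟩ := cauchySeq_tendsto_of_complete hcauchy
  have hgrad : Tendsto a atTop (𝓝 (‖E.grad y‖ ^ 2)) := (((E.grad.continuous.tendsto y).comp hy).norm).pow 2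
  refine ⟨y, ?_, hy, le_of_tendsto' hgrad h, fun n => hmono.ge_of_tendsto hgrad n⟩
  exact tendsto_nhds_unique ((E.ι.continuous.tendsto y).comp hy) hP

end ClosedForm

end

section

/-! ### The Dirichlet form of the Gibbs measure -/

variable {X : Type*} [MeasurableSpace X] {μ : Measure X}

lemma L2.inner_eq_integral (F G : Lp ℝ 2 μ) :
    ⟪F, G⟫ = ∫ x, F x * G x ∂μ := by
  rw [MeasureTheory.L2.inner_def]
  exact integral_congr_ae (.of_forall fun x => by simp [mul_comm])

lemma L2.norm_sq_eq_integral (F : Lp ℝ 2 μ) :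
    ‖F‖ ^ 2 = ∫ x, F x ^ 2 ∂μ := by
  rw [← real_inner_self_eq_norm_sq, L2.inner_eq_integral]
  simp only [sq]

lemma L2.integrable_mul (F G : Lp ℝ 2 μ) :
    Integrable (fun x => F x * G x) μ := by
  refine (MeasureTheory.L2.integrable_inner F G).congr (.of_forall fun x => ?_)
  simp [mul_comm]

lemma L2.integrable_sq (F : Lp ℝ 2 μ) :
    Integrable (fun x => F x ^ 2) μ := by simpa only [sq] using L2.integrable_mul F F

/-- Convergence in `L²` of square integrable functions implies convergence of the integrals of
products with a bounded weight. -/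
lemma tendsto_integral_mul_mul {u v : ℕ → X → ℝ}
    {U V : X → ℝ} (hu : ∀ n, MemLp (u n) 2 μ) (hv : ∀ n, MemLp (v n) 2 μ) (hU : MemLp U 2 μ)
    (hV : MemLp V 2 μ) (h1 : Tendsto (fun n => eLpNorm (u n - U) 2 μ) atTop (𝓝 0))
    (h2 : Tendsto (fun n => eLpNorm (v n - V) 2 μ) atTop (𝓝 0)) {g : X → ℝ}
    (hg : AEStronglyMeasurable g μ) {B : ℝ} (hB : ∀ x, |g x| ≤ B) :
    Tendsto (fun n => ∫ x, u n x * v n x * g x ∂μ) atTop (𝓝 (∫ x, U x * V x * g x ∂μ)) := by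
  have hgv : ∀ w : X → ℝ, MemLp w 2 μ → MemLp (fun x => w x * g x) 2 μ := fun w hw => by
    refine (hw.const_mul B).of_le (hw.1.mul hg) (.of_forall fun x => ?_)
    rw [norm_mul, norm_mul, mul_comm, norm_eq_abs (g x), norm_eq_abs B]
    exact mul_le_mul_of_nonneg_right ((hB x).trans (le_abs_self B)) (norm_nonneg _)
  have t1 : Tendsto (fun n => (hu n).toLp (u n)) atTop (𝓝 (hU.toLp U)) :=
    (Lp.tendsto_Lp_iff_tendsto_eLpNorm'' _ hu _ hU).2 h1
  have t2 : Tendsto (fun n => (hgv _ (hv n)).toLp _) atTop (𝓝 ((hgv _ hV).toLp _)) := by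
    refine (Lp.tendsto_Lp_iff_tendsto_eLpNorm'' _ (fun n => hgv _ (hv n)) _ (hgv _ hV)).2 ?_
    have h3 : Tendsto (fun n => ofReal |B| * eLpNorm (v n - V) 2 μ) atTop (𝓝 0) := by
      have := ENNReal.Tendsto.const_mul (a := ofReal |B|) h2 (Or.inr ofReal_ne_top)
      rwa [mul_zero] at this
    refine tendsto_of_tendsto_of_tendsto_of_le_of_le tendsto_const_nhds h3 (fun _ => zero_le) fun n => ?_
    refine eLpNorm_le_mul_eLpNorm_of_ae_le_mul (.of_forall fun x => ?_) 2
    simp only [Pi.sub_apply]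
    rw [← sub_mul, norm_mul, mul_comm, norm_eq_abs (g x)]
    exact mul_le_mul_of_nonneg_right ((hB x).trans (le_abs_self B)) (norm_nonneg _)
  have h4 := t1.inner (𝕜 := ℝ) t2
  have e : ∀ (a b : X → ℝ) (ha : MemLp a 2 μ) (hb : MemLp b 2 μ),
      ⟪ha.toLp a, (hgv b hb).toLp _⟫ = ∫ x, a x * b x * g x ∂μ := fun a b ha hb => by
    rw [L2.inner_eq_integral]
    refine integral_congr_ae ?_
    filter_upwards [ha.coeFn_toLp, (hgv b hb).coeFn_toLp] with x h5 h6
    rw [h5, h6, mul_assoc]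
  have h5 := h4.congr fun n => e _ _ (hu n) (hv n)
  rwa [e _ _ hU hV] at h5

variable {N d : ℕ} {s σ : ℝ}
local notation "𝕏" => TorusConfig N d
local notation "𝐛" => logGrad s σ

/-- The (unnormalized) Gibbs measure. -/
def gibbsMeasure (N d : ℕ) (s σ : ℝ) : Measure (TorusConfig N d) :=
  volume.withDensity fun x => ofReal (gibbsCont s σ x)

local notation "𝔪" => gibbsMeasure N d s σ

lemma gibbsMeasure_ac : 𝔪 ≪ volume := withDensity_absolutelyContinuous _ _

/-- The Gibbs measure weighted with the modulus of the interaction force. -/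
def forceMeasure (N d : ℕ) (s σ : ℝ) (i : Fin N) (k : Fin d) : Measure (TorusConfig N d) :=
  (gibbsMeasure N d s σ).withDensity fun x => ofReal |logGrad s σ i k x|

lemma forceMeasure_ac (i : Fin N) (k : Fin d) : forceMeasure N d s σ i k ≪ 𝔪 :=
  withDensity_absolutelyContinuous _ _

/-- The continuously differentiable functions, as a subalgebra of the continuous ones. -/
def smoothSubalgebra (N d : ℕ) : Subalgebra ℝ C(TorusConfig N d, ℝ) where
  carrier := {u | IsC1 u}
  mul_mem' hu hv := hu.mul hv
  add_mem' hu hv := hu.add hv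
  algebraMap_mem' c := isC1_const c

lemma separatesPoints_smoothSubalgebra : (smoothSubalgebra N d).SeparatesPoints := fun x y hxy => by
  obtain ⟨i, k, h⟩ : ∃ i k, x i k ≠ y i k := by
    by_contra! h; exact hxy (funext fun i => funext fun k => h i k)
  have hs : IsC1 (fun x : 𝕏 => circleSin (x i k)) := isC1_of_lift (by
    simp only [configMk, circleSin_coe]; fun_prop)
  have hc : IsC1 (fun x : 𝕏 => circleCos (x i k)) := isC1_of_lift (by
    simp only [configMk, circleCos_coe]; fun_prop)
  by_contra! hcon
  have h1 := hcon _ ⟨⟨_, hs.continuous⟩, hs, rfl⟩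
  have h2 := hcon _ ⟨⟨_, hc.continuous⟩, hc, rfl⟩
  refine h ?_
  simp only [ContinuousMap.coe_mk] at h1 h2
  revert h1 h2
  induction x i k using induction_on with | H a =>
  induction y i k using induction_on with | H b =>
  intro h1 h2
  have h3 : (2 * π * a : Real.Angle) = (2 * π * b : ℝ) := Real.Angle.cos_sin_inj h2 h1
  rw [Real.Angle.angle_eq_iff_two_pi_dvd_sub] at h3
  obtain ⟨n, hn⟩ := h3
  have h4 : a - b = n := by
    have : 2 * π * (a - b) = 2 * π * n := by linarith
    exact mul_left_cancel₀ (by positivity) this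
  change (a : 𝕊) = (b : 𝕊)
  rw [← sub_eq_zero, ← AddCircle.coe_sub, h4, AddCircle.coe_eq_zero_iff]
  exact ⟨n, by simp⟩

variable [hp : Fact (Admissible N d s σ)]

lemma measurable_gibbsCont : Measurable (gibbsCont (N := N) (d := d) s σ) :=
  (continuous_gibbsCont hp.out).measurable

instance isFiniteMeasure_gibbsMeasure : IsFiniteMeasure 𝔪 := by
  refine isFiniteMeasure_withDensity_ofReal ?_
  exact (integrable_of_continuous (continuous_gibbsCont hp.out)).2

lemma ac_gibbsMeasure : (volume : Measure 𝕏) ≪ 𝔪 := by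
  refine withDensity_absolutelyContinuous' measurable_gibbsCont.ennreal_ofReal.aemeasurable ?_
  filter_upwards [ae_notMem_collisions hp.out.one_le_d] with x hx
  exact (ENNReal.ofReal_pos.2 (gibbsCont_pos hx)).ne'

lemma ae_gibbsMeasure_iff {p : 𝕏 → Prop} :
    (∀ᵐ x ∂𝔪, p x) ↔ ∀ᵐ x, p x :=
  ⟨fun h => ac_gibbsMeasure.ae_le h, fun h => gibbsMeasure_ac.ae_le h⟩

lemma integral_gibbsMeasure (f : 𝕏 → ℝ) :
    ∫ x, f x ∂𝔪 = ∫ x, f x * gibbsCont s σ x := by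
  rw [gibbsMeasure, integral_withDensity_eq_integral_toReal_smul measurable_gibbsCont.ennreal_ofReal
    (.of_forall fun x => ofReal_lt_top)]
  refine integral_congr_ae (.of_forall fun x => ?_)
  simp only [toReal_ofReal (gibbsCont_nonneg _ _ _), smul_eq_mul]; ring

lemma integrable_gibbsMeasure_iff {f : 𝕏 → ℝ} :
    Integrable f 𝔪 ↔ Integrable fun x => f x * gibbsCont s σ x := by
  rw [gibbsMeasure, integrable_withDensity_iff measurable_gibbsCont.ennreal_ofReal
    (.of_forall fun x => ofReal_lt_top)]
  simp only [toReal_ofReal (gibbsCont_nonneg _ _ _)]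

lemma integrable_logGrad (i : Fin N) (k : Fin d) :
    Integrable (𝐛 i k) 𝔪 :=
  integrable_gibbsMeasure_iff.2 (integrable_logGrad_gibbsCont hp.out i k)

lemma integral_forceMeasure (i : Fin N) (k : Fin d) (f : 𝕏 → ℝ) :
    ∫ x, f x ∂(forceMeasure N d s σ i k) = ∫ x, f x * |𝐛 i k x| ∂𝔪 := by
  have hm : Measurable fun x => ofReal |logGrad s σ i k x| := by
    have := measurable_logGrad hp.out i k
    fun_prop
  rw [forceMeasure, integral_withDensity_eq_integral_toReal_smul hm (.of_forall fun x => ofReal_lt_top)]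
  refine integral_congr_ae (.of_forall fun x => ?_)
  simp only [toReal_ofReal (abs_nonneg _), smul_eq_mul]; ring

lemma integrable_forceMeasure_iff {i : Fin N} {k : Fin d} {f : 𝕏 → ℝ} :
    Integrable f (forceMeasure N d s σ i k) ↔ Integrable (fun x => f x * |𝐛 i k x|) 𝔪 := by
  have hm : Measurable fun x => ofReal |logGrad s σ i k x| := by
    have := measurable_logGrad hp.out i k
    fun_prop
  rw [forceMeasure, integrable_withDensity_iff hm (.of_forall fun x => ofReal_lt_top)]
  simp only [toReal_ofReal (abs_nonneg _)]

instance (i : Fin N) (k : Fin d) : IsFiniteMeasure (forceMeasure N d s σ i k) :=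
  isFiniteMeasure_withDensity_ofReal (integrable_logGrad i k).abs.2

lemma memLp_of_continuous {u : 𝕏 → ℝ} (hu : Continuous u)
    (μ : Measure 𝕏) [IsFiniteMeasure μ] : MemLp u 2 μ := by
  obtain ⟨B, hB⟩ := exists_abs_le_of_continuous hu
  exact MemLp.of_bound hu.aestronglyMeasurable B (.of_forall hB)

/-- Square integrable functions for the Gibbs measure. -/
abbrev GibbsL2 (N d : ℕ) (s σ : ℝ) : Type := Lp ℝ 2 (gibbsMeasure N d s σ)

/-- Pairs of a function (the component `none`) and a vector field, square integrable for the Gibbs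
measure. -/
abbrev GibbsPair (N d : ℕ) (s σ : ℝ) : Type := PiLp 2 fun _ : Option (Fin N × Fin d) => GibbsL2 N d s σ

/-- Square integrable vector fields for the Gibbs measure. -/
abbrev GibbsField (N d : ℕ) (s σ : ℝ) : Type := PiLp 2 fun _ : Fin N × Fin d => GibbsL2 N d s σ

/-- The graph of the gradient on continuously differentiable functions. -/
def smoothGraph (N d : ℕ) (s σ : ℝ) [Fact (Admissible N d s σ)] : Submodule ℝ (GibbsPair N d s σ) where
  carrier := {y | ∃ u : TorusConfig N d → ℝ, IsC1 u ∧ y none =ᵐ[gibbsMeasure N d s σ] u ∧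
    ∀ p : Fin N × Fin d, y (some p) =ᵐ[gibbsMeasure N d s σ] 𝐃 p.1 p.2 u}
  zero_mem' := ⟨fun _ => 0, isC1_const 0, Lp.coeFn_zero _ _ _, fun p => by
    refine (Lp.coeFn_zero _ _ _).trans (.of_forall fun x => ?_)
    exact (configPartial_eq (hasDerivAt_const _ _)).symm⟩
  add_mem' := by
    rintro a b ⟨u, hu, hu1, hu2⟩ ⟨v, hv, hv1, hv2⟩
    refine ⟨_, hu.add hv, (Lp.coeFn_add _ _).trans (hu1.add hv1), fun p => ?_⟩
    refine (Lp.coeFn_add _ _).trans (((hu2 p).add (hv2 p)).trans (.of_forall fun x => ?_))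
    exact (configPartial_eq (hu.hasDerivAt_add hv p.1 p.2 x)).symm
  smul_mem' := by
    rintro c a ⟨u, hu, hu1, hu2⟩
    refine ⟨_, hu.const_mul c, (Lp.coeFn_smul _ _).trans (hu1.const_smul c), fun p => ?_⟩
    refine (Lp.coeFn_smul _ _).trans (((hu2 p).const_smul c).trans (.of_forall fun x => ?_))
    exact (configPartial_eq ((hu.hasDerivAt p.1 p.2 x).const_mul c)).symm

/-- The domain of the closed Dirichlet form, as a space of pairs of a function and its gradient. -/
abbrev FormDomain (N d : ℕ) (s σ : ℝ) [Fact (Admissible N d s σ)] : Type :=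
  (smoothGraph N d s σ).topologicalClosure

instance : CompleteSpace (FormDomain N d s σ) :=
  (smoothGraph N d s σ).isClosed_topologicalClosure.completeSpace_coe

lemma exists_smoothGraph {u : 𝕏 → ℝ} (hu : IsC1 u) :
    ∃ y ∈ smoothGraph N d s σ, y none =ᵐ[𝔪] u ∧
      ∀ p : Fin N × Fin d, y (some p) =ᵐ[𝔪] 𝐃 p.1 p.2 u := by
  have h1 := memLp_of_continuous hu.continuous 𝔪
  have h2 := fun p : Fin N × Fin d => memLp_of_continuous (hu.continuous_partial p.1 p.2) 𝔪
  let y : GibbsPair N d s σ := WithLp.toLp 2 fun o => o.elim (h1.toLp u) fun p => (h2 p).toLp _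
  have hy1 : y none =ᵐ[𝔪] u := h1.coeFn_toLp
  have hy2 : ∀ p : Fin N × Fin d, y (some p) =ᵐ[𝔪] 𝐃 p.1 p.2 u := fun p => (h2 p).coeFn_toLp
  exact ⟨y, ⟨u, hu, hy1, hy2⟩, hy1, hy2⟩

/-- The function component of an element of the domain. -/
def domainFst (N d : ℕ) (s σ : ℝ) [Fact (Admissible N d s σ)] : FormDomain N d s σ →L[ℝ] GibbsL2 N d s σ :=
  (PiLp.proj (𝕜 := ℝ) 2 (fun _ : Option (Fin N × Fin d) => GibbsL2 N d s σ) none) ∘L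
    (smoothGraph N d s σ).topologicalClosure.subtypeL

/-- The gradient component of an element of the domain. -/
def domainGrad (N d : ℕ) (s σ : ℝ) [Fact (Admissible N d s σ)] :
    FormDomain N d s σ →L[ℝ] GibbsField N d s σ :=
  ((PiLp.continuousLinearEquiv 2 ℝ (fun _ : Fin N × Fin d => GibbsL2 N d s σ)).symm :
      ((_ : Fin N × Fin d) → GibbsL2 N d s σ) →L[ℝ] GibbsField N d s σ) ∘L
    (ContinuousLinearMap.pi fun p =>
      PiLp.proj (𝕜 := ℝ) 2 (fun _ : Option (Fin N × Fin d) => GibbsL2 N d s σ) (some p)) ∘L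
    (smoothGraph N d s σ).topologicalClosure.subtypeL

lemma denseRange_domainFst : DenseRange (domainFst N d s σ) := by
  have h1 : DenseRange (ContinuousMap.toLp 2 𝔪 ℝ) :=
    ContinuousMap.toLp_denseRange ℝ _ _ (by norm_num)
  have h2 : Dense ((smoothSubalgebra N d : Subalgebra ℝ C(𝕏, ℝ)) : Set C(𝕏, ℝ)) := fun f => by
    exact ContinuousMap.continuousMap_mem_subalgebra_closure_of_separatesPoints _
      separatesPoints_smoothSubalgebra f
  have h3 := h1.dense_image (ContinuousMap.toLp 2 𝔪 ℝ).continuous h2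
  refine h3.mono ?_
  rintro _ ⟨u, hu, rfl⟩
  obtain ⟨y, hy, hy1, -⟩ := exists_smoothGraph (s := s) (σ := σ) hu
  refine ⟨⟨y, (smoothGraph N d s σ).le_topologicalClosure hy⟩, ?_⟩
  refine Lp.ext (hy1.trans ?_)
  exact (ContinuousMap.coeFn_toLp 𝔪 u).symm

/-- The closed Dirichlet form of the Gibbs measure. -/
def dirichlet (N d : ℕ) (s σ : ℝ) [Fact (Admissible N d s σ)] :
    ClosedForm (FormDomain N d s σ) (GibbsL2 N d s σ) (GibbsField N d s σ) where
  ι := domainFst N d s σ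
  grad := domainGrad N d s σ
  inner_eq x y := by
    rw [Submodule.coe_inner, PiLp.inner_apply, Fintype.sum_option, PiLp.inner_apply]
    rfl
  dense := denseRange_domainFst

/-- Elements of the domain are limits of continuously differentiable functions with their
gradients. -/
lemma exists_seq_smooth (y : FormDomain N d s σ) : ∃ u : ℕ → 𝕏 → ℝ, (∀ n, IsC1 (u n)) ∧
    Tendsto (fun n => eLpNorm (u n - ⇑((dirichlet N d s σ).ι y)) 2 𝔪) atTop (𝓝 0) ∧
    ∀ p : Fin N × Fin d, Tendsto (fun n => eLpNorm (𝐃 p.1 p.2 (u n)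
      - ⇑((dirichlet N d s σ).grad y p)) 2 𝔪) atTop (𝓝 0) := by
  obtain ⟨z, hz, hlim⟩ := mem_closure_iff_seq_limit.1 y.2
  choose u hu hu1 hu2 using hz
  have hproj : ∀ o, Tendsto (fun n => z n o) atTop (𝓝 (y.1 o)) := fun o =>
    ((PiLp.proj (𝕜 := ℝ) 2 (fun _ : Option (Fin N × Fin d) => GibbsL2 N d s σ) o).continuous.tendsto _).comp hlim
  have key : ∀ (o : Option (Fin N × Fin d)) (w : ℕ → 𝕏 → ℝ), (∀ n, z n o =ᵐ[𝔪] w n) →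
      Tendsto (fun n => eLpNorm (w n - ⇑(y.1 o)) 2 𝔪) atTop (𝓝 0) := fun o w hw => by
    have h1 := tendsto_iff_edist_tendsto_0.1 (hproj o)
    refine h1.congr fun n => ?_
    rw [Lp.edist_def]
    exact eLpNorm_congr_ae ((hw n).sub (ae_eq_refl _))
  exact ⟨u, hu, key none u hu1, fun p => key (some p) _ fun n => hu2 n p⟩

end

section

variable {N d : ℕ} {s σ : ℝ} [hp : Fact (Admissible N d s σ)]
local notation "𝕏" => TorusConfig N d
local notation "𝔪" => gibbsMeasure N d s σ
local notation "𝓔" => dirichlet N d s σ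
local notation "𝐆" => gibbsCont s σ
local notation "𝐛" => logGrad s σ

/-! ### The chain rule in the domain of the form -/

lemma tendsto_eLpNorm_two_of_dominated {X : Type*} [MeasurableSpace X] {μ : Measure X} {f : ℕ → X → ℝ}
    {g : X → ℝ} (hf : ∀ n, AEStronglyMeasurable (f n) μ) (hg : MemLp g 2 μ)
    (hfg : ∀ n, ∀ᵐ x ∂μ, |f n x| ≤ |g x|) (hlim : ∀ᵐ x ∂μ, Tendsto (fun n => f n x) atTop (𝓝 0)) :
    Tendsto (fun n => eLpNorm (f n) 2 μ) atTop (𝓝 0) := by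
  have hi : Tendsto (fun n => ∫ x, f n x ^ 2 ∂μ) atTop (𝓝 (∫ _, 0 ∂μ)) := by
    refine tendsto_integral_of_dominated_convergence (fun x => g x ^ 2) (fun n => (hf n).pow 2)
      hg.integrable_sq (fun n => (hfg n).mono fun x hx => ?_) (hlim.mono fun x hx => ?_)
    · rw [norm_eq_abs, abs_pow, ← sq_abs (g x)]
      exact pow_le_pow_left₀ (abs_nonneg _) hx 2
    · simpa using hx.pow 2
  rw [integral_zero] at hi
  have h2 : ∀ n, eLpNorm (f n) 2 μ = ofReal (√(∫ x, f n x ^ 2 ∂μ)) := fun n => by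
    have hm : MemLp (f n) 2 μ := hg.of_le (hf n) (hfg n)
    rw [hm.eLpNorm_eq_integral_rpow_norm (by norm_num) (by norm_num), sqrt_eq_rpow]
    norm_num
  simp only [h2]
  have h3 := tendsto_ofReal ((continuous_sqrt.tendsto 0).comp hi)
  simpa using h3

/-- The form is closed. -/
lemma exists_domain_of_tendsto {u : ℕ → 𝕏 → ℝ} (hu : ∀ n, IsC1 (u n))
    {U : 𝕏 → ℝ} {V : Fin N × Fin d → 𝕏 → ℝ}
    (hU : MemLp U 2 𝔪) (hV : ∀ p, MemLp (V p) 2 𝔪)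
    (h1 : Tendsto (fun n => eLpNorm (u n - U) 2 𝔪) atTop (𝓝 0))
    (h2 : ∀ p : Fin N × Fin d, Tendsto (fun n => eLpNorm (𝐃 p.1 p.2 (u n) - V p) 2
      𝔪) atTop (𝓝 0)) :
    ∃ y, (𝓔).ι y =ᵐ[𝔪] U ∧ ∀ p, (𝓔).grad y p =ᵐ[𝔪] V p := by
  choose z hz hz1 hz2 using fun n => exists_smoothGraph (s := s) (σ := σ) (hu n)
  set y : GibbsPair N d s σ := WithLp.toLp 2 fun o => o.elim (hU.toLp U) fun p => (hV p).toLp _ with hy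
  have hlim : Tendsto z atTop (𝓝 y) := by
    have h3 : Tendsto (fun n => (WithLp.ofLp (z n))) atTop
        (𝓝 fun o => (o.elim (hU.toLp U) fun p => (hV p).toLp _ : GibbsL2 N d s σ)) := by
      refine tendsto_pi_nhds.2 fun o => ?_
      rw [tendsto_iff_edist_tendsto_0]
      cases o with
      | none =>
        refine h1.congr fun n => ?_
        rw [Lp.edist_def]
        exact (eLpNorm_congr_ae ((hz1 n).sub hU.coeFn_toLp)).symm
      | some p =>
        refine (h2 p).congr fun n => ?_
        rw [Lp.edist_def]
        exact (eLpNorm_congr_ae ((hz2 n p).sub (hV p).coeFn_toLp)).symm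
    exact ((PiLp.continuous_toLp 2 _).tendsto _).comp h3
  refine ⟨⟨y, mem_closure_of_tendsto hlim (.of_forall hz)⟩, hU.coeFn_toLp, fun p => (hV p).coeFn_toLp⟩

lemma exists_domain_of_isC1 {u : 𝕏 → ℝ} (hu : IsC1 u) :
    ∃ y, (𝓔).ι y =ᵐ[𝔪] u ∧ ∀ p, (𝓔).grad y p =ᵐ[𝔪] 𝐃 p.1 p.2 u := by
  obtain ⟨y, hy, h1, h2⟩ := exists_smoothGraph (s := s) (σ := σ) hu
  exact ⟨⟨y, (smoothGraph N d s σ).le_topologicalClosure hy⟩, h1, h2⟩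

lemma exists_seq_smooth_ae (y : FormDomain N d s σ) : ∃ u : ℕ → 𝕏 → ℝ, (∀ n, IsC1 (u n)) ∧
    Tendsto (fun n => eLpNorm (u n - ⇑((𝓔).ι y)) 2 𝔪) atTop (𝓝 0) ∧
    (∀ p : Fin N × Fin d, Tendsto (fun n => eLpNorm (𝐃 p.1 p.2 (u n)
      - ⇑((𝓔).grad y p)) 2 𝔪) atTop (𝓝 0)) ∧
    ∀ᵐ x ∂𝔪, Tendsto (fun n => u n x) atTop (𝓝 ((𝓔).ι y x)) := by
  obtain ⟨u, hu, h1, h2⟩ := exists_seq_smooth y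
  have h3 := tendstoInMeasure_of_tendsto_eLpNorm (by norm_num : (2 : ENNReal) ≠ 0)
    (fun n => (hu n).continuous.aestronglyMeasurable) (Lp.aestronglyMeasurable _) h1
  obtain ⟨ns, hns, h4⟩ := h3.exists_seq_tendsto_ae
  exact ⟨fun n => u (ns n), fun n => hu _, h1.comp hns.tendsto_atTop,
    fun p => (h2 p).comp hns.tendsto_atTop, h4⟩

lemma exists_domain_comp_of_tendsto {u : ℕ → 𝕏 → ℝ} (hu : ∀ n, IsC1 (u n))
    {U : 𝕏 → ℝ} {V : Fin N × Fin d → 𝕏 → ℝ}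
    (hU : MemLp U 2 𝔪) (hV : ∀ p, MemLp (V p) 2 𝔪)
    (h1 : Tendsto (fun n => eLpNorm (u n - U) 2 𝔪) atTop (𝓝 0))
    (h2 : ∀ p : Fin N × Fin d, Tendsto (fun n => eLpNorm (𝐃 p.1 p.2 (u n) - V p) 2 𝔪) atTop (𝓝 0))
    (h3 : ∀ᵐ x ∂𝔪, Tendsto (fun n => u n x) atTop (𝓝 (U x)))
    {η η' : ℝ → ℝ} (hη : ∀ r, HasDerivAt η (η' r) r)
    (hη' : Continuous η') {L : ℝ} (hL : ∀ r, |η' r| ≤ L) :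
    ∃ w, (𝓔).ι w =ᵐ[𝔪] (fun x => η (U x)) ∧ ∀ p, (𝓔).grad w p =ᵐ[𝔪] fun x => η' (U x) * V p x := by
  have hL0 : 0 ≤ L := (abs_nonneg _).trans (hL 0)
  have hηc : Continuous η := continuous_iff_continuousAt.2 fun r => (hη r).continuousAt
  have hlip : ∀ a b, |η a - η b| ≤ L * |a - b| := fun a b =>
    Convex.norm_image_sub_le_of_norm_hasDerivWithin_le (fun x _ => (hη x).hasDerivWithinAt)
      (fun x _ => hL x) convex_univ (mem_univ b) (mem_univ a)
  have hη'm : ∀ {f : 𝕏 → ℝ}, AEStronglyMeasurable f 𝔪 →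
      AEStronglyMeasurable (fun x => η' (f x)) 𝔪 := fun hf =>
    hη'.comp_aestronglyMeasurable hf
  have hηU : MemLp (fun x => η (U x)) 2 𝔪 := by
    have h40 : MemLp (fun _ : 𝕏 => |η 0|) 2 𝔪 := memLp_const _
    have h41 : MemLp (fun x => L * ‖U x‖) 2 𝔪 := hU.norm.const_mul L
    have h4 := h40.add h41
    refine h4.mono (hηc.comp_aestronglyMeasurable hU.1) (.of_forall fun x => ?_)
    rw [Pi.add_apply, norm_eq_abs, norm_eq_abs, norm_eq_abs,
      abs_of_nonneg (by positivity : 0 ≤ |η 0| + L * |U x|)]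
    have h5 := hlip (U x) 0
    rw [sub_zero] at h5
    have h6 := abs_add_le (η (U x) - η 0) (η 0)
    rw [sub_add_cancel] at h6
    linarith
  have hηV : ∀ p, MemLp (fun x => η' (U x) * V p x) 2 𝔪 := fun p => by
    refine ((hV p).const_mul L).of_le ((hη'm hU.1).mul (hV p).1) (.of_forall fun x => ?_)
    rw [norm_mul, norm_mul, norm_eq_abs (η' _), norm_eq_abs L]
    exact mul_le_mul_of_nonneg_right ((hL _).trans (le_abs_self L)) (norm_nonneg _)
  have hmul : ∀ {F : ℕ → ENNReal}, Tendsto F atTop (𝓝 0) →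
      Tendsto (fun n => ofReal L * F n) atTop (𝓝 0) := fun hF => by
    simpa using ENNReal.Tendsto.const_mul hF (Or.inr ofReal_ne_top)
  refine exists_domain_of_tendsto (fun n => (hu n).comp (η' := η') (fun x => hη _) hη'.continuousOn)
    hηU hηV ?_ fun p => ?_
  · refine tendsto_of_tendsto_of_tendsto_of_le_of_le tendsto_const_nhds (hmul h1) (fun _ => zero_le) fun n => ?_
    exact eLpNorm_le_mul_eLpNorm_of_ae_le_mul (.of_forall fun x => hlip _ _) 2
  · have e : ∀ n, 𝐃 p.1 p.2 (fun x => η (u n x)) - (fun x => η' (U x) * V p x)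
        = (fun x => η' (u n x) * (𝐃 p.1 p.2 (u n) x - V p x))
          + fun x => (η' (u n x) - η' (U x)) * V p x := fun n => by
      funext x
      simp only [Pi.sub_apply, Pi.add_apply]
      rw [configPartial_eq ((hu n).hasDerivAt_comp (hη _))]
      ring
    have hm1 : ∀ n, AEStronglyMeasurable (𝐃 p.1 p.2 (u n)) 𝔪 := fun n =>
      ((hu n).continuous_partial p.1 p.2).aestronglyMeasurable
    have hm2 := (hV p).1
    have hm3 : ∀ n, AEStronglyMeasurable (fun x => η' (u n x)) 𝔪 := fun n =>
      hη'm (hu n).continuous.aestronglyMeasurable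
    have hm4 := hη'm hU.1
    have t1 : Tendsto (fun n => eLpNorm (fun x => η' (u n x) * (𝐃 p.1 p.2 (u n) x
        - V p x)) 2 𝔪) atTop (𝓝 0) := by
      refine tendsto_of_tendsto_of_tendsto_of_le_of_le tendsto_const_nhds (hmul (h2 p)) (fun _ => zero_le)
        fun n => ?_
      refine eLpNorm_le_mul_eLpNorm_of_ae_le_mul (.of_forall fun x => ?_) 2
      rw [norm_mul]
      exact mul_le_mul_of_nonneg_right (hL _) (norm_nonneg _)
    have t2 : Tendsto (fun n => eLpNorm (fun x => (η' (u n x) - η' (U x)) * V p x) 2 𝔪) atTop (𝓝 0) := by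
      refine tendsto_eLpNorm_two_of_dominated (fun n => ((hm3 n).sub hm4).mul hm2)
        ((hV p).const_mul (2 * L)) (fun n => Eventually.of_forall fun x => ?_) ?_
      · rw [abs_mul, abs_mul]
        refine mul_le_mul_of_nonneg_right ?_ (abs_nonneg _)
        refine (abs_sub _ _).trans ?_
        rw [abs_of_nonneg (by positivity : 0 ≤ 2 * L)]
        linarith [hL (u n x), hL (U x)]
      · filter_upwards [h3] with x hx
        have := (((hη'.tendsto _).comp hx).sub_const (η' (U x))).mul_const (V p x)
        simpa using this
    have t3 := t1.add t2
    rw [add_zero] at t3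
    refine tendsto_of_tendsto_of_tendsto_of_le_of_le tendsto_const_nhds t3 (fun _ => zero_le) fun n => ?_
    dsimp only
    rw [e n]
    exact eLpNorm_add_le ((hm3 n).mul ((hm1 n).sub hm2)) (((hm3 n).sub hm4).mul hm2) (by norm_num)

/-- The chain rule. -/
lemma exists_domain_comp (y : FormDomain N d s σ) {η η' : ℝ → ℝ} (hη : ∀ r, HasDerivAt η (η' r) r)
    (hη' : Continuous η') {L : ℝ} (hL : ∀ r, |η' r| ≤ L) :
    ∃ w, (𝓔).ι w =ᵐ[𝔪] (fun x => η ((𝓔).ι y x)) ∧ ∀ p, (𝓔).grad w p =ᵐ[𝔪]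
        fun x => η' ((𝓔).ι y x) * (𝓔).grad y p x := by
  obtain ⟨u, hu, h1, h2, h3⟩ := exists_seq_smooth_ae y
  exact exists_domain_comp_of_tendsto hu (Lp.memLp _) (fun p => Lp.memLp _) h1 h2 h3 hη hη' hL

section

/-! ### The Markov property -/

section Markov

variable {X : Type*} [MeasurableSpace X] {μ : Measure X} [IsFiniteMeasure μ]

lemma L2.integrable (F : Lp ℝ 2 μ) : Integrable F μ := (Lp.memLp F).integrable (by norm_num)

lemma L2.inner_one (F : Lp ℝ 2 μ) : ⟪F, Lp.const 2 μ 1⟫ = ∫ x, F x ∂μ := by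
  rw [L2.inner_eq_integral]
  refine integral_congr_ae ?_
  filter_upwards [Lp.coeFn_const 2 μ (1 : ℝ)] with x hx
  rw [hx, Function.const_apply, mul_one]

/-- An operator that preserves positivity, constants and integrals. -/
structure IsMarkov (B : Lp ℝ 2 μ →L[ℝ] Lp ℝ 2 μ) : Prop where
  nonneg : ∀ F, 0 ≤ F → 0 ≤ B F
  one : B (Lp.const 2 μ 1) = Lp.const 2 μ 1
  inner_one : ∀ F, ⟪B F, Lp.const 2 μ 1⟫ = ⟪F, Lp.const 2 μ 1⟫

namespace IsMarkov

variable {B : Lp ℝ 2 μ →L[ℝ] Lp ℝ 2 μ}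

lemma id : IsMarkov (1 : Lp ℝ 2 μ →L[ℝ] Lp ℝ 2 μ) := ⟨fun _ h => h, rfl, fun _ => rfl⟩

lemma mul {C : Lp ℝ 2 μ →L[ℝ] Lp ℝ 2 μ} (hB : IsMarkov B) (hC : IsMarkov C) : IsMarkov (B * C) where
  nonneg F h := hB.nonneg _ (hC.nonneg F h)
  one := by rw [mul_apply_eq_comp, hC.one, hB.one]
  inner_one F := by rw [mul_apply_eq_comp, hB.inner_one, hC.inner_one]

lemma pow (hB : IsMarkov B) : ∀ n : ℕ, IsMarkov (B ^ n)
  | 0 => by rw [pow_zero]; exact .id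
  | n + 1 => by rw [pow_succ]; exact (pow hB n).mul hB

lemma mono (hB : IsMarkov B) {F G : Lp ℝ 2 μ} (h : F ≤ G) : B F ≤ B G := by
  have := hB.nonneg (G - F) (sub_nonneg.2 h)
  rwa [map_sub, sub_nonneg] at this

lemma const (hB : IsMarkov B) (c : ℝ) : B (Lp.const 2 μ c) = Lp.const 2 μ c := by
  have h : Lp.const 2 μ c = c • Lp.const 2 μ 1 := by
    have := ((Lp.constL 2 μ ℝ : ℝ →L[ℝ] Lp ℝ 2 μ)).map_smul c 1
    simpa using this
  rw [h, map_smul, hB.one]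

lemma ae_ge (hB : IsMarkov B) {F : Lp ℝ 2 μ} {a : ℝ} (h : ∀ᵐ x ∂μ, a ≤ F x) : ∀ᵐ x ∂μ, a ≤ B F x := by
  have h1 : Lp.const 2 μ a ≤ F := by
    rw [← Lp.coeFn_le]
    filter_upwards [h, Lp.coeFn_const 2 μ a] with x hx h2
    rwa [h2]
  have h3 := hB.mono h1
  rw [hB.const, ← Lp.coeFn_le] at h3
  filter_upwards [h3, Lp.coeFn_const 2 μ a] with x hx h2
  rwa [h2] at hx

lemma integral_eq (hB : IsMarkov B) (F : Lp ℝ 2 μ) : ∫ x, B F x ∂μ = ∫ x, F x ∂μ := by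
  rw [← L2.inner_one, hB.inner_one, L2.inner_one]

/-- Contraction in `L¹`. -/
lemma integral_abs_le (hB : IsMarkov B) (F : Lp ℝ 2 μ) : ∫ x, |B F x| ∂μ ≤ ∫ x, |F x| ∂μ := by
  have h1 := (Lp.coeFn_le _ _).2 (hB.mono (le_abs_self F))
  have h2 := (Lp.coeFn_le _ _).2 (hB.mono (neg_le_abs F))
  rw [map_neg] at h2
  calc ∫ x, |B F x| ∂μ ≤ ∫ x, B |F| x ∂μ := by
        refine integral_mono_ae (L2.integrable _).abs (L2.integrable _) ?_
        filter_upwards [h1, h2, Lp.coeFn_neg (B F)] with x h3 h4 h5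
        rw [h5, Pi.neg_apply] at h4
        exact abs_le.2 ⟨by linarith, h3⟩
    _ = ∫ x, |F| x ∂μ := hB.integral_eq _
    _ = ∫ x, |F x| ∂μ := integral_congr_ae (Lp.coeFn_abs F)

end IsMarkov

end Markov

variable {l : ℝ}

lemma P_one (hl : 0 < l) :
    (𝓔).P l (Lp.const 2 𝔪 1) = Lp.const 2 𝔪 1 := by
  obtain ⟨y, hy1, hy2⟩ := exists_domain_of_isC1 (N := N) (d := d) (s := s) (σ := σ) (isC1_const 1)
  have h1 : (𝓔).ι y = Lp.const 2 𝔪 1 := Lp.ext (hy1.trans (Lp.coeFn_const _ _ _).symm)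
  have h2 : (𝓔).grad y = 0 := by
    refine PiLp.ext fun p => Lp.ext ((hy2 p).trans ?_)
    refine EventuallyEq.trans (.of_forall fun x => ?_) (Lp.coeFn_zero _ _ _).symm
    exact configPartial_eq (hasDerivAt_const _ _)
  rw [← h1, ClosedForm.P_apply]
  congr 1
  refine ((𝓔).J_unique hl fun z => ?_).symm
  rw [h2, inner_zero_left, add_zero]

lemma inner_grad_eq (y w : FormDomain N d s σ) :
    ⟪(𝓔).grad y, (𝓔).grad w⟫ = ∑ p, ∫ x, (𝓔).grad y p x * (𝓔).grad w p x ∂𝔪 := by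
  rw [PiLp.inner_apply]
  exact sum_congr rfl fun p _ => L2.inner_eq_integral _ _

lemma hasDerivAt_integral {η' : ℝ → ℝ} (h : Continuous η') (c r : ℝ) :
    HasDerivAt (fun r => ∫ t in c..r, η' t) (η' r) r :=
  intervalIntegral.integral_hasDerivAt_right (h.intervalIntegrable _ _)
    h.aestronglyMeasurable.stronglyMeasurableAtFilter h.continuousAt

/-- The resolvent preserves positivity: test the equation with a nondecreasing function of the
solution that vanishes exactly on `[0,∞)`. -/
lemma P_nonneg (hl : 0 < l) {F : GibbsL2 N d s σ} (hF : 0 ≤ F) : 0 ≤ (𝓔).P l F := by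
  set η' : ℝ → ℝ := fun t => min (max (-t) 0) 1 with hη'
  have hc : Continuous η' := by fun_prop
  have h0 : ∀ r, 0 ≤ η' r := fun r => le_min (le_max_right _ _) zero_le_one
  have h1 : ∀ r, |η' r| ≤ 1 := fun r => by rw [abs_of_nonneg (h0 r)]; exact min_le_right _ _
  set η : ℝ → ℝ := fun r => ∫ t in (0 : ℝ)..r, η' t with hη
  have hpos : ∀ r, 0 ≤ r → η r = 0 := fun r hr => by
    refine intervalIntegral.integral_zero_ae (.of_forall fun t ht => ?_)
    rw [uIoc_of_le hr] at ht
    simp only [hη']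
    rw [max_eq_right (by linarith [ht.1]), min_eq_left zero_le_one]
  have hneg : ∀ r, r < 0 → η r < 0 := fun r hr => by
    simp only [hη]
    rw [intervalIntegral.integral_symm, neg_lt_zero]
    refine intervalIntegral.intervalIntegral_pos_of_pos_on (hc.intervalIntegrable _ _) (fun t ht => ?_) hr
    exact lt_min (lt_max_of_lt_left (by linarith [ht.2])) one_pos
  have hnp : ∀ r, η r ≤ 0 := fun r => by
    rcases le_or_gt 0 r with h | h
    · exact (hpos r h).le
    · exact (hneg r h).le
  obtain ⟨w, hw1, hw2⟩ := exists_domain_comp ((𝓔).J l F) (hasDerivAt_integral hc 0) hc h1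
  have hspec := (𝓔).J_spec hl F w
  rw [inner_grad_eq, ← ClosedForm.P_apply] at *
  set u := (𝓔).P l F with hu
  have e1 : 0 ≤ ∑ p, ∫ x, (𝓔).grad ((𝓔).J l F) p x * (𝓔).grad w p x ∂𝔪 := by
    refine sum_nonneg fun p _ => integral_nonneg_of_ae ?_
    filter_upwards [hw2 p] with x hx
    rw [hx, Pi.zero_apply, mul_left_comm]
    exact mul_nonneg (h0 _) (mul_self_nonneg _)
  have e2 : ⟪F, (𝓔).ι w⟫ ≤ 0 := by
    rw [L2.inner_eq_integral]
    refine integral_nonpos_of_ae ?_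
    filter_upwards [hw1, (Lp.coeFn_nonneg F).2 hF] with x hx h2
    rw [hx]
    exact mul_nonpos_of_nonneg_of_nonpos h2 (hnp _)
  have hsgn : ∀ r, 0 ≤ r * η r := fun r => by
    rcases le_or_gt 0 r with h | h
    · rw [hpos r h, mul_zero]
    · exact mul_nonneg_of_nonpos_of_nonpos h.le (hneg r h).le
  have e3 : 0 ≤ᵐ[𝔪] fun x => u x * (𝓔).ι w x := by
    filter_upwards [hw1] with x hx
    rw [hx]
    exact hsgn _
  have e4 : ∫ x, u x * (𝓔).ι w x ∂𝔪 = 0 := by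
    refine le_antisymm ?_ (integral_nonneg_of_ae e3)
    rw [← L2.inner_eq_integral]
    by_contra! hcon
    have := mul_pos hl hcon
    have := mul_nonpos_of_nonneg_of_nonpos hl.le e2
    linarith
  rw [← Lp.coeFn_nonneg]
  filter_upwards [(integral_eq_zero_iff_of_nonneg_ae e3 (L2.integrable_mul _ _)).1 e4, hw1] with x hx h2
  by_contra hcon
  rw [Pi.zero_apply, not_le] at hcon
  rw [h2] at hx
  exact (mul_pos_of_neg_of_neg hcon (hneg _ hcon)).ne' hx

lemma isMarkov_P (hl : 0 < l) : IsMarkov ((𝓔).P l) where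
  nonneg F hF := P_nonneg hl hF
  one := P_one hl
  inner_one F := by rw [← ClosedForm.inner_P_comm _ hl, P_one hl]

lemma isMarkov_T (hl : 0 < l) {t : ℝ} (ht : 0 ≤ t) : IsMarkov ((𝓔).T l t) := by
  have hc : ∀ n : ℕ, 0 ≤ exp (-(t * l)) * ((t * l) ^ n / n.factorial) := fun n => by positivity
  have hsum : HasSum (fun n : ℕ => exp (-(t * l)) * ((t * l) ^ n / n.factorial)) 1 := by
    have h1 := (NormedSpace.expSeries_div_hasSum_exp (t * l)).mul_left (exp (-(t * l)))
    rwa [← Real.exp_eq_exp_ℝ, ← exp_add, neg_add_cancel, Real.exp_zero] at h1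
  refine ⟨fun F hF => ?_, ?_, fun F => ?_⟩
  · refine ((𝓔).hasSum_T l t F).nonneg fun n => ?_
    have h1 := ((isMarkov_P hl).pow n).nonneg F hF
    rw [← Lp.coeFn_nonneg] at h1 ⊢
    filter_upwards [h1, Lp.coeFn_smul (exp (-(t * l)) * ((t * l) ^ n / n.factorial))
      (((𝓔).P l ^ n) F)] with x h2 h3
    rw [h3]
    exact mul_nonneg (hc n) h2
  · have h1 := (𝓔).hasSum_T l t (Lp.const 2 𝔪 1)
    simp only [((isMarkov_P hl).pow _).one] at h1
    have h2 := hsum.smul_const (Lp.const 2 𝔪 (1 : ℝ))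
    rw [one_smul] at h2
    exact h1.unique h2
  · have h1 := ((innerSL ℝ (Lp.const 2 𝔪 1))).hasSum ((𝓔).hasSum_T l t F)
    have h2 : ∀ n : ℕ, innerSL ℝ (Lp.const 2 𝔪 1)
        ((exp (-(t * l)) * ((t * l) ^ n / n.factorial)) • ((𝓔).P l ^ n) F)
        = (exp (-(t * l)) * ((t * l) ^ n / n.factorial)) * ⟪F, Lp.const 2 𝔪 1⟫ := fun n => by
      rw [map_smul, innerSL_apply_apply, real_inner_comm, ((isMarkov_P hl).pow n).inner_one, smul_eq_mul]
    have h3 := hsum.mul_right ⟪F, Lp.const 2 𝔪 1⟫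
    rw [one_mul] at h3
    have h4 := (h1.congr_fun fun n => (h2 n).symm).unique h3
    rwa [innerSL_apply_apply, real_inner_comm] at h4

end

section

/-! ### Integration by parts in the domain of the form -/

variable {X : Type*} [MeasurableSpace X] {μ : Measure X}

/-- Fatou's lemma for nonnegative real functions. -/
lemma integrable_and_integral_le_of_tendsto {f : ℕ → X → ℝ} {g : X → ℝ} {a : ℕ → ℝ} {b : ℝ} (hf : ∀ n, Integrable (f n) μ)
    (h0 : ∀ n, 0 ≤ᵐ[μ] f n) (ha : ∀ n, ∫ x, f n x ∂μ ≤ a n) (hab : Tendsto a atTop (𝓝 b))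
    (hlim : ∀ᵐ x ∂μ, Tendsto (fun n => f n x) atTop (𝓝 (g x))) :
    Integrable g μ ∧ ∫ x, g x ∂μ ≤ b := by
  have hgm : AEStronglyMeasurable g μ := aestronglyMeasurable_of_tendsto_ae _ (fun n => (hf n).1) hlim
  have hg0 : 0 ≤ᵐ[μ] g := by
    filter_upwards [hlim, ae_all_iff.2 h0] with x h1 h2
    exact ge_of_tendsto' h1 h2
  have hb : 0 ≤ b := ge_of_tendsto' hab fun n => (integral_nonneg_of_ae (h0 n)).trans (ha n)
  have hle : ∫⁻ x, ofReal (g x) ∂μ ≤ ofReal b := by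
    calc ∫⁻ x, ofReal (g x) ∂μ = ∫⁻ x, liminf (fun n => ofReal (f n x)) atTop ∂μ := by
          refine lintegral_congr_ae ?_
          filter_upwards [hlim] with x hx
          exact ((tendsto_ofReal hx).liminf_eq).symm
      _ ≤ liminf (fun n => ∫⁻ x, ofReal (f n x) ∂μ) atTop :=
          lintegral_liminf_le' fun n => (hf n).1.aemeasurable.ennreal_ofReal
      _ ≤ liminf (fun n => ofReal (a n)) atTop := by
          refine liminf_le_liminf (.of_forall fun n => ?_)
          rw [← ofReal_integral_eq_lintegral_ofReal (hf n) (h0 n)]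
          exact ofReal_le_ofReal (ha n)
      _ = ofReal b := (tendsto_ofReal hab).liminf_eq
  have hi : Integrable g μ := by
    refine ⟨hgm, ?_⟩
    rw [hasFiniteIntegral_iff_ofReal hg0]
    exact hle.trans_lt ofReal_lt_top
  refine ⟨hi, ?_⟩
  rwa [← ofReal_integral_eq_lintegral_ofReal hi hg0, ENNReal.ofReal_le_ofReal_iff hb] at hle

lemma exists_seq_domain (y : FormDomain N d s σ) : ∃ (w : ℕ → FormDomain N d s σ)
    (u : ℕ → TorusConfig N d → ℝ), (∀ n, IsC1 (u n)) ∧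
    (∀ n, (𝓔).ι (w n) =ᵐ[𝔪] u n) ∧
    (∀ n p, (𝓔).grad (w n) p =ᵐ[𝔪] 𝐃 p.1 p.2 (u n)) ∧
    Tendsto w atTop (𝓝 y) ∧
    ∀ᵐ x ∂𝔪, Tendsto (fun n => u n x) atTop (𝓝 ((𝓔).ι y x)) := by
  obtain ⟨z, hz, hlim⟩ := mem_closure_iff_seq_limit.1 y.2
  choose u hu hu1 hu2 using hz
  obtain ⟨v, hv⟩ : ∃ v : ℕ → FormDomain N d s σ, ∀ n, (v n).1 = z n :=
    ⟨fun n => ⟨z n, subset_closure ⟨u n, hu n, hu1 n, hu2 n⟩⟩, fun n => rfl⟩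
  have hlim' : Tendsto v atTop (𝓝 y) := tendsto_subtype_rng.2 (hlim.congr fun n => (hv n).symm)
  have hv1 : ∀ n, (𝓔).ι (v n) =ᵐ[𝔪] u n := fun n => by
    have : (𝓔).ι (v n) = z n none := by rw [← hv n]; rfl
    rw [this]
    exact hu1 n
  have hv2 : ∀ n p, (𝓔).grad (v n) p =ᵐ[𝔪] 𝐃 p.1 p.2 (u n) := fun n p => by
    have : (𝓔).grad (v n) p = z n (some p) := by rw [← hv n]; rfl
    rw [this]
    exact hu2 n p
  have h1 := ((𝓔).ι.continuous.tendsto y).comp hlim'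
  obtain ⟨ns, hns, h2⟩ := (tendstoInMeasure_of_tendsto_Lp h1).exists_seq_tendsto_ae
  refine ⟨fun n => v (ns n), fun n => u (ns n), fun n => hu _, fun n => hv1 _, fun n => hv2 _,
    hlim'.comp hns.tendsto_atTop, ?_⟩
  filter_upwards [h2, ae_all_iff.2 hv1] with x h3 h4
  exact h3.congr fun n => h4 _

lemma L2.integral_abs_mul_le (F G : Lp ℝ 2 μ) :
    ∫ x, |F x| * |G x| ∂μ ≤ ‖F‖ * ‖G‖ := by
  have h1 : ∫ x, |F x| * |G x| ∂μ = ⟪|F|, |G|⟫ := by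
    rw [L2.inner_eq_integral]
    refine integral_congr_ae ?_
    filter_upwards [Lp.coeFn_abs F, Lp.coeFn_abs G] with x h2 h3
    rw [h2, h3]
  rw [h1, ← norm_abs_eq_norm F, ← norm_abs_eq_norm G]
  exact real_inner_le_norm _ _

/-- The force is a form-bounded perturbation, with the multiplicative form of the bound. -/
lemma exists_force_bound : ∃ C ≥ 0, ∀ (y : FormDomain N d s σ) (i : Fin N) (k : Fin d),
    MemLp ((𝓔).ι y) 2 (forceMeasure N d s σ i k) ∧
    ∫ x, (𝓔).ι y x ^ 2 ∂(forceMeasure N d s σ i k) ≤ C * (‖(𝓔).ι y‖ ^ 2 + ‖(𝓔).ι y‖ * ‖(𝓔).grad y‖) := by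
  obtain ⟨C, hC, h⟩ := exists_logGrad_bound hp.out
  set K : ℝ := ((Fintype.card (Fin N × Fin d) : ℕ) : ℝ) with hK
  have hK0 : 0 ≤ K := cast_nonneg _
  refine ⟨C * (1 + K), by positivity, fun y i k => ?_⟩
  obtain ⟨w, u, hu, hw1, hw2, hlim, hae⟩ := exists_seq_domain y
  set E := 𝓔
  have hb : ∀ n, ∫ x, u n x ^ 2 ∂(forceMeasure N d s σ i k)
      ≤ C * (1 + K) * (‖E.ι (w n)‖ ^ 2 + ‖E.ι (w n)‖ * ‖E.grad (w n)‖) := by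
    intro n
    have h1 := h (u n) (hu n) i k
    have e1 : ∫ x, u n x ^ 2 ∂(forceMeasure N d s σ i k)
        = ∫ x, u n x ^ 2 * (|𝐛 i k x| * 𝐆 x) := by
      rw [integral_forceMeasure, integral_gibbsMeasure]
      simp only [mul_assoc]
    have e2 : ∫ x, u n x ^ 2 * 𝐆 x = ‖E.ι (w n)‖ ^ 2 := by
      rw [← integral_gibbsMeasure, L2.norm_sq_eq_integral]
      refine integral_congr_ae ((hw1 n).mono fun x hx => ?_)
      simp only [hx]
    have e3 : ∀ p : Fin N × Fin d, ∫ x, |u n x| * |𝐃 p.1 p.2 (u n) x| * 𝐆 x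
        ≤ ‖E.ι (w n)‖ * ‖E.grad (w n)‖ := by
      intro p
      rw [← integral_gibbsMeasure]
      have e4 : ∫ x, |u n x| * |𝐃 p.1 p.2 (u n) x| ∂𝔪
          = ∫ x, |E.ι (w n) x| * |E.grad (w n) p x| ∂𝔪 := by
        refine integral_congr_ae ?_
        filter_upwards [hw1 n, hw2 n p] with x h3 h4
        simp only [h3, h4]
      rw [e4]
      exact (L2.integral_abs_mul_le _ _).trans
        (mul_le_mul_of_nonneg_left (PiLp.norm_apply_le _ _) (norm_nonneg _))
    have e5 : energyBound s σ (u n) ≤ (1 + K) * (‖E.ι (w n)‖ ^ 2 + ‖E.ι (w n)‖ * ‖E.grad (w n)‖) := by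
      unfold energyBound
      rw [e2, ← Fintype.sum_prod_type']
      have e6 := sum_le_sum fun p (_ : p ∈ (univ : Finset (Fin N × Fin d))) => e3 p
      rw [sum_const, card_univ, nsmul_eq_mul] at e6
      have e7 : 0 ≤ ‖E.ι (w n)‖ * ‖E.grad (w n)‖ := by positivity
      nlinarith [mul_nonneg hK0 (sq_nonneg ‖E.ι (w n)‖)]
    rw [e1, mul_assoc]
    exact h1.trans (mul_le_mul_of_nonneg_left e5 hC)
  have ht : Tendsto (fun n => C * (1 + K) * (‖E.ι (w n)‖ ^ 2 + ‖E.ι (w n)‖ * ‖E.grad (w n)‖)) atTop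
      (𝓝 (C * (1 + K) * (‖E.ι y‖ ^ 2 + ‖E.ι y‖ * ‖E.grad y‖))) := by
    have : Continuous fun v => C * (1 + K) * (‖E.ι v‖ ^ 2 + ‖E.ι v‖ * ‖E.grad v‖) := by fun_prop
    exact (this.tendsto y).comp hlim
  have hfin := integrable_and_integral_le_of_tendsto
    (fun n => (memLp_of_continuous (hu n).continuous (forceMeasure N d s σ i k)).integrable_sq)
    (fun n => Eventually.of_forall fun x => sq_nonneg _) hb ht
    (Filter.Eventually.mono ((forceMeasure_ac i k).ae_le hae) fun x hx => Tendsto.pow hx 2)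
  refine ⟨(memLp_two_iff_integrable_sq ?_).2 hfin.1, hfin.2⟩
  exact (Lp.aestronglyMeasurable (E.ι y)).mono_ac (forceMeasure_ac i k)

lemma eLpNorm_two_eq {f : X → ℝ} (hf : MemLp f 2 μ) :
    eLpNorm f 2 μ = ofReal (√(∫ x, f x ^ 2 ∂μ)) := by
  rw [hf.eLpNorm_eq_integral_rpow_norm (by norm_num) (by norm_num), sqrt_eq_rpow]
  norm_num

/-- The product rule tested against a weight, for the square of an element of the domain. -/
lemma integral_sq_mul_partial (y : FormDomain N d s σ) {ψ : TorusConfig N d → ℝ} (hψ : IsC1 ψ)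
    (i : Fin N) (k : Fin d) :
    ∫ x, (𝓔).ι y x * (𝓔).ι y x * 𝐃 i k ψ x ∂𝔪 = -(2 * ∫ x, (𝓔).ι y x * (𝓔).grad y (i, k) x * ψ x
            ∂𝔪)
        - ∫ x, (𝓔).ι y x * (𝓔).ι y x * (ψ x * 𝐛 i k x) ∂𝔪 := by
  obtain ⟨w, u, hu, hw1, hw2, hlim, hae⟩ := exists_seq_domain y
  obtain ⟨C, hC, hF⟩ := exists_force_bound (N := N) (d := d) (s := s) (σ := σ)
  obtain ⟨B1, hB1⟩ := exists_abs_le_of_continuous hψ.continuous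
  obtain ⟨B2, hB2⟩ := exists_abs_le_of_continuous (hψ.continuous_partial i k)
  have hm := measurable_logGrad (N := N) hp.out i k
  have hiu := fun n => memLp_of_continuous (hu n).continuous 𝔪
  have hip := fun n => memLp_of_continuous ((hu n).continuous_partial i k) 𝔪
  have hif := fun n => memLp_of_continuous (hu n).continuous (forceMeasure N d s σ i k)
  have c1 : Tendsto (fun n => eLpNorm (u n - ⇑((𝓔).ι y)) 2 𝔪) atTop (𝓝 0) := by
    have h1 := tendsto_iff_edist_tendsto_0.1 (((𝓔).ι.continuous.tendsto y).comp hlim)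
    refine h1.congr fun n => ?_
    rw [Function.comp_apply, Lp.edist_def]
    exact eLpNorm_congr_ae ((hw1 n).sub (ae_eq_refl _))
  have c2 : Tendsto (fun n => eLpNorm (𝐃 i k (u n) - ⇑((𝓔).grad y (i, k))) 2 𝔪) atTop (𝓝 0) := by
    have h0 := ((𝓔).grad.continuous.tendsto y).comp hlim
    have h1 := tendsto_iff_edist_tendsto_0.1 (((PiLp.proj (𝕜 := ℝ) 2
      (fun _ : Fin N × Fin d => GibbsL2 N d s σ) (i, k)).continuous.tendsto _).comp h0)
    refine h1.congr fun n => ?_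
    rw [Function.comp_apply, Lp.edist_def]
    exact eLpNorm_congr_ae ((hw2 n (i, k)).sub (ae_eq_refl _))
  have c3 : Tendsto (fun n => eLpNorm (u n - ⇑((𝓔).ι y)) 2 (forceMeasure N d s σ i k)) atTop (𝓝 0) := by
    have h1 : ∀ n, eLpNorm (u n - ⇑((𝓔).ι y)) 2 (forceMeasure N d s σ i k)
        = ofReal (√(∫ x, (𝓔).ι (w n - y) x ^ 2 ∂(forceMeasure N d s σ i k))) := by
      intro n
      rw [← eLpNorm_two_eq (hF _ i k).1]
      refine eLpNorm_congr_ae ((forceMeasure_ac i k).ae_le ?_)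
      rw [map_sub]
      exact ((hw1 n).symm.sub (ae_eq_refl _)).trans (Lp.coeFn_sub _ _).symm
    simp only [h1]
    have h2 : Tendsto (fun n => C * (‖(𝓔).ι (w n - y)‖ ^ 2
        + ‖(𝓔).ι (w n - y)‖ * ‖(𝓔).grad (w n - y)‖)) atTop (𝓝 0) := by
      have h3 : Continuous fun v => C * (‖(𝓔).ι (v - y)‖ ^ 2
        + ‖(𝓔).ι (v - y)‖ * ‖(𝓔).grad (v - y)‖) := by fun_prop
      have h4 := (h3.tendsto y).comp hlim
      simp only [sub_self, map_zero, norm_zero, mul_zero, add_zero, ne_eq, OfNat.ofNat_ne_zero,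
        not_false_eq_true, zero_pow] at h4
      exact h4
    have h3 := squeeze_zero (fun n => integral_nonneg fun x => sq_nonneg _) (fun n => (hF (w n - y) i k).2) h2
    have h4 := tendsto_ofReal ((continuous_sqrt.tendsto 0).comp h3)
    simpa using h4
  set sg : TorusConfig N d → ℝ := fun x => if 0 ≤ 𝐛 i k x then 1 else -1 with hsg
  have hsgm : Measurable sg := Measurable.ite (hm measurableSet_Ici) measurable_const measurable_const
  have hsg1 : ∀ x, |ψ x * sg x| ≤ B1 := fun x => by
    rw [abs_mul]
    have : |sg x| = 1 := by simp only [hsg]; split_ifs <;> simp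
    rw [this, mul_one]; exact hB1 x
  have hforce : ∀ f : TorusConfig N d → ℝ, ∫ x, f x * (ψ x * sg x) ∂(forceMeasure N d s σ i k)
      = ∫ x, f x * (ψ x * 𝐛 i k x) ∂𝔪 := fun f => by
    rw [integral_forceMeasure]
    refine integral_congr_ae (.of_forall fun x => ?_)
    have : sg x * |𝐛 i k x| = 𝐛 i k x := by
      simp only [hsg]
      split_ifs with h
      · rw [one_mul, abs_of_nonneg h]
      · rw [abs_of_neg (not_le.1 h)]; ring
    simp only [mul_assoc]
    rw [this]
  have t1 := tendsto_integral_mul_mul hiu hiu (Lp.memLp _) (Lp.memLp _) c1 c1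
    (hψ.continuous_partial i k).aestronglyMeasurable hB2
  have t2 := tendsto_integral_mul_mul hiu hip (Lp.memLp _) (Lp.memLp _) c1 c2
    hψ.continuous.aestronglyMeasurable hB1
  have t3 := tendsto_integral_mul_mul hif hif (hF y i k).1 (hF y i k).1 c3 c3
    (hψ.continuous.measurable.mul hsgm).aestronglyMeasurable hsg1
  simp only [Pi.mul_apply, hforce (fun x => (𝓔).ι y x * (𝓔).ι y x)] at t3
  have t4 := (t2.const_mul 2).neg.sub t3
  refine tendsto_nhds_unique t1 (t4.congr fun n => ?_)
  have hibp := integral_partial_gibbsCont hp.out (((hu n).mul (hu n)).mul hψ) i k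
  have e1 : ∀ x, 𝐃 i k (fun x => u n x * u n x * ψ x) x
      = 2 * (u n x * 𝐃 i k (u n) x * ψ x) + u n x * u n x * 𝐃 i k ψ x :=
    (hu n).partial_sq_mul hψ i k
  have hpc := (hu n).continuous_partial i k
  have hψp := hψ.continuous_partial i k
  have i1 : Integrable (fun x => u n x * 𝐃 i k (u n) x * ψ x) 𝔪 :=
    (memLp_of_continuous (((hu n).continuous.mul hpc).mul hψ.continuous) _).integrable (by norm_num)
  have i2 : Integrable (fun x => u n x * u n x * 𝐃 i k ψ x) 𝔪 :=
    (memLp_of_continuous (((hu n).continuous.mul (hu n).continuous).mul hψp) _).integrable (by norm_num)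
  simp only [e1] at hibp
  rw [← integral_gibbsMeasure, integral_add (i1.const_mul 2) i2, integral_const_mul] at hibp
  have e2 : ∫ x, u n x * u n x * ψ x * (𝐛 i k x * 𝐆 x)
      = ∫ x, u n x * u n x * (ψ x * sg x) ∂(forceMeasure N d s σ i k) := by
    rw [hforce (fun x => u n x * u n x), integral_gibbsMeasure]
    simp only [mul_assoc]
  rw [e2] at hibp
  linarith

lemma integrable_sq_mul_logGrad (y : FormDomain N d s σ) (i : Fin N) (k : Fin d) :
    Integrable (fun x => (𝓔).ι y x ^ 2 * 𝐛 i k x) 𝔪 := by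
  obtain ⟨C, hC, hF⟩ := exists_force_bound (N := N) (d := d) (s := s) (σ := σ)
  have h1 := integrable_forceMeasure_iff.1 (hF y i k).1.integrable_sq
  refine h1.mono (((Lp.aestronglyMeasurable _).pow 2).mul
    (measurable_logGrad hp.out i k).aestronglyMeasurable) (.of_forall fun x => ?_)
  rw [norm_mul, norm_mul, norm_eq_abs |_|, abs_abs, ← norm_eq_abs]

/-! ### Square roots and logarithms in the domain of the form -/

lemma abs_one_div_le {c b : ℝ} (hc : 0 < c) (h : c ≤ b) : |1 / b| ≤ 1 / c := by
  rw [abs_of_nonneg (by have := hc.trans_le h; positivity)]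
  exact one_div_le_one_div_of_le hc h

lemma exists_domain_primitive {c : ℝ} (y : FormDomain N d s σ) (h : ∀ᵐ x ∂𝔪, c ≤ (𝓔).ι y x) {η η' : ℝ → ℝ}
    (hη : ∀ r, c ≤ r → HasDerivAt η (η' r) r) (hη' : Continuous fun r => η' (max r c)) {L : ℝ}
    (hL : ∀ r, c ≤ r → |η' r| ≤ L) :
    ∃ w, (𝓔).ι w =ᵐ[𝔪] (fun x => η ((𝓔).ι y x)) ∧ ∀ p, (𝓔).grad w p =ᵐ[𝔪]
        fun x => η' ((𝓔).ι y x) * (𝓔).grad y p x := by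
  have h1 : ∀ r, HasDerivAt (fun r => η c + ∫ t in c..r, η' (max t c)) (η' (max r c)) r := fun r =>
    (hasDerivAt_integral hη' c r).const_add _
  obtain ⟨w, hw1, hw2⟩ := exists_domain_comp y h1 hη' (L := L) fun r => hL _ (le_max_right _ _)
  have h2 : ∀ r, c ≤ r → η c + ∫ t in c..r, η' (max t c) = η r := fun r hr => by
    have e : ∫ t in c..r, η' (max t c) = ∫ t in c..r, η' t := by
      refine intervalIntegral.integral_congr fun t ht => ?_
      rw [uIcc_of_le hr] at ht
      simp only [max_eq_left ht.1]
    have hc' : ContinuousOn η' (uIcc c r) := by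
      refine hη'.continuousOn.congr fun t ht => ?_
      rw [uIcc_of_le hr] at ht
      simp only [max_eq_left ht.1]
    rw [e, integral_eq_sub_of_hasDerivAt (fun t ht => ?_) hc'.intervalIntegrable]
    · ring
    · rw [uIcc_of_le hr] at ht
      exact hη t ht.1
  refine ⟨w, ?_, fun p => ?_⟩
  · filter_upwards [hw1, h] with x hx h3
    rw [hx, h2 _ h3]
  · filter_upwards [hw2 p, h] with x hx h3
    rw [hx, max_eq_left h3]

lemma exists_domain_log {c : ℝ} (hc : 0 < c) (y : FormDomain N d s σ) (h : ∀ᵐ x ∂𝔪, c ≤ (𝓔).ι y x) :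
    ∃ w, (𝓔).ι w =ᵐ[𝔪] (fun x => log ((𝓔).ι y x)) ∧ ∀ p, (𝓔).grad w p =ᵐ[𝔪]
        fun x => ((𝓔).ι y x)⁻¹ * (𝓔).grad y p x := by
  have h0 : ∀ r, c ≤ r → 0 < r := fun r hr => hc.trans_le hr
  refine exists_domain_primitive y h (η' := fun r => r⁻¹) (fun r hr => Real.hasDerivAt_log (h0 r hr).ne')
    ((continuous_id.max continuous_const).inv₀ fun r => (h0 _ (le_max_right _ _)).ne') (L := 1 / c)
    fun r hr => ?_
  rw [← one_div]
  exact abs_one_div_le hc hr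

lemma exists_domain_sqrt {c : ℝ} (hc : 0 < c) (y : FormDomain N d s σ) (h : ∀ᵐ x ∂𝔪, c ≤ (𝓔).ι y x) :
    ∃ w, (𝓔).ι w =ᵐ[𝔪] (fun x => 2 * √((𝓔).ι y x)) ∧ ∀ p, (𝓔).grad w p =ᵐ[𝔪]
        fun x => (√((𝓔).ι y x))⁻¹ * (𝓔).grad y p x := by
  have h0 : ∀ r, c ≤ r → 0 < r := fun r hr => hc.trans_le hr
  refine exists_domain_primitive y h (η := fun r => 2 * √r) (η' := fun r => (√r)⁻¹) (fun r hr => ?_)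
    ((continuous_sqrt.comp (continuous_id.max continuous_const)).inv₀ fun r =>
      (sqrt_pos.2 (h0 _ (le_max_right _ _))).ne') (L := 1 / √c) fun r hr => ?_
  · have h1 := (Real.hasDerivAt_sqrt (h0 r hr).ne').const_mul 2
    refine h1.congr_deriv ?_
    have := (sqrt_pos.2 (h0 r hr)).ne'
    field_simp
  · rw [← one_div]
    exact abs_one_div_le (sqrt_pos.2 hc) (Real.sqrt_le_sqrt hr)

end

/-! ### Curves of square integrable functions -/

section Curves

variable {X Y : Type*} [MeasurableSpace X] [MeasurableSpace Y] {μ : Measure X}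

lemma measurable_uncurry_simpleFunc (S : SimpleFunc Y (Lp ℝ 2 μ)) :
    Measurable fun p : Y × X => (S p.1 : X → ℝ) p.2 := by
  classical
  have e : (fun p : Y × X => (S p.1 : X → ℝ) p.2)
      = fun p => ∑ c ∈ S.range, (S ⁻¹' {c}).indicator (fun _ => 1) p.1 * (c : X → ℝ) p.2 := by
    funext p
    rw [Finset.sum_eq_single (S p.1)]
    · simp
    · intro c _ hc
      rw [indicator_of_notMem (by simpa using fun h => hc h.symm), zero_mul]
    · intro h
      exact absurd (SimpleFunc.mem_range_self S p.1) h
  rw [e]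
  refine Finset.measurable_sum _ fun c _ => Measurable.mul ?_ ?_
  · exact (measurable_const.indicator (S.measurableSet_fiber c)).comp measurable_fst
  · exact (Lp.stronglyMeasurable c).measurable.comp measurable_snd

/-- A strongly measurable curve of square integrable functions has a jointly measurable version. -/
lemma exists_measurable_uncurry {F : Y → Lp ℝ 2 μ} (hF : StronglyMeasurable F) :
    ∃ Ψ : Y × X → ℝ, Measurable Ψ ∧ ∀ t, (fun x => Ψ (t, x)) =ᵐ[μ] F t := by
  classical
  set S : ℕ → SimpleFunc Y (Lp ℝ 2 μ) := hF.approx with hS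
  have hex : ∀ (j : ℕ) (t : Y), ∃ n, dist (S n t) (F t) ≤ (1 / 2 : ℝ) ^ j := fun j t => by
    have h1 := (tendsto_iff_dist_tendsto_zero.1 (hF.tendsto_approx t)).eventually
      (ge_mem_nhds (show (0 : ℝ) < (1 / 2) ^ j by positivity))
    exact h1.exists
  set M : ℕ → Y → ℕ := fun j t => Nat.find (hex j t) with hM
  have hMm : ∀ j, Measurable (M j) := fun j => by
    refine measurable_find (hex j) fun n => ?_
    have h1 : StronglyMeasurable fun t => dist (S n t) (F t) := (S n).stronglyMeasurable.dist hF
    exact h1.measurable measurableSet_Iic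
  set Φ : ℕ → Y × X → ℝ := fun j p => (S (M j p.1) p.1 : X → ℝ) p.2 with hΦ
  have hΦm : ∀ j, Measurable (Φ j) := fun j => by
    have h1 : Measurable fun q : ℕ × (Y × X) => (S q.1 q.2.1 : X → ℝ) q.2.2 :=
      measurable_from_prod_countable_right fun n => measurable_uncurry_simpleFunc (S n)
    exact h1.comp (((hMm j).comp measurable_fst).prodMk measurable_id)
  refine ⟨fun p => limUnder atTop fun j => Φ j p,
    (StronglyMeasurable.limUnder fun j => (hΦm j).stronglyMeasurable).measurable, fun t => ?_⟩
  have hd : ∀ j, dist (S (M j t) t) (F t) ≤ (1 / 2 : ℝ) ^ j := fun j => Nat.find_spec (hex j t)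
  have hae : ∀ᵐ x ∂μ, ∃ l : ℝ, Tendsto (fun j => Φ j (t, x)) atTop (𝓝 l) := by
    refine Lp.ae_tendsto_of_cauchy_eLpNorm (p := 2) (f := fun j x => Φ j (t, x))
      (B := fun j => ofReal (3 * (1 / 2 : ℝ) ^ j)) (fun j => Lp.aestronglyMeasurable (S (M j t) t))
      (by norm_num) ?_ fun K n m hn hm => ?_
    · have hs : Summable fun j : ℕ => 3 * (1 / 2 : ℝ) ^ j :=
        (summable_geometric_of_lt_one (by norm_num) (by norm_num)).mul_left 3
      rw [← ENNReal.ofReal_tsum_of_nonneg (fun j => by positivity) hs]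
      exact ofReal_ne_top
    · change eLpNorm (⇑(S (M n t) t) - ⇑(S (M m t) t)) 2 μ < _
      rw [← Lp.edist_def, edist_dist]
      refine (ENNReal.ofReal_lt_ofReal_iff (by positivity)).2 ?_
      have h1 := dist_triangle_right (S (M n t) t) (S (M m t) t) (F t)
      have h2 : ∀ j, K ≤ j → (1 / 2 : ℝ) ^ j ≤ (1 / 2) ^ K := fun j hj =>
        pow_le_pow_of_le_one (by norm_num) (by norm_num) hj
      have h3 : (0 : ℝ) < (1 / 2) ^ K := by positivity
      linarith [hd n, hd m, h2 n hn, h2 m hm]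
  have hlim : Tendsto (fun j => S (M j t) t) atTop (𝓝 (F t)) := by
    rw [tendsto_iff_dist_tendsto_zero]
    exact squeeze_zero (fun _ => dist_nonneg) hd
      (tendsto_pow_atTop_nhds_zero_of_lt_one (by norm_num) (by norm_num))
  obtain ⟨ns, hns, h2⟩ := (tendstoInMeasure_of_tendsto_Lp hlim).exists_seq_tendsto_ae
  filter_upwards [hae, h2] with x ⟨l, hl⟩ h3
  have h4 : l = F t x := tendsto_nhds_unique (hl.comp hns.tendsto_atTop) h3
  rw [← h4]
  exact hl.limUnder_eq

lemma sqrt_sub_sqrt_sq_le (a b : ℝ) : (√a - √b) ^ 2 ≤ |a - b| := by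
  have key : ∀ a b : ℝ, b ≤ a → (√a - √b) ^ 2 ≤ a - b := fun a b hab => by
    rcases le_or_gt b 0 with hb | hb
    · rw [Real.sqrt_eq_zero_of_nonpos hb, sub_zero]
      rcases le_or_gt a 0 with ha | ha
      · rw [Real.sqrt_eq_zero_of_nonpos ha]; simpa using hab
      · rw [sq_sqrt ha.le]; linarith
    · have h1 := Real.sqrt_le_sqrt hab
      have h2 := Real.sqrt_nonneg b
      nlinarith [sq_sqrt hb.le, sq_sqrt (hb.le.trans hab)]
  rcases le_total b a with h | h
  · rw [abs_of_nonneg (sub_nonneg.2 h)]; exact key a b h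
  · rw [abs_sub_comm, abs_of_nonneg (sub_nonneg.2 h), ← neg_sub, neg_sq]; exact key b a h

lemma memLp_sqrt {f : X → ℝ} (hf : Integrable f μ) : MemLp (fun x => 2 * √(f x)) 2 μ := by
  have hm : AEStronglyMeasurable (fun x => 2 * √(f x)) μ :=
    (continuous_sqrt.comp_aestronglyMeasurable hf.1).const_mul 2
  refine (memLp_two_iff_integrable_sq hm).2 ((hf.abs.const_mul 4).mono (hm.pow 2) (.of_forall fun x => ?_))
  have h1 := sqrt_sub_sqrt_sq_le (f x) 0
  rw [Real.sqrt_zero, sub_zero, sub_zero] at h1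
  rw [norm_eq_abs, norm_eq_abs, abs_of_nonneg (sq_nonneg _), abs_of_nonneg (by positivity)]
  linarith

/-- Twice the square root of an integrable function. -/
def sqrtLp {f : X → ℝ} (hf : Integrable f μ) : Lp ℝ 2 μ := (memLp_sqrt hf).toLp _

lemma coeFn_sqrtLp {f : X → ℝ} (hf : Integrable f μ) : sqrtLp hf =ᵐ[μ] fun x => 2 * √(f x) :=
  (memLp_sqrt hf).coeFn_toLp

lemma norm_sqrtLp_sub_sq_le {f g : X → ℝ} (hf : Integrable f μ) (hg : Integrable g μ) :
    ‖sqrtLp hf - sqrtLp hg‖ ^ 2 ≤ 4 * ∫ x, |f x - g x| ∂μ := by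
  rw [L2.norm_sq_eq_integral, ← integral_const_mul]
  refine integral_mono_ae (L2.integrable_sq _) ((hf.sub hg).abs.const_mul 4) ?_
  filter_upwards [Lp.coeFn_sub (sqrtLp hf) (sqrtLp hg), coeFn_sqrtLp hf, coeFn_sqrtLp hg] with x h1 h2 h3
  rw [h1, Pi.sub_apply, h2, h3]
  have h4 := sqrt_sub_sqrt_sq_le (f x) (g x)
  linarith

lemma coeFn_sqrtLp_sq {f : X → ℝ} (hf : Integrable f μ) (h0 : 0 ≤ᵐ[μ] f) :
    ∀ᵐ x ∂μ, sqrtLp hf x ^ 2 / 4 = f x := by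
  filter_upwards [coeFn_sqrtLp hf, h0] with x h1 h2
  rw [h1, mul_pow, sq_sqrt h2]
  ring

lemma L2.integral_abs_coe_sub (F G : Lp ℝ 2 μ) :
    ∫ x, |F x - G x| ∂μ = ∫ x, |(F - G) x| ∂μ :=
  integral_congr_ae ((Lp.coeFn_sub F G).mono fun x hx => by simp only [hx, Pi.sub_apply])

variable [IsFiniteMeasure μ]

lemma L2.integral_abs_le (F : Lp ℝ 2 μ) :
    ∫ x, |F x| ∂μ ≤ ‖F‖ * ‖Lp.const 2 μ (1 : ℝ)‖ := by
  have h1 := L2.integral_abs_mul_le F (Lp.const 2 μ 1)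
  refine le_trans (le_of_eq (integral_congr_ae ?_)) h1
  filter_upwards [Lp.coeFn_const 2 μ (1 : ℝ)] with x hx
  rw [hx, Function.const_apply, abs_one, mul_one]

lemma L2.integral_abs_sub_le (F G H : Lp ℝ 2 μ) :
    ∫ x, |F x - H x| ∂μ ≤ (∫ x, |F x - G x| ∂μ) + ∫ x, |G x - H x| ∂μ := by
  have i1 : Integrable (fun x => |F x - G x|) μ := ((L2.integrable F).sub (L2.integrable G)).abs
  have i2 : Integrable (fun x => |G x - H x|) μ := ((L2.integrable G).sub (L2.integrable H)).abs
  rw [← integral_add i1 i2]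
  exact integral_mono (((L2.integrable F).sub (L2.integrable H)).abs) (i1.add i2) fun x => abs_sub_le _ _ _

lemma IsMarkov.integral_abs_sub_le {B : Lp ℝ 2 μ →L[ℝ] Lp ℝ 2 μ} (hB : IsMarkov B) (F G : Lp ℝ 2 μ) :
    ∫ x, |B F x - B G x| ∂μ ≤ ∫ x, |F x - G x| ∂μ := by
  rw [L2.integral_abs_coe_sub, L2.integral_abs_coe_sub, ← map_sub]
  exact hB.integral_abs_le _

/-- The primitive of a Lipschitz function, and the functional it defines on square integrable
functions. -/
def primitiveFunctional (μ : Measure X) (g : ℝ → ℝ) (F : Lp ℝ 2 μ) : ℝ := ∫ x, (∫ r in (0 : ℝ)..F x, g r) ∂μ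

/-- The composition of a square integrable function with a Lipschitz function. -/
def lipComp {K : NNReal} {g : ℝ → ℝ} (hg : LipschitzWith K g) (F : Lp ℝ 2 μ) : Lp ℝ 2 μ :=
  LipschitzWith.compLp (g := fun r => g r - g 0)
    (show LipschitzWith K fun r => g r - g 0 from fun a b => by simpa [edist_dist, dist_eq] using hg a b)
    (sub_self _) F + Lp.const 2 μ (g 0)

lemma coeFn_lipComp {K : NNReal} {g : ℝ → ℝ} (hg : LipschitzWith K g) (F : Lp ℝ 2 μ) :
    lipComp hg F =ᵐ[μ] fun x => g (F x) := by
  refine (Lp.coeFn_add _ _).trans ?_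
  filter_upwards [LipschitzWith.coeFn_compLp
    (show LipschitzWith K fun r => g r - g 0 from fun a b => by
      simpa [edist_dist, dist_eq] using hg a b)
    (sub_self _) F, Lp.coeFn_const 2 μ (g 0)] with x h1 h2
  rw [Pi.add_apply, h1, h2]
  simp

lemma continuous_lipComp {K : NNReal} {g : ℝ → ℝ} (hg : LipschitzWith K g) :
    Continuous fun F : Lp ℝ 2 μ => lipComp hg F :=
  (LipschitzWith.continuous_compLp _ _).add_const _

lemma abs_primitive_sub_le {K : NNReal} {g : ℝ → ℝ} (hg : LipschitzWith K g) (a b : ℝ) :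
    |(∫ r in (0 : ℝ)..b, g r) - (∫ r in (0 : ℝ)..a, g r) - g a * (b - a)| ≤ K * (b - a) ^ 2 := by
  have hi : ∀ a b, IntervalIntegrable g volume a b := fun a b => hg.continuous.intervalIntegrable _ _
  have e : (∫ r in 0..b, g r) - (∫ r in 0..a, g r) - g a * (b - a)
      = ∫ r in a..b, (g r - g a) := by
    rw [intervalIntegral.integral_interval_sub_left (hi _ _) (hi _ _),
      intervalIntegral.integral_sub (hi _ _) intervalIntegrable_const, intervalIntegral.integral_const,
      smul_eq_mul]
    ring
  rw [e, ← norm_eq_abs]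
  refine (intervalIntegral.norm_integral_le_of_norm_le_const (C := K * |b - a|) fun r hr => ?_).trans_eq ?_
  · have h1 := hg.dist_le_mul r a
    rw [dist_eq, dist_eq] at h1
    refine h1.trans (mul_le_mul_of_nonneg_left ?_ K.2)
    exact abs_sub_left_of_mem_uIcc (uIoc_subset_uIcc hr)
  · rw [mul_assoc, ← sq, sq_abs]

lemma integrable_primitive {K : NNReal} {g : ℝ → ℝ} (hg : LipschitzWith K g) (F : Lp ℝ 2 μ) :
    Integrable (fun x => ∫ r in (0 : ℝ)..F x, g r) μ := by
  have hc : Continuous fun b => ∫ r in 0..b, g r :=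
    continuous_iff_continuousAt.2 fun b => (hasDerivAt_integral hg.continuous 0 b).continuousAt
  refine (((L2.integrable F).abs.const_mul |g 0|).add ((L2.integrable_sq F).const_mul K)).mono
    (hc.comp_aestronglyMeasurable (Lp.aestronglyMeasurable F)) (.of_forall fun x => ?_)
  have h1 := abs_primitive_sub_le hg 0 (F x)
  rw [intervalIntegral.integral_same, sub_zero, sub_zero] at h1
  have h2 := abs_sub_abs_le_abs_sub (∫ r in 0..F x, g r) (g 0 * F x)
  rw [abs_mul] at h2
  rw [norm_eq_abs, norm_eq_abs, Pi.add_apply]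
  refine le_trans ?_ (le_abs_self _)
  linarith

/-- The gradient of the functional given by a primitive is the composition with the function. -/
lemma hasDerivAt_primitiveFunctional {K : NNReal} {g : ℝ → ℝ} (hg : LipschitzWith K g)
    {H : ℝ → Lp ℝ 2 μ} {H' : Lp ℝ 2 μ} {t : ℝ} (hH : HasDerivAt H H' t) :
    HasDerivAt (fun t => primitiveFunctional μ g (H t)) ⟪lipComp hg (H t), H'⟫ t := by
  have h1 : HasFDerivAt (primitiveFunctional μ g) (innerSL ℝ (lipComp hg (H t))) (H t) := by
    refine HasFDerivAt.of_isLittleO ?_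
    have hO : (fun G : Lp ℝ 2 μ => primitiveFunctional μ g G - primitiveFunctional μ g (H t)
        - innerSL ℝ (lipComp hg (H t)) (G - H t)) =O[𝓝 (H t)] fun G => ‖G - H t‖ ^ 2 := by
      refine Asymptotics.IsBigO.of_bound K (.of_forall fun G => ?_)
      have e : primitiveFunctional μ g G - primitiveFunctional μ g (H t)
          - innerSL ℝ (lipComp hg (H t)) (G - H t)
          = ∫ x, ((∫ r in 0..G x, g r) - (∫ r in 0..H t x, g r)
              - lipComp hg (H t) x * (G - H t) x) ∂μ := by
        have i1 : Integrable (fun x => (∫ r in 0..G x, g r) - ∫ r in 0..H t x, g r) μ :=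
          (integrable_primitive hg _).sub (integrable_primitive hg _)
        rw [integral_sub i1 (L2.integrable_mul _ _),
          integral_sub (integrable_primitive hg _) (integrable_primitive hg _),
          innerSL_apply_apply, L2.inner_eq_integral]
        rfl
      rw [e, norm_pow, norm_norm, L2.norm_sq_eq_integral, ← integral_const_mul]
      refine norm_integral_le_of_norm_le ((L2.integrable_sq _).const_mul _) ?_
      filter_upwards [Lp.coeFn_sub G (H t), coeFn_lipComp hg (H t)] with x h2 h3
      rw [h2, h3, Pi.sub_apply]
      exact abs_primitive_sub_le hg _ _
    refine hO.trans_isLittleO ?_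
    have h2 : (fun G : Lp ℝ 2 μ => ‖G - H t‖ ^ 2) =o[𝓝 (H t)] fun G => ‖G - H t‖ := by
      refine (Asymptotics.isLittleO_pow_id one_lt_two).comp_tendsto ?_
      have : Continuous fun G : Lp ℝ 2 μ => ‖G - H t‖ := by fun_prop
      simpa using this.tendsto (H t)
    exact h2.of_norm_right
  exact h1.comp_hasDerivAt t hH

end Curves

/-! ### The approximating flows and their limit -/

/-- Truncation to the interval `[1/(n+1), n+1]`. -/
def clip (n : ℕ) (r : ℝ) : ℝ := max (1 / (n + 1)) (min r (n + 1))

lemma lower_pos (n : ℕ) : (0 : ℝ) < 1 / (n + 1) := by positivity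

lemma lower_le_one (n : ℕ) : (1 : ℝ) / (n + 1) ≤ 1 := by
  rw [div_le_one (by positivity)]
  linarith

lemma lower_le_clip (n : ℕ) (r : ℝ) : 1 / ((n : ℝ) + 1) ≤ clip n r := le_max_left _ _

lemma clip_pos (n : ℕ) (r : ℝ) : 0 < clip n r := (lower_pos n).trans_le (lower_le_clip n r)

lemma clip_le (n : ℕ) (r : ℝ) : clip n r ≤ n + 1 :=
  max_le ((lower_le_one n).trans (by linarith)) (min_le_right _ _)

lemma continuous_clip (n : ℕ) : Continuous (clip n) := by unfold clip; fun_prop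

lemma clip_le_add_one (n : ℕ) {r : ℝ} (hr : 0 ≤ r) : clip n r ≤ r + 1 :=
  max_le ((lower_le_one n).trans (by linarith)) ((min_le_left _ _).trans (by linarith))

lemma clip_cases (n : ℕ) (r : ℝ) :
    clip n r = r ∨ (clip n r ≤ 1) ∨ (1 ≤ clip n r ∧ clip n r ≤ r) := by
  have h1 := lower_le_one n
  have h2 : (1 : ℝ) ≤ n + 1 := by linarith
  unfold clip
  rcases le_total r (n + 1) with h | h
  · rw [min_eq_left h]
    rcases le_total (1 / ((n : ℝ) + 1)) r with h3 | h3
    · left; exact max_eq_right h3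
    · right; left; rw [max_eq_left h3]; exact h1
  · rw [min_eq_right h]
    right; right
    exact ⟨h2.trans (le_max_right _ _), max_le (h1.trans (h2.trans h)) h⟩

lemma tendsto_clip {r : ℝ} (hr : 0 ≤ r) : Tendsto (fun n => clip n r) atTop (𝓝 r) := by
  have h1 : Tendsto (fun n : ℕ => max (1 / ((n : ℝ) + 1)) r) atTop (𝓝 (max 0 r)) :=
    tendsto_one_div_add_atTop_nhds_zero_nat.max tendsto_const_nhds
  rw [max_eq_right hr] at h1
  refine h1.congr' ?_
  filter_upwards [eventually_ge_atTop ⌈r⌉₊] with n hn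
  have h2 : r ≤ n + 1 := (Nat.le_ceil r).trans ((Nat.cast_le.2 hn).trans (by linarith))
  rw [clip, min_eq_left h2]

lemma abs_mul_log_le_one {r : ℝ} (h0 : 0 ≤ r) (h1 : r ≤ 1) : |r * log r| ≤ 1 := by
  rcases h0.eq_or_lt with h | h
  · simp [← h]
  · rw [mul_comm]; exact (Real.abs_log_mul_self_lt r h h1).le

lemma neg_one_le_mul_log {r : ℝ} (h0 : 0 ≤ r) : -1 ≤ r * log r := by
  rcases le_total r 1 with h | h
  · exact (abs_le.1 (abs_mul_log_le_one h0 h)).1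
  · linarith [mul_nonneg h0 (log_nonneg h)]

lemma abs_clip_mul_log_le (n : ℕ) {r : ℝ} (hr : 0 ≤ r) :
    |clip n r * log (clip n r)| ≤ |r * log r| + 1 := by
  rcases clip_cases n r with h | h | ⟨h, h'⟩
  · rw [h]; linarith
  · linarith [abs_mul_log_le_one (clip_pos n r).le h, abs_nonneg (r * log r)]
  · rw [abs_of_nonneg (mul_nonneg (clip_pos n r).le (log_nonneg h)),
      abs_of_nonneg (mul_nonneg hr (log_nonneg (h.trans h')))]
    have := mul_le_mul h' (log_le_log (by linarith) h') (log_nonneg h) hr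
    linarith

/-- Densities with respect to the Gibbs measure that have finite entropy. -/
structure FiniteEntropy (s σ : ℝ) (h : TorusConfig N d → ℝ) : Prop where
  nonneg : 0 ≤ᵐ[gibbsMeasure N d s σ] h
  integrable : Integrable h (gibbsMeasure N d s σ)
  entropy : Integrable (fun x => h x * log (h x)) (gibbsMeasure N d s σ)

namespace FiniteEntropy

variable {h₀ : TorusConfig N d → ℝ} (h : FiniteEntropy s σ h₀)

include h

lemma memLp_clip (n : ℕ) : MemLp (fun x => clip n (h₀ x)) 2 𝔪 := by
  refine MemLp.of_bound ((continuous_clip n).comp_aestronglyMeasurable h.integrable.1) (n + 1)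
    (.of_forall fun x => ?_)
  rw [norm_of_nonneg (clip_pos n _).le]
  exact clip_le n _

/-- The truncated datum. -/
def cut (n : ℕ) : GibbsL2 N d s σ := (h.memLp_clip n).toLp _

lemma coeFn_cut (n : ℕ) : h.cut n =ᵐ[𝔪] fun x => clip n (h₀ x) := (h.memLp_clip n).coeFn_toLp

lemma tendsto_cut : Tendsto (fun n => ∫ x, |h.cut n x - h₀ x| ∂𝔪) atTop (𝓝 0) := by
  have h1 : Tendsto (fun n => ∫ x, |clip n (h₀ x) - h₀ x| ∂𝔪) atTop (𝓝 (∫ _, 0 ∂𝔪)) := by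
    refine tendsto_integral_of_dominated_convergence (fun x => 2 * |h₀ x| + 1) (fun n => ?_)
      ((h.integrable.abs.const_mul 2).add (integrable_const 1)) (fun n => ?_) ?_
    · exact (((continuous_clip n).comp_aestronglyMeasurable h.integrable.1).sub h.integrable.1).norm
    · filter_upwards [h.nonneg] with x hx
      rw [norm_eq_abs, abs_abs, abs_of_nonneg hx]
      have h2 := clip_le_add_one n hx
      have h3 := clip_pos n (h₀ x)
      rw [Pi.zero_apply] at hx
      exact abs_le.2 ⟨by linarith, by linarith⟩
    · filter_upwards [h.nonneg] with x hx
      have := ((tendsto_clip hx).sub_const (h₀ x)).abs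
      simpa using this
  rw [integral_zero] at h1
  refine h1.congr fun n => integral_congr_ae ?_
  filter_upwards [h.coeFn_cut n] with x hx
  rw [hx]

lemma tendsto_integral_cut :
    Tendsto (fun n => ∫ x, h.cut n x ∂𝔪) atTop (𝓝 (∫ x, h₀ x ∂𝔪)) := by
  rw [tendsto_iff_norm_sub_tendsto_zero]
  refine squeeze_zero (fun _ => norm_nonneg _) (fun n => ?_) h.tendsto_cut
  rw [← integral_sub (L2.integrable _) h.integrable]
  exact norm_integral_le_integral_norm _

lemma tendsto_entropy_cut :
    Tendsto (fun n => ∫ x, h.cut n x * log (h.cut n x) ∂𝔪) atTop (𝓝 (∫ x, h₀ x * log (h₀ x) ∂𝔪)) := by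
  have h1 : Tendsto (fun n => ∫ x, clip n (h₀ x) * log (clip n (h₀ x)) ∂𝔪) atTop
      (𝓝 (∫ x, h₀ x * log (h₀ x) ∂𝔪)) := by
    refine tendsto_integral_of_dominated_convergence (fun x => |h₀ x * log (h₀ x)| + 1) (fun n => ?_)
      (h.entropy.abs.add (integrable_const 1)) (fun n => ?_) ?_
    · exact continuous_mul_log.comp_aestronglyMeasurable
        ((continuous_clip n).comp_aestronglyMeasurable h.integrable.1)
    · filter_upwards [h.nonneg] with x hx
      exact abs_clip_mul_log_le n hx
    · filter_upwards [h.nonneg] with x hx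
      exact (continuous_mul_log.tendsto _).comp (tendsto_clip hx)
  refine h1.congr fun n => integral_congr_ae ?_
  filter_upwards [h.coeFn_cut n] with x hx
  rw [hx]

lemma integral_cut_le (n : ℕ) : ∫ x, h.cut n x ∂𝔪 ≤ ∫ x, (h₀ x + 1) ∂𝔪 := by
  refine integral_mono_ae (L2.integrable _) (h.integrable.add (integrable_const 1)) ?_
  filter_upwards [h.coeFn_cut n, h.nonneg] with x h1 h2
  rw [h1]
  exact clip_le_add_one n h2

/-- The flow of the Yosida approximation, started from the truncated datum. -/
def flow (n : ℕ) (t : ℝ) : GibbsL2 N d s σ := (𝓔).T (n + 1) (σ * t) (h.cut n)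

/-- The resolvent applied to the approximating flow. -/
def smoothFlow (n : ℕ) (t : ℝ) : GibbsL2 N d s σ := (𝓔).P (n + 1) (h.flow n t)

omit h in
lemma succ_pos (n : ℕ) : (0 : ℝ) < n + 1 := by positivity

lemma flow_zero (n : ℕ) : h.flow n 0 = h.cut n := by
  rw [flow, mul_zero, ClosedForm.T_zero]

lemma hasDerivAt_flow (n : ℕ) (t : ℝ) :
    HasDerivAt (h.flow n) (-(σ • (𝓔).A (n + 1) (h.flow n t))) t := by
  have h1 := (𝓔).hasDerivAt_T (n + 1) (σ * t) (h.cut n)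
  have h2 : HasDerivAt (fun t : ℝ => σ * t) σ t := by simpa using (hasDerivAt_id t).const_mul σ
  have h3 := h1.scomp t h2
  rw [smul_neg] at h3
  exact h3

lemma continuous_flow (n : ℕ) : Continuous (h.flow n) :=
  continuous_iff_continuousAt.2 fun t => (h.hasDerivAt_flow n t).continuousAt

lemma continuous_smoothFlow (n : ℕ) : Continuous (h.smoothFlow n) :=
  ((𝓔).P (n + 1)).continuous.comp (h.continuous_flow n)

omit h in
lemma isMarkov_time (n : ℕ) {t : ℝ} (ht : 0 ≤ t) : IsMarkov ((𝓔).T (n + 1) (σ * t)) :=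
  isMarkov_T (succ_pos n) (mul_nonneg hp.out.σ_pos.le ht)

lemma flow_ge (n : ℕ) {t : ℝ} (ht : 0 ≤ t) :
    ∀ᵐ x ∂𝔪, 1 / ((n : ℝ) + 1) ≤ h.flow n t x := by
  refine (isMarkov_time n ht).ae_ge ?_
  filter_upwards [h.coeFn_cut n] with x hx
  rw [hx]
  exact lower_le_clip n _

lemma smoothFlow_ge (n : ℕ) {t : ℝ} (ht : 0 ≤ t) :
    ∀ᵐ x ∂𝔪, 1 / ((n : ℝ) + 1) ≤ h.smoothFlow n t x :=
  (isMarkov_P (succ_pos n)).ae_ge (h.flow_ge n ht)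

lemma integral_flow (n : ℕ) {t : ℝ} (ht : 0 ≤ t) :
    ∫ x, h.flow n t x ∂𝔪 = ∫ x, h.cut n x ∂𝔪 :=
  (isMarkov_time n ht).integral_eq _

lemma integral_smoothFlow (n : ℕ) {t : ℝ} (ht : 0 ≤ t) :
    ∫ x, h.smoothFlow n t x ∂𝔪 = ∫ x, h.cut n x ∂𝔪 :=
  ((isMarkov_P (succ_pos n)).integral_eq _).trans (h.integral_flow n ht)

/-- The approximating flows form a Cauchy sequence in `L¹`: by contractivity the datum may be
replaced by a fixed square integrable one. -/
lemma exists_integral_abs_sub_le {t ε : ℝ} (ht : 0 ≤ t) (hε : 0 < ε) : ∃ M : ℕ, ∀ n m : ℕ, M ≤ n → M ≤ m →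
    ∫ x, |h.flow n t x - h.flow m t x| ∂𝔪 ≤ ε ∧
    ∫ x, |h.smoothFlow n t x - h.flow m t x| ∂𝔪 ≤ ε := by
  set E := 𝓔 with hE
  set c := ‖Lp.const 2 𝔪 (1 : ℝ)‖ with hc
  have hc0 : 0 ≤ c := norm_nonneg _
  obtain ⟨k, hk⟩ := eventually_atTop.1 (h.tendsto_cut.eventually (gt_mem_nhds (show (0 : ℝ) < ε / 8 by positivity)))
  have hcut : ∀ n, k ≤ n → ∫ x, |h.cut n x - h.cut k x| ∂𝔪 ≤ ε / 4 := fun n hn => by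
    have i1 : ∀ j, Integrable (fun x => |h.cut j x - h₀ x|) 𝔪 := fun j =>
      ((L2.integrable _).sub h.integrable).abs
    have h1 : ∫ x, |h.cut n x - h.cut k x| ∂𝔪
        ≤ (∫ x, |h.cut n x - h₀ x| ∂𝔪) + ∫ x, |h.cut k x - h₀ x| ∂𝔪 := by
      rw [← integral_add (i1 n) (i1 k)]
      refine integral_mono ((L2.integrable _).sub (L2.integrable _)).abs ((i1 n).add (i1 k)) fun x => ?_
      have := abs_sub_le (h.cut n x) (h₀ x) (h.cut k x)
      rwa [abs_sub_comm (h₀ x)] at this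
    have h2 := hk n hn
    have h3 := hk k le_rfl
    linarith
  set R := fun n : ℕ => E.T (n + 1) (σ * t) (h.cut k)
  have hδ : 0 < ε / (4 * (c + 1)) := by positivity
  have hδc : ε / (4 * (c + 1)) * c ≤ ε / 4 := by
    rw [div_mul_eq_mul_div, div_le_div_iff₀ (by positivity) (by positivity)]
    nlinarith
  obtain ⟨M1, hM1⟩ := E.exists_norm_T_sub_lt (h.cut k) hδ
  have htp : Tendsto (fun n : ℕ => E.P ((n : ℝ) + 1) (h.cut k)) atTop (𝓝 (h.cut k)) :=
    (E.tendsto_P (h.cut k)).comp (tendsto_atTop_add_const_right _ _ tendsto_natCast_atTop_atTop)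
  obtain ⟨M2, hM2⟩ := Metric.tendsto_atTop.1 htp _ hδ
  have hT : ∀ n m : ℕ, ⌈M1⌉₊ ≤ n → ⌈M1⌉₊ ≤ m →
      ∫ x, |R n x - R m x| ∂𝔪 ≤ ε / 4 := fun n m hn hm => by
    rw [L2.integral_abs_coe_sub]
    have h1 : ∀ n : ℕ, ⌈M1⌉₊ ≤ n → M1 ≤ (n : ℝ) + 1 := fun n hn =>
      (Nat.le_ceil M1).trans ((Nat.cast_le.2 hn).trans (by linarith))
    have h2 := (hM1 (n + 1) (m + 1) (σ * t) (h1 n hn) (h1 m hm) (mul_nonneg hp.out.σ_pos.le ht) le_rfl).le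
    exact (L2.integral_abs_le _).trans ((mul_le_mul_of_nonneg_right h2 hc0).trans hδc)
  have hflow : ∀ n, k ≤ n → ∫ x, |h.flow n t x - R n x| ∂𝔪 ≤ ε / 4 := fun n hn =>
    ((isMarkov_time n ht).integral_abs_sub_le _ _).trans (hcut n hn)
  have hsm : ∀ n, k ≤ n → M2 ≤ n → ∫ x, |h.smoothFlow n t x - R n x|
      ∂𝔪 ≤ ε / 4 + ε / 4 := fun n hn hn2 => by
    have h1 := L2.integral_abs_sub_le (h.smoothFlow n t) (E.P (n + 1) (R n))
      (R n)
    have h2 := ((isMarkov_P (succ_pos n)).integral_abs_sub_le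
      (h.flow n t) (R n)).trans (hflow n hn)
    have h3 : E.P (n + 1) (R n) = E.T (n + 1) (σ * t) (E.P (n + 1) (h.cut k)) :=
      (DFunLike.congr_fun (E.T_comm (E.P_comm_A (succ_pos n) (succ_pos n)) (σ * t)).eq (h.cut k)).symm
    have h4 : ∫ x, |E.P (n + 1) (R n) x - R n x|
        ∂𝔪 ≤ ε / 4 := by
      rw [h3]
      refine ((isMarkov_time n ht).integral_abs_sub_le _ _).trans ?_
      rw [L2.integral_abs_coe_sub]
      have h5 := (hM2 n hn2).le
      rw [dist_eq_norm] at h5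
      exact (L2.integral_abs_le _).trans ((mul_le_mul_of_nonneg_right h5 hc0).trans hδc)
    exact h1.trans (add_le_add h2 h4)
  have hsymm : ∀ F G : GibbsL2 N d s σ, ∫ x, |F x - G x| ∂𝔪
      = ∫ x, |G x - F x| ∂𝔪 := fun F G => by simp only [abs_sub_comm]
  refine ⟨max k (max ⌈M1⌉₊ M2), fun n m hn hm => ?_⟩
  simp only [max_le_iff] at hn hm
  have h1 := hT n m hn.2.1 hm.2.1
  have h2 := hflow m hm.1
  rw [hsymm] at h2
  have h3 := L2.integral_abs_sub_le (R n) (R m) (h.flow m t)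
  constructor
  · have h4 := L2.integral_abs_sub_le (h.flow n t) (R n) (h.flow m t)
    linarith [hflow n hn.1]
  · have h4 := L2.integral_abs_sub_le (h.smoothFlow n t) (R n) (h.flow m t)
    linarith [hsm n hn.1 hn.2.2]

/-- Twice the square root of the approximating flow. -/
def root (n : ℕ) (t : ℝ) : GibbsL2 N d s σ := sqrtLp (L2.integrable (h.flow n t))

/-- Twice the square root of the resolvent of the approximating flow. -/
def smoothRoot (n : ℕ) (t : ℝ) : GibbsL2 N d s σ := sqrtLp (L2.integrable (h.smoothFlow n t))

omit h in
lemma continuous_sqrtLp : Continuous fun F : GibbsL2 N d s σ => sqrtLp (L2.integrable F) := by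
  refine continuous_iff_continuousAt.2 fun F => ?_
  rw [ContinuousAt, tendsto_iff_norm_sub_tendsto_zero]
  have h1 : Tendsto (fun G : GibbsL2 N d s σ => √(4 * (‖G - F‖ * ‖Lp.const 2 𝔪 (1 : ℝ)‖))) (𝓝 F) (𝓝 0) := by
    have : Continuous fun G : GibbsL2 N d s σ => √(4 * (‖G - F‖ * ‖Lp.const 2 𝔪 (1 : ℝ)‖)) := by fun_prop
    simpa using this.tendsto F
  refine squeeze_zero (fun _ => norm_nonneg _) (fun G => Real.le_sqrt_of_sq_le ?_) h1
  refine (norm_sqrtLp_sub_sq_le _ _).trans (mul_le_mul_of_nonneg_left ?_ (by norm_num))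
  rw [L2.integral_abs_coe_sub]
  exact L2.integral_abs_le _

lemma cauchySeq_root {t : ℝ} (ht : 0 ≤ t) : CauchySeq fun n => h.root n t := by
  refine Metric.cauchySeq_iff.2 fun ε hε => ?_
  obtain ⟨M, hM⟩ := h.exists_integral_abs_sub_le ht (show 0 < ε ^ 2 / 8 by positivity)
  refine ⟨M, fun m hm n hn => ?_⟩
  rw [dist_eq_norm]
  have h1 := (norm_sqrtLp_sub_sq_le (L2.integrable (h.flow m t)) (L2.integrable (h.flow n t)))
  have h2 := (hM m n hm hn).1
  refine lt_of_pow_lt_pow_left₀ 2 hε.le ?_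
  change ‖sqrtLp _ - sqrtLp _‖ ^ 2 < _
  nlinarith

/-- The limit of the square roots of the approximating flows. -/
def rootFlow (t : ℝ) : GibbsL2 N d s σ := limUnder atTop fun n => h.root n (max t 0)

lemma tendsto_root {t : ℝ} (ht : 0 ≤ t) : Tendsto (fun n => h.root n t) atTop (𝓝 (h.rootFlow t)) := by
  have := (h.cauchySeq_root ht).tendsto_limUnder
  unfold rootFlow
  rwa [max_eq_left ht]

lemma tendsto_smoothRoot {t : ℝ} (ht : 0 ≤ t) :
    Tendsto (fun n => h.smoothRoot n t) atTop (𝓝 (h.rootFlow t)) := by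
  have h1 : Tendsto (fun n => h.smoothRoot n t - h.root n t) atTop (𝓝 0) := by
    refine Metric.tendsto_atTop.2 fun ε hε => ?_
    obtain ⟨M, hM⟩ := h.exists_integral_abs_sub_le ht (show 0 < ε ^ 2 / 8 by positivity)
    refine ⟨M, fun n hn => ?_⟩
    rw [dist_zero_right]
    have h1 := (norm_sqrtLp_sub_sq_le (L2.integrable (h.smoothFlow n t)) (L2.integrable (h.flow n t)))
    have h2 := (hM n n hn hn).2
    refine lt_of_pow_lt_pow_left₀ 2 hε.le ?_
    change ‖sqrtLp _ - sqrtLp _‖ ^ 2 < _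
    nlinarith
  simpa using h1.add (h.tendsto_root ht)

lemma continuous_smoothRoot (n : ℕ) : Continuous (h.smoothRoot n) :=
  continuous_sqrtLp.comp (h.continuous_smoothFlow n)

lemma stronglyMeasurable_rootFlow : StronglyMeasurable h.rootFlow :=
  StronglyMeasurable.limUnder fun n => ((continuous_sqrtLp.comp (h.continuous_flow n)).comp
    (continuous_id.max continuous_const)).stronglyMeasurable

lemma smoothRoot_sq (n : ℕ) {t : ℝ} (ht : 0 ≤ t) :
    ∀ᵐ x ∂𝔪, h.smoothRoot n t x ^ 2 / 4 = h.smoothFlow n t x :=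
  coeFn_sqrtLp_sq _ ((h.smoothFlow_ge n ht).mono fun _ hx => (lower_pos n).le.trans hx)

lemma root_sq (n : ℕ) {t : ℝ} (ht : 0 ≤ t) :
    ∀ᵐ x ∂𝔪, h.root n t x ^ 2 / 4 = h.flow n t x :=
  coeFn_sqrtLp_sq _ ((h.flow_ge n ht).mono fun _ hx => (lower_pos n).le.trans hx)

lemma norm_root_sq (n : ℕ) {t : ℝ} (ht : 0 ≤ t) :
    ‖h.root n t‖ ^ 2 = 4 * ∫ x, h.cut n x ∂𝔪 := by
  rw [← h.integral_flow n ht, ← integral_const_mul, L2.norm_sq_eq_integral]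
  refine integral_congr_ae ((h.root_sq n ht).mono fun x hx => ?_)
  simp only [← hx]; ring

lemma norm_smoothRoot_sq (n : ℕ) {t : ℝ} (ht : 0 ≤ t) :
    ‖h.smoothRoot n t‖ ^ 2 = 4 * ∫ x, h.cut n x ∂𝔪 := by
  rw [← h.integral_smoothFlow n ht, ← integral_const_mul, L2.norm_sq_eq_integral]
  refine integral_congr_ae ((h.smoothRoot_sq n ht).mono fun x hx => ?_)
  simp only [← hx]; ring

/-- Conservation of mass. -/
lemma norm_rootFlow_sq {t : ℝ} (ht : 0 ≤ t) :
    ‖h.rootFlow t‖ ^ 2 = 4 * ∫ x, h₀ x ∂𝔪 := by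
  have h1 := (h.tendsto_root ht).norm.pow 2
  simp only [h.norm_root_sq _ ht] at h1
  exact tendsto_nhds_unique h1 (h.tendsto_integral_cut.const_mul 4)

lemma rootFlow_zero : h.rootFlow 0 =ᵐ[𝔪] fun x => 2 * √(h₀ x) := by
  have h1 : Tendsto (fun n => h.root n 0) atTop (𝓝 (sqrtLp h.integrable)) := by
    rw [tendsto_iff_norm_sub_tendsto_zero]
    have h2 : Tendsto (fun n => √(4 * ∫ x, |h.cut n x - h₀ x| ∂𝔪)) atTop (𝓝 0) := by
      have := (continuous_sqrt.tendsto _).comp (h.tendsto_cut.const_mul 4)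
      rw [mul_zero, Real.sqrt_zero] at this
      exact this
    refine squeeze_zero (fun _ => norm_nonneg _) (fun n => Real.le_sqrt_of_sq_le ?_) h2
    have h3 := norm_sqrtLp_sub_sq_le (L2.integrable (h.flow n 0)) h.integrable
    rw [h.flow_zero] at h3
    change ‖sqrtLp _ - _‖ ^ 2 ≤ _
    simp only [h.flow_zero]
    exact h3
  rw [tendsto_nhds_unique (h.tendsto_root le_rfl) h1]
  exact coeFn_sqrtLp h.integrable

end FiniteEntropy

/-! ### Entropy dissipation -/

/-- The logarithm, extended by a constant below `c`. -/
def logAbove (c r : ℝ) : ℝ := log (max r c)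

lemma lipschitzWith_logAbove {c : ℝ} (hc : 0 < c) :
    LipschitzWith (Real.toNNReal (1 / c)) (logAbove c) := by
  have key : ∀ a b : ℝ, b ≤ a → logAbove c a - logAbove c b ≤ 1 / c * (a - b) := fun a b hab => by
    have h1 : c ≤ max b c := le_max_right _ _
    have h2 : 0 < max b c := hc.trans_le h1
    have h3 : max b c ≤ max a c := max_le_max hab le_rfl
    have h4 : max a c - max b c ≤ a - b := by
      have := abs_max_sub_max_le_abs a b c
      rwa [abs_of_nonneg (by linarith), abs_of_nonneg (by linarith)] at this
    unfold logAbove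
    rw [← Real.log_div (h2.trans_le h3).ne' h2.ne']
    refine (Real.log_le_sub_one_of_pos (div_pos (h2.trans_le h3) h2)).trans ?_
    rw [div_sub_one h2.ne', one_div, ← div_eq_inv_mul]
    exact div_le_div₀ (by linarith) h4 hc h1
  refine LipschitzWith.of_dist_le_mul fun a b => ?_
  rw [Real.coe_toNNReal _ (by positivity), dist_eq, dist_eq]
  have mono : ∀ a b : ℝ, b ≤ a → logAbove c b ≤ logAbove c a := fun a b hab =>
    log_le_log (hc.trans_le (le_max_right _ _)) (max_le_max hab le_rfl)
  rcases le_total b a with h | h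
  · rw [abs_of_nonneg (sub_nonneg.2 (mono a b h)), abs_of_nonneg (sub_nonneg.2 h)]
    exact key a b h
  · rw [abs_sub_comm, abs_sub_comm a, abs_of_nonneg (sub_nonneg.2 (mono b a h)),
      abs_of_nonneg (sub_nonneg.2 h)]
    exact key b a h

lemma logAbove_mono {c : ℝ} (hc : 0 < c) : Monotone (logAbove c) := fun _ _ hab =>
  log_le_log (hc.trans_le (le_max_right _ _)) (max_le_max hab le_rfl)

lemma integral_logAbove_add_one {c r : ℝ} (hc : 0 < c) (hr : c ≤ r) :
    ∫ t in (0 : ℝ)..r, (logAbove c t + 1) = r * log r + c := by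
  have hcont : Continuous fun t => logAbove c t + 1 := (lipschitzWith_logAbove hc).continuous.add_const 1
  rw [← intervalIntegral.integral_add_adjacent_intervals (hcont.intervalIntegrable _ _)
    (hcont.intervalIntegrable _ _)]
  have e1 : ∫ t in 0..c, (logAbove c t + 1) = c * (log c + 1) := by
    have : ∫ t in 0..c, (logAbove c t + 1) = ∫ _ in 0..c, (log c + 1) := by
      refine intervalIntegral.integral_congr fun t ht => ?_
      rw [uIcc_of_le hc.le] at ht
      simp only [logAbove, max_eq_right ht.2]
    rw [this, intervalIntegral.integral_const, smul_eq_mul, sub_zero]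
  have e2 : ∫ t in c..r, (logAbove c t + 1) = r * log r - c * log c := by
    refine integral_eq_sub_of_hasDerivAt (f := fun t => t * log t) (fun t ht => ?_)
      (hcont.intervalIntegrable _ _)
    rw [uIcc_of_le hr] at ht
    rw [logAbove, max_eq_left ht.1]
    exact Real.hasDerivAt_mul_log (hc.trans_le ht.1).ne'
  rw [e1, e2]
  ring

namespace FiniteEntropy

variable {h₀ : TorusConfig N d → ℝ} (h : FiniteEntropy s σ h₀)

include h

/-- The dissipation `⟪log v, A H⟫` of the approximating flow `H`, where `v` is its resolvent. -/
def dissipation (n : ℕ) (t : ℝ) : ℝ := ⟪lipComp (lipschitzWith_logAbove (lower_pos n)) (h.smoothFlow n t),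
    (𝓔).A (n + 1) (h.flow n t)⟫

lemma continuous_dissipation (n : ℕ) : Continuous (h.dissipation n) :=
  ((continuous_lipComp (lipschitzWith_logAbove (lower_pos n))).comp (h.continuous_smoothFlow n)).inner
    (((𝓔).A (n + 1)).continuous.comp (h.continuous_flow n))

/-- The square root `z = 2√v` of the smoothed flow is in the domain, `∇v = (z/2) ∇z`, and its energy
is the dissipation. -/
lemma exists_domain_smoothRoot (n : ℕ) {t : ℝ} (ht : 0 ≤ t) :
    ∃ y, (𝓔).ι y = h.smoothRoot n t ∧ (∀ p, (𝓔).grad ((𝓔).J (n + 1) (h.flow n t)) p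
        =ᵐ[𝔪] fun x => 1 / 2 * (h.smoothRoot n t x * (𝓔).grad y p x)) ∧
      ‖(𝓔).grad y‖ ^ 2 = h.dissipation n t := by
  set Y := (𝓔).J (n + 1) (h.flow n t) with hY
  have hge : ∀ᵐ x ∂𝔪, 1 / ((n : ℝ) + 1) ≤ (𝓔).ι Y x := h.smoothFlow_ge n ht
  obtain ⟨y, hy1, hy2⟩ := exists_domain_sqrt (lower_pos n) Y hge
  obtain ⟨w, hw1, hw2⟩ := exists_domain_log (lower_pos n) Y hge
  have e1 : (𝓔).ι y = h.smoothRoot n t :=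
    Lp.ext (hy1.trans (coeFn_sqrtLp (L2.integrable (h.smoothFlow n t))).symm)
  refine ⟨y, e1, fun p => ?_, ?_⟩
  · filter_upwards [hy1, hy2 p, hge] with x h1 h2 h3
    rw [← e1, h1, h2]
    have h4 : 0 < √((𝓔).ι Y x) := sqrt_pos.2 ((lower_pos n).trans_le h3)
    field_simp
  · have e2 : lipComp (lipschitzWith_logAbove (lower_pos n)) (h.smoothFlow n t) = (𝓔).ι w := by
      refine Lp.ext ((coeFn_lipComp _ _).trans ?_)
      filter_upwards [hw1, hge] with x h1 h2
      change log (max ((𝓔).ι Y x) _) = _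
      rw [h1, max_eq_left h2]
    rw [dissipation, e2, real_inner_comm, ClosedForm.inner_A _ (succ_pos n), inner_grad_eq,
      ← real_inner_self_eq_norm_sq, inner_grad_eq]
    refine sum_congr rfl fun p _ => integral_congr_ae ?_
    filter_upwards [hy2 p, hw2 p, hge] with x h1 h2 h3
    rw [h1, h2]
    have h5 : 0 < (𝓔).ι Y x := (lower_pos n).trans_le h3
    have h4 : √((𝓔).ι Y x) * √((𝓔).ι Y x) = (𝓔).ι Y x := Real.mul_self_sqrt h5.le
    rw [mul_mul_mul_comm, ← mul_inv, h4]
    ring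

lemma dissipation_nonneg (n : ℕ) {t : ℝ} (ht : 0 ≤ t) : 0 ≤ h.dissipation n t := by
  obtain ⟨y, -, -, h1⟩ := h.exists_domain_smoothRoot n ht
  rw [← h1]; positivity

lemma norm_grad_J_smoothRoot_le (n m : ℕ) {t : ℝ} (ht : 0 ≤ t) :
    ‖(𝓔).grad ((𝓔).J (m + 1) (h.smoothRoot n t))‖ ^ 2 ≤ h.dissipation n t := by
  obtain ⟨y, h0, -, h1⟩ := h.exists_domain_smoothRoot n ht
  rw [← h1, ← h0]
  exact pow_le_pow_left₀ (norm_nonneg _) ((𝓔).J_ι_bounds (succ_pos m) y).1 2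

lemma entropy_dissipation_le (n : ℕ) {t : ℝ} (ht : 0 ≤ t) :
    (∫ x, h.flow n t x * log (h.flow n t x) ∂𝔪) + σ * ∫ τ in (0 : ℝ)..t, h.dissipation n τ
      ≤ ∫ x, h.cut n x * log (h.cut n x) ∂𝔪 := by
  set E := 𝓔 with hE
  set c : ℝ := 1 / (n + 1) with hc
  have hc0 : 0 < c := lower_pos n
  have hlip := (lipschitzWith_logAbove hc0)
  have hg : LipschitzWith (Real.toNNReal (1 / c)) (fun r => logAbove c r + 1) := fun a b => by
    simpa [edist_dist, dist_eq] using hlip a b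
  have hder := fun t => hasDerivAt_primitiveFunctional hg (h.hasDerivAt_flow n t)
  have hcont : Continuous fun t => ⟪lipComp hg (h.flow n t), -(σ • E.A (n + 1) (h.flow n t))⟫ :=
    ((continuous_lipComp hg).comp (h.continuous_flow n)).inner
      (((E.A (n + 1)).continuous.comp (h.continuous_flow n)).const_smul σ).neg
  have hftc := integral_eq_sub_of_hasDerivAt (a := 0) (b := t) (fun r _ => hder r)
    (hcont.intervalIntegrable _ _)
  have hval : ∀ {r : ℝ}, 0 ≤ r → primitiveFunctional 𝔪 (fun r => logAbove c r + 1)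
      (h.flow n r) = (∫ x, h.flow n r x * log (h.flow n r x) ∂𝔪) + ∫ _, c ∂𝔪 := by
    intro r hr
    have hi := integrable_primitive hg (h.flow n r)
    have hae : (fun x => ∫ t in 0..h.flow n r x, (logAbove c t + 1)) =ᵐ[𝔪]
        fun x => h.flow n r x * log (h.flow n r x) + c := by
      filter_upwards [h.flow_ge n hr] with x hx
      exact integral_logAbove_add_one hc0 hx
    have hi2 : Integrable (fun x => h.flow n r x * log (h.flow n r x)) 𝔪 := by
      refine ((hi.congr hae).sub (integrable_const c)).congr (.of_forall fun x => ?_)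
      simp
    rw [primitiveFunctional, integral_congr_ae hae, integral_add hi2 (integrable_const c)]
  rw [hval ht, hval le_rfl, h.flow_zero] at hftc
  -- replace `log H` by `log v`, whose pairing with the generator is the energy of `2√v`
  have hle : ∀ r ∈ Icc 0 t, ⟪lipComp hg (h.flow n r), -(σ • E.A (n + 1) (h.flow n r))⟫
      ≤ -(σ * h.dissipation n r) := fun r hr => by
    set F := h.flow n r
    set S := h.smoothFlow n r
    set A := E.A (n + 1) F with hA
    set G := lipComp hg F
    set L := lipComp hlip F
    rw [inner_neg_right, inner_smul_right, neg_le_neg_iff]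
    refine mul_le_mul_of_nonneg_left ?_ hp.out.σ_pos.le
    -- The constant drops out by conservation of mass, and the logarithm is increasing.
    have e1 : ∫ x, A x ∂𝔪 = 0 := by
      rw [← L2.inner_one, hA, ClosedForm.A_apply, real_inner_smul_left, inner_sub_left,
        (isMarkov_P (succ_pos n)).inner_one, sub_self, mul_zero]
    have e2 : ⟪G, A⟫
        = ⟪L, A⟫ := by
      rw [L2.inner_eq_integral, L2.inner_eq_integral]
      have h1 : (fun x => G x * A x)
          =ᵐ[𝔪] fun x => L x * A x
            + A x := by
        filter_upwards [coeFn_lipComp hg F, coeFn_lipComp hlip F] with x h1 h2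
        rw [h1, h2]; ring
      rw [integral_congr_ae h1, integral_add (L2.integrable_mul _ _) (L2.integrable _), e1, add_zero]
    rw [e2, dissipation, ← sub_nonneg, ← inner_sub_left, L2.inner_eq_integral]
    refine integral_nonneg_of_ae ?_
    filter_upwards [Lp.coeFn_sub L (lipComp hlip S),
      coeFn_lipComp hlip F, coeFn_lipComp hlip S,
      Lp.coeFn_smul ((n : ℝ) + 1) (F - S),
      Lp.coeFn_sub F S] with x h1 h2 h3 h4 h5
    have h6 : A x = ((n : ℝ) + 1) * (F x - S x) := by
      rw [hA, ClosedForm.A_apply]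
      change (((n : ℝ) + 1) • (F - S)) x = _
      rw [h4, Pi.smul_apply, h5, Pi.sub_apply, smul_eq_mul]
    rw [Pi.zero_apply, h1, Pi.sub_apply, h2, h3, h6, mul_left_comm]
    refine mul_nonneg (succ_pos n).le ?_
    rcases le_total (F x) (S x) with h7 | h7
    · exact mul_nonneg_of_nonpos_of_nonpos (sub_nonpos.2 (logAbove_mono hc0 h7)) (sub_nonpos.2 h7)
    · exact mul_nonneg (sub_nonneg.2 (logAbove_mono hc0 h7)) (sub_nonneg.2 h7)
  have hcd : Continuous fun r => -(σ * h.dissipation n r) := ((h.continuous_dissipation n).const_mul σ).neg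
  have hint := intervalIntegral.integral_mono_on (μ := volume) ht (hcont.intervalIntegrable _ _)
    (hcd.intervalIntegrable _ _) hle
  rw [intervalIntegral.integral_neg, intervalIntegral.integral_const_mul] at hint
  linarith

/-- The density of the limit flow with respect to the Gibbs measure. -/
def density (t : ℝ) (x : TorusConfig N d) : ℝ := h.rootFlow t x ^ 2 / 4

/-- A bound for the total dissipation that does not depend on the approximation. -/
lemma exists_dissipation_le : ∃ K : ℝ, ∀ (n : ℕ) {t : ℝ}, 0 ≤ t →
    ∫ τ in (0 : ℝ)..t, h.dissipation n τ ≤ K := by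
  obtain ⟨B, hB⟩ := h.tendsto_entropy_cut.bddAbove_range
  refine ⟨(B + ∫ _ : TorusConfig N d, 1 ∂𝔪) / σ, fun n t ht => ?_⟩
  have h1 := h.entropy_dissipation_le n ht
  have h2 := hB ⟨n, rfl⟩
  have h3 : -∫ _ : TorusConfig N d, 1 ∂𝔪 ≤ ∫ x, h.flow n t x * log (h.flow n t x) ∂𝔪 := by
    rw [← integral_neg]
    by_cases hi : Integrable (fun x => h.flow n t x * log (h.flow n t x)) 𝔪
    · refine integral_mono_ae (integrable_const _) hi ((h.flow_ge n ht).mono fun x hx => ?_)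
      exact neg_one_le_mul_log ((lower_pos n).le.trans hx)
    · rw [integral_undef hi]
      exact integral_nonpos fun _ => by simp
  rw [le_div_iff₀ hp.out.σ_pos]
  dsimp only at h2
  linarith

lemma integrable_flow_mul_log (n : ℕ) {t : ℝ} (ht : 0 ≤ t) :
    Integrable (fun x => h.flow n t x * log (h.flow n t x)) 𝔪 := by
  refine ((L2.integrable_sq (h.flow n t)).add (integrable_const 1)).mono
    (continuous_mul_log.comp_aestronglyMeasurable (Lp.aestronglyMeasurable _))
    ((h.flow_ge n ht).mono fun x hx => ?_)
  have h0 := (lower_pos n).le.trans hx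
  rw [Pi.add_apply, norm_eq_abs, norm_of_nonneg (by positivity)]
  rcases le_total (h.flow n t x) 1 with h1 | h1
  · linarith [abs_mul_log_le_one h0 h1, sq_nonneg (h.flow n t x)]
  · rw [abs_of_nonneg (mul_nonneg h0 (log_nonneg h1))]
    nlinarith [Real.log_le_self h0]

/-- The entropy inequality, with the energy of the resolvent of the limit in place of the
dissipation. -/
lemma entropy_le (m : ℕ) {t : ℝ} (ht : 0 ≤ t) :
    Integrable (fun x => h.density t x * log (h.density t x)) 𝔪 ∧
    (∫ x, h.density t x * log (h.density t x) ∂𝔪) + σ * ∫ τ in (0 : ℝ)..t,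
        ‖(𝓔).grad ((𝓔).J (m + 1) (h.rootFlow τ))‖ ^ 2
      ≤ ∫ x, h₀ x * log (h₀ x) ∂𝔪 := by
  set E := 𝓔 with hE
  have hcE : Continuous fun z : GibbsL2 N d s σ => ‖E.grad (E.J (m + 1) z)‖ ^ 2 := by fun_prop
  have hEb : ∀ z : GibbsL2 N d s σ, ‖E.grad (E.J (m + 1) z)‖ ^ 2 ≤ ‖E.grad ∘L E.J (m + 1)‖ ^ 2 * ‖z‖ ^ 2 := fun z => by
    rw [← mul_pow]
    exact pow_le_pow_left₀ (norm_nonneg _) ((E.grad ∘L E.J (m + 1)).le_opNorm z) 2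
  set R := ∫ x, (h₀ x + 1) ∂𝔪 with hR
  have hlim1 : Tendsto (fun n => ∫ τ in 0..t, ‖E.grad (E.J (m + 1) (h.smoothRoot n τ))‖ ^ 2) atTop
      (𝓝 (∫ τ in 0..t, ‖E.grad (E.J (m + 1) (h.rootFlow τ))‖ ^ 2)) := by
    refine intervalIntegral.tendsto_integral_filter_of_dominated_convergence
      (fun _ => ‖E.grad ∘L E.J (m + 1)‖ ^ 2 * (4 * R)) (.of_forall fun n => ?_)
      (.of_forall fun n => Eventually.of_forall fun τ hτ => ?_) intervalIntegrable_const
      (.of_forall fun τ hτ => ?_)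
    · exact (hcE.comp (h.continuous_smoothRoot n)).aestronglyMeasurable
    · rw [uIoc_of_le ht] at hτ
      rw [norm_of_nonneg (by positivity)]
      refine (hEb _).trans (mul_le_mul_of_nonneg_left ?_ (by positivity))
      rw [h.norm_smoothRoot_sq n hτ.1.le]
      gcongr; exact h.integral_cut_le n
    · rw [uIoc_of_le ht] at hτ
      exact (hcE.tendsto _).comp (h.tendsto_smoothRoot hτ.1.le)
  have hn : ∀ n, (∫ x, (h.flow n t x * log (h.flow n t x) + 1) ∂𝔪) ≤ (∫ x, h.cut n x * log (h.cut n x) ∂𝔪)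
        + (∫ _, 1 ∂𝔪)
        - σ * ∫ τ in 0..t, ‖E.grad (E.J (m + 1) (h.smoothRoot n τ))‖ ^ 2 := fun n => by
    rw [integral_add (h.integrable_flow_mul_log n ht) (integrable_const 1)]
    have h1 := h.entropy_dissipation_le n ht
    have h2 : ∫ τ in 0..t, ‖E.grad (E.J (m + 1) (h.smoothRoot n τ))‖ ^ 2
        ≤ ∫ τ in 0..t, h.dissipation n τ :=
      intervalIntegral.integral_mono_on ht ((hcE.comp (h.continuous_smoothRoot n)).intervalIntegrable _ _)
        ((h.continuous_dissipation n).intervalIntegrable _ _)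
        fun τ hτ => h.norm_grad_J_smoothRoot_le n m hτ.1
    have h3 := mul_le_mul_of_nonneg_left h2 hp.out.σ_pos.le
    linarith
  obtain ⟨ns, hns, hae⟩ := (tendstoInMeasure_of_tendsto_Lp (h.tendsto_root ht)).exists_seq_tendsto_ae
  have hfat := integrable_and_integral_le_of_tendsto
    (f := fun j x => h.flow (ns j) t x * log (h.flow (ns j) t x) + 1)
    (g := fun x => h.density t x * log (h.density t x) + 1)
    (fun j => (h.integrable_flow_mul_log (ns j) ht).add (integrable_const 1))
    (fun j => (h.flow_ge (ns j) ht).mono fun x hx => by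
      have := neg_one_le_mul_log ((lower_pos (ns j)).le.trans hx)
      simp only [Pi.zero_apply]
      linarith) (fun j => hn (ns j))
    ((((h.tendsto_entropy_cut.add_const _).sub (hlim1.const_mul σ))).comp hns.tendsto_atTop) (by
      filter_upwards [hae, ae_all_iff.2 fun n => h.root_sq n ht] with x h1 h2
      have h3 : Tendsto (fun j => h.flow (ns j) t x) atTop (𝓝 (h.density t x)) := by
        simp only [← h2]
        exact (h1.pow 2).div_const 4
      exact ((continuous_mul_log.tendsto _).comp h3).add_const 1)
  have hi : Integrable (fun x => h.density t x * log (h.density t x)) 𝔪 := by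
    refine (hfat.1.sub (integrable_const 1)).congr (.of_forall fun x => ?_)
    simp
  refine ⟨hi, ?_⟩
  have h4 := hfat.2
  rw [integral_add hi (integrable_const 1)] at h4
  linarith

end FiniteEntropy

/-! ### The gradient of the limit flow -/

namespace FiniteEntropy

variable {h₀ : TorusConfig N d → ℝ} (h : FiniteEntropy s σ h₀)

include h

/-- The energy of the resolvent of the limit flow. -/
def energy (m : ℕ) (τ : ℝ) : ℝ := ‖(𝓔).grad ((𝓔).J (m + 1) (h.rootFlow τ))‖ ^ 2

lemma stronglyMeasurable_grad_J (m : ℕ) : StronglyMeasurable fun τ =>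
    (𝓔).grad ((𝓔).J (m + 1) (h.rootFlow τ)) :=
  ((𝓔).grad.continuous.comp ((𝓔).J (m + 1)).continuous).comp_stronglyMeasurable h.stronglyMeasurable_rootFlow

lemma measurable_energy (m : ℕ) : Measurable (h.energy m) :=
  ((h.stronglyMeasurable_grad_J m).norm.measurable).pow_const 2

lemma energy_nonneg (m : ℕ) (τ : ℝ) : 0 ≤ h.energy m τ := sq_nonneg _

lemma monotone_energy : Monotone h.energy := fun m m' hm τ => by
  have h1 := (𝓔).norm_grad_J_sub_sq_le (succ_pos m)
    (show (m : ℝ) + 1 ≤ m' + 1 by have := Nat.cast_le (α := ℝ).2 hm; linarith) (h.rootFlow τ)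
  unfold energy
  linarith [sq_nonneg ‖(𝓔).grad ((𝓔).J (m' + 1) (h.rootFlow τ)) - (𝓔).grad ((𝓔).J (m + 1) (h.rootFlow τ))‖]

/-- The times at which the limit flow has finite energy. -/
def finiteTimes : Set ℝ := {τ | ∃ K : ℕ, ∀ m, h.energy m τ ≤ K}

lemma measurableSet_finiteTimes : MeasurableSet h.finiteTimes := by
  have : h.finiteTimes = ⋃ K : ℕ, ⋂ m, {τ | h.energy m τ ≤ K} := by
    ext τ; simp [finiteTimes]
  rw [this]
  exact MeasurableSet.iUnion fun K => MeasurableSet.iInter fun m => h.measurable_energy m measurableSet_Iic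

open Classical in
/-- The gradient of the limit flow `2√h`, at the times of finite energy. -/
def rootGrad (τ : ℝ) : GibbsField N d s σ := h.finiteTimes.piecewise (fun τ => limUnder atTop fun m : ℕ =>
    (𝓔).grad ((𝓔).J (m + 1) (h.rootFlow τ))) 0 τ

lemma stronglyMeasurable_rootGrad : StronglyMeasurable h.rootGrad := by
  classical
  exact StronglyMeasurable.piecewise h.measurableSet_finiteTimes
    (StronglyMeasurable.limUnder fun m => h.stronglyMeasurable_grad_J m) stronglyMeasurable_zero

lemma exists_domain_rootFlow {τ : ℝ} (hτ : τ ∈ h.finiteTimes) :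
    ∃ y, (𝓔).ι y = h.rootFlow τ ∧ (𝓔).grad y = h.rootGrad τ ∧
      Tendsto (fun m => h.energy m τ) atTop (𝓝 (‖h.rootGrad τ‖ ^ 2)) := by
  classical
  obtain ⟨K, hK⟩ := hτ
  obtain ⟨y, h1, h2, -⟩ := (𝓔).exists_tendsto_grad_J hK
  have h3 := ((𝓔).grad.continuous.tendsto y).comp h2
  have h4 : (𝓔).grad y = h.rootGrad τ := by
    rw [rootGrad, piecewise_eq_of_mem _ _ _ (show τ ∈ h.finiteTimes from ⟨K, hK⟩)]
    exact h3.limUnder_eq.symm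
  refine ⟨y, h1, h4, ?_⟩
  rw [← h4]
  exact h3.norm.pow 2

lemma integrableOn_energy (m : ℕ) (t : ℝ) : IntegrableOn (h.energy m) (Ioc 0 t) := by
  refine Measure.integrableOn_of_bounded (by simp)
    (h.measurable_energy m).aestronglyMeasurable (M := ‖(𝓔).grad ∘L (𝓔).J (m + 1)‖ ^ 2
      * (4 * ∫ x, h₀ x ∂𝔪)) ?_
  refine (ae_restrict_iff' measurableSet_Ioc).2 (.of_forall fun τ hτ => ?_)
  rw [norm_of_nonneg (h.energy_nonneg m τ), ← h.norm_rootFlow_sq hτ.1.le, ← mul_pow]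
  exact pow_le_pow_left₀ (norm_nonneg _) (((𝓔).grad ∘L (𝓔).J (m + 1)).le_opNorm _) 2

lemma integral_energy_le (m : ℕ) {t : ℝ} (ht : 0 ≤ t) :
    ∫ τ in Ioc 0 t, h.energy m τ ≤ ((∫ x, h₀ x * log (h₀ x) ∂𝔪)
      - ∫ x, h.density t x * log (h.density t x) ∂𝔪) / σ := by
  have h1 := (h.entropy_le m ht).2
  rw [integral_of_le ht] at h1
  rw [le_div_iff₀ hp.out.σ_pos]
  change _ + σ * ∫ τ in Ioc 0 t, h.energy m τ ≤ _ at h1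
  linarith

lemma ae_mem_finiteTimes {t : ℝ} (ht : 0 ≤ t) : ∀ᵐ τ ∂(volume.restrict (Ioc 0 t)), τ ∈ h.finiteTimes := by
  set B := ((∫ x, h₀ x * log (h₀ x) ∂𝔪) - ∫ x, h.density t x * log (h.density t x) ∂𝔪) / σ with hB
  have h1 : ∫⁻ τ in Ioc 0 t, ⨆ m, ofReal (h.energy m τ) ≤ ofReal B := by
    rw [lintegral_iSup (fun m => (h.measurable_energy m).ennreal_ofReal)
      fun m m' hm τ => ofReal_le_ofReal (h.monotone_energy hm τ)]
    refine iSup_le fun m => ?_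
    rw [← ofReal_integral_eq_lintegral_ofReal (h.integrableOn_energy m t)
      (.of_forall fun τ => h.energy_nonneg m τ)]
    exact ofReal_le_ofReal (h.integral_energy_le m ht)
  have h2 : ∀ᵐ τ ∂(volume.restrict (Ioc 0 t)), ⨆ m, ofReal (h.energy m τ) < ⊤ :=
    ae_lt_top (Measurable.iSup fun m => (h.measurable_energy m).ennreal_ofReal) (h1.trans_lt ofReal_lt_top).ne
  filter_upwards [h2] with τ hτ
  obtain ⟨K, hK⟩ := ENNReal.exists_nat_gt hτ.ne
  refine ⟨K, fun m => ?_⟩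
  have h3 := (le_iSup (fun m => ofReal (h.energy m τ)) m).trans hK.le
  rw [← ENNReal.ofReal_natCast] at h3
  exact (ENNReal.ofReal_le_ofReal_iff (cast_nonneg K)).1 h3

lemma ae_mem_finiteTimes_Ioi : ∀ᵐ τ ∂(volume.restrict (Ioi 0)), τ ∈ h.finiteTimes := by
  rw [ae_restrict_iff' measurableSet_Ioi]
  have h1 : ∀ n : ℕ, ∀ᵐ τ, τ ∈ Ioc (0 : ℝ) n → τ ∈ h.finiteTimes := fun n =>
    (ae_restrict_iff' measurableSet_Ioc).1 (h.ae_mem_finiteTimes (cast_nonneg n))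
  filter_upwards [ae_all_iff.2 h1] with τ hτ hpos
  obtain ⟨n, hn⟩ := exists_nat_ge τ
  exact hτ n ⟨hpos, hn⟩

/-- The entropy inequality for the limit flow. -/
lemma rootGrad_entropy {t : ℝ} (ht : 0 ≤ t) :
    IntegrableOn (fun τ => ‖h.rootGrad τ‖ ^ 2) (Ioc 0 t) ∧
    (∫ x, h.density t x * log (h.density t x) ∂𝔪) + σ * ∫ τ in (0 : ℝ)..t, ‖h.rootGrad τ‖ ^ 2
      ≤ ∫ x, h₀ x * log (h₀ x) ∂𝔪 := by
  have h1 := integrable_and_integral_le_of_tendsto (fun m => h.integrableOn_energy m t)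
    (fun m => Eventually.of_forall fun τ => h.energy_nonneg m τ) (fun m => h.integral_energy_le m ht)
    tendsto_const_nhds ((h.ae_mem_finiteTimes ht).mono fun τ hτ => (h.exists_domain_rootFlow hτ).choose_spec.2.2)
  refine ⟨h1.1, ?_⟩
  have h2 := h1.2
  rw [le_div_iff₀ hp.out.σ_pos] at h2
  rw [integral_of_le ht]
  linarith

end FiniteEntropy

section

/-! ### Test functions as curves -/

section Tests

variable {φ : ℝ → TorusConfig N d → ℝ}

namespace IsSpaceTimeTest

lemma contDiff_lift (h : IsSpaceTimeTest φ) :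
    ContDiff ℝ ∞ (fun p : ℝ × (Fin N → Fin d → ℝ) => φ p.1 (configMk p.2)) := h.smooth

lemma continuous_uncurry (h : IsSpaceTimeTest φ) : Continuous (Function.uncurry φ) := by
  have h1 : IsOpenQuotientMap (Prod.map id configMk : ℝ × (Fin N → Fin d → ℝ) → ℝ × 𝕏) :=
    IsOpenQuotientMap.id.prodMap isOpenQuotientMap_configMk
  exact h1.continuous_comp_iff.1 (contDiff_lift h).continuous

lemma isSmoothConfig (h : IsSpaceTimeTest φ) (t : ℝ) : IsSmoothConfig (φ t) :=
  (contDiff_lift h).comp (contDiff_const.prodMk contDiff_id)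

lemma hasDerivAt (h : IsSpaceTimeTest φ) (t : ℝ) (x : 𝕏) :
    HasDerivAt (fun r => φ r x) (deriv (fun r => φ r x) t) t := by
  obtain ⟨y, rfl⟩ := isOpenQuotientMap_configMk.surjective x
  have h1 : ContDiff ℝ ∞ (fun r => φ r (configMk y)) := (contDiff_lift h).comp (contDiff_id.prodMk contDiff_const)
  exact (h1.differentiable (by simp) t).hasDerivAt

/-- The partial derivatives of a test function are test functions. -/
lemma partial_space (h : IsSpaceTimeTest φ) (i : Fin N) (k : Fin d) :
    IsSpaceTimeTest fun t => 𝐃 i k (φ t) := by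
  refine ⟨?_, ?_⟩
  · have h1 := contDiff_lift h
    have e : (fun p : ℝ × (Fin N → Fin d → ℝ) => 𝐃 i k (φ p.1) (configMk p.2))
        = fun p => fderiv ℝ (fun p : ℝ × (Fin N → Fin d → ℝ) => φ p.1 (configMk p.2)) p
            (0, single i (single k 1)) := by
      funext p
      have hd : DifferentiableAt ℝ (fun y => φ p.1 (configMk y)) p.2 :=
        ((isSmoothConfig h p.1 : ContDiff ℝ ∞ _).differentiable (by simp)) p.2
      rw [configPartial_eq (hasDerivAt_of_lift i k hd)]
      have h2 : HasFDerivAt (fun p : ℝ × (Fin N → Fin d → ℝ) => φ p.1 (configMk p.2)) _ (p.1, p.2) :=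
        (h1.differentiable (by simp) p).hasFDerivAt
      have h3 := h2.comp p.2 (hasFDerivAt_prodMk_right p.1 p.2)
      have h4 := h3.fderiv
      change fderiv ℝ (fun y => φ p.1 (configMk y)) p.2 = _ at h4
      rw [h4]
      simp
    change ContDiff ℝ ∞ (fun p : ℝ × (Fin N → Fin d → ℝ) => 𝐃 i k (φ p.1) (configMk p.2))
    rw [e]
    exact (h1.fderiv_right (by simp)).clm_apply contDiff_const
  · obtain ⟨T, hT⟩ := h.support
    refine ⟨T, fun t ht x => ?_⟩
    have : φ t = fun _ => 0 := funext (hT t ht)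
    rw [this]
    exact configPartial_eq (hasDerivAt_const _ _)

/-- The time derivative of a test function is a test function. -/
lemma partial_time (h : IsSpaceTimeTest φ) : IsSpaceTimeTest fun t x => deriv (fun r => φ r x) t := by
  refine ⟨?_, ?_⟩
  · have h1 := contDiff_lift h
    have e : (fun p : ℝ × (Fin N → Fin d → ℝ) => deriv (fun r => φ r (configMk p.2)) p.1)
        = fun p => fderiv ℝ (fun p : ℝ × (Fin N → Fin d → ℝ) => φ p.1 (configMk p.2)) p (1, 0) := by
      funext p
      have h2 : HasFDerivAt (fun p : ℝ × (Fin N → Fin d → ℝ) => φ p.1 (configMk p.2)) _ (p.1, p.2) :=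
        (h1.differentiable (by simp) p).hasFDerivAt
      have h3 := h2.comp_hasDerivAt p.1 ((hasDerivAt_id p.1).prodMk (hasDerivAt_const p.1 p.2))
      exact h3.deriv
    change ContDiff ℝ ∞ (fun p : ℝ × (Fin N → Fin d → ℝ) => deriv (fun r => φ r (configMk p.2)) p.1)
    rw [e]
    exact (h1.fderiv_right (by simp)).clm_apply contDiff_const
  · obtain ⟨T, hT⟩ := h.support
    refine ⟨T + 1, fun t ht x => ?_⟩
    have h1 : (fun r => φ r x) =ᶠ[𝓝 t] fun _ => 0 := by
      filter_upwards [lt_mem_nhds (show T < t by linarith)] with r hr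
      exact hT r hr.le x
    rw [h1.deriv_eq, deriv_const]

lemma exists_abs_le (h : IsSpaceTimeTest φ) (T : ℝ) : ∃ B : ℝ, ∀ t ∈ Icc 0 T, ∀ x, |φ t x| ≤ B := by
  obtain ⟨B, hB⟩ := ((isCompact_Icc (a := 0)).prod
    (isCompact_univ)).exists_bound_of_continuousOn (continuous_uncurry h).continuousOn
  exact ⟨B, fun t ht x => hB (t, x) ⟨ht, mem_univ x⟩⟩

/-- A test function as a curve of continuous functions. -/
def curve (h : IsSpaceTimeTest φ) : ℝ → C(𝕏, ℝ) := (ContinuousMap.mk _ (continuous_uncurry h)).curry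

lemma continuous_curve (h : IsSpaceTimeTest φ) : Continuous (curve h) := ContinuousMap.continuous _

lemma hasDerivAt_curve (h : IsSpaceTimeTest φ) (t : ℝ) :
    HasDerivAt (curve h) (curve (partial_time h) t) t := by
  have h1 : HasDerivAt (fun t => curve h 0 + ∫ r in 0..t, curve (partial_time h) r)
      (curve (partial_time h) t) t :=
    (intervalIntegral.integral_hasDerivAt_right ((continuous_curve _).intervalIntegrable _ _)
      (continuous_curve _).aestronglyMeasurable.stronglyMeasurableAtFilter
      (continuous_curve _).continuousAt).const_add _
  refine h1.congr_of_eventuallyEq (.of_forall fun t => ?_)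
  ext x
  have h2 := (ContinuousMap.evalCLM ℝ x).intervalIntegral_comp_comm
    ((continuous_curve (partial_time h)).intervalIntegrable (μ := volume) 0 t)
  have h3 := integral_eq_sub_of_hasDerivAt (a := 0) (b := t)
    (fun r _ => hasDerivAt h r x) (by
      have : Continuous fun r => deriv (fun r => φ r x) r :=
        (continuous_uncurry (partial_time h)).comp (continuous_id.prodMk continuous_const)
      exact this.intervalIntegrable _ _)
  rw [ContinuousMap.add_apply]
  change φ t x = φ 0 x + ContinuousMap.evalCLM ℝ x (∫ r in 0..t, curve (partial_time h) r)
  rw [← h2]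
  change φ t x = φ 0 x + ∫ r in 0..t, deriv (fun r => φ r x) r
  rw [h3]
  ring

end IsSpaceTimeTest

end Tests

variable {φ : ℝ → TorusConfig N d → ℝ}

/-- A test function as a curve of square integrable functions. -/
def testLp (s σ : ℝ) [Fact (Admissible N d s σ)] (h : IsSpaceTimeTest φ) (t : ℝ) : GibbsL2 N d s σ :=
  ContinuousMap.toLp 2 (gibbsMeasure N d s σ) ℝ (IsSpaceTimeTest.curve h t)

lemma coeFn_testLp (h : IsSpaceTimeTest φ) (t : ℝ) : testLp s σ h t =ᵐ[𝔪] φ t :=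
  ContinuousMap.coeFn_toLp 𝔪 _

lemma continuous_testLp (h : IsSpaceTimeTest φ) : Continuous (testLp (N := N) (d := d) s σ h) :=
  (ContinuousMap.toLp 2 𝔪 ℝ).continuous.comp (IsSpaceTimeTest.continuous_curve h)

lemma hasDerivAt_testLp (h : IsSpaceTimeTest φ) (t : ℝ) :
    HasDerivAt (testLp (N := N) (d := d) s σ h) (testLp s σ (IsSpaceTimeTest.partial_time h) t) t :=
  (ContinuousMap.toLp (E := ℝ) 2 𝔪 ℝ).hasFDerivAt.comp_hasDerivAt t (IsSpaceTimeTest.hasDerivAt_curve h t)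

namespace FiniteEntropy

variable {h₀ : TorusConfig N d → ℝ} (h : FiniteEntropy s σ h₀)

include h

/-- The generator of the approximating flow, tested against a smooth function. -/
lemma inner_A_testLp (hφ : IsSpaceTimeTest φ) (n : ℕ) {t : ℝ} (ht : 0 ≤ t) :
    -⟪(𝓔).A (n + 1) (h.flow n t), testLp s σ hφ t⟫ = (1 / 4) * ∑ i, ∑ k, ((∫ x, h.smoothRoot n t x ^ 2
            * 𝐃 i k (𝐃 i k (φ t)) x ∂𝔪)
          + ∫ x, h.smoothRoot n t x ^ 2 * (𝐃 i k (φ t) x * logGrad s σ i k x) ∂𝔪) := by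
  have hsm := IsSpaceTimeTest.isSmoothConfig hφ t
  obtain ⟨w, hw1, hw2⟩ := exists_domain_of_isC1 (s := s) (σ := σ) (IsSmoothConfig.isC1 hsm)
  obtain ⟨y, hy1, hy2, -⟩ := h.exists_domain_smoothRoot n ht
  have e1 : testLp s σ hφ t = (𝓔).ι w := Lp.ext ((coeFn_testLp hφ t).trans hw1.symm)
  rw [e1, ClosedForm.inner_A _ (succ_pos n), inner_grad_eq, ← sum_neg_distrib, mul_sum, Fintype.sum_prod_type]
  refine sum_congr rfl fun i _ => ?_
  rw [mul_sum]
  refine sum_congr rfl fun k _ => ?_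
  have h1 := integral_sq_mul_partial y (IsSmoothConfig.isC1 (IsSmoothConfig.partial hsm i k)) i k
  have e2 : ∫ x, (𝓔).grad ((𝓔).J (n + 1) (h.flow n t)) (i, k) x * (𝓔).grad w (i, k) x ∂𝔪
      = 1 / 2 * ∫ x, (𝓔).ι y x * (𝓔).grad y (i, k) x * 𝐃 i k (φ t) x ∂𝔪 := by
    rw [← integral_const_mul]
    refine integral_congr_ae ?_
    filter_upwards [hy2 (i, k), hw2 (i, k)] with x h2 h3
    rw [h2, h3, hy1]
    ring
  rw [e2]
  simp only [hy1, ← sq] at h1 ⊢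
  rw [h1]
  ring

/-- The equation solved by the approximating flow, in weak form. -/
lemma flow_weak_eq (hφ : IsSpaceTimeTest φ) (n : ℕ) {T : ℝ} (hT : 0 ≤ T) (hsupp : ∀ x, φ T x = 0) :
    ∫ t in (0 : ℝ)..T, ((1 / 4) * (∫ x, h.root n t x ^ 2 * deriv (fun r => φ r x) t ∂𝔪)
      + σ * ((1 / 4) * ∑ i, ∑ k, ((∫ x, h.smoothRoot n t x ^ 2
            * 𝐃 i k (𝐃 i k (φ t)) x ∂𝔪)
          + ∫ x, h.smoothRoot n t x ^ 2 * (𝐃 i k (φ t) x * logGrad s σ i k x) ∂𝔪)))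
      = -∫ x, h.cut n x * φ 0 x ∂𝔪 := by
  have hφ' := IsSpaceTimeTest.partial_time hφ
  have hder : ∀ t, HasDerivAt (fun t => ⟪h.flow n t, testLp s σ hφ t⟫)
      (⟪h.flow n t, testLp s σ hφ' t⟫ + ⟪-(σ • (𝓔).A (n + 1) (h.flow n t)), testLp s σ hφ t⟫) t :=
    fun t => (h.hasDerivAt_flow n t).inner ℝ (hasDerivAt_testLp hφ t)
  have hA : Continuous fun t => -(σ • (𝓔).A (n + 1) (h.flow n t)) :=
    ((((𝓔).A (n + 1)).continuous.comp (h.continuous_flow n)).const_smul σ).neg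
  have hcont : Continuous fun t => ⟪h.flow n t, testLp s σ hφ' t⟫
      + ⟪-(σ • (𝓔).A (n + 1) (h.flow n t)), testLp s σ hφ t⟫ :=
    ((h.continuous_flow n).inner (continuous_testLp hφ')).add (hA.inner (continuous_testLp hφ))
  have hftc := integral_eq_sub_of_hasDerivAt (a := 0) (b := T) (fun t _ => hder t)
    (hcont.intervalIntegrable _ _)
  have e0 : testLp s σ hφ T = 0 := by
    refine Lp.ext ((coeFn_testLp hφ T).trans (EventuallyEq.trans ?_ (Lp.coeFn_zero _ _ _).symm))
    exact Eventually.of_forall hsupp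
  have e1 : ⟪h.flow n 0, testLp s σ hφ 0⟫ = ∫ x, h.cut n x * φ 0 x ∂𝔪 := by
    rw [h.flow_zero, L2.inner_eq_integral]
    refine integral_congr_ae ?_
    filter_upwards [coeFn_testLp hφ 0] with x hx
    rw [hx]
  rw [e0, inner_zero_right, zero_sub, e1] at hftc
  rw [← hftc]
  refine intervalIntegral.integral_congr fun t ht => ?_
  rw [uIcc_of_le hT] at ht
  rw [inner_neg_left, real_inner_smul_left, ← mul_neg, h.inner_A_testLp hφ n ht.1, ← integral_const_mul]
  congr 1
  rw [L2.inner_eq_integral]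
  refine integral_congr_ae ?_
  filter_upwards [coeFn_testLp hφ' t, h.root_sq n ht.1] with x h1 h2
  rw [h1, ← h2]
  ring

end FiniteEntropy

end

section

/-! ### Passage to the limit in the weak equation -/

/-- Integrable functions on `[0,T]` whose integrals converge. -/
structure TendstoIntegral (T : ℝ) (f : ℕ → ℝ → ℝ) (g : ℝ → ℝ) : Prop where
  integrable : ∀ n, IntervalIntegrable (f n) volume 0 T
  integrable_lim : IntervalIntegrable g volume 0 T
  tendsto : Tendsto (fun n => ∫ t in (0 : ℝ)..T, f n t) atTop (𝓝 (∫ t in (0 : ℝ)..T, g t))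

namespace TendstoIntegral

variable {T : ℝ} {f f' : ℕ → ℝ → ℝ} {g g' : ℝ → ℝ}

lemma add (h : TendstoIntegral T f g) (h' : TendstoIntegral T f' g') :
    TendstoIntegral T (fun n t => f n t + f' n t) fun t => g t + g' t := by
  refine ⟨fun n => (h.integrable n).add (h'.integrable n), h.integrable_lim.add h'.integrable_lim, ?_⟩
  rw [intervalIntegral.integral_add h.integrable_lim h'.integrable_lim]
  refine (h.tendsto.add h'.tendsto).congr fun n => ?_
  rw [intervalIntegral.integral_add (h.integrable n) (h'.integrable n)]

lemma const_mul (h : TendstoIntegral T f g) (c : ℝ) :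
    TendstoIntegral T (fun n t => c * f n t) fun t => c * g t := by
  refine ⟨fun n => (h.integrable n).const_mul c, h.integrable_lim.const_mul c, ?_⟩
  simp only [intervalIntegral.integral_const_mul]
  exact h.tendsto.const_mul c

lemma sum {ι : Type*} (S : Finset ι) {f : ι → ℕ → ℝ → ℝ} {g : ι → ℝ → ℝ}
    (h : ∀ j, TendstoIntegral T (f j) (g j)) :
    TendstoIntegral T (fun n t => ∑ j ∈ S, f j n t) fun t => ∑ j ∈ S, g j t := by
  classical
  induction S using Finset.induction_on with
  | empty =>
    simp only [Finset.sum_empty]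
    exact ⟨fun n => intervalIntegrable_const, intervalIntegrable_const, tendsto_const_nhds⟩
  | insert a S ha ih =>
    simp only [Finset.sum_insert ha]
    exact (h a).add ih

end TendstoIntegral

lemma tendsto_zero_of_le_cube {a e : ℕ → ℝ} {L M : ℝ} (hL : 0 ≤ L) (hM : 0 ≤ M) (he : Tendsto e atTop (𝓝 0))
    (h : ∀ n κ, 0 < κ → κ ≤ 1 → |a n| ≤ L * ((κ⁻¹) ^ 3 * e n + κ * M)) : Tendsto a atTop (𝓝 0) := by
  refine Metric.tendsto_atTop.2 fun ε hε => ?_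
  set κ := min 1 (ε / (2 * (L * M + 1))) with hκ
  have hLM : 0 ≤ L * M := mul_nonneg hL hM
  have hκ0 : 0 < κ := lt_min one_pos (by positivity)
  have h1 : κ * (L * M) ≤ ε / 2 := by
    refine (mul_le_mul_of_nonneg_right (min_le_right _ _) hLM).trans ?_
    rw [div_mul_eq_mul_div, div_le_div_iff₀ (by positivity) (by positivity)]
    nlinarith
  have h2 : Tendsto (fun n => L * ((κ⁻¹) ^ 3 * e n)) atTop (𝓝 0) := by
    have := (he.const_mul ((κ⁻¹) ^ 3)).const_mul L
    rwa [mul_zero, mul_zero] at this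
  obtain ⟨n₀, hn₀⟩ := eventually_atTop.1 (h2.eventually (gt_mem_nhds (half_pos hε)))
  refine ⟨n₀, fun n hn => ?_⟩
  rw [dist_eq, sub_zero]
  have h3 := h n κ hκ0 (min_le_left _ _)
  have h4 := hn₀ n hn
  linarith

lemma stronglyMeasurable_integral_sq_mul {X Y : Type*} [MeasurableSpace X] [MeasurableSpace Y]
    {μ : Measure X} [SFinite μ] {F : Y → Lp ℝ 2 μ} (hF : StronglyMeasurable F) {q : Y × X → ℝ}
    (hq : Measurable q) : StronglyMeasurable fun t => ∫ x, F t x ^ 2 * q (t, x) ∂μ := by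
  obtain ⟨Ψ, hΨ, h1⟩ := exists_measurable_uncurry hF
  have e : (fun t => ∫ x, F t x ^ 2 * q (t, x) ∂μ) = fun t => ∫ x, (Ψ (t, x) ^ 2 * q (t, x)) ∂μ := by
    funext t
    refine integral_congr_ae ?_
    filter_upwards [h1 t] with x hx
    rw [hx]
  rw [e]
  exact ((hΨ.pow_const 2).mul hq).stronglyMeasurable.integral_prod_right'

lemma abs_integral_sq_mul_le {X : Type*} [MeasurableSpace X] {μ : Measure X} (F : Lp ℝ 2 μ) {q : X → ℝ}
    {B : ℝ} (hB : ∀ x, |q x| ≤ B) : |∫ x, F x ^ 2 * q x ∂μ| ≤ B * ‖F‖ ^ 2 := by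
  rw [L2.norm_sq_eq_integral, ← integral_const_mul, ← norm_eq_abs]
  refine norm_integral_le_of_norm_le ((L2.integrable_sq F).const_mul B) (.of_forall fun x => ?_)
  rw [norm_mul, norm_eq_abs (q x), norm_of_nonneg (sq_nonneg _), mul_comm]
  gcongr; exact hB x

variable {φ : ℝ → TorusConfig N d → ℝ}

lemma integrable_sq_mul_bounded_logGrad (y : FormDomain N d s σ) (i : Fin N) (k : Fin d)
    {ψ : TorusConfig N d → ℝ} (hψ : Continuous ψ) :
    Integrable (fun x => (𝓔).ι y x ^ 2 * (ψ x * 𝐛 i k x)) 𝔪 := by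
  obtain ⟨B, hB⟩ := exists_abs_le_of_continuous hψ
  refine ((integrable_sq_mul_logGrad y i k).bdd_mul hψ.aestronglyMeasurable
    (.of_forall hB)).congr (.of_forall fun x => ?_)
  ring

lemma weighted_force_bound {C κ a b a' b' Y W Y' W' I J : ℝ} (hC : 0 ≤ C) (hκ : 0 < κ) (hκ1 : κ ≤ 1)
    (h2 : I ≤ C * (a ^ 2 + a * a')) (h3 : J ≤ C * (b ^ 2 + b * b'))
    (p1 : b ^ 2 + a ^ 2 = 2 * (Y ^ 2 + W ^ 2)) (p2 : b' ^ 2 + a' ^ 2 = 2 * (Y' ^ 2 + W' ^ 2)) :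
    1 / (2 * κ) * I + κ / 2 * J ≤ 4 * C * ((κ⁻¹) ^ 3 * a ^ 2 + κ * (Y ^ 2 + W ^ 2 + Y' ^ 2 + W' ^ 2)) := by
  have hκi : 1 ≤ κ⁻¹ := (one_le_inv₀ hκ).2 hκ1
  have hκκ : κ⁻¹ * κ = 1 := inv_mul_cancel₀ hκ.ne'
  set r := κ⁻¹ with hr
  have k1 : 1 / (2 * κ) = r / 2 := by rw [hr]; field_simp
  rw [k1]
  have q1 : a ^ 2 + a * a' ≤ (3 / 2) * r ^ 2 * a ^ 2 + κ ^ 2 / 2 * a' ^ 2 := by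
    have h5 : 0 ≤ (r * a - κ * a') ^ 2 := sq_nonneg _
    have h6 : r * a * (κ * a') = a * a' := by linear_combination (a * a') * hκκ
    have h7 : a ^ 2 ≤ r ^ 2 * a ^ 2 := le_mul_of_one_le_left (sq_nonneg _) (one_le_pow₀ hκi)
    nlinarith
  have q2 : b ^ 2 + b * b' ≤ (3 / 2) * b ^ 2 + 1 / 2 * b' ^ 2 := by nlinarith [sq_nonneg (b - b')]
  have t1 : r / 2 * (C * (a ^ 2 + a * a')) ≤ C * ((3 / 4) * r ^ 3 * a ^ 2 + κ / 4 * a' ^ 2) := by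
    have h5 := mul_le_mul_of_nonneg_left q1 (show 0 ≤ r / 2 * C by positivity)
    have h6 : r / 2 * C * ((3 / 2) * r ^ 2 * a ^ 2 + κ ^ 2 / 2 * a' ^ 2)
        = C * ((3 / 4) * r ^ 3 * a ^ 2 + κ / 4 * a' ^ 2) := by
      linear_combination (C * κ / 4 * a' ^ 2) * hκκ
    linarith
  have t2 := mul_le_mul_of_nonneg_left q2 (show 0 ≤ κ / 2 * C by positivity)
  have t3 := mul_le_mul_of_nonneg_left h2 (show 0 ≤ r / 2 by positivity)
  have t4 := mul_le_mul_of_nonneg_left h3 (show 0 ≤ κ / 2 by positivity)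
  have m1 : 0 ≤ C * κ * a' ^ 2 := by positivity
  have m2 : 0 ≤ C * κ * b' ^ 2 := by positivity
  have m3 : 0 ≤ C * κ * a ^ 2 := by positivity
  have m4 : 0 ≤ C * κ * b ^ 2 := by positivity
  have m5 : 0 ≤ C * r ^ 3 * a ^ 2 := by positivity
  have s1 : C * κ * (a' ^ 2 + b' ^ 2) = C * κ * (2 * (Y' ^ 2 + W' ^ 2)) := by
    rw [show a' ^ 2 + b' ^ 2 = 2 * (Y' ^ 2 + W' ^ 2) by linarith]
  have s2 : C * κ * (a ^ 2 + b ^ 2) = C * κ * (2 * (Y ^ 2 + W ^ 2)) := by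
    rw [show a ^ 2 + b ^ 2 = 2 * (Y ^ 2 + W ^ 2) by linarith]
  linarith

/-- The force is continuous with respect to convergence in `L²`, with a loss in the energy that can be
made small. -/
lemma exists_force_sub_bound : ∃ C ≥ 0, ∀ (y w : FormDomain N d s σ) (i : Fin N) (k : Fin d)
    (ψ : TorusConfig N d → ℝ) (B κ : ℝ), Continuous ψ → (∀ x, |ψ x| ≤ B) → 0 < κ → κ ≤ 1 →
    |(∫ x, (𝓔).ι y x ^ 2 * (ψ x * 𝐛 i k x) ∂𝔪)
      - ∫ x, (𝓔).ι w x ^ 2 * (ψ x * 𝐛 i k x) ∂𝔪|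
      ≤ B * C * ((κ⁻¹) ^ 3 * ‖(𝓔).ι y - (𝓔).ι w‖ ^ 2 + κ * (‖(𝓔).ι y‖ ^ 2 + ‖(𝓔).ι w‖ ^ 2
          + ‖(𝓔).grad y‖ ^ 2 + ‖(𝓔).grad w‖ ^ 2)) := by
  obtain ⟨C, hC, hF⟩ := exists_force_bound (N := N) (d := d) (s := s) (σ := σ)
  refine ⟨4 * C, by positivity, fun y w i k ψ B κ hψ hB hκ hκ1 => ?_⟩
  set E := 𝓔 with hE
  have hB0 : 0 ≤ B := (abs_nonneg _).trans (hB 0)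
  have ha := hF (y - w) i k
  have hb := hF (y + w) i k
  have iab : Integrable (fun x => (1 / (2 * κ)) * E.ι (y - w) x ^ 2 + κ / 2 * E.ι (y + w) x ^ 2)
      (forceMeasure N d s σ i k) :=
    (ha.1.integrable_sq.const_mul _).add (hb.1.integrable_sq.const_mul _)
  have h1 : |(∫ x, E.ι y x ^ 2 * (ψ x * 𝐛 i k x) ∂𝔪)
      - ∫ x, E.ι w x ^ 2 * (ψ x * 𝐛 i k x) ∂𝔪|
      ≤ B * ∫ x, ((1 / (2 * κ)) * E.ι (y - w) x ^ 2 + κ / 2 * E.ι (y + w) x ^ 2)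
          ∂(forceMeasure N d s σ i k) := by
    rw [← integral_sub (integrable_sq_mul_bounded_logGrad y i k hψ)
      (integrable_sq_mul_bounded_logGrad w i k hψ), integral_forceMeasure, ← integral_const_mul,
      ← norm_eq_abs]
    refine norm_integral_le_of_norm_le ((integrable_forceMeasure_iff.1 iab).const_mul B) ?_
    rw [map_sub, map_add]
    filter_upwards [Lp.coeFn_sub (E.ι y) (E.ι w), Lp.coeFn_add (E.ι y) (E.ι w)] with x h2 h3
    rw [h2, h3, Pi.sub_apply, Pi.add_apply]
    set a := E.ι y x
    set b := E.ι w x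
    have e : a ^ 2 * (ψ x * 𝐛 i k x) - b ^ 2 * (ψ x * 𝐛 i k x)
        = ψ x * (((a - b) * (a + b)) * 𝐛 i k x) := by ring
    rw [e, norm_mul, norm_mul, norm_eq_abs, norm_eq_abs, norm_eq_abs]
    refine mul_le_mul (hB x) (mul_le_mul_of_nonneg_right ?_ (abs_nonneg _)) (by positivity) hB0
    have e1 : |(a - b) * (a + b)| ≤ (1 / (2 * κ)) * |a - b| ^ 2 + κ / 2 * |a + b| ^ 2 := by
      rw [abs_mul]
      have h5 : (1 / (2 * κ)) * |a - b| ^ 2 + κ / 2 * |a + b| ^ 2 - |a - b| * |a + b|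
          = (1 / (2 * κ)) * (|a - b| - κ * |a + b|) ^ 2 := by field_simp; ring
      have h6 : 0 ≤ (1 / (2 * κ)) * (|a - b| - κ * |a + b|) ^ 2 := by positivity
      linarith
    rwa [sq_abs, sq_abs] at e1
  rw [integral_add (ha.1.integrable_sq.const_mul _) (hb.1.integrable_sq.const_mul _),
    integral_const_mul, integral_const_mul] at h1
  refine h1.trans ?_
  rw [mul_assoc]
  refine mul_le_mul_of_nonneg_left ?_ hB0
  have h2 := ha.2
  have h3 := hb.2
  rw [map_sub, map_sub] at h2
  rw [map_add, map_add] at h3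
  -- The parallelogram identities turn the bounds for `y ± w` into bounds for `y` and `w`.
  have p1 := parallelogram_law_with_norm ℝ (E.ι y) (E.ι w)
  have p2 := parallelogram_law_with_norm ℝ (E.grad y) (E.grad w)
  exact weighted_force_bound hC hκ hκ1 h2 h3 p1 p2

namespace FiniteEntropy

variable {h₀ : TorusConfig N d → ℝ} (h : FiniteEntropy s σ h₀)

lemma tendstoIntegral_of_bound {F : ℕ → ℝ → GibbsL2 N d s σ} {G : ℝ → GibbsL2 N d s σ} {R T : ℝ}
    (hT : 0 ≤ T) (hF : ∀ n, StronglyMeasurable (F n)) (hG : StronglyMeasurable G)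
    (hR : ∀ n, ∀ t, 0 ≤ t → ‖F n t‖ ^ 2 ≤ R) (hRG : ∀ t, 0 ≤ t → ‖G t‖ ^ 2 ≤ R)
    (hlim : ∀ t, 0 ≤ t → Tendsto (fun n => F n t) atTop (𝓝 (G t))) (hφ : IsSpaceTimeTest φ) :
    TendstoIntegral T (fun n t => ∫ x, F n t x ^ 2 * φ t x ∂𝔪) fun t => ∫ x, G t x ^ 2 * φ t x ∂𝔪 := by
  obtain ⟨B, hB⟩ := IsSpaceTimeTest.exists_abs_le hφ T
  have hφm := (IsSpaceTimeTest.continuous_uncurry hφ).measurable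
  have hB0 : 0 ≤ B := (abs_nonneg _).trans (hB 0 ⟨le_rfl, hT⟩ 0)
  have hb : ∀ (H : GibbsL2 N d s σ) t, t ∈ Ioc 0 T → ‖H‖ ^ 2 ≤ R →
      ‖∫ x, H x ^ 2 * φ t x ∂𝔪‖ ≤ B * R := fun H t ht hH =>
    (abs_integral_sq_mul_le H (hB t (Ioc_subset_Icc_self ht))).trans (by gcongr)
  have hm : ∀ {H : ℝ → GibbsL2 N d s σ}, StronglyMeasurable H →
      StronglyMeasurable fun t => ∫ x, H t x ^ 2 * φ t x ∂𝔪 := fun hH =>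
    stronglyMeasurable_integral_sq_mul hH hφm
  have hint : ∀ {H : ℝ → GibbsL2 N d s σ}, StronglyMeasurable H → (∀ t, 0 ≤ t → ‖H t‖ ^ 2 ≤ R) →
      IntervalIntegrable (fun t => ∫ x, H t x ^ 2 * φ t x ∂𝔪) volume 0 T := by
    intro H hH hHR
    rw [intervalIntegrable_iff_integrableOn_Ioc_of_le hT]
    refine Measure.integrableOn_of_bounded (M := B * R) (by simp) (hm hH).aestronglyMeasurable ?_
    exact (ae_restrict_iff' measurableSet_Ioc).2 (.of_forall fun t ht => hb _ t ht (hHR t ht.1.le))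
  refine ⟨fun n => hint (hF n) (hR n), hint hG hRG, ?_⟩
  refine intervalIntegral.tendsto_integral_filter_of_dominated_convergence (fun _ => B * R)
    (.of_forall fun n => (hm (hF n)).aestronglyMeasurable)
    (.of_forall fun n => Eventually.of_forall fun t ht => ?_) intervalIntegrable_const
    (.of_forall fun t ht => ?_)
  · rw [uIoc_of_le hT] at ht
    exact hb _ t ht (hR n t ht.1.le)
  · rw [uIoc_of_le hT] at ht
    have h1 := tendsto_iff_edist_tendsto_0.1 (hlim t ht.1.le)
    simp only [Lp.edist_def] at h1
    have h2 := tendsto_integral_mul_mul (fun n => Lp.memLp (F n t)) (fun n => Lp.memLp (F n t))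
      (Lp.memLp (G t)) (Lp.memLp (G t)) h1 h1
      (IsSmoothConfig.isC1 (IsSpaceTimeTest.isSmoothConfig hφ t)).continuous.aestronglyMeasurable
      (hB t (Ioc_subset_Icc_self ht))
    simpa only [sq] using h2

include h

lemma norm_rootFlow_sq_le {t : ℝ} (ht : 0 ≤ t) :
    ‖h.rootFlow t‖ ^ 2 ≤ 4 * ∫ x, (h₀ x + 1) ∂𝔪 := by
  rw [h.norm_rootFlow_sq ht]
  refine mul_le_mul_of_nonneg_left ?_ (by norm_num)
  exact integral_mono h.integrable (h.integrable.add (integrable_const 1)) fun x => by simp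

lemma norm_smoothRoot_sq_le (n : ℕ) {t : ℝ} (ht : 0 ≤ t) :
    ‖h.smoothRoot n t‖ ^ 2 ≤ 4 * ∫ x, (h₀ x + 1) ∂𝔪 := by
  rw [h.norm_smoothRoot_sq n ht]
  exact mul_le_mul_of_nonneg_left (h.integral_cut_le n) (by norm_num)

lemma norm_root_sq_le (n : ℕ) {t : ℝ} (ht : 0 ≤ t) :
    ‖h.root n t‖ ^ 2 ≤ 4 * ∫ x, (h₀ x + 1) ∂𝔪 := by
  rw [h.norm_root_sq n ht]
  exact mul_le_mul_of_nonneg_left (h.integral_cut_le n) (by norm_num)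

lemma tendstoIntegral_force (hφ : IsSpaceTimeTest φ) (i : Fin N) (k : Fin d) {T : ℝ} (hT : 0 ≤ T) :
    TendstoIntegral T (fun n t => ∫ x, h.smoothRoot n t x ^ 2 * (φ t x * 𝐛 i k x) ∂𝔪)
      fun t => ∫ x, h.rootFlow t x ^ 2 * (φ t x * 𝐛 i k x) ∂𝔪 := by
  obtain ⟨C, hC, hF⟩ := exists_force_sub_bound (N := N) (d := d) (s := s) (σ := σ)
  obtain ⟨K, hK⟩ := h.exists_dissipation_le
  obtain ⟨B, hB⟩ := IsSpaceTimeTest.exists_abs_le hφ T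
  have hB0 : 0 ≤ B := (abs_nonneg _).trans (hB 0 ⟨le_rfl, hT⟩ 0)
  have hc : ∀ t, Continuous (φ t) := fun t =>
    (IsSmoothConfig.isC1 (IsSpaceTimeTest.isSmoothConfig hφ t)).continuous
  set R := 4 * ∫ x, (h₀ x + 1) ∂𝔪 with hR
  have hR0 : 0 ≤ R := (sq_nonneg _).trans (h.norm_rootFlow_sq_le le_rfl)
  set f : ℕ → ℝ → ℝ := fun n t => ∫ x, h.smoothRoot n t x ^ 2 * (φ t x * 𝐛 i k x) ∂𝔪 with hf
  set g : ℝ → ℝ := fun t => ∫ x, h.rootFlow t x ^ 2 * (φ t x * 𝐛 i k x) ∂𝔪 with hg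
  have hq : Measurable fun p : ℝ × TorusConfig N d => φ p.1 p.2 * 𝐛 i k p.2 :=
    (IsSpaceTimeTest.continuous_uncurry hφ).measurable.mul ((measurable_logGrad hp.out i k).comp measurable_snd)
  have hsm : ∀ n, StronglyMeasurable (h.smoothRoot n) := fun n => (h.continuous_smoothRoot n).stronglyMeasurable
  have hfm : ∀ n, StronglyMeasurable (f n) := fun n => stronglyMeasurable_integral_sq_mul (hsm n) hq
  have hgm : StronglyMeasurable g := stronglyMeasurable_integral_sq_mul h.stronglyMeasurable_rootFlow hq
  have hE := (h.rootGrad_entropy hT).1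
  have hD : ∀ n, IntegrableOn (h.dissipation n) (Ioc 0 T) := fun n =>
    ((h.continuous_dissipation n).intervalIntegrable 0 T).1
  -- compare with the zero element, to bound the force itself
  have hzero : ∀ y : FormDomain N d s σ, ‖(𝓔).ι y‖ ^ 2 ≤ R → ∀ t ∈ Ioc 0 T,
      |∫ x, (𝓔).ι y x ^ 2 * (φ t x * 𝐛 i k x) ∂𝔪|
        ≤ B * C * (2 * R + ‖(𝓔).grad y‖ ^ 2) := fun y hy t ht => by
    have h1 := hF y 0 i k (φ t) B 1 (hc t) (hB t (Ioc_subset_Icc_self ht)) one_pos le_rfl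
    have h0 : ∫ x, (𝓔).ι 0 x ^ 2 * (φ t x * 𝐛 i k x) ∂𝔪 = 0 := by
      rw [map_zero]
      refine integral_eq_zero_of_ae ?_
      filter_upwards [Lp.coeFn_zero ℝ 2 𝔪] with x hx
      rw [hx]; simp
    rw [h0, sub_zero, map_zero, map_zero, sub_zero, norm_zero, norm_zero] at h1
    refine h1.trans (mul_le_mul_of_nonneg_left ?_ (by positivity))
    rw [inv_one]
    linarith
  have hgi : IntegrableOn g (Ioc 0 T) := by
    refine Integrable.mono' (((integrable_const (2 * R)).add hE).const_mul (B * C))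
      hgm.aestronglyMeasurable ?_
    filter_upwards [h.ae_mem_finiteTimes hT, ae_restrict_mem measurableSet_Ioc] with t h1 h2
    obtain ⟨y, hy1, hy2, -⟩ := h.exists_domain_rootFlow h1
    have h3 := hzero y (hy1 ▸ h.norm_rootFlow_sq_le h2.1.le) t h2
    rw [hy1, hy2] at h3
    exact h3
  have hfi : ∀ n, IntegrableOn (f n) (Ioc 0 T) := fun n => by
    refine Integrable.mono' (((integrable_const (2 * R)).add (hD n)).const_mul (B * C))
      (hfm n).aestronglyMeasurable ?_
    filter_upwards [ae_restrict_mem measurableSet_Ioc] with t h2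
    obtain ⟨y, hy1, -, hy2⟩ := h.exists_domain_smoothRoot n h2.1.le
    have h3 := hzero y (hy1 ▸ h.norm_smoothRoot_sq_le n h2.1.le) t h2
    rw [hy1, hy2] at h3
    exact h3
  have hδm : ∀ n, StronglyMeasurable fun t => ‖h.smoothRoot n t - h.rootFlow t‖ ^ 2 := fun n =>
    ((hsm n).sub h.stronglyMeasurable_rootFlow).norm.pow 2
  have hδb : ∀ n, ∀ t, 0 ≤ t → ‖h.smoothRoot n t - h.rootFlow t‖ ^ 2 ≤ 4 * R := fun n t ht => by
    have h1 := norm_sub_le (h.smoothRoot n t) (h.rootFlow t)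
    have h2 := h.norm_smoothRoot_sq_le n ht
    have h3 := h.norm_rootFlow_sq_le ht
    have h4 := pow_le_pow_left₀ (norm_nonneg _) h1 2
    nlinarith
  have hδi : ∀ n, IntegrableOn (fun t => ‖h.smoothRoot n t - h.rootFlow t‖ ^ 2) (Ioc 0 T) := fun n => by
    refine Measure.integrableOn_of_bounded (M := 4 * R) (by simp) (hδm n).aestronglyMeasurable ?_
    refine (ae_restrict_iff' measurableSet_Ioc).2 (.of_forall fun t ht => ?_)
    rw [norm_of_nonneg (sq_nonneg _)]
    exact hδb n t ht.1.le
  have hδ : Tendsto (fun n => ∫ t in Ioc 0 T, ‖h.smoothRoot n t - h.rootFlow t‖ ^ 2) atTop (𝓝 0) := by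
    have h1 : Tendsto (fun n => ∫ t in Ioc 0 T, ‖h.smoothRoot n t - h.rootFlow t‖ ^ 2) atTop
        (𝓝 (∫ _ in Ioc 0 T, 0)) := by
      refine tendsto_integral_of_dominated_convergence (fun _ => 4 * R)
        (fun n => (hδm n).aestronglyMeasurable) (integrable_const _) (fun n => ?_) ?_
      · refine (ae_restrict_iff' measurableSet_Ioc).2 (.of_forall fun t ht => ?_)
        rw [norm_of_nonneg (sq_nonneg _)]
        exact hδb n t ht.1.le
      · refine (ae_restrict_iff' measurableSet_Ioc).2 (.of_forall fun t ht => ?_)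
        have h2 := ((h.tendsto_smoothRoot ht.1.le).sub_const (h.rootFlow t)).norm.pow 2
        simpa using h2
    simpa using h1
  set M : ℝ := 2 * R * T + K + ∫ t in Ioc 0 T, ‖h.rootGrad t‖ ^ 2 with hM
  have hMb : ∀ n, ∫ t in Ioc 0 T, (2 * R + h.dissipation n t + ‖h.rootGrad t‖ ^ 2) ≤ M := fun n => by
    have i1 : IntegrableOn (fun t => 2 * R + h.dissipation n t) (Ioc 0 T) := (integrable_const _).add (hD n)
    rw [integral_add i1 hE, integral_add (integrable_const _) (hD n), setIntegral_const]
    have h1 := hK n hT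
    rw [integral_of_le hT] at h1
    have h2 : volume.real (Ioc 0 T) = T := by simp [Measure.real, hT]
    rw [h2, smul_eq_mul]
    linarith
  have hM0 : 0 ≤ M := le_trans (setIntegral_nonneg measurableSet_Ioc fun t ht => by
    have := h.dissipation_nonneg 0 ht.1.le
    positivity) (hMb 0)
  refine ⟨fun n => (intervalIntegrable_iff_integrableOn_Ioc_of_le hT).2 (hfi n),
    (intervalIntegrable_iff_integrableOn_Ioc_of_le hT).2 hgi, ?_⟩
  simp only [integral_of_le hT]
  rw [← tendsto_sub_nhds_zero_iff]
  -- `n → ∞` at fixed `κ` kills the first term, then `κ → 0` the second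
  refine tendsto_zero_of_le_cube (L := B * C) (by positivity) hM0 hδ fun n κ hκ hκ1 => ?_
  rw [← integral_sub (hfi n) hgi, ← norm_eq_abs]
  have hi : IntegrableOn (fun t => B * C * ((κ⁻¹) ^ 3 * ‖h.smoothRoot n t - h.rootFlow t‖ ^ 2
      + κ * (2 * R + h.dissipation n t + ‖h.rootGrad t‖ ^ 2))) (Ioc 0 T) :=
    (((hδi n).const_mul _).add ((((integrable_const _).add (hD n)).add hE).const_mul κ)).const_mul _
  refine (norm_integral_le_of_norm_le hi ?_).trans ?_
  · filter_upwards [h.ae_mem_finiteTimes hT, ae_restrict_mem measurableSet_Ioc] with t h1 h2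
    obtain ⟨w, hw1, hw2, -⟩ := h.exists_domain_rootFlow h1
    obtain ⟨y, hy1, -, hy2⟩ := h.exists_domain_smoothRoot n h2.1.le
    have h3 := hF y w i k (φ t) B κ (hc t) (hB t (Ioc_subset_Icc_self h2)) hκ hκ1
    rw [hy1, hy2, hw1, hw2] at h3
    refine h3.trans (mul_le_mul_of_nonneg_left ?_ (by positivity))
    refine add_le_add le_rfl (mul_le_mul_of_nonneg_left ?_ hκ.le)
    linarith [h.norm_smoothRoot_sq_le n h2.1.le, h.norm_rootFlow_sq_le h2.1.le]
  · have i2 : IntegrableOn (fun t => κ * (2 * R + h.dissipation n t + ‖h.rootGrad t‖ ^ 2)) (Ioc 0 T) :=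
      (((integrable_const _).add (hD n)).add hE).const_mul κ
    rw [integral_const_mul, integral_add ((hδi n).const_mul _) i2, integral_const_mul, integral_const_mul]
    refine mul_le_mul_of_nonneg_left ?_ (by positivity)
    exact add_le_add le_rfl (mul_le_mul_of_nonneg_left (hMb n) hκ.le)

/-- The limit flow solves the equation in weak form. -/
lemma rootFlow_weak_eq (hφ : IsSpaceTimeTest φ) {T : ℝ} (hT : 0 ≤ T) (hsupp : ∀ x, φ T x = 0) :
    ∫ t in (0 : ℝ)..T, ((1 / 4) * (∫ x, h.rootFlow t x ^ 2 * deriv (fun r => φ r x) t ∂𝔪)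
      + σ * ((1 / 4) * ∑ i, ∑ k, ((∫ x, h.rootFlow t x ^ 2 * 𝐃 i k (𝐃 i k (φ t)) x ∂𝔪)
          + ∫ x, h.rootFlow t x ^ 2 * (𝐃 i k (φ t) x * 𝐛 i k x) ∂𝔪)))
      = -∫ x, h₀ x * φ 0 x ∂𝔪 := by
  have t1 := tendstoIntegral_of_bound (F := h.root) hT
    (fun n => (continuous_sqrtLp.comp (h.continuous_flow n)).stronglyMeasurable)
    h.stronglyMeasurable_rootFlow (fun n t ht => h.norm_root_sq_le n ht)
    (fun t ht => h.norm_rootFlow_sq_le ht) (fun t ht => h.tendsto_root ht) (IsSpaceTimeTest.partial_time hφ)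
  have t2 := fun i k => tendstoIntegral_of_bound hT
    (fun n => (h.continuous_smoothRoot n).stronglyMeasurable)
    h.stronglyMeasurable_rootFlow (fun n t ht => h.norm_smoothRoot_sq_le n ht)
    (fun t ht => h.norm_rootFlow_sq_le ht) (fun t ht => h.tendsto_smoothRoot ht)
    (IsSpaceTimeTest.partial_space (IsSpaceTimeTest.partial_space hφ i k) i k)
  have t3 := fun i k => h.tendstoIntegral_force (IsSpaceTimeTest.partial_space hφ i k) i k hT
  have t4 := (t1.const_mul (1 / 4)).add (((TendstoIntegral.sum univ fun i =>
    TendstoIntegral.sum univ fun k => (t2 i k).add (t3 i k)).const_mul (1 / 4)).const_mul σ)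
  have t5 := t4.tendsto
  simp only [h.flow_weak_eq hφ _ hT hsupp] at t5
  refine tendsto_nhds_unique t5 (Tendsto.neg ?_)
  obtain ⟨B, hB⟩ := exists_abs_le_of_continuous
    (IsSmoothConfig.isC1 (IsSpaceTimeTest.isSmoothConfig hφ 0)).continuous
  have hφm := (IsSmoothConfig.isC1 (IsSpaceTimeTest.isSmoothConfig hφ 0)).continuous.aestronglyMeasurable
    (μ := 𝔪)
  have ib : ∀ {u : TorusConfig N d → ℝ}, Integrable u 𝔪 → Integrable (fun x => u x * φ 0 x) 𝔪 := fun hu =>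
    hu.mul_bdd hφm (.of_forall hB)
  rw [tendsto_iff_norm_sub_tendsto_zero]
  have hz : Tendsto (fun n => B * ∫ x, |h.cut n x - h₀ x| ∂𝔪) atTop (𝓝 0) := by
    simpa using h.tendsto_cut.const_mul B
  refine squeeze_zero (fun _ => norm_nonneg _) (fun n => ?_) hz
  rw [← integral_sub (ib (L2.integrable _)) (ib h.integrable), ← integral_const_mul]
  refine norm_integral_le_of_norm_le (((L2.integrable _).sub h.integrable).abs.const_mul B)
    (.of_forall fun x => ?_)
  rw [← sub_mul, norm_mul, mul_comm, norm_eq_abs, norm_eq_abs]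
  gcongr; exact hB x

end FiniteEntropy

end

section

/-! ### The entropy solution -/

variable {φ : ℝ → TorusConfig N d → ℝ}

namespace FiniteEntropy

variable {h₀ : TorusConfig N d → ℝ} (h : FiniteEntropy s σ h₀)

include h

/-- A jointly measurable version of the square root of the limit flow. -/
def rootVersion : ℝ × 𝕏 → ℝ := (exists_measurable_uncurry h.stronglyMeasurable_rootFlow).choose

lemma measurable_rootVersion : Measurable h.rootVersion :=
  (exists_measurable_uncurry h.stronglyMeasurable_rootFlow).choose_spec.1

lemma rootVersion_ae (t : ℝ) :
    (fun x => h.rootVersion (t, x)) =ᵐ[𝔪] h.rootFlow t :=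
  (exists_measurable_uncurry h.stronglyMeasurable_rootFlow).choose_spec.2 t

lemma stronglyMeasurable_rootGrad_apply (p : Fin N × Fin d) : StronglyMeasurable fun t => h.rootGrad t p :=
  (PiLp.proj (𝕜 := ℝ) 2 (fun _ : Fin N × Fin d => GibbsL2 N d s σ) p).continuous.comp_stronglyMeasurable
    h.stronglyMeasurable_rootGrad

/-- A jointly measurable version of the gradient of the square root of the limit flow. -/
def gradVersion (p : Fin N × Fin d) : ℝ × 𝕏 → ℝ :=
  (exists_measurable_uncurry (h.stronglyMeasurable_rootGrad_apply p)).choose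

lemma measurable_gradVersion (p : Fin N × Fin d) : Measurable (h.gradVersion p) :=
  (exists_measurable_uncurry (h.stronglyMeasurable_rootGrad_apply p)).choose_spec.1

lemma gradVersion_ae (p : Fin N × Fin d) (t : ℝ) :
    (fun x => h.gradVersion p (t, x)) =ᵐ[𝔪] h.rootGrad t p :=
  (exists_measurable_uncurry (h.stronglyMeasurable_rootGrad_apply p)).choose_spec.2 t

/-- The solution: the density of the limit flow times the Gibbs factor. -/
def solution (t : ℝ) (x : 𝕏) : ℝ := h.rootVersion (t, x) ^ 2 / 4 * 𝐆 x

/-- The weak gradient of the solution. -/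
def solutionGrad (t : ℝ) (i : Fin N) (k : Fin d) (x : 𝕏) : ℝ :=
  (1 / 2 * (h.rootVersion (t, x) * h.gradVersion (i, k) (t, x))
    + 1 / 4 * (h.rootVersion (t, x) ^ 2 * 𝐛 i k x)) * 𝐆 x

lemma measurable_solution : Measurable (Function.uncurry h.solution) :=
  ((h.measurable_rootVersion.pow_const 2).div_const 4).mul (measurable_gibbsCont.comp measurable_snd)

lemma solution_nonneg (t : ℝ) (x : 𝕏) : 0 ≤ h.solution t x :=
  mul_nonneg (by positivity) (gibbsCont_nonneg _ _ _)

lemma integral_solution_mul (t : ℝ) (q : 𝕏 → ℝ) :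
    ∫ x, h.solution t x * q x = 1 / 4 * ∫ x, h.rootFlow t x ^ 2 * q x ∂𝔪 := by
  rw [← integral_const_mul, integral_gibbsMeasure]
  refine integral_congr_ae ?_
  filter_upwards [ae_gibbsMeasure_iff.1 (h.rootVersion_ae t)] with x hx
  rw [solution, hx]
  ring

lemma integrable_solution_mul_iff (t : ℝ) {q : 𝕏 → ℝ} :
    Integrable (fun x => h.solution t x * q x) ↔ Integrable (fun x => h.rootFlow t x ^ 2 * q x) 𝔪 := by
  have e : (fun x => h.solution t x * q x) =ᵐ[volume]
      fun x => (1 / 4) * ((h.rootFlow t x ^ 2 * q x) * 𝐆 x) := by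
    filter_upwards [ae_gibbsMeasure_iff.1 (h.rootVersion_ae t)] with x hx
    rw [solution, hx]
    ring
  rw [integrable_congr e, integrable_const_mul_iff (by norm_num), integrable_gibbsMeasure_iff]

lemma integrable_solution (t : ℝ) : Integrable (h.solution t) := by
  have h1 := (h.integrable_solution_mul_iff t (q := fun _ => 1)).2 (by simpa using L2.integrable_sq _)
  simpa using h1

lemma integral_solution {t : ℝ} (ht : 0 ≤ t) :
    ∫ x, h.solution t x = ∫ x, h₀ x ∂𝔪 := by
  have h1 := h.integral_solution_mul t fun _ => 1
  simp only [mul_one] at h1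
  rw [h1, ← L2.norm_sq_eq_integral, h.norm_rootFlow_sq ht]
  ring

lemma solution_div_gibbsFactor (t : ℝ) :
    ∀ᵐ x, h.solution t x / gibbsFactor s σ x = h.density t x := by
  filter_upwards [ae_notMem_collisions hp.out.one_le_d,
    ae_gibbsMeasure_iff.1 (h.rootVersion_ae t)] with x hx h1
  rw [solution, h1, gibbsCont_eq hx, density, mul_div_cancel_right₀ _ (gibbsFactor_pos (s := s) (σ := σ) x).ne']

lemma log_mul_solution (t : ℝ) :
    (fun x => log (h.solution t x / gibbsFactor s σ x) * h.solution t x) =ᵐ[volume]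
      fun x => (h.density t x * log (h.density t x)) * 𝐆 x := by
  filter_upwards [h.solution_div_gibbsFactor t, ae_gibbsMeasure_iff.1 (h.rootVersion_ae t)] with x h1 h2
  rw [h1, solution, h2, density]
  ring

lemma integrable_log_mul_solution {t : ℝ} (ht : 0 ≤ t) :
    Integrable (fun x => log (h.solution t x / gibbsFactor s σ x) * h.solution t x) := by
  rw [integrable_congr (h.log_mul_solution t), ← integrable_gibbsMeasure_iff]
  exact (h.entropy_le 0 ht).1

lemma gibbsEntropy_solution (t : ℝ) :
    gibbsEntropy s σ (h.solution t) = ∫ x, h.density t x * log (h.density t x) ∂𝔪 := by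
  rw [gibbsEntropy, integral_congr_ae (h.log_mul_solution t), integral_gibbsMeasure]

/-- The weak gradient of the solution at the times of finite energy. -/
lemma hasWeakPartial_solution {t : ℝ} (ht : t ∈ h.finiteTimes) (i : Fin N) (k : Fin d) :
    HasWeakPartial i k (h.solution t) (h.solutionGrad t i k) := by
  obtain ⟨y, hy1, hy2, -⟩ := h.exists_domain_rootFlow ht
  have i1 := L2.integrable_mul (h.rootFlow t) (h.rootGrad t (i, k))
  have i2 : Integrable (fun x => h.rootFlow t x ^ 2 * 𝐛 i k x) 𝔪 := by
    rw [← hy1]; exact integrable_sq_mul_logGrad y i k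
  have e : h.solutionGrad t i k =ᵐ[volume] fun x => (1 / 2 * (h.rootFlow t x * h.rootGrad t (i, k) x)
      + 1 / 4 * (h.rootFlow t x ^ 2 * 𝐛 i k x)) * 𝐆 x := by
    filter_upwards [ae_gibbsMeasure_iff.1 (h.rootVersion_ae t),
      ae_gibbsMeasure_iff.1 (h.gradVersion_ae (i, k) t)] with x h1 h2
    rw [solutionGrad, h1, h2]
  refine ⟨h.integrable_solution t, ?_, fun ψ hψ => ?_⟩
  · rw [integrable_congr e, ← integrable_gibbsMeasure_iff]
    exact (i1.const_mul _).add (i2.const_mul _)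
  · have hψ1 := IsSmoothConfig.isC1 hψ
    have h1 := integral_sq_mul_partial y hψ1 i k
    rw [hy1, hy2] at h1
    have i3 : Integrable (fun x => h.rootFlow t x * h.rootGrad t (i, k) x * ψ x) 𝔪 := by
      obtain ⟨B, hB⟩ := exists_abs_le_of_continuous hψ1.continuous
      exact i1.mul_bdd hψ1.continuous.aestronglyMeasurable (.of_forall hB)
    have i4 : Integrable (fun x => h.rootFlow t x ^ 2 * (ψ x * 𝐛 i k x)) 𝔪 := by
      rw [← hy1]; exact integrable_sq_mul_bounded_logGrad y i k hψ1.continuous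
    have e2 : ∫ x, h.solutionGrad t i k x * ψ x
        = 1 / 2 * (∫ x, h.rootFlow t x * h.rootGrad t (i, k) x * ψ x ∂𝔪)
          + 1 / 4 * ∫ x, h.rootFlow t x ^ 2 * (ψ x * 𝐛 i k x) ∂𝔪 := by
      rw [← integral_const_mul, ← integral_const_mul, ← integral_add (i3.const_mul _) (i4.const_mul _),
        integral_gibbsMeasure]
      refine integral_congr_ae (e.mono fun x hx => ?_)
      simp only [hx]
      ring
    rw [h.integral_solution_mul, e2]
    simp only [sq] at h1 ⊢
    rw [h1]
    ring

omit h in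
lemma integrable_slab_of_nonpos {T : ℝ} (hT : T ≤ 0) (F : ℝ × 𝕏 → ℝ) :
    Integrable F (slabMeasure N d T) := by
  rw [slabMeasure, Ioc_eq_empty (not_lt.2 hT), Measure.restrict_empty, Measure.zero_prod]
  exact integrable_zero_measure

omit h in
omit hp in
lemma ae_slab_of_ae {T : ℝ} {P : 𝕏 → Prop} (hP : ∀ᵐ x, P x) :
    ∀ᵐ p ∂(slabMeasure N d T), P p.2 :=
  Measure.quasiMeasurePreserving_snd.ae hP

/-- The force is integrable against the solution in space and time. -/
lemma integrable_solution_mul_logGrad (T : ℝ) (i : Fin N) (k : Fin d) :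
    Integrable (fun p : ℝ × 𝕏 => h.solution p.1 p.2 * 𝐛 i k p.2) (slabMeasure N d T) := by
  rcases le_total T 0 with hT | hT
  · exact integrable_slab_of_nonpos hT _
  obtain ⟨C, hC, hF⟩ := exists_force_bound (N := N) (d := d) (s := s) (σ := σ)
  set R := 4 * ∫ x, (h₀ x + 1) ∂𝔪 with hR
  have hm : Measurable fun p : ℝ × 𝕏 => h.solution p.1 p.2 * 𝐛 i k p.2 :=
    h.measurable_solution.mul ((measurable_logGrad hp.out i k).comp measurable_snd)
  rw [slabMeasure, integrable_prod_iff hm.aestronglyMeasurable]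
  have hfin := h.ae_mem_finiteTimes hT
  constructor
  · filter_upwards [hfin] with t ht
    obtain ⟨y, hy1, -, -⟩ := h.exists_domain_rootFlow ht
    rw [h.integrable_solution_mul_iff, ← hy1]
    exact integrable_sq_mul_logGrad y i k
  · refine Integrable.mono' (g := fun t => C * (2 * R + ‖h.rootGrad t‖ ^ 2))
      (((integrable_const _).add (h.rootGrad_entropy hT).1).const_mul C)
      hm.norm.stronglyMeasurable.integral_prod_right'.aestronglyMeasurable ?_
    filter_upwards [hfin, ae_restrict_mem measurableSet_Ioc] with t ht h2
    obtain ⟨y, hy1, hy2, -⟩ := h.exists_domain_rootFlow ht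
    rw [norm_of_nonneg (integral_nonneg fun x => norm_nonneg _)]
    have e : ∫ x, ‖h.solution t x * 𝐛 i k x‖ = ∫ x, h.solution t x * |𝐛 i k x| := by
      refine integral_congr_ae (.of_forall fun x => ?_)
      simp only [norm_mul, norm_eq_abs, abs_of_nonneg (h.solution_nonneg t x)]
    have h3 := (hF y i k).2
    rw [integral_forceMeasure, hy1, hy2] at h3
    have h4 := h.norm_rootFlow_sq_le h2.1.le
    have h5 : 0 ≤ ∫ x, h.rootFlow t x ^ 2 * |𝐛 i k x| ∂𝔪 := integral_nonneg fun x => by positivity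
    have h6 : ‖h.rootFlow t‖ * ‖h.rootGrad t‖ ≤ ‖h.rootFlow t‖ ^ 2 + ‖h.rootGrad t‖ ^ 2 := by
      nlinarith [sq_nonneg ‖h.rootFlow t‖]
    have h7 := mul_le_mul_of_nonneg_left
      (show ‖h.rootFlow t‖ ^ 2 + ‖h.rootFlow t‖ * ‖h.rootGrad t‖ ≤ 2 * R + ‖h.rootGrad t‖ ^ 2 by linarith) hC
    calc ∫ x, ‖h.solution t x * 𝐛 i k x‖
        = 1 / 4 * ∫ x, h.rootFlow t x ^ 2 * |𝐛 i k x| ∂𝔪 := by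
          rw [e, h.integral_solution_mul]
      _ ≤ C * (2 * R + ‖h.rootGrad t‖ ^ 2) := by linarith

lemma integrable_solution_slab (T : ℝ) :
    Integrable (fun p : ℝ × 𝕏 => h.solution p.1 p.2) (slabMeasure N d T) := by
  have hm := h.measurable_solution
  change Integrable (Function.uncurry h.solution) _
  rw [slabMeasure, integrable_prod_iff hm.aestronglyMeasurable]
  refine ⟨Eventually.of_forall fun t => h.integrable_solution t, ?_⟩
  refine Measure.integrableOn_of_bounded (M := ∫ x, h₀ x ∂𝔪) (by simp)
    hm.norm.stronglyMeasurable.integral_prod_right'.aestronglyMeasurable ?_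
  refine (ae_restrict_iff' measurableSet_Ioc).2 (.of_forall fun t ht => ?_)
  rw [norm_of_nonneg (integral_nonneg fun x => norm_nonneg _), ← h.integral_solution ht.1.le]
  refine (integral_congr_ae (.of_forall fun x => ?_)).le
  exact norm_of_nonneg (h.solution_nonneg t x)

lemma integrable_solution_mul_drift (T : ℝ) (i : Fin N) (k : Fin d) :
    Integrable (fun p : ℝ × 𝕏 => h.solution p.1 p.2 * interactionDrift s (-1) i k p.2)
      (slabMeasure N d T) := by
  refine ((h.integrable_solution_mul_logGrad T i k).const_mul σ).congr ?_
  filter_upwards [ae_slab_of_ae (ae_notMem_collisions hp.out.one_le_d)] with p hp'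
  rw [interactionDrift_eq hp.out i k hp']
  ring

omit h in
omit hp in
lemma integrable_mul_test {f : ℝ × 𝕏 → ℝ} {T : ℝ} (hf : Integrable f (slabMeasure N d T))
    (hφ : IsSpaceTimeTest φ) : Integrable (fun p => f p * φ p.1 p.2) (slabMeasure N d T) := by
  obtain ⟨B, hB⟩ := IsSpaceTimeTest.exists_abs_le hφ T
  refine hf.mul_bdd (c := B) (IsSpaceTimeTest.continuous_uncurry hφ).aestronglyMeasurable ?_
  have h1 : ∀ᵐ p ∂(slabMeasure N d T), p.1 ∈ Ioc 0 T :=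
    Measure.quasiMeasurePreserving_fst.ae (ae_restrict_mem measurableSet_Ioc)
  filter_upwards [h1] with p hp'
  exact hB p.1 (Ioc_subset_Icc_self hp') p.2

omit h in
omit hp in
/-- Integrals of functions that vanish after the time `T`. -/
lemma integral_Ioi_eq_slab {T : ℝ} {F : ℝ × 𝕏 → ℝ} (hF : ∀ p, T < p.1 → F p = 0) :
    ∫ p, F p ∂((volume.restrict (Ioi (0 : ℝ))).prod volume) = ∫ p, F p ∂(slabMeasure N d T) := by
  have e : ∀ S : Set ℝ, (volume.restrict S).prod (volume : Measure 𝕏)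
      = (volume.prod volume).restrict (S ×ˢ Set.univ) := fun S => by
    rw [← Measure.prod_restrict, Measure.restrict_univ]
  rw [slabMeasure, e, e]
  refine (setIntegral_eq_of_subset_of_forall_sdiff_eq_zero (measurableSet_Ioi.prod MeasurableSet.univ)
    (prod_mono Ioc_subset_Ioi_self le_rfl) fun p hp' => hF p ?_)
  by_contra! hcon
  exact hp'.2 ⟨⟨hp'.1.1, hcon⟩, mem_univ _⟩

/-- The solution solves the equation in the sense of distributions. -/
lemma solution_weak_eq (hφ : IsSpaceTimeTest φ) :
    ∫ p : ℝ × 𝕏, h.solution p.1 p.2 * (deriv (fun r => φ r p.2) p.1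
        + ∑ i, ∑ k, interactionDrift s (-1) i k p.2 * 𝐃 i k (φ p.1) p.2
        + σ * ∑ i, ∑ k, 𝐃 i k (𝐃 i k (φ p.1)) p.2)
      ∂((volume.restrict (Ioi (0 : ℝ))).prod volume)
    = -∫ x, h₀ x * φ 0 x ∂𝔪 := by
  obtain ⟨T₀, hT₀⟩ := hφ.support
  set T := max T₀ 0 with hT
  have hT0 : 0 ≤ T := le_max_right _ _
  have hφ1 := IsSpaceTimeTest.partial_time hφ
  have hφ2 := fun i k => IsSpaceTimeTest.partial_space hφ i k
  have hφ3 := fun i k => IsSpaceTimeTest.partial_space (hφ2 i k) i k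
  have hae := ae_notMem_collisions (N := N) hp.out.one_le_d
  rw [integral_Ioi_eq_slab (T := T) fun p hp' => ?_]
  swap
  · have h1 : T₀ < p.1 := (le_max_left _ _).trans_lt hp'
    have h2 : φ p.1 = fun _ => 0 := funext (hT₀ p.1 h1.le)
    have h3 : (fun r => φ r p.2) =ᶠ[𝓝 p.1] fun _ => 0 := by
      filter_upwards [lt_mem_nhds h1] with r hr
      exact hT₀ r hr.le p.2
    have h4 : ∀ i k, 𝐃 i k (fun _ : 𝕏 => 0) = fun _ => 0 := fun i k =>
      funext fun x => configPartial_eq (hasDerivAt_const _ _)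
    rw [h3.deriv_eq, deriv_const, h2]
    simp [h4]
  rw [← h.rootFlow_weak_eq hφ hT0 fun x => hT₀ T (le_max_left _ _) x]
  have hFi : Integrable (fun p : ℝ × 𝕏 => h.solution p.1 p.2 * (deriv (fun r => φ r p.2) p.1
        + ∑ i, ∑ k, interactionDrift s (-1) i k p.2 * 𝐃 i k (φ p.1) p.2
        + σ * ∑ i, ∑ k, 𝐃 i k (𝐃 i k (φ p.1)) p.2)) (slabMeasure N d T) := by
    have j1 := integrable_mul_test (h.integrable_solution_slab T) hφ1
    have j2 := (integral_sum_sum fun i k =>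
      integrable_mul_test (h.integrable_solution_mul_drift T i k) (hφ2 i k)).1
    have j3 := (integral_sum_sum fun i k =>
      integrable_mul_test (h.integrable_solution_slab T) (hφ3 i k)).1
    refine ((j1.add j2).add (j3.const_mul σ)).congr (.of_forall fun p => ?_)
    simp only [Pi.add_apply, mul_add, mul_sum]
    simp only [mul_left_comm, mul_assoc]
  rw [slabMeasure, integral_prod _ hFi, integral_of_le hT0]
  refine integral_congr_ae ?_
  filter_upwards [h.ae_mem_finiteTimes hT0, ae_restrict_mem measurableSet_Ioc] with t ht ht2
  obtain ⟨y, hy1, -, -⟩ := h.exists_domain_rootFlow ht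
  have ib : ∀ {q : 𝕏 → ℝ}, Continuous q → Integrable (fun x => h.rootFlow t x ^ 2 * q x) 𝔪 := fun hq => by
    obtain ⟨B, hB⟩ := exists_abs_le_of_continuous hq
    exact (L2.integrable_sq _).mul_bdd hq.aestronglyMeasurable (.of_forall hB)
  have hc : ∀ {χ : ℝ → 𝕏 → ℝ}, IsSpaceTimeTest χ → Continuous (χ t) := fun hχ =>
    (IsSmoothConfig.isC1 (IsSpaceTimeTest.isSmoothConfig hχ t)).continuous
  have k1 := ib (hc hφ1)
  have k2 := fun i k => ib (hc (hφ3 i k))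
  have k3 : ∀ i k, Integrable (fun x => h.rootFlow t x ^ 2 * (𝐃 i k (φ t) x * 𝐛 i k x))
      𝔪 := fun i k => by
    rw [← hy1]; exact integrable_sq_mul_bounded_logGrad y i k (hc (hφ2 i k))
  have k4 := integral_sum_sum fun i k => (k2 i k).add (k3 i k)
  simp only [← integral_add (k2 _ _) (k3 _ _)]
  erw [← k4.2]
  rw [mul_left_comm σ, ← mul_add, ← integral_const_mul σ,
    ← integral_add k1 (k4.1.const_mul σ), ← integral_const_mul, integral_gibbsMeasure]
  refine integral_congr_ae ?_
  filter_upwards [hae, ae_gibbsMeasure_iff.1 (h.rootVersion_ae t)] with x hx h1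
  simp only [interactionDrift_eq hp.out _ _ hx, solution, h1]
  simp only [Pi.add_apply, sum_add_distrib, mul_add, add_mul, mul_sum, sum_mul]
  ring_nf
  simp only [mul_right_comm _ (𝐛 _ _ x)]
  exact add_right_comm _ _ _

/-- The Fisher information of the solution is bounded by the energy of its square root, off the
collisions. -/
lemma fisherDensity_bounds (t : ℝ) (i : Fin N) {x : 𝕏} (hx : x ∉ collisions N d) :
    0 ≤ fisherDensity s σ (h.solution t) (h.solutionGrad t) i x ∧
    fisherDensity s σ (h.solution t) (h.solutionGrad t) i x
      ≤ (∑ k, h.gradVersion (i, k) (t, x) ^ 2) * 𝐆 x := by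
  have hG := gibbsCont_pos (s := s) (σ := σ) hx
  refine ⟨mul_nonneg (sum_nonneg fun k _ => sq_nonneg _) (h.solution_nonneg t x), ?_⟩
  by_cases hz : h.rootVersion (t, x) = 0
  · have : h.solution t x = 0 := by rw [solution, hz]; ring
    rw [fisherDensity, this, mul_zero]
    exact mul_nonneg (sum_nonneg fun k _ => sq_nonneg _) hG.le
  · refine le_of_eq ?_
    rw [fisherDensity, sum_mul, sum_mul]
    refine sum_congr rfl fun k _ => ?_
    rw [configPartial_log_gibbsFactor hp.out i k hx, solutionGrad, solution]
    have := hG.ne'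
    field_simp
    ring

lemma integral_gradVersion_sq (i : Fin N) (t : ℝ) :
    Integrable (fun x => (∑ k, h.gradVersion (i, k) (t, x) ^ 2) * 𝐆 x) ∧
    ∫ x, (∑ k, h.gradVersion (i, k) (t, x) ^ 2) * 𝐆 x = ∑ k, ‖h.rootGrad t (i, k)‖ ^ 2 := by
  have hi : ∀ k, Integrable (fun x => h.gradVersion (i, k) (t, x) ^ 2) 𝔪 := fun k => by
    refine (L2.integrable_sq (h.rootGrad t (i, k))).congr ?_
    filter_upwards [h.gradVersion_ae (i, k) t] with x hx
    rw [hx]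
  refine ⟨integrable_gibbsMeasure_iff.1 (integrable_finsetSum _ fun k _ => hi k), ?_⟩
  rw [← integral_gibbsMeasure, integral_finsetSum _ fun k _ => hi k]
  refine sum_congr rfl fun k _ => ?_
  rw [L2.norm_sq_eq_integral]
  refine integral_congr_ae ?_
  filter_upwards [h.gradVersion_ae (i, k) t] with x hx
  rw [hx]

lemma sum_norm_rootGrad_sq (t : ℝ) : ∑ i, ∑ k, ‖h.rootGrad t (i, k)‖ ^ 2 = ‖h.rootGrad t‖ ^ 2 := by
  rw [PiLp.norm_sq_eq_of_L2, Fintype.sum_prod_type]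

lemma integrableOn_partial_energy {T : ℝ} (hT : 0 ≤ T) (i : Fin N) :
    IntegrableOn (fun t => ∑ k, ‖h.rootGrad t (i, k)‖ ^ 2) (Ioc 0 T) := by
  have hm : StronglyMeasurable fun t => ∑ k, ‖h.rootGrad t (i, k)‖ ^ 2 :=
    Finset.stronglyMeasurable_fun_sum _ fun k _ => (h.stronglyMeasurable_rootGrad_apply (i, k)).norm.pow 2
  refine Integrable.mono' (h.rootGrad_entropy hT).1 hm.aestronglyMeasurable (.of_forall fun t => ?_)
  rw [norm_of_nonneg (sum_nonneg fun k _ => sq_nonneg _), ← h.sum_norm_rootGrad_sq]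
  exact single_le_sum (f := fun i => ∑ k, ‖h.rootGrad t (i, k)‖ ^ 2)
    (fun j _ => sum_nonneg fun k _ => sq_nonneg _) (mem_univ i)

lemma integrable_fisherDensity (T : ℝ) (i : Fin N) :
    Integrable (fun p : ℝ × 𝕏 => fisherDensity s σ (h.solution p.1) (h.solutionGrad p.1) i p.2)
      (slabMeasure N d T) := by
  rcases le_total T 0 with hT | hT
  · exact integrable_slab_of_nonpos hT _
  have hcol := ae_slab_of_ae (T := T) (ae_notMem_collisions (N := N) hp.out.one_le_d)
  have hdom : Integrable (fun p : ℝ × 𝕏 =>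
      (∑ k, h.gradVersion (i, k) p ^ 2) * 𝐆 p.2) (slabMeasure N d T) := by
    have hm : Measurable fun p : ℝ × 𝕏 => (∑ k, h.gradVersion (i, k) p ^ 2) * 𝐆 p.2 :=
      (Finset.measurable_sum _ fun k _ => (h.measurable_gradVersion (i, k)).pow_const 2).mul
        (measurable_gibbsCont.comp measurable_snd)
    rw [slabMeasure, integrable_prod_iff hm.aestronglyMeasurable]
    refine ⟨Eventually.of_forall fun t => (h.integral_gradVersion_sq i t).1, ?_⟩
    refine (h.integrableOn_partial_energy hT i).congr (.of_forall fun t => ?_)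
    dsimp only
    rw [← (h.integral_gradVersion_sq i t).2]
    refine integral_congr_ae (.of_forall fun x => (norm_of_nonneg ?_).symm)
    exact mul_nonneg (sum_nonneg fun k _ => sq_nonneg _) (gibbsCont_nonneg _ _ _)
  refine Integrable.mono' hdom ?_ ?_
  · have hm : Measurable fun p : ℝ × 𝕏 =>
        (∑ k, (h.solutionGrad p.1 i k p.2 / h.solution p.1 p.2 - 𝐛 i k p.2) ^ 2)
          * h.solution p.1 p.2 := by
      have hs := h.measurable_solution
      have hl : ∀ k, Measurable fun p : ℝ × 𝕏 => 𝐛 i k p.2 := fun k =>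
        (measurable_logGrad hp.out i k).comp measurable_snd
      have hg : ∀ k, Measurable fun p : ℝ × 𝕏 => h.solutionGrad p.1 i k p.2 := fun k =>
        (((h.measurable_rootVersion.mul (h.measurable_gradVersion (i, k))).const_mul _).add
          (((h.measurable_rootVersion.pow_const 2).mul (hl k)).const_mul _)).mul
            (measurable_gibbsCont.comp measurable_snd)
      exact (Finset.measurable_sum _ fun k _ => (((hg k).div hs).sub (hl k)).pow_const 2).mul hs
    refine hm.aestronglyMeasurable.congr ?_
    filter_upwards [hcol] with p hp'
    simp only [fisherDensity, configPartial_log_gibbsFactor hp.out i _ hp']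
  · filter_upwards [hcol] with p hp'
    have h1 := h.fisherDensity_bounds p.1 i hp'
    rw [norm_of_nonneg h1.1]
    exact h1.2

lemma sum_integral_fisherDensity_le {t : ℝ} (ht : 0 ≤ t) :
    ∑ i, ∫ τ in (0 : ℝ)..t, ∫ x, fisherDensity s σ (h.solution τ) (h.solutionGrad τ) i x
      ≤ ∫ τ in (0 : ℝ)..t, ‖h.rootGrad τ‖ ^ 2 := by
  have e : ∫ τ in 0..t, ‖h.rootGrad τ‖ ^ 2
      = ∑ i, ∫ τ in 0..t, ∑ k, ‖h.rootGrad τ (i, k)‖ ^ 2 := by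
    rw [← intervalIntegral.integral_finsetSum fun i _ =>
      (intervalIntegrable_iff_integrableOn_Ioc_of_le ht).2 (h.integrableOn_partial_energy ht i)]
    simp only [h.sum_norm_rootGrad_sq]
  rw [e]
  refine sum_le_sum fun i _ => ?_
  rw [integral_of_le ht, integral_of_le ht]
  refine integral_mono (h.integrable_fisherDensity t i).integral_prod_left
    (h.integrableOn_partial_energy ht i) fun τ => ?_
  dsimp only
  rw [← (h.integral_gradVersion_sq i τ).2]
  refine integral_mono_of_nonneg ?_ (h.integral_gradVersion_sq i τ).1 ?_
  · filter_upwards [ae_notMem_collisions hp.out.one_le_d] with x hx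
    exact (h.fisherDensity_bounds τ i hx).1
  · filter_upwards [ae_notMem_collisions hp.out.one_le_d] with x hx
    exact (h.fisherDensity_bounds τ i hx).2

end FiniteEntropy

/-- A probability density of finite entropy, divided by the Gibbs factor. -/
lemma finiteEntropy_div {f₀ : 𝕏 → ℝ} (hf₀ : ∀ᵐ x, 0 ≤ f₀ x) (hi : Integrable f₀)
    (he : Integrable (fun x => log (f₀ x / gibbsFactor s σ x) * f₀ x)) :
    FiniteEntropy s σ (fun x => f₀ x / gibbsFactor s σ x) := by
  have hcol := ae_notMem_collisions (N := N) hp.out.one_le_d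
  refine ⟨ae_gibbsMeasure_iff.2 ?_, integrable_gibbsMeasure_iff.2 (hi.congr ?_),
    integrable_gibbsMeasure_iff.2 (he.congr ?_)⟩
  · filter_upwards [hf₀] with x hx
    exact div_nonneg hx (gibbsFactor_pos (s := s) (σ := σ) x).le
  · filter_upwards [hcol] with x hx
    rw [gibbsCont_eq hx, div_mul_cancel₀ _ (gibbsFactor_pos (s := s) (σ := σ) x).ne']
  · filter_upwards [hcol] with x hx
    rw [gibbsCont_eq hx]
    have := (gibbsFactor_pos (s := s) (σ := σ) x).ne'
    field_simp

lemma gibbsCont_mul_div (f₀ q : 𝕏 → ℝ) :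
    ∫ x, f₀ x / gibbsFactor s σ x * q x ∂𝔪 = ∫ x, f₀ x * q x := by
  rw [integral_gibbsMeasure]
  refine integral_congr_ae ?_
  filter_upwards [ae_notMem_collisions hp.out.one_le_d] with x hx
  have := (gibbsFactor_pos (s := s) (σ := σ) x).ne'
  rw [gibbsCont_eq hx]
  field_simp

lemma isGlobalEntropySolution {f₀ : 𝕏 → ℝ} (hf₀ : ∀ᵐ x, 0 ≤ f₀ x) (hmass : ∫ x, f₀ x = 1)
    (h : FiniteEntropy s σ (fun x => f₀ x / gibbsFactor s σ x)) :
    IsGlobalEntropySolution s σ (-1 : Matrix (Fin d) (Fin d) ℝ) f₀ h.solution where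
  measurable := h.measurable_solution.aestronglyMeasurable
  nonneg t _ := Eventually.of_forall (h.solution_nonneg t)
  integrable t _ := h.integrable_solution t
  mass t ht := by
    have h1 := gibbsCont_mul_div (s := s) (σ := σ) f₀ fun _ => 1
    simp only [mul_one] at h1
    rw [h.integral_solution ht, h1, hmass]
  solution :=
    { initial := by
        filter_upwards [ae_gibbsMeasure_iff.1 (h.rootVersion_ae 0), ae_gibbsMeasure_iff.1 h.rootFlow_zero, hf₀,
          ae_notMem_collisions hp.out.one_le_d] with x h1 h2 h3 h4
        have hG := gibbsFactor_pos (s := s) (σ := σ) x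
        rw [FiniteEntropy.solution, h1, h2, mul_pow, sq_sqrt (div_nonneg h3 hG.le), gibbsCont_eq h4]
        field_simp
        ring
      flux_integrable := fun T i k => h.integrable_solution_mul_drift T i k
      weak_eq := fun φ hφ => by
        rw [h.solution_weak_eq hφ, gibbsCont_mul_div]
        ring }
  entropy_integrable t ht := h.integrable_log_mul_solution ht
  dissipation := by
    refine ⟨h.solutionGrad, ?_, h.integrable_fisherDensity, fun t ht => ?_⟩
    · filter_upwards [h.ae_mem_finiteTimes_Ioi] with t ht
      exact fun i k => h.hasWeakPartial_solution ht i k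
    · have h1 := (h.rootGrad_entropy ht).2
      have h2 := mul_le_mul_of_nonneg_left (h.sum_integral_fisherDensity_le ht) hp.out.σ_pos.le
      have h3 : gibbsEntropy s σ f₀ = ∫ x, f₀ x / gibbsFactor s σ x * log (f₀ x / gibbsFactor s σ x) ∂𝔪 := by
        rw [gibbsCont_mul_div f₀ fun x => log (f₀ x / gibbsFactor s σ x), gibbsEntropy]
        simp only [mul_comm]
      rw [h.gibbsEntropy_solution, h3]
      linarith

end

end

end RieszFlow

end

theorem lemma5p2 (d N : ℕ) (hd : 1 ≤ d) (hN : 1 ≤ N) (s σ : ℝ) (hs : -1 ≤ s) (hsd : s < (d : ℝ))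
    (hσ : 0 < σ) (f₀ : TorusConfig N d → ℝ)
    (hf₀_nonneg : ∀ᵐ x, 0 ≤ f₀ x) (hf₀_int : MeasureTheory.Integrable f₀)
    (hf₀_mass : ∫ x, f₀ x = 1)
    (hf₀_ent : MeasureTheory.Integrable
      (fun x => Real.log (f₀ x / gibbsFactor s σ x) * f₀ x)) :
    ∃ f : ℝ → TorusConfig N d → ℝ,
      IsGlobalEntropySolution s σ (-1 : Matrix (Fin d) (Fin d) ℝ) f₀ f := by
  have : Fact (RieszFlow.Admissible N d s σ) := ⟨⟨hd, hN, hs, hsd, hσ⟩⟩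
  have h := RieszFlow.finiteEntropy_div (s := s) (σ := σ) hf₀_nonneg hf₀_int hf₀_ent
  exact ⟨h.solution, RieszFlow.isGlobalEntropySolution hf₀_nonneg hf₀_mass h⟩
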